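/- **Setting.** For a simple complex Lie algebra $\mathfrak g$ among $\mathfrak{sl}_N,\mathfrak{sp}_{2n},\mathfrak{so}_{2n+1},\mathfrak{so}_{2n+2}$ (realised by matrices preserving an antidiagonal form where relevant, with upper triangular Borel subalgebra), let $p_{-1}=\sum_k f_k$ be the principal nilpotent sum of the negative simple root vectors, $\{p_{-1},2\check\rho,p_1\}$ the principal $\mathfrak{sl}_2$-triple, and $V_{\mathfrak g,i}=\{x\in\mathfrak g:[p_1,x]=0,\ [\check\rho,x]=(i-1)x\}$. A $\mathfrak g$-oper on $\mathbb G_m=\operatorname{Spec}\mathbb C[t,t^{-1}]$ (for the adjoint group $G$, with Borel subgroup $B$) is a $B(\mathbb C[t,t^{-1}])$-gauge class of connections $\partial_t+\sum_k\psi_kf_k+v$ with $\psi_k\in\mathbb C[t,t^{-1}]^\times$, $v\in\mathfrak b[t,t^{-1}]$. For $d\ge1$ let $\mathrm{Op}_{\mathfrak g}(\mathbb G_m)_{(0,\varpi(0)),(\infty,1/d)}$ be the set of $\mathfrak g$-opers that have a regular singularity at $0$ with residue $\varpi(0)$ (that is, are $B(\mathbb C((t)))$-equivalent to some $\partial_t+t^{-1}M(t)$,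 with $M=\sum_k\psi_kf_k+v$, $\psi_k\in\mathbb C[[t]]^\times$, $v\in\mathfrak b[[t]]$ and $M(0)$ nilpotent) and whose maximal formal slope at $\infty$ is $\le 1/d$. Given nonzero $q_j\in V_{\mathfrak g,j}$, one for each fundamental degree $j\ge d$, write $\nabla_{\mathfrak g}(\lambda)=\partial_t+t^{-1}p_{-1}+\sum_{j\ge d}\lambda_j q_j$ with $\lambda_j\in\mathbb C$. **Proposition.** Let $1\le m\le n$ and $d=2m$. (i) Let $p_i$ be a nonzero element of $V_{\mathfrak{sl}_{2n},i}$ for $2\le i\le 2n$. Then $p_{2i}$ is a basis of $V_{\mathfrak{sp}_{2n},2i}$ for $1\le i\le n$, and pushout along $\mathfrak{sp}_{2n}\to\mathfrak{sl}_{2n}$ is a well-defined injective map $$\mathrm{Op}_{\mathfrak{sp}_{2n}}(\mathbb G_m)_{(0,\varpi(0)),(\infty,\frac1{2m})}\hookrightarrow \mathrm{Op}_{\mathfrak{sl}_{2n}}(\mathbb G_m)_{(0,\varpi(0)),(\infty,\frac1{2m})},\qquad \nabla_{\mathfrak{sp}_{2n}}(\lambda_m,\lambda_{m+1},\dots,\lambda_n)\mapsto\nabla_{\mathfrak{sl}_{2n}}(\lambda_m,0,\lambda_{m+1},\dots,0,\lambda_n),$$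 where the $\nabla$'s are formed with the $p_{2i}$, $m\le i\le n$, resp. the $p_i$, $2m\le i\le 2n$. (ii) Let $p_i$ be a nonzero element of $V_{\mathfrak{sl}_{2n+1},i}$ for $2\le i\le 2n+1$. Then $p_{2i}$ is a basis of $V_{\mathfrak{so}_{2n+1},2i}$ for $1\le i\le n$, and pushout along $\mathfrak{so}_{2n+1}\to\mathfrak{sl}_{2n+1}$ is a well-defined injective map $$\mathrm{Op}_{\mathfrak{so}_{2n+1}}(\mathbb G_m)_{(0,\varpi(0)),(\infty,\frac1{2m})}\hookrightarrow \mathrm{Op}_{\mathfrak{sl}_{2n+1}}(\mathbb G_m)_{(0,\varpi(0)),(\infty,\frac1{2m})},\qquad \nabla_{\mathfrak{so}_{2n+1}}(\lambda_m,\dots,\lambda_n)\mapsto\nabla_{\mathfrak{sl}_{2n+1}}(\lambda_m,0,\lambda_{m+1},\dots,\lambda_n,0),$$ where the $\nabla$'s are formed with the $p_{2i}$, $m\le i\le n$, resp. the $p_i$, $2m\le i\le 2n+1$. In (i) and (ii) the maps $\lambda\mapsto\nabla_{\mathfrak g}(\lambda)$ into the four oper spaces are well defined and injective, and if $2m>n$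 they are bijective, so that $\lambda$ gives coordinates on the oper spaces, identifying them with affine spaces. (iii) Assume $d=2m>n+1$. Let $p_{2i}$ be a nonzero element of $V_{\mathfrak{so}_{2n+1},2i}$ for $1\le i\le n$. For $2i>n+1$, $i\le n$, the image of $p_{2i}$ under the standard inclusion $\mathfrak{so}_{2n+1}\to\mathfrak{so}_{2n+2}$ is a basis of $V_{\mathfrak{so}_{2n+2},2i}$; pushout along this inclusion is a well-defined injective map $$\mathrm{Op}_{\mathfrak{so}_{2n+1}}(\mathbb G_m)_{(0,\varpi(0)),(\infty,\frac1{2m})}\hookrightarrow \mathrm{Op}_{\mathfrak{so}_{2n+2}}(\mathbb G_m)_{(0,\varpi(0)),(\infty,\frac1{2m})},\qquad \nabla_{\mathfrak{so}_{2n+1}}(\lambda_m,\dots,\lambda_n)\mapsto\nabla_{\mathfrak{so}_{2n+2}}(\lambda_m,\dots,\lambda_n),$$ where the $\nabla$'s are formed with the $p_{2i}$, $m\le i\le n$, and their images; and $\lambda\mapsto\nabla_{\mathfrak g}(\lambda)$ is a bijection from $\mathbb C^{n-m+1}$ onto each of the two oper spaces. -/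

import Mathlib

open scoped LaurentPolynomial LaurentSeries PowerSeries

noncomputable section

namespace Oper

/-! ## Split classical Lie algebras over `ℂ`, realised by matrices with the upper triangular Borel -/

/-- `sl N` is `𝔰𝔩_N`, `sp n` is `𝔰𝔭_{2n}`, `soOdd n` is `𝔰𝔬_{2n+1}`, `soEven r` is `𝔰𝔬_{2r}`. -/
inductive ClassicalType
  | sl (N : ℕ)
  | sp (n : ℕ)
  | soOdd (n : ℕ)
  | soEven (r : ℕ)

open ClassicalType

/-- Size of the matrices of the standard representation. -/
abbrev ClassicalType.size : ClassicalType → ℕ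
  | sl N => N
  | sp n => 2 * n
  | soOdd n => 2 * n + 1
  | soEven r => 2 * r

/-- Rank of the semisimple Lie algebra. -/
abbrev ClassicalType.rank : ClassicalType → ℕ
  | sl N => N - 1
  | sp n => n
  | soOdd n => n
  | soEven r => r

/-- Square matrices of the size of the standard representation. -/
abbrev Mat (c : ClassicalType) (R : Type) : Type := Matrix (Fin c.size) (Fin c.size) R

/-- The antidiagonal form `J`. With rows and columns numbered from `1`, its antidiagonal entry in
row `i` and column `j` is `(-1) ^ i` for `sp` and `soOdd`, and `(-1) ^ max i j` for `soEven`.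
(There is no form in type `sl`.) -/
def form : (c : ClassicalType) → Mat c ℂ
  | sl _ => 0
  | sp n => Matrix.of fun a b => if a.val + b.val + 1 = 2 * n then (-1) ^ (a.val + 1) else 0
  | soOdd n => Matrix.of fun a b =>
      if a.val + b.val + 1 = 2 * n + 1 then (-1) ^ (a.val + 1) else 0
  | soEven r => Matrix.of fun a b =>
      if a.val + b.val + 1 = 2 * r then (-1) ^ (max a.val b.val + 1) else 0

section Ring

variable {R : Type} [CommRing R] [Algebra ℂ R]

/-- A complex matrix seen with entries in a `ℂ`-algebra. -/
def const {m n : Type} (R : Type) [CommRing R] [Algebra ℂ R] (X : Matrix m n ℂ) : Matrix m n R :=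
  X.map (algebraMap ℂ R)

/-- `X ∈ 𝔤(R)`: trace zero for `sl`, and `X J + J Xᵀ = 0` for the other types. -/
def MemLie (c : ClassicalType) (X : Mat c R) : Prop :=
  match c with
  | sl _ => X.trace = 0
  | c => X * const R (form c) + const R (form c) * X.transpose = 0

/-- `g` represents an `R`-point of the adjoint group of type `c`.
The adjoint group is the quotient by the scalars `𝔾_m` of `GL_N` in type `sl`, and of the (identity
component of the) group of similitudes of `J` in the other types; all `R`-points of the quotient
lift when `R` has trivial Picard group, as do all rings `R` used below. -/
def MemGroup (c : ClassicalType) (g : GL (Fin c.size) R) : Prop :=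
  match c with
  | sl _ => True
  | soEven r => ∃ μ : Rˣ, g.val * const R (form (soEven r)) * g.val.transpose
      = μ.val • const R (form (soEven r)) ∧ g.val.det = μ.val ^ r
  | c => ∃ μ : Rˣ, g.val * const R (form c) * g.val.transpose = μ.val • const R (form c)

/-- `g` represents an `R`-point of the Borel subgroup `B` (upper triangular matrices) of the
adjoint group. -/
def MemBorel (c : ClassicalType) (g : GL (Fin c.size) R) : Prop :=
  MemGroup c g ∧ g.val.BlockTriangular id

/-- Gauge equivalence of the connections `∂ + A` and `∂ + A'` through `g`, modulo scalar matrices: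
`A' = g A g⁻¹ - ∂(g) g⁻¹ + f`. For `A, A' ∈ 𝔤(R)` this says that the class of `g` in the adjoint
group takes `∂ + A` to `∂ + A'` (the scalar `f` is determined by `A' ∈ 𝔤(R)`). -/
def Gauge {N : ℕ} (der : R → R) (g : GL (Fin N) R) (A A' : Matrix (Fin N) (Fin N) R) : Prop :=
  ∃ f : R, A' = g.val * A * g⁻¹.val - g.val.map der * g⁻¹.val + f • (1 : Matrix (Fin N) (Fin N) R)

end Ring

/-- The negative simple root vectors `f_k`, `k < rank`. -/
def negSimple : (c : ClassicalType) → ℕ → Mat c ℂ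
  | sl _, k => Matrix.of fun a b => if a.val = k + 1 ∧ b.val = k then 1 else 0
  | sp n, k => Matrix.of fun a b =>
      if (a.val = k + 1 ∧ b.val = k) ∨ (a.val + k + 1 = 2 * n ∧ b.val + k + 2 = 2 * n)
      then 1 else 0
  | soOdd n, k => Matrix.of fun a b =>
      if (a.val = k + 1 ∧ b.val = k) ∨ (a.val + k + 1 = 2 * n + 1 ∧ b.val + k + 2 = 2 * n + 1)
      then 1 else 0
  | soEven r, k => Matrix.of fun a b =>
      if k + 1 < r then
        if (a.val = k + 1 ∧ b.val = k) ∨ (a.val + k + 1 = 2 * r ∧ b.val + k + 2 = 2 * r)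
        then 1 else 0
      else
        if (a.val = r ∧ b.val + 2 = r) ∨ (a.val = r + 1 ∧ b.val + 1 = r) then 1 else 0

/-- The principal nilpotent element `p₋₁ = ∑ f_k`. -/
def pMinus (c : ClassicalType) : Mat c ℂ := ∑ k : Fin c.rank, negSimple c k

/-- `2ρ̌`, the sum of the positive coroots. -/
def twoRho : (c : ClassicalType) → Mat c ℂ
  | sl N => Matrix.diagonal fun a => (N : ℂ) - 1 - 2 * (a.val : ℂ)
  | sp n => Matrix.diagonal fun a => 2 * (n : ℂ) - 1 - 2 * (a.val : ℂ)
  | soOdd n => Matrix.diagonal fun a => 2 * (n : ℂ) - 2 * (a.val : ℂ)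
  | soEven r => Matrix.diagonal fun a =>
      if a.val < r then 2 * (r : ℂ) - 2 - 2 * (a.val : ℂ) else 2 * (r : ℂ) - 2 * (a.val : ℂ)

/-- The element `p₁` of the principal `𝔰𝔩₂`-triple `{p₋₁, 2ρ̌, p₁}`. -/
def pPlus : (c : ClassicalType) → Mat c ℂ
  | sl N => Matrix.of fun a b =>
      if b.val = a.val + 1 then ((a.val : ℂ) + 1) * ((N : ℂ) - 1 - a.val) else 0
  | sp n => Matrix.of fun a b =>
      if b.val = a.val + 1 then ((a.val : ℂ) + 1) * (2 * (n : ℂ) - 1 - a.val) else 0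
  | soOdd n => Matrix.of fun a b =>
      if b.val = a.val + 1 then ((a.val : ℂ) + 1) * (2 * (n : ℂ) - a.val) else 0
  | soEven r => Matrix.of fun a b =>
      if a.val + 2 < r ∧ b.val = a.val + 1 then ((a.val : ℂ) + 1) * (2 * (r : ℂ) - 2 - a.val)
      else if a.val + 2 = r ∧ (b.val + 1 = r ∨ b.val = r) then (r : ℂ) * ((r : ℂ) - 1) / 2
      else if (a.val + 1 = r ∨ a.val = r) ∧ b.val = r + 1 then (r : ℂ) * ((r : ℂ) - 1) / 2
      else if r + 1 ≤ a.val ∧ b.val = a.val + 1 then (a.val : ℂ) * (2 * (r : ℂ) - 1 - a.val)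
      else 0

/-- `V_{𝔤,i}`: the elements of degree `i - 1` (for the grading by `ad ρ̌`) of the centraliser of
`p₁` in `𝔤`. -/
def canonicalSpace (c : ClassicalType) (i : ℕ) : Submodule ℂ (Mat c ℂ) where
  carrier := {x | MemLie c x ∧ pPlus c * x = x * pPlus c ∧
    twoRho c * x - x * twoRho c = (2 * ((i : ℂ) - 1)) • x}
  zero_mem' := by
    refine ⟨?_, by simp, by simp⟩
    cases c <;> simp [MemLie]
  add_mem' := by
    rintro x y ⟨hx, hx1, hx2⟩ ⟨hy, hy1, hy2⟩
    refine ⟨?_, by rw [mul_add, add_mul, hx1, hy1], ?_⟩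
    · cases c
      · simp only [MemLie] at *
        rw [Matrix.trace_add, hx, hy, add_zero]
      all_goals
        simp only [MemLie] at *
        rw [Matrix.transpose_add, add_mul, mul_add, add_add_add_comm, hx, hy, add_zero]
    · rw [mul_add, add_mul, add_sub_add_comm, hx2, hy2, smul_add]
  smul_mem' := by
    rintro a x ⟨hx, hx1, hx2⟩
    refine ⟨?_, by rw [Matrix.mul_smul, Matrix.smul_mul, hx1], ?_⟩
    · cases c
      · simp only [MemLie] at *
        rw [Matrix.trace_smul, hx, smul_zero]
      all_goals
        simp only [MemLie] at *
        rw [Matrix.transpose_smul, Matrix.smul_mul, Matrix.mul_smul, ← smul_add, hx, smul_zero]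
    · rw [Matrix.mul_smul, Matrix.smul_mul, ← smul_sub, hx2, smul_comm]

/-! ## Opers on `𝔾_m = Spec ℂ[t, t⁻¹]` -/

/-- `A ∈ 𝔤(R)` is of the form `∑ ψ_k f_k + v` with `ψ_k ∈ Rˣ` and `v ∈ 𝔟(R)`. -/
def IsOperForm (c : ClassicalType) {R : Type} [CommRing R] [Algebra ℂ R] (A : Mat c R) : Prop :=
  MemLie c A ∧ ∃ ψ : Fin c.rank → Rˣ,
    (A - ∑ k : Fin c.rank, (ψ k).val • const R (negSimple c k)).BlockTriangular id

/-- The derivation `d/dt` of `ℂ[t, t⁻¹]`. -/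
def laurentDeriv (f : ℂ[T;T⁻¹]) : ℂ[T;T⁻¹] :=
  f.coeff.sum fun k a => LaurentPolynomial.C ((k : ℂ) * a) * LaurentPolynomial.T (k - 1)

/-- Connections `∂_t + A` of oper form on the trivial bundle over `𝔾_m`. -/
def OperConn (c : ClassicalType) : Type := {A : Mat c ℂ[T;T⁻¹] // IsOperForm c A}

/-- The set of `𝔤`-opers on `𝔾_m`, for the adjoint group: as every `B`-bundle on `𝔾_m` is trivial,
it is the quotient of the connections of oper form by the gauge action of `B(ℂ[t, t⁻¹])`. -/
def OperGm (c : ClassicalType) : Type :=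
  Quot fun A A' : OperConn c =>
    ∃ g : GL (Fin c.size) ℂ[T;T⁻¹], MemBorel c g ∧ Gauge laurentDeriv g A.1 A'.1

/-- The oper defined by a connection of oper form. -/
def toOper {c : ClassicalType} (A : OperConn c) : OperGm c := Quot.mk _ A

/-- The monomial `x ^ k` as a unit of `ℂ((x))`. -/
def xPow (k : ℤ) : (ℂ⸨X⸩)ˣ where
  val := HahnSeries.single k 1
  inv := HahnSeries.single (-k) 1
  val_inv := by simp
  inv_val := by simp

/-- The substitution `t = x ^ k` (`k ≠ 0`), from `ℂ[t, t⁻¹]` to `ℂ((x))`. -/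
def expand (k : ℤ) : ℂ[T;T⁻¹] →+* ℂ⸨X⸩ :=
  LaurentPolynomial.eval₂ HahnSeries.C (xPow k)

/-- The pullback along `t = x ^ k` of `∂_t + A`, that is `∂_x + k x ^ (k - 1) A (x ^ k)`.
For `k = 1` this is the restriction to the formal punctured disc at `0`; for `k = -b` it is the
restriction to the formal punctured disc at `∞`, pulled back along the `b`-fold ramified covering
`x ^ b = t⁻¹`. -/
def pullback {c : ClassicalType} (k : ℤ) (A : Mat c ℂ[T;T⁻¹]) : Mat c ℂ⸨X⸩ :=
  (HahnSeries.single (k - 1) (k : ℂ) : ℂ⸨X⸩) • A.map (expand k)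

/-- The derivation `d/dx` of `ℂ((x))`. -/
def formalDeriv (f : ℂ⸨X⸩) : ℂ⸨X⸩ := LaurentSeries.derivative ℂ f

/-- The matrix `x ^ (-(a + 1)) M(x)`, with `M(x)` a matrix of power series. -/
def polar {c : ClassicalType} (a : ℕ) (M : Mat c ℂ⟦X⟧) : Mat c ℂ⸨X⸩ :=
  (xPow (-((a : ℤ) + 1))).val • M.map (HahnSeries.ofPowerSeries ℤ ℂ)

/-- The value at `x = 0`. -/
def atZero {c : ClassicalType} (M : Mat c ℂ⟦X⟧) : Mat c ℂ :=
  M.map (PowerSeries.constantCoeff (R := ℂ))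

/-- Regular singularity at `0` with residue `ϖ(0)`: up to the gauge action of `B(ℂ((t)))`, the oper
is `∂_t + t⁻¹ (∑ ψ_k f_k + v)` with `ψ_k ∈ ℂ[[t]]ˣ` and `v ∈ 𝔟(ℂ[[t]])`, and the class in `𝔤 // G`
of the value at `0` of `∑ ψ_k f_k + v` is the class of `0`, that is, this value is nilpotent. -/
def RegularResidueZero (c : ClassicalType) (A : Mat c ℂ[T;T⁻¹]) : Prop :=
  ∃ (g : GL (Fin c.size) ℂ⸨X⸩) (M : Mat c ℂ⟦X⟧), MemBorel c g ∧ IsOperForm c M ∧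
    Gauge formalDeriv g (pullback 1 A) (polar 0 M) ∧ IsNilpotent (atZero M)

/-- `q` is the (maximal formal) slope at `∞` of the connection `∂_t + A`, for the adjoint group `G`:
either `q = 0` and the connection is regular singular, or `q = a / b > 0` and, after pullback along
`x ^ b = t⁻¹`, the connection is `G(ℂ((x)))`-gauge equivalent to one with a pole of order `a + 1`
whose leading coefficient is not nilpotent. -/
def IsSlopeAtInfty (c : ClassicalType) (A : Mat c ℂ[T;T⁻¹]) (q : ℚ) : Prop :=
  ∃ a b : ℕ, 0 < b ∧ q = (a : ℚ) / b ∧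
    ∃ (g : GL (Fin c.size) ℂ⸨X⸩) (M : Mat c ℂ⟦X⟧), MemGroup c g ∧ MemLie c M ∧
      Gauge formalDeriv g (pullback (-(b : ℤ)) A) (polar a M) ∧
      ((a = 0 ∧ b = 1) ∨ (0 < a ∧ ¬ IsNilpotent (atZero M)))

/-- The space `Op_𝔤(𝔾_m)_{(0,ϖ(0)),(∞,1/d)}` of the `𝔤`-opers on `𝔾_m` with a regular singularity
at `0` with residue `ϖ(0)` and maximal formal slope `≤ 1/d` at `∞`. -/
def OperSpace (c : ClassicalType) (d : ℕ) : Set (OperGm c) :=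
  {x | ∃ A : OperConn c, toOper A = x ∧ RegularResidueZero c A.1 ∧
    ∃ q : ℚ, IsSlopeAtInfty c A.1 q ∧ q ≤ 1 / (d : ℚ)}

/-! ## Explicit opers and pushout -/

/-- The matrix `t⁻¹ p₋₁ + ∑ λ_j q_j` of the connection `∂_t + t⁻¹ p₋₁ + ∑ λ_j q_j`. -/
def nabla (c : ClassicalType) {k : ℕ} (q : Fin k → Mat c ℂ) (l : Fin k → ℂ) : Mat c ℂ[T;T⁻¹] :=
  (LaurentPolynomial.T (-1) : ℂ[T;T⁻¹]) • const ℂ[T;T⁻¹] (pMinus c)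
    + const ℂ[T;T⁻¹] (∑ j, l j • q j)

/-- `x` is the map `λ ↦ [∂_t + t⁻¹ p₋₁ + ∑ λ_j q_j]` into the space of opers. -/
def IsNablaMap (c : ClassicalType) (d : ℕ) {k : ℕ} (q : Fin k → Mat c ℂ)
    (x : (Fin k → ℂ) → OperSpace c d) : Prop :=
  ∀ l, ∃ A : OperConn c, A.1 = nabla c q l ∧ (x l).1 = toOper A

/-- `ι` is the pushout of opers along the homomorphism `φ`: it takes the class of `∂_t + A` to the
class of `∂_t + φ(A)`. -/
def IsPushout (c c' : ClassicalType) (d : ℕ) (φ : Mat c ℂ[T;T⁻¹] → Mat c' ℂ[T;T⁻¹])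
    (ι : OperSpace c d → OperSpace c' d) : Prop :=
  ∀ (A : OperConn c) (hA : toOper A ∈ OperSpace c d),
    ∃ A' : OperConn c', A'.1 = φ A.1 ∧ (ι ⟨toOper A, hA⟩).1 = toOper A'

/-- `(λ_0, λ_1, …) ↦ (λ_0, 0, λ_1, 0, …)`. -/
def insertZeros {k k' : ℕ} (l : Fin k → ℂ) : Fin k' → ℂ := fun j =>
  if h : j.val % 2 = 0 ∧ j.val / 2 < k then l ⟨j.val / 2, h.2⟩ else 0

/-- The linear map `ℂ^{2n+1} → ℂ^{2n+2}` with `e_i ↦ e_i` for `i < n`, `e_n ↦ e_n + e_{n+1}` and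
`e_i ↦ 2 e_{i+1}` for `i > n` (indices from `0`); it multiplies the invariant symmetric form by `-2`,
and its image is the orthogonal complement of the anisotropic vector `e_n - e_{n+1}`. -/
def soIncl (n : ℕ) : Matrix (Fin (2 * (n + 1))) (Fin (2 * n + 1)) ℂ := Matrix.of fun a b =>
  if b.val < n then (if a.val = b.val then 1 else 0)
  else if b.val = n then (if a.val = n ∨ a.val = n + 1 then 1 else 0)
  else (if a.val = b.val + 1 then 2 else 0)

/-- The left inverse of `soIncl n` with kernel spanned by `e_n - e_{n+1}`. -/
def soProj (n : ℕ) : Matrix (Fin (2 * n + 1)) (Fin (2 * (n + 1))) ℂ := Matrix.of fun b a =>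
  if b.val < n then (if a.val = b.val then 1 else 0)
  else if b.val = n then (if a.val = n ∨ a.val = n + 1 then 1 / 2 else 0)
  else (if a.val = b.val + 1 then 1 / 2 else 0)

/-- The standard inclusion `𝔰𝔬_{2n+1} → 𝔰𝔬_{2n+2}`, over a `ℂ`-algebra `R`: the given action on the
image of `soIncl n`, and `0` on its orthogonal complement. -/
def soInclusion (n : ℕ) {R : Type} [CommRing R] [Algebra ℂ R] (X : Mat (soOdd n) R) :
    Mat (soEven (n + 1)) R :=
  const R (soIncl n) * X * const R (soProj n)

end Oper

end

set_option linter.unusedSectionVars false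

/-! Everything rests on canonical forms. The standard basis is graded by height, so that `p₋₁` has
degree `-1`, `p₁` has degree `1`, and upper triangular matrices have degree at least `0`. Kostant's
argument shows that `ad p₁ ∘ ad p₋₁` is injective in positive degrees
(`GradedTriple.eq_zero_of_bracket`, by positivity of a hermitian form for which `p₁` and `p₋₁` are
adjoint). Hence every connection of oper form is `B`-equivalent to exactly one `∂ + p₋₁ + v` with
`v` of positive degree centralising `p₁` (`Principal.canonical_exists`,
`Principal.canonical_unique`). This holds over any `ℂ`-algebra and for any derivation. With `t d/dt`
on `ℂ[t, t⁻¹]`, an oper on `𝔾_m` is the same thing as a canonical `v`, through `∂_t + t⁻¹ (p₋₁ +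
v)`.

The local conditions are then read off from `v`. At `0`, uniqueness over `ℂ((t))` forces `v` to have
power series entries. Since `p₋₁` is the only nilpotent element of the slice `p₋₁ + ⨁ V_i`
(`NilpotentSlice`), residue `ϖ(0)` forces `v(0) = 0` (`Principal.coeff_eq_zero_of_regular`). At `∞`,
gauging by a fractional power of the cocharacter `ρ̌` shows that a term of `v` in `t ^ e V_i`
contributes slope `e / i`, and the slope is the largest of these numbers: the leading term is a
multiple of a slice element other than `p₋₁`, so it is not nilpotent (`Principal.exists_slope`), and
a slope so exhibited is unique (`slope_le`). Thus slope at most `1/d` means `e d ≤ i` for every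
term. If all `i` are below `2d`, only `e = 1` and `i ≥ d` survive, so `v = t w` with `w` constant
(`Principal.exists_tConst`). Conversely every such `w` gives an oper in the space
(`Principal.tConst_mem`). This yields the maps `λ ↦ ∇(λ)`, their injectivity and, in the stated
ranges, their bijectivity (`exists_nablaMap`).

The pushouts are injective because the inclusions match the principal triples, hence take canonical
forms to canonical forms (`IsEmbedding.exists_pushout`). In `𝔰𝔩_N` the space `V_i` is spanned by `p₁
^ (i - 1)`, and odd powers of `p₁` are exactly those that lie in `𝔰𝔭` or `𝔰𝔬`, which explains the
even indices and the inserted zeros. In `𝔰𝔬_{2n+2}` the additional canonical element is the Pfaffian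
one, of degree `n + 1`; the assumption `2m > n + 1` puts it out of range. It still has to be treated
in the nilpotent slice property: an element of the slice with nonzero Pfaffian part is invertible
(`nilpotentSlice_soEven`). -/

namespace Oper

/-! ### Matrices graded by the height of basis vectors -/

section Degree

variable {ι R : Type*} [CommRing R] (ht : ι → ℕ)

/-- The degree of the matrix unit in position `(a, b)`. -/
def deg (a b : ι) : ℤ := (ht b : ℤ) - ht a

/-- All entries of `X` in degrees other than `k` vanish. -/
def HasDeg (k : ℤ) (X : Matrix ι ι R) : Prop := ∀ a b, deg ht a b ≠ k → X a b = 0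

/-- All entries of `X` in degrees smaller than `k` vanish. -/
def DegGE (k : ℤ) (X : Matrix ι ι R) : Prop := ∀ a b, deg ht a b < k → X a b = 0

/-- The component of degree `k`. -/
def degComp (k : ℤ) (X : Matrix ι ι R) : Matrix ι ι R :=
  Matrix.of fun a b => if deg ht a b = k then X a b else 0

variable {ht} {X Y : Matrix ι ι R} {i j k : ℤ}

lemma deg_add (a b c : ι) : deg ht a b + deg ht b c = deg ht a c := by
  simp only [deg]; ring

lemma degComp_apply (a b : ι) : degComp ht k X a b = if deg ht a b = k then X a b else 0 := rfl

lemma hasDeg_degComp : HasDeg ht k (degComp ht k X) := fun a b h => by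
  rw [degComp_apply, if_neg h]

lemma HasDeg.degGE (h : HasDeg ht k X) (hj : j ≤ k) : DegGE ht j X :=
  fun a b hab => h a b (by omega)

lemma DegGE.mono (h : DegGE ht k X) (hj : j ≤ k) : DegGE ht j X :=
  fun a b hab => h a b (by omega)

lemma HasDeg.degComp_eq (h : HasDeg ht k X) : degComp ht k X = X := by
  ext a b; rw [degComp_apply]; split_ifs with hh
  · rfl
  · exact (h a b hh).symm

lemma HasDeg.degComp_ne (h : HasDeg ht k X) (hj : j ≠ k) : degComp ht j X = 0 := by
  ext a b; rw [degComp_apply]; split_ifs with hh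
  · exact h a b (by omega)
  · rfl

lemma DegGE.degComp_lt (h : DegGE ht k X) (hj : j < k) : degComp ht j X = 0 := by
  ext a b; rw [degComp_apply]; split_ifs with hh
  · exact h a b (by omega)
  · rfl

lemma degGE_succ (h : DegGE ht k X) (h0 : degComp ht k X = 0) : DegGE ht (k + 1) X := by
  intro a b hab
  rcases lt_or_eq_of_le (show deg ht a b ≤ k by omega) with h1 | h1
  · exact h a b h1
  · have := congrFun (congrFun h0 a) b
    rwa [degComp_apply, if_pos h1] at this

lemma DegGE.sub_degComp (h : DegGE ht k X) : DegGE ht (k + 1) (X - degComp ht k X) := by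
  intro a b hab
  rw [Matrix.sub_apply, degComp_apply]
  split_ifs with h1
  · exact sub_self _
  · rw [h a b (by omega), sub_zero]

lemma HasDeg.zero : HasDeg ht k (0 : Matrix ι ι R) := fun _ _ _ => rfl
lemma DegGE.zero : DegGE ht k (0 : Matrix ι ι R) := fun _ _ _ => rfl

lemma DegGE.add (hX : DegGE ht k X) (hY : DegGE ht k Y) : DegGE ht k (X + Y) :=
  fun a b h => by rw [Matrix.add_apply, hX a b h, hY a b h, add_zero]

lemma DegGE.sub (hX : DegGE ht k X) (hY : DegGE ht k Y) : DegGE ht k (X - Y) :=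
  fun a b h => by rw [Matrix.sub_apply, hX a b h, hY a b h, sub_zero]

lemma DegGE.smul (r : R) (hX : DegGE ht k X) : DegGE ht k (r • X) :=
  fun a b h => by rw [Matrix.smul_apply, hX a b h, smul_zero]

lemma HasDeg.add (hX : HasDeg ht k X) (hY : HasDeg ht k Y) : HasDeg ht k (X + Y) :=
  fun a b h => by rw [Matrix.add_apply, hX a b h, hY a b h, add_zero]

lemma HasDeg.sub (hX : HasDeg ht k X) (hY : HasDeg ht k Y) : HasDeg ht k (X - Y) :=
  fun a b h => by rw [Matrix.sub_apply, hX a b h, hY a b h, sub_zero]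

lemma HasDeg.smul (r : R) (hX : HasDeg ht k X) : HasDeg ht k (r • X) :=
  fun a b h => by rw [Matrix.smul_apply, hX a b h, smul_zero]

lemma HasDeg.map {S : Type*} [CommRing S] {f : R → S} (h0 : f 0 = 0) (hX : HasDeg ht k X) :
    HasDeg ht k (X.map f) :=
  fun a b h => by rw [Matrix.map_apply, hX a b h, h0]

lemma DegGE.map {S : Type*} [CommRing S] {f : R → S} (h0 : f 0 = 0) (hX : DegGE ht k X) :
    DegGE ht k (X.map f) :=
  fun a b h => by rw [Matrix.map_apply, hX a b h, h0]

lemma degComp_add : degComp ht k (X + Y) = degComp ht k X + degComp ht k Y := by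
  ext a b; simp only [degComp_apply, Matrix.add_apply]; split_ifs <;> simp

lemma degComp_sub : degComp ht k (X - Y) = degComp ht k X - degComp ht k Y := by
  ext a b; simp only [degComp_apply, Matrix.sub_apply]; split_ifs <;> simp

lemma degComp_smul (r : R) : degComp ht k (r • X) = r • degComp ht k X := by
  ext a b; simp only [degComp_apply, Matrix.smul_apply]; split_ifs <;> simp

lemma eq_zero_of_degComp (h : ∀ k, degComp ht k X = 0) : X = 0 := by
  ext a b
  have := congrFun (congrFun (h (deg ht a b)) a) b
  rwa [degComp_apply, if_pos rfl] at this

variable [Fintype ι]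

lemma DegGE.mul (hX : DegGE ht i X) (hY : DegGE ht j Y) (hk : k ≤ i + j) :
    DegGE ht k (X * Y) := by
  intro a b h
  rw [Matrix.mul_apply]
  refine Finset.sum_eq_zero fun c _ => ?_
  by_cases h1 : deg ht a c < i
  · rw [hX a c h1, zero_mul]
  · rw [hY c b (by have := deg_add (ht := ht) a c b; omega), mul_zero]

lemma HasDeg.mul (hX : HasDeg ht i X) (hY : HasDeg ht j Y) (hk : k = i + j) :
    HasDeg ht k (X * Y) := by
  intro a b h
  rw [Matrix.mul_apply]
  refine Finset.sum_eq_zero fun c _ => ?_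
  by_cases h1 : deg ht a c = i
  · rw [hY c b (by have := deg_add (ht := ht) a c b; omega), mul_zero]
  · rw [hX a c h1, zero_mul]

lemma HasDeg.degComp_mul (hX : HasDeg ht i X) (hk : k = i + j) :
    degComp ht k (X * Y) = X * degComp ht j Y := by
  ext a b
  rw [degComp_apply, Matrix.mul_apply, Matrix.mul_apply]
  split_ifs with h
  · refine Finset.sum_congr rfl fun c _ => ?_
    by_cases h1 : deg ht a c = i
    · rw [degComp_apply, if_pos (by have := deg_add (ht := ht) a c b; omega)]
    · rw [hX a c h1, zero_mul, zero_mul]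
  · refine (Finset.sum_eq_zero fun c _ => ?_).symm
    by_cases h1 : deg ht a c = i
    · rw [degComp_apply, if_neg (by have := deg_add (ht := ht) a c b; omega), mul_zero]
    · rw [hX a c h1, zero_mul]

lemma HasDeg.degComp_mul_right (hY : HasDeg ht j Y) (hk : k = i + j) :
    degComp ht k (X * Y) = degComp ht i X * Y := by
  ext a b
  rw [degComp_apply, Matrix.mul_apply, Matrix.mul_apply]
  split_ifs with h
  · refine Finset.sum_congr rfl fun c _ => ?_
    by_cases h1 : deg ht c b = j
    · rw [degComp_apply, if_pos (by have := deg_add (ht := ht) a c b; omega)]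
    · rw [hY c b h1, mul_zero, mul_zero]
  · refine (Finset.sum_eq_zero fun c _ => ?_).symm
    by_cases h1 : deg ht c b = j
    · rw [degComp_apply, if_neg (by have := deg_add (ht := ht) a c b; omega), zero_mul]
    · rw [hY c b h1, mul_zero]

lemma DegGE.trace_eq_zero (hX : DegGE ht k X) (hk : 0 < k) : X.trace = 0 :=
  Finset.sum_eq_zero fun a _ => hX a a (by simp only [deg]; omega)

lemma HasDeg.trace_eq_zero (hX : HasDeg ht k X) (hk : k ≠ 0) : X.trace = 0 :=
  Finset.sum_eq_zero fun a _ => hX a a (by simp only [deg]; omega)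

lemma DegGE.eq_zero (hX : DegGE ht k X) (hk : ∀ a, (ht a : ℤ) < k) : X = 0 := by
  ext a b
  exact hX a b (by have := hk b; simp only [deg]; omega)

variable [DecidableEq ι]

lemma HasDeg.one : HasDeg ht 0 (1 : Matrix ι ι R) := by
  intro a b h
  rw [Matrix.one_apply_ne]
  rintro rfl
  exact h (by simp [deg])

lemma HasDeg.pow (hX : HasDeg ht i X) (m : ℕ) : HasDeg ht (m * i) (X ^ m) := by
  induction m with
  | zero => simpa using HasDeg.one
  | succ m ih => rw [pow_succ]; exact ih.mul hX (by push_cast; ring)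

lemma DegGE.pow (hX : DegGE ht i X) (m : ℕ) : DegGE ht (m * i) (X ^ m) := by
  induction m with
  | zero => simpa using (HasDeg.one (ht := ht)).degGE le_rfl
  | succ m ih => rw [pow_succ]; exact ih.mul hX (by push_cast; linarith)

lemma DegGE.isNilpotent (hX : DegGE ht 1 X) : IsNilpotent X := by
  obtain ⟨m, hm⟩ : ∃ m : ℕ, ∀ a, ht a < m := by
    refine ⟨Finset.univ.sup ht + 1, fun a => Nat.lt_succ_of_le (Finset.le_sup (Finset.mem_univ a))⟩
  exact ⟨m, (hX.pow m).eq_zero fun a => by have := hm a; simp; omega⟩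

lemma HasDeg.isNilpotent (hX : HasDeg ht i X) (hi : i ≠ 0) : IsNilpotent X := by
  obtain ⟨m, hm⟩ : ∃ m : ℕ, ∀ a, ht a < m := by
    refine ⟨Finset.univ.sup ht + 1, fun a => Nat.lt_succ_of_le (Finset.le_sup (Finset.mem_univ a))⟩
  refine ⟨m, ?_⟩
  ext a b
  refine hX.pow m a b ?_
  have h1 := hm a
  have h2 := hm b
  simp only [deg]
  rcases lt_or_gt_of_ne hi with h | h <;> nlinarith

end Degree

end Oper

/-! ### Graded `𝔰𝔩₂`-triples and positivity -/

namespace Oper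

section Triple

variable {ι : Type} [Fintype ι] [DecidableEq ι]

/-- An `𝔰𝔩₂`-triple of matrices graded by heights, whose nilpotent elements are adjoint to each
other for a positive diagonal hermitian form. -/
structure GradedTriple (ht : ι → ℕ) (e f : Matrix ι ι ℂ) : Prop where
  deg_e : HasDeg ht 1 e
  deg_f : HasDeg ht (-1) f
  adjoint : ∃ S : ι → ℝ, (∀ a, 0 < S a) ∧ ∀ a b, (S a : ℂ) * e a b = star (f b a) * S b
  bracket : ∃ κ : ℂ, e * f - f * e = Matrix.diagonal fun a => κ - 2 * (ht a : ℂ)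

/-- The adjoint of a matrix with respect to a diagonal hermitian form. -/
noncomputable def weightedAdjoint (S : ι → ℝ) (X : Matrix ι ι ℂ) : Matrix ι ι ℂ :=
  Matrix.of fun a b => (S a : ℂ)⁻¹ * star (X b a) * S b

lemma weightedAdjoint_mul {S : ι → ℝ} (hS : ∀ a, 0 < S a) (X Y : Matrix ι ι ℂ) :
    weightedAdjoint S (X * Y) = weightedAdjoint S Y * weightedAdjoint S X := by
  ext a b
  simp only [weightedAdjoint, Matrix.of_apply, Matrix.mul_apply, star_sum, star_mul',
    Finset.mul_sum, Finset.sum_mul]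
  refine Finset.sum_congr rfl fun c _ => ?_
  have : (S c : ℂ) ≠ 0 := by exact_mod_cast (hS c).ne'
  field_simp

lemma weightedAdjoint_sub (S : ι → ℝ) (X Y : Matrix ι ι ℂ) :
    weightedAdjoint S (X - Y) = weightedAdjoint S X - weightedAdjoint S Y := by
  ext a b
  simp only [weightedAdjoint, Matrix.of_apply, Matrix.sub_apply, star_sub]
  ring

/-- A weighted sum of squares, hence a norm. Its positivity takes the place of the representation
theory of `𝔰𝔩₂`. -/
lemma trace_mul_weightedAdjoint {S : ι → ℝ} (X : Matrix ι ι ℂ) :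
    (X * weightedAdjoint S X).trace
      = ((∑ a, ∑ b, Complex.normSq (X a b) * ((S b)⁻¹ * S a) : ℝ) : ℂ) := by
  simp only [Matrix.trace, Matrix.diag, Matrix.mul_apply, weightedAdjoint, Matrix.of_apply]
  push_cast
  refine Finset.sum_congr rfl fun a _ => Finset.sum_congr rfl fun b _ => ?_
  rw [← Complex.mul_conj]
  simp only [RCLike.star_def]
  ring

lemma eq_zero_of_trace_mul_weightedAdjoint {S : ι → ℝ} (hS : ∀ a, 0 < S a) {X : Matrix ι ι ℂ}
    (h : (∑ a, ∑ b, Complex.normSq (X a b) * ((S b)⁻¹ * S a) : ℝ) ≤ 0) : X = 0 := by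
  have hpos : ∀ a b, 0 ≤ Complex.normSq (X a b) * ((S b)⁻¹ * S a) := fun a b =>
    mul_nonneg (Complex.normSq_nonneg _) (mul_pos (inv_pos.2 (hS b)) (hS a)).le
  have h0 := le_antisymm h (Finset.sum_nonneg fun a _ => Finset.sum_nonneg fun b _ => hpos a b)
  ext a b
  rw [Finset.sum_eq_zero_iff_of_nonneg
    (fun a _ => Finset.sum_nonneg fun b _ => hpos a b)] at h0
  have h1 := h0 a (Finset.mem_univ a)
  rw [Finset.sum_eq_zero_iff_of_nonneg (fun b _ => hpos a b)] at h1
  have h2 := h1 b (Finset.mem_univ b)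
  rcases mul_eq_zero.1 h2 with h3 | h3
  · exact Complex.normSq_eq_zero.1 h3
  · exact absurd h3 (mul_pos (inv_pos.2 (hS b)) (hS a)).ne'

namespace GradedTriple

variable {ht : ι → ℕ} {e f : Matrix ι ι ℂ}

/-- Since `e` and `f` are adjoint, so are `ad e` and `ad f` for the trace norm. Thus `[e, [f, y]] =
0` gives `[f, y] = 0`, and then `[f, [e, y]] = -2k y` makes the squared norm of `[e, y]` equal to
`-2k` times that of `y`, which is impossible for `k ≥ 1` unless `y = 0`. -/
theorem eq_zero_of_bracket (h : GradedTriple ht e f) {y : Matrix ι ι ℂ} {k : ℤ} (hk : 1 ≤ k)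
    (hy : HasDeg ht k y) (hc : e * (f * y - y * f) = (f * y - y * f) * e) : y = 0 := by
  obtain ⟨S, hS, hef⟩ := h.adjoint
  have hS' : ∀ a, (S a : ℂ) ≠ 0 := fun a => by exact_mod_cast (hS a).ne'
  have hf : weightedAdjoint S f = e := by
    ext a b
    simp only [weightedAdjoint, Matrix.of_apply]
    rw [mul_assoc, ← hef, inv_mul_cancel_left₀ (hS' a)]
  have he : weightedAdjoint S e = f := by
    ext a b
    simp only [weightedAdjoint, Matrix.of_apply]
    have := congrArg star (hef b a)
    simp only [star_mul', RCLike.star_def, Complex.conj_ofReal, Complex.conj_conj] at this ⊢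
    rw [mul_assoc, mul_comm _ (S b : ℂ), this, mul_comm (f a b), inv_mul_cancel_left₀ (hS' a)]
  have key : ∀ u x : Matrix ι ι ℂ, ∀ z : Matrix ι ι ℂ,
      ((u * x - x * u) * weightedAdjoint S z).trace
        = (x * (weightedAdjoint S z * u - u * weightedAdjoint S z)).trace := by
    intro u x z
    simp only [sub_mul, mul_sub, Matrix.trace_sub]
    rw [mul_assoc, Matrix.trace_mul_comm, mul_assoc, mul_assoc]
  -- The squared norm of `z = [f, y]` is the trace of `y` against `[z*, f]`, and `[z*, f]` is the
  -- adjoint of `[e, z] = 0`.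
  have hz : f * y - y * f = 0 := by
    refine eq_zero_of_trace_mul_weightedAdjoint hS (le_of_eq ?_)
    have := trace_mul_weightedAdjoint (S := S) (f * y - y * f)
    set z := f * y - y * f with hzdef
    have h1 : weightedAdjoint S z * f - f * weightedAdjoint S z = 0 := by
      have : weightedAdjoint S (e * z - z * e) = weightedAdjoint S 0 := by rw [hc, sub_self]
      rw [weightedAdjoint_sub, weightedAdjoint_mul hS, weightedAdjoint_mul hS, he] at this
      rw [this]; ext a b; simp [weightedAdjoint]
    nth_rewrite 1 [hzdef] at this
    rw [key, h1, mul_zero, Matrix.trace_zero] at this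
    exact_mod_cast this.symm
  obtain ⟨κ, hκ⟩ := h.bracket
  -- The Jacobi identity, with `[f, y] = 0` and `[h, y] = 2k y` for `h = [e, f]`.
  have hhy : f * (e * y - y * e) - (e * y - y * e) * f = -(2 * (k : ℂ)) • y := by
    have h1 : f * (e * y - y * e) - (e * y - y * e) * f
        = -((e * f - f * e) * y - y * (e * f - f * e)) + (e * (f * y - y * f)
          - (f * y - y * f) * e) := by noncomm_ring
    rw [h1, hz, hκ]
    ext a b
    simp only [mul_zero, zero_mul, sub_zero, add_zero, Matrix.neg_apply, Matrix.sub_apply,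
      Matrix.diagonal_mul, Matrix.mul_diagonal, Matrix.smul_apply, smul_eq_mul]
    by_cases hab : deg ht a b = k
    · rw [← hab]; simp only [deg]; push_cast; ring
    · rw [hy a b hab]; ring
  have h2 := trace_mul_weightedAdjoint (S := S) (e * y - y * e)
  rw [key] at h2
  have h3 : weightedAdjoint S (e * y - y * e) * e - e * weightedAdjoint S (e * y - y * e)
      = -(2 * (k : ℂ)) • weightedAdjoint S y := by
    have h4 : weightedAdjoint S (f * (e * y - y * e) - (e * y - y * e) * f)
        = weightedAdjoint S (-(2 * (k : ℂ)) • y) := by rw [hhy]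
    rw [weightedAdjoint_sub, weightedAdjoint_mul hS, weightedAdjoint_mul hS, hf] at h4
    rw [h4]
    ext a b
    simp [weightedAdjoint]
    ring
  rw [h3, Matrix.mul_smul, Matrix.trace_smul, trace_mul_weightedAdjoint, smul_eq_mul] at h2
  -- Both sums are nonnegative while the factor on the left is negative, so both vanish.
  have h5 : -(2 * (k : ℝ)) * (∑ a, ∑ b, Complex.normSq (y a b) * ((S b)⁻¹ * S a))
      = ∑ a, ∑ b, Complex.normSq ((e * y - y * e) a b) * ((S b)⁻¹ * S a) := by
    exact_mod_cast h2
  have h6 : 0 ≤ ∑ a, ∑ b, Complex.normSq ((e * y - y * e) a b) * ((S b)⁻¹ * S a) :=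
    Finset.sum_nonneg fun a _ => Finset.sum_nonneg fun b _ =>
      mul_nonneg (Complex.normSq_nonneg _) (mul_pos (inv_pos.2 (hS b)) (hS a)).le
  have hk' : (1 : ℝ) ≤ k := by exact_mod_cast hk
  exact eq_zero_of_trace_mul_weightedAdjoint hS (by nlinarith)

/-- The injective endomorphism `ad e ∘ ad f` of the degree `k + 1` part of `L` is surjective by
finite dimension, so it attains `[e, x]`. This is the decomposition of `L` in degree `k` into the
centraliser of `e` and the image of `ad f`. -/
theorem exists_bracket (h : GradedTriple ht e f) (L : Submodule ℂ (Matrix ι ι ℂ))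
    (hLe : ∀ x ∈ L, e * x - x * e ∈ L) (hLf : ∀ x ∈ L, f * x - x * f ∈ L)
    {x : Matrix ι ι ℂ} {k : ℤ} (hk : 0 ≤ k) (hx : HasDeg ht k x) (hxL : x ∈ L) :
    ∃ y ∈ L, HasDeg ht (k + 1) y ∧
      e * (x - (f * y - y * f)) = (x - (f * y - y * f)) * e := by
  let W : Submodule ℂ (Matrix ι ι ℂ) :=
    { carrier := {y | y ∈ L ∧ HasDeg ht (k + 1) y}
      zero_mem' := ⟨L.zero_mem, HasDeg.zero⟩
      add_mem' := fun ha hb => ⟨L.add_mem ha.1 hb.1, ha.2.add hb.2⟩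
      smul_mem' := fun c _ ha => ⟨L.smul_mem c ha.1, ha.2.smul c⟩ }
  have hdeg : ∀ y, HasDeg ht k y → HasDeg ht (k + 1) (e * y - y * e) := fun y hy =>
    (h.deg_e.mul hy (by ring)).sub (hy.mul h.deg_e (by ring))
  have hdeg' : ∀ y, HasDeg ht (k + 1) y → HasDeg ht k (f * y - y * f) := fun y hy =>
    (h.deg_f.mul hy (by ring)).sub (hy.mul h.deg_f (by ring))
  let T : W →ₗ[ℂ] W :=
    { toFun := fun y => ⟨e * (f * y.1 - y.1 * f) - (f * y.1 - y.1 * f) * e,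
        hLe _ (hLf _ y.2.1), hdeg _ (hdeg' _ y.2.2)⟩
      map_add' := fun y z => by
        ext1
        simp only [Submodule.coe_add]
        noncomm_ring
      map_smul' := fun c y => by
        ext1
        simp only [Submodule.coe_smul, Matrix.mul_smul, Matrix.smul_mul, ← smul_sub,
          RingHom.id_apply] }
  have hinj : Function.Injective T := by
    rw [← LinearMap.ker_eq_bot, LinearMap.ker_eq_bot']
    intro y hy
    have h1 : e * (f * y.1 - y.1 * f) - (f * y.1 - y.1 * f) * e = 0 := congrArg Subtype.val hy
    exact Subtype.ext (h.eq_zero_of_bracket (by omega) y.2.2 (sub_eq_zero.1 h1))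
  obtain ⟨y, hy⟩ := LinearMap.injective_iff_surjective.1 hinj ⟨e * x - x * e, hLe _ hxL, hdeg _ hx⟩
  have h1 : e * (f * y.1 - y.1 * f) - (f * y.1 - y.1 * f) * e = e * x - x * e :=
    congrArg Subtype.val hy
  refine ⟨y.1, y.2.1, y.2.2, ?_⟩
  rw [mul_sub e x, sub_mul x, sub_eq_sub_iff_sub_eq_sub, ← h1]

end GradedTriple

end Triple

/-! ### Base change from `ℂ` to a `ℂ`-algebra -/

section BaseChange

variable {m n : Type} {R : Type} [CommRing R] [Algebra ℂ R]

/-- Coordinates in a basis of `R` over `ℂ`; only finitely many occur in the entries of one matrix.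
Linear problems with complex coefficients can thus be solved coordinate by coordinate over `ℂ`. -/
lemma exists_eq_sum_smul_const [Finite m] [Finite n] (X : Matrix m n R) :
    ∃ (κ : Type) (s : Finset κ) (b : κ → R) (l : κ → R →ₗ[ℂ] ℂ),
      X = ∑ i ∈ s, b i • const R (X.map (l i)) := by
  classical
  cases nonempty_fintype m
  cases nonempty_fintype n
  let B := Module.Basis.ofVectorSpace ℂ R
  refine ⟨_, Finset.univ.biUnion fun p : m × n => (B.repr (X p.1 p.2)).support, B,
    fun i => B.coord i, ?_⟩
  ext a b
  rw [Matrix.sum_apply]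
  simp only [Matrix.smul_apply, const, Matrix.map_apply, smul_eq_mul, Module.Basis.coord_apply]
  conv_lhs => rw [← B.linearCombination_repr (X a b), Finsupp.linearCombination_apply, Finsupp.sum]
  refine (Finset.sum_subset (Finset.subset_biUnion_of_mem
    (fun p : m × n => (B.repr (X p.1 p.2)).support) (Finset.mem_univ (a, b))) ?_).trans ?_
  · intro i _ hi
    rw [Finsupp.notMem_support_iff.1 hi, zero_smul]
  · refine Finset.sum_congr rfl fun i _ => ?_
    rw [Algebra.smul_def, mul_comm]

lemma eq_zero_of_map {X : Matrix m n R} (h : ∀ l : R →ₗ[ℂ] ℂ, X.map l = 0) : X = 0 := by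
  ext a b
  exact (Module.forall_dual_apply_eq_zero_iff ℂ _).1 fun l => congrFun (congrFun (h l) a) b

lemma const_add (X Y : Matrix m n ℂ) : const R (X + Y) = const R X + const R Y :=
  Matrix.map_add _ (map_add _) _ _

lemma const_sub (X Y : Matrix m n ℂ) : const R (X - Y) = const R X - const R Y :=
  Matrix.map_sub _ (map_sub _) _ _

lemma const_zero : const R (0 : Matrix m n ℂ) = 0 := Matrix.map_zero _ (map_zero _)

lemma const_one [DecidableEq m] : const R (1 : Matrix m m ℂ) = 1 :=
  Matrix.map_one _ (map_zero _) (map_one _)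

lemma const_smul (r : ℂ) (X : Matrix m n ℂ) : const R (r • X) = algebraMap ℂ R r • const R X := by
  ext a b; simp [const]

lemma const_apply (X : Matrix m n ℂ) (a : m) (b : n) :
    const R X a b = algebraMap ℂ R (X a b) := rfl

lemma const_self (X : Matrix m n ℂ) : const ℂ X = X := by ext; rfl

variable [Fintype n] {p : Type}

lemma map_mul_const (l : R →ₗ[ℂ] ℂ) (X : Matrix m n R) (Y : Matrix n p ℂ) :
    (X * const R Y).map l = X.map l * Y := by
  ext a b
  simp only [Matrix.map_apply, Matrix.mul_apply, const, map_sum]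
  refine Finset.sum_congr rfl fun c _ => ?_
  rw [mul_comm, ← Algebra.smul_def, map_smul, smul_eq_mul, mul_comm]

lemma map_const_mul (l : R →ₗ[ℂ] ℂ) (X : Matrix m n ℂ) (Y : Matrix n p R) :
    (const R X * Y).map l = X * Y.map l := by
  ext a b
  simp only [Matrix.map_apply, Matrix.mul_apply, const, map_sum]
  refine Finset.sum_congr rfl fun c _ => ?_
  rw [← Algebra.smul_def, map_smul, smul_eq_mul]

lemma const_mul (X : Matrix m n ℂ) (Y : Matrix n p ℂ) :
    const R (X * Y) = const R X * const R Y := Matrix.map_mul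

lemma HasDeg.baseChange {ht : n → ℕ} {k : ℤ} {X : Matrix n n ℂ} (h : HasDeg ht k X) :
    HasDeg ht k (const R X) := h.map (map_zero _)

/-- Injectivity of `ad e ∘ ad f` in positive degrees, over a `ℂ`-algebra. -/
theorem GradedTriple.eq_zero_of_bracket_const [DecidableEq n] {ht : n → ℕ} {e f : Matrix n n ℂ}
    (h : GradedTriple ht e f) {y : Matrix n n R} {k : ℤ} (hk : 1 ≤ k) (hy : HasDeg ht k y)
    (hc : Oper.const R e * (Oper.const R f * y - y * Oper.const R f)
      = (Oper.const R f * y - y * Oper.const R f) * Oper.const R e) : y = 0 := by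
  refine eq_zero_of_map fun l => h.eq_zero_of_bracket hk (hy.map (map_zero l)) ?_
  have h1 := congrArg (fun X => Matrix.map X l) hc
  simp only [map_const_mul, map_mul_const, Matrix.map_sub l (map_sub l)] at h1
  exact h1

end BaseChange

end Oper

/-! ### Gauge transformations and membership in the Lie algebra -/

namespace Oper

open ClassicalType

/-- `ℂ`-linear derivations of a `ℂ`-algebra. -/
abbrev AlgDer (R : Type) [CommRing R] [Algebra ℂ R] : Type := Derivation ℂ R R

/-- The derivation given by an additive map that satisfies the Leibniz rule and kills `ℂ`. -/
def AlgDer.ofFun {R : Type} [CommRing R] [Algebra ℂ R] (f : R → R)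
    (hadd : ∀ x y, f (x + y) = f x + f y) (hmul : ∀ x y, f (x * y) = x * f y + y * f x)
    (hconst : ∀ r : ℂ, f (algebraMap ℂ R r) = 0) : AlgDer R :=
  Derivation.mk'
    { toFun := f
      map_add' := hadd
      map_smul' := fun r x => by
        rw [Algebra.smul_def, hmul, hconst, mul_zero, add_zero, RingHom.id_apply,
          Algebra.smul_def] }
    hmul

section Gauge

variable {R : Type} [CommRing R] [Algebra ℂ R]

lemma map_derivation_mul {m n p : Type} [Fintype n] (D : Derivation ℂ R R) (X : Matrix m n R)
    (Y : Matrix n p R) : (X * Y).map D = X.map D * Y + X * Y.map D := by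
  ext a b
  simp only [Matrix.map_apply, Matrix.mul_apply, Matrix.add_apply, map_sum, Derivation.leibniz,
    smul_eq_mul, Finset.sum_add_distrib]
  rw [add_comm]
  congr 1
  exact Finset.sum_congr rfl fun c _ => mul_comm _ _

lemma map_derivation_const {m n : Type} (D : Derivation ℂ R R) (X : Matrix m n ℂ) :
    (const R X).map D = 0 := by
  ext a b; simp [const]

lemma map_derivation_one {n : Type} [DecidableEq n] (D : Derivation ℂ R R) :
    (1 : Matrix n n R).map D = 0 := by
  rw [← const_one (R := R), map_derivation_const]

variable {N : ℕ} {D : Derivation ℂ R R} {g h : GL (Fin N) R} {A A' A'' : Matrix (Fin N) (Fin N) R}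

/-- Multiplication by `g` on the right removes the inverse; all later computations use this form. -/
lemma gauge_iff : Gauge D g A A' ↔
    ∃ f : R, A' * g.val = g.val * A - g.val.map D + f • g.val := by
  have h1 : g⁻¹.val * g.val = 1 := Units.inv_mul g
  have h2 : g.val * g⁻¹.val = 1 := Units.mul_inv g
  refine exists_congr fun f => ⟨fun h => ?_, fun h => ?_⟩
  · rw [h, add_mul, sub_mul, mul_assoc _ g⁻¹.val, h1, mul_one, mul_assoc _ g⁻¹.val, h1, mul_one,
      Matrix.smul_mul, one_mul]
  · rw [← mul_one A', ← h2, ← mul_assoc, h, add_mul, sub_mul, Matrix.smul_mul, h2]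

lemma Gauge.refl (D : Derivation ℂ R R) (A : Matrix (Fin N) (Fin N) R) : Gauge D 1 A A :=
  gauge_iff.2 ⟨0, by simp [map_derivation_one]⟩

lemma Gauge.trans (h1 : Gauge D g A A') (h2 : Gauge D h A' A'') : Gauge D (h * g) A A'' := by
  obtain ⟨f, hf⟩ := gauge_iff.1 h1
  obtain ⟨f', hf'⟩ := gauge_iff.1 h2
  refine gauge_iff.2 ⟨f + f', ?_⟩
  rw [Units.val_mul, ← mul_assoc, hf', map_derivation_mul, add_mul, sub_mul, mul_assoc, hf]
  simp only [mul_add, mul_sub, Matrix.mul_smul, Matrix.smul_mul, add_smul, mul_assoc]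
  abel

lemma Gauge.symm (h1 : Gauge D g A A') : Gauge D g⁻¹ A' A := by
  obtain ⟨f, hf⟩ := gauge_iff.1 h1
  have h2 : g⁻¹.val * g.val = 1 := Units.inv_mul g
  have h3 : g.val * g⁻¹.val = 1 := Units.mul_inv g
  have h4 : g⁻¹.val.map D * g.val + g⁻¹.val * g.val.map D = 0 := by
    rw [← map_derivation_mul, h2, map_derivation_one]
  have h5 : g⁻¹.val.map D = - (g⁻¹.val * g.val.map D * g⁻¹.val) := by
    rw [← mul_one (g⁻¹.val.map D), ← h3, ← mul_assoc, eq_neg_of_add_eq_zero_left h4, neg_mul]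
  refine gauge_iff.2 ⟨-f, ?_⟩
  have h6 : A = g⁻¹.val * (A' * g.val + g.val.map D - f • g.val) := by
    rw [hf, add_right_comm, add_sub_cancel_right, sub_add_cancel, ← mul_assoc, h2, one_mul]
  conv_lhs => rw [h6]
  rw [h5]
  simp only [mul_add, mul_sub, add_mul, sub_mul, Matrix.mul_smul, Matrix.smul_mul, mul_assoc, h2,
    h3, mul_one, one_mul]
  simp only [neg_smul, sub_neg_eq_add]
  abel

/-- The factor `s` is the derivative of the substitution `φ`, the `dt/dx` that enters the pullback
of a connection. -/
lemma Gauge.map {S : Type} [CommRing S] [Algebra ℂ S] {D' : Derivation ℂ S S} {φ : R →+* S} (s : S)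
    (hφ : ∀ x, D' (φ x) = s * φ (D x)) (h : Gauge D g A A') :
    Gauge D' (Matrix.GeneralLinearGroup.map φ g) (s • A.map φ) (s • A'.map φ) := by
  obtain ⟨f, hf⟩ := gauge_iff.1 h
  refine gauge_iff.2 ⟨s * φ f, ?_⟩
  have h1 : (Matrix.GeneralLinearGroup.map φ g).val = g.val.map φ := rfl
  have h2 : (g.val.map φ).map D' = s • (g.val.map D).map φ := by
    ext a b; simp [hφ]
  have h3 := congrArg (fun X => Matrix.map X φ) hf
  simp only [Matrix.map_mul, Matrix.map_add φ (map_add φ), Matrix.map_sub φ (map_sub φ)] at h3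
  have h4 : (f • g.val).map φ = φ f • g.val.map φ := by ext a b; simp
  rw [h1, h2, Matrix.smul_mul, h3, h4, Matrix.mul_smul, smul_add, smul_sub, mul_smul]

end Gauge

section Form

variable {ι : Type} [Fintype ι] [DecidableEq ι] {R : Type} [CommRing R] [Algebra ℂ R]

lemma skew_conj {J A g h : Matrix ι ι R} {μ : R} (hg : h * g = 1) (hJ : g * J * g.transpose = μ • J)
    (hA : A * J + J * A.transpose = 0) :
    (μ • (g * A * h * J + J * (g * A * h).transpose)) = 0 := by
  have h1 : (g * A * h) * (g * J * g.transpose)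
      + (g * J * g.transpose) * (g * A * h).transpose = 0 := by
    have h2 : g.transpose * h.transpose = 1 := by
      rw [← Matrix.transpose_mul, hg, Matrix.transpose_one]
    calc _ = g * A * (h * g) * J * g.transpose
          + g * J * (g.transpose * h.transpose) * A.transpose * g.transpose := by
            simp only [Matrix.transpose_mul, mul_assoc]
      _ = g * (A * J + J * A.transpose) * g.transpose := by
            rw [hg, h2]; noncomm_ring
      _ = 0 := by rw [hA]; simp
  rw [hJ] at h1
  rwa [Matrix.mul_smul, Matrix.smul_mul, ← smul_add] at h1

lemma skew_derivation (D : Derivation ℂ R R) {J : Matrix ι ι ℂ} {g h : Matrix ι ι R} {μ : R}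
    (hg : h * g = 1) (hJ : g * const R J * g.transpose = μ • const R J) :
    μ • (g.map D * h * const R J + const R J * (g.map D * h).transpose) = D μ • const R J := by
  have h1 := congrArg (fun X => Matrix.map X D) hJ
  have h2 : (μ • const R J).map D = D μ • const R J := by
    ext a b
    simp only [Matrix.map_apply, Matrix.smul_apply, const, smul_eq_mul, Derivation.leibniz,
      Derivation.map_algebraMap]
    ring
  have h3 : g.transpose.map D = (g.map D).transpose := rfl
  simp only [h2, map_derivation_mul, map_derivation_const, mul_zero, add_zero, h3] at h1
  have h4 : g.transpose * h.transpose = 1 := by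
      rw [← Matrix.transpose_mul, hg, Matrix.transpose_one]
  rw [← h1]
  calc μ • (g.map D * h * const R J + const R J * (g.map D * h).transpose)
      = g.map D * h * (μ • const R J) + (μ • const R J) * (g.map D * h).transpose := by
        rw [Matrix.mul_smul, Matrix.smul_mul, smul_add]
    _ = g.map D * (h * g) * const R J * g.transpose
        + g * const R J * (g.transpose * h.transpose) * (g.map D).transpose := by
        rw [← hJ]; simp only [Matrix.transpose_mul, mul_assoc]
    _ = _ := by rw [hg, h4]; simp [mul_assoc]

end Form

/-- The types defined by a form. -/
def HasForm : ClassicalType → Prop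
  | sl _ => False
  | _ => True

lemma hasForm_or (c : ClassicalType) : (∃ N, c = sl N) ∨ HasForm c := by
  cases c
  · exact Or.inl ⟨_, rfl⟩
  all_goals exact Or.inr trivial

section Lie

variable {R : Type} [CommRing R] [Algebra ℂ R] {c : ClassicalType} {X Y A : Mat c R}

lemma memLie_iff (hc : HasForm c) :
    MemLie c X ↔ X * const R (form c) + const R (form c) * X.transpose = 0 := by
  cases c
  · exact hc.elim
  all_goals exact Iff.rfl

lemma memLie_sl {N : ℕ} {X : Mat (sl N) R} : MemLie (sl N) X ↔ X.trace = 0 := Iff.rfl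

lemma MemLie.zero : MemLie c (0 : Mat c R) := by
  rcases hasForm_or c with ⟨N, rfl⟩ | hc
  · exact Matrix.trace_zero _ _
  · rw [memLie_iff hc]; simp

lemma MemLie.add (hX : MemLie c X) (hY : MemLie c Y) : MemLie c (X + Y) := by
  rcases hasForm_or c with ⟨N, rfl⟩ | hc
  · rw [memLie_sl] at *; rw [Matrix.trace_add, hX, hY, add_zero]
  · rw [memLie_iff hc] at *
    rw [Matrix.transpose_add, add_mul, mul_add, add_add_add_comm, hX, hY, add_zero]

lemma MemLie.smul (r : R) (hX : MemLie c X) : MemLie c (r • X) := by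
  rcases hasForm_or c with ⟨N, rfl⟩ | hc
  · rw [memLie_sl] at *; rw [Matrix.trace_smul, hX, smul_zero]
  · rw [memLie_iff hc] at *
    rw [Matrix.transpose_smul, Matrix.smul_mul, Matrix.mul_smul, ← smul_add, hX, smul_zero]

lemma MemLie.sub (hX : MemLie c X) (hY : MemLie c Y) : MemLie c (X - Y) := by
  simpa [sub_eq_add_neg] using hX.add (hY.smul (-1))

lemma MemLie.sum {κ : Type*} (s : Finset κ) {F : κ → Mat c R} (h : ∀ i ∈ s, MemLie c (F i)) :
    MemLie c (∑ i ∈ s, F i) := by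
  classical
  induction s using Finset.induction_on with
  | empty => simpa using MemLie.zero
  | insert a s ha ih =>
    rw [Finset.sum_insert ha]
    exact (h a (by simp)).add (ih fun i hi => h i (by simp [hi]))

lemma MemLie.bracket (hX : MemLie c X) (hY : MemLie c Y) : MemLie c (X * Y - Y * X) := by
  rcases hasForm_or c with ⟨N, rfl⟩ | hc
  · rw [memLie_sl, Matrix.trace_sub, Matrix.trace_mul_comm, sub_self]
  · rw [memLie_iff hc] at *
    set J := const R (form c)
    have h1 : X * J = -(J * X.transpose) := eq_neg_of_add_eq_zero_left hX
    have h2 : Y * J = -(J * Y.transpose) := eq_neg_of_add_eq_zero_left hY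
    have h4 : Y * X * J = J * (X * Y).transpose := by
      rw [Matrix.transpose_mul, mul_assoc, h1, mul_neg, ← mul_assoc, h2]
      simp [mul_assoc]
    have h5 : X * Y * J = J * (Y * X).transpose := by
      rw [Matrix.transpose_mul, mul_assoc, h2, mul_neg, ← mul_assoc, h1]
      simp [mul_assoc]
    rw [sub_mul, h4, h5, Matrix.transpose_sub, mul_sub]
    abel

lemma MemLie.map_linear (l : R →ₗ[ℂ] ℂ) (hX : MemLie c X) : MemLie c (X.map l : Mat c ℂ) := by
  rcases hasForm_or c with ⟨N, rfl⟩ | hc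
  · rw [memLie_sl] at *
    have := congrArg l hX
    rw [map_zero] at this
    rw [← this]
    exact (AddMonoidHom.map_trace (l : R →+ ℂ) X).symm
  · rw [memLie_iff hc] at *
    have := congrArg (fun X => Matrix.map X l) hX
    simp only [Matrix.map_add l (map_add l), map_mul_const, map_const_mul,
      Matrix.map_zero l (map_zero l)] at this
    rw [const_self]
    exact this

/-- The equations of `𝔤` have complex coefficients and linear functionals separate the points of
`R`, so membership can be tested after applying every functional. -/
lemma MemLie.of_map_linear (h : ∀ l : R →ₗ[ℂ] ℂ, MemLie c (X.map l : Mat c ℂ)) : MemLie c X := by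
  rcases hasForm_or c with ⟨N, rfl⟩ | hc
  · refine (Module.forall_dual_apply_eq_zero_iff ℂ _).1 fun l => ?_
    have := h l
    rw [memLie_sl] at this
    rw [← this]
    exact AddMonoidHom.map_trace (l : R →+ ℂ) X
  · rw [memLie_iff hc]
    refine eq_zero_of_map fun l => ?_
    have := h l
    rw [memLie_iff hc, const_self] at this
    simp only [Matrix.map_add l (map_add l), map_mul_const, map_const_mul]
    exact this

lemma MemLie.map_algHom {S : Type} [CommRing S] [Algebra ℂ S] (φ : R →ₐ[ℂ] S) (hX : MemLie c X) :
    MemLie c (X.map φ : Mat c S) := by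
  refine MemLie.of_map_linear fun l => ?_
  rw [Matrix.map_map]
  exact hX.map_linear (l ∘ₗ φ.toLinearMap)

lemma MemLie.baseChange {X : Mat c ℂ} (hX : MemLie c X) : MemLie c (const R X) :=
  hX.map_algHom (Algebra.ofId ℂ R)

lemma MemLie.of_map_algHom {S : Type} [CommRing S] [Algebra ℂ S] (φ : R →ₐ[ℂ] S)
    (hφ : Function.Injective φ) (hX : MemLie c (X.map φ : Mat c S)) : MemLie c X := by
  have hJ : ∀ J : Mat c ℂ, Oper.const S J = (Oper.const R J).map φ := by
    intro J; ext a b; simp [Oper.const]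
  rcases hasForm_or c with ⟨N, rfl⟩ | hc
  · rw [memLie_sl] at *
    apply hφ
    rw [map_zero, ← hX]
    exact AddMonoidHom.map_trace (φ : R →+ S) X
  · rw [memLie_iff hc] at *
    refine Matrix.map_injective hφ ?_
    simp only [Matrix.map_add φ (map_add φ), Matrix.map_mul, Matrix.map_zero φ (map_zero φ)]
    rw [← hJ]
    exact hX

variable {D : Derivation ℂ R R} {g : GL (Fin c.size) R}

lemma MemGroup.exists_similitude (hc : HasForm c) (hg : MemGroup c g) : ∃ μ : Rˣ,
    g.val * const R (form c) * g.val.transpose = μ.val • const R (form c) := by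
  cases c
  · exact hc.elim
  · exact hg
  · exact hg
  · obtain ⟨μ, h, -⟩ := hg; exact ⟨μ, h⟩

lemma MemLie.conj (hg : MemGroup c g) (hA : MemLie c A) :
    MemLie c (g.val * A * g⁻¹.val : Mat c R) := by
  rcases hasForm_or c with ⟨N, rfl⟩ | hc
  · rw [memLie_sl] at *
    rw [Matrix.trace_mul_comm, ← mul_assoc, Units.inv_mul, one_mul, hA]
  · obtain ⟨μ, hμ⟩ := hg.exists_similitude hc
    rw [memLie_iff hc] at *
    have := skew_conj (Units.inv_mul g) hμ hA
    rwa [← Units.smul_def, smul_eq_zero_iff_eq] at this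

/-- The adjoint group is a quotient by scalars, so a representative `g` moves a connection out of
`𝔤` by a scalar matrix only, and one correction `f` brings it back. -/
lemma MemLie.gauge (hg : MemGroup c g) (hA : MemLie c A) :
    ∃ f : R, MemLie c (g.val * A * g⁻¹.val - g.val.map D * g⁻¹.val + f • 1 : Mat c R) := by
  rcases hasForm_or c with ⟨N, rfl⟩ | hc
  · have h1 : MemLie (sl N) (g.val * A * g⁻¹.val : Mat (sl N) R) := hA.conj hg
    rw [memLie_sl] at h1
    -- For `𝔰𝔩_N` the correction is the trace of `D(g) g⁻¹` divided by `N`.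
    refine ⟨algebraMap ℂ R ((N : ℂ)⁻¹) * (g.val.map D * g⁻¹.val).trace, ?_⟩
    rw [memLie_sl, Matrix.trace_add, Matrix.trace_sub, h1, Matrix.trace_smul, Matrix.trace_one,
      Fintype.card_fin]
    rcases Nat.eq_zero_or_pos N with rfl | hN
    · simp [Matrix.trace]
    · have : algebraMap ℂ R ((N : ℂ)⁻¹) * (N : R) = 1 := by
        rw [← map_natCast (algebraMap ℂ R), ← map_mul, inv_mul_cancel₀ (Nat.cast_ne_zero.2 hN.ne'), map_one]
      rw [smul_eq_mul, mul_right_comm, this, one_mul]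
      ring
  · obtain ⟨μ, hμ⟩ := hg.exists_similitude hc
    have h1 : MemLie c (g.val * A * g⁻¹.val : Mat c R) := hA.conj hg
    rw [memLie_iff hc] at h1
    have h2 := skew_derivation D (Units.inv_mul g) hμ
    have h3 : algebraMap ℂ R 2⁻¹ + algebraMap ℂ R 2⁻¹ = 1 := by
      rw [← map_add, ← map_one (algebraMap ℂ R)]; norm_num
    -- As `g` scales the form by `μ`, the matrix `D(g) g⁻¹` fails to be skew by `μ⁻¹ D(μ)`. A scalar
    -- counts twice in `X J + J Xᵀ`, whence the factor one half.
    refine ⟨algebraMap ℂ R 2⁻¹ * (μ⁻¹.val * D μ), ?_⟩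
    rw [memLie_iff hc]
    have h4 : g.val.map D * g⁻¹.val * const R (form c)
        + const R (form c) * (g.val.map D * g⁻¹.val).transpose
        = (μ⁻¹.val * D μ) • const R (form c) := by
      rw [mul_smul, ← h2, smul_smul, Units.inv_mul, one_smul]
    have h5 : (algebraMap ℂ R 2⁻¹ * (μ⁻¹.val * D μ)) • const R (form c)
        + (algebraMap ℂ R 2⁻¹ * (μ⁻¹.val * D μ)) • const R (form c)
        = (μ⁻¹.val * D μ) • const R (form c) := by
      rw [← add_smul, ← add_mul, h3, one_mul]
    simp only [Matrix.transpose_add, Matrix.transpose_sub, Matrix.transpose_smul,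
      Matrix.transpose_one, add_mul, sub_mul, mul_add, mul_sub, Matrix.smul_mul, Matrix.mul_smul,
      one_mul, mul_one]
    calc _ = (g.val * A * g⁻¹.val * const R (form c)
          + const R (form c) * (g.val * A * g⁻¹.val).transpose)
        - (g.val.map D * g⁻¹.val * const R (form c)
          + const R (form c) * (g.val.map D * g⁻¹.val).transpose)
        + ((algebraMap ℂ R 2⁻¹ * (μ⁻¹.val * D μ)) • const R (form c)
          + (algebraMap ℂ R 2⁻¹ * (μ⁻¹.val * D μ)) • const R (form c)) := by abel
      _ = 0 := by rw [h1, h4, h5]; abel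

end Lie

end Oper

/-! ### Heights, similitudes and the Borel subgroup -/

namespace Oper

open ClassicalType

/-- The height of a basis vector of the standard representation: weights of the principal cocharacter
decrease with the height. -/
def height : (c : ClassicalType) → Fin c.size → ℕ
  | soEven r, a => if a.val < r then a.val else a.val - 1
  | sl _, a => a.val
  | sp _, a => a.val
  | soOdd _, a => a.val

section Group

variable {R : Type} [CommRing R] [Algebra ℂ R] {c : ClassicalType}

lemma inv_blockTriangular {N : ℕ} {α : Type*} [LinearOrder α] {b : Fin N → α} {g : GL (Fin N) R}
    (h : g.val.BlockTriangular b) : g⁻¹.val.BlockTriangular b := by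
  let : Invertible g.val := g.invertible
  rw [Matrix.coe_units_inv]
  exact Matrix.blockTriangular_inv_of_blockTriangular h

lemma MemGroup.one : MemGroup c (1 : GL (Fin c.size) R) := by
  cases c
  · trivial
  · exact ⟨1, by simp⟩
  · exact ⟨1, by simp⟩
  · exact ⟨1, by simp, by simp⟩

lemma similitude_mul {ι : Type} [Fintype ι] {J g h : Matrix ι ι R} {μ ν : R}
    (hg : g * J * g.transpose = μ • J) (hh : h * J * h.transpose = ν • J) :
    (g * h) * J * (g * h).transpose = (μ * ν) • J := by
  calc _ = g * (h * J * h.transpose) * g.transpose := by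
        rw [Matrix.transpose_mul]; simp only [mul_assoc]
    _ = _ := by rw [hh, Matrix.mul_smul, Matrix.smul_mul, hg, smul_smul, mul_comm]

lemma MemGroup.mul {g h : GL (Fin c.size) R} (hg : MemGroup c g) (hh : MemGroup c h) :
    MemGroup c (g * h) := by
  cases c
  · trivial
  · obtain ⟨μ, hμ⟩ := hg
    obtain ⟨ν, hν⟩ := hh
    exact ⟨μ * ν, similitude_mul hμ hν⟩
  · obtain ⟨μ, hμ⟩ := hg
    obtain ⟨ν, hν⟩ := hh
    exact ⟨μ * ν, similitude_mul hμ hν⟩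
  · obtain ⟨μ, hμ, hμ'⟩ := hg
    obtain ⟨ν, hν, hν'⟩ := hh
    refine ⟨μ * ν, similitude_mul hμ hν, ?_⟩
    rw [Units.val_mul, Matrix.det_mul, hμ', hν', Units.val_mul, mul_pow]

lemma similitude_inv {N : ℕ} {J : Matrix (Fin N) (Fin N) R} {g : GL (Fin N) R} {μ : Rˣ}
    (hg : g.val * J * g.val.transpose = μ.val • J) :
    g⁻¹.val * J * g⁻¹.val.transpose = μ⁻¹.val • J := by
  have h1 : g.val.transpose * g⁻¹.val.transpose = 1 := by
    rw [← Matrix.transpose_mul, Units.inv_mul, Matrix.transpose_one]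
  have h2 : J = μ⁻¹.val • (g.val * J * g.val.transpose) := by
    rw [hg, smul_smul, Units.inv_mul, one_smul]
  nth_rewrite 1 [h2]
  rw [Matrix.mul_smul, Matrix.smul_mul]
  congr 1
  calc _ = (g⁻¹.val * g.val) * J * (g.val.transpose * g⁻¹.val.transpose) := by
        simp only [mul_assoc]
    _ = J := by rw [h1, Units.inv_mul, one_mul, mul_one]

lemma MemGroup.inv {g : GL (Fin c.size) R} (hg : MemGroup c g) : MemGroup c g⁻¹ := by
  cases c
  · trivial
  · obtain ⟨μ, hμ⟩ := hg
    exact ⟨μ⁻¹, similitude_inv hμ⟩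
  · obtain ⟨μ, hμ⟩ := hg
    exact ⟨μ⁻¹, similitude_inv hμ⟩
  · obtain ⟨μ, hμ, hμ'⟩ := hg
    refine ⟨μ⁻¹, similitude_inv hμ, ?_⟩
    rename_i r
    have h1 : g⁻¹.val.det * g.val.det = 1 := by
      rw [← Matrix.det_mul, Units.inv_mul, Matrix.det_one]
    rw [hμ'] at h1
    have h2 : (μ.val) ^ r * (μ⁻¹.val) ^ r = 1 := by rw [← mul_pow, Units.mul_inv, one_pow]
    calc g⁻¹.val.det = g⁻¹.val.det * (μ.val ^ r * μ⁻¹.val ^ r) := by rw [h2, mul_one]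
      _ = _ := by rw [← mul_assoc, h1, one_mul]

lemma MemBorel.one : MemBorel c (1 : GL (Fin c.size) R) :=
  ⟨MemGroup.one, Matrix.blockTriangular_one⟩

lemma MemBorel.mul {g h : GL (Fin c.size) R} (hg : MemBorel c g) (hh : MemBorel c h) :
    MemBorel c (g * h) :=
  ⟨hg.1.mul hh.1, hg.2.mul hh.2⟩

lemma MemBorel.inv {g : GL (Fin c.size) R} (hg : MemBorel c g) : MemBorel c g⁻¹ :=
  ⟨hg.1.inv, inv_blockTriangular hg.2⟩

lemma const_map_algHom {S : Type} [CommRing S] [Algebra ℂ S] (φ : R →ₐ[ℂ] S) {m n : Type}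
    (X : Matrix m n ℂ) : (const R X).map φ = const S X := by
  ext a b; simp [const]

lemma similitude_map {S : Type} [CommRing S] [Algebra ℂ S] (φ : R →ₐ[ℂ] S) {ι : Type} [Fintype ι]
    {J : Matrix ι ι ℂ} {g : Matrix ι ι R} {μ : R}
    (hg : g * const R J * g.transpose = μ • const R J) :
    g.map φ * const S J * (g.map φ).transpose = φ μ • const S J := by
  have h := congrArg (fun X => Matrix.map X φ) hg
  simp only [Matrix.map_mul, const_map_algHom] at h
  rw [← Matrix.transpose_map, h, ← const_map_algHom φ]
  ext a b; simp

lemma MemGroup.map {S : Type} [CommRing S] [Algebra ℂ S] (φ : R →ₐ[ℂ] S) {g : GL (Fin c.size) R}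
    (hg : MemGroup c g) : MemGroup c (Matrix.GeneralLinearGroup.map (φ : R →+* S) g) := by
  cases c
  · trivial
  · obtain ⟨μ, hμ⟩ := hg
    exact ⟨Units.map (φ : R →* S) μ, similitude_map φ hμ⟩
  · obtain ⟨μ, hμ⟩ := hg
    exact ⟨Units.map (φ : R →* S) μ, similitude_map φ hμ⟩
  · obtain ⟨μ, hμ, hμ'⟩ := hg
    refine ⟨Units.map (φ : R →* S) μ, similitude_map φ hμ, ?_⟩
    have h1 : (Matrix.GeneralLinearGroup.map (φ : R →+* S) g).val = g.val.map φ := rfl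
    rw [h1]
    have h2 : (g.val.map φ).det = φ g.val.det := (RingHom.map_det (φ : R →+* S) g.val).symm
    rw [h2, hμ', map_pow]
    rfl

lemma MemBorel.map {S : Type} [CommRing S] [Algebra ℂ S] (φ : R →ₐ[ℂ] S) {g : GL (Fin c.size) R}
    (hg : MemBorel c g) : MemBorel c (Matrix.GeneralLinearGroup.map (φ : R →+* S) g) := by
  refine ⟨hg.1.map φ, fun a b hab => ?_⟩
  change φ (g.val a b) = 0
  rw [hg.2 hab, map_zero]

lemma form_apply_of_ne {a b : Fin c.size} (h : a.val + b.val + 1 ≠ c.size) : form c a b = 0 := by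
  cases c
  · rfl
  all_goals simp only [form, Matrix.of_apply]; exact if_neg h

lemma form_rev_ne_zero (hc : HasForm c) (a : Fin c.size) : form c a a.rev ≠ 0 := by
  have h : a.val + a.rev.val + 1 = c.size := by rw [Fin.val_rev]; omega
  cases c
  · exact hc.elim
  all_goals
    simp only [form, Matrix.of_apply]
    rw [if_pos h]
    exact pow_ne_zero _ (by norm_num)

lemma mul_form_apply (X : Mat c R) (a b : Fin c.size) :
    (X * const R (form c)) a b = X a b.rev * algebraMap ℂ R (form c b.rev b) := by
  rw [Matrix.mul_apply, Finset.sum_eq_single b.rev]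
  · rfl
  · intro x _ hx
    rw [const_apply, form_apply_of_ne, map_zero, mul_zero]
    intro h
    apply hx
    ext
    rw [Fin.val_rev]
    omega
  · simp

lemma form_mul_apply (X : Mat c R) (a b : Fin c.size) :
    (const R (form c) * X) a b = algebraMap ℂ R (form c a a.rev) * X a.rev b := by
  rw [Matrix.mul_apply, Finset.sum_eq_single a.rev]
  · rfl
  · intro x _ hx
    rw [const_apply, form_apply_of_ne, map_zero, zero_mul]
    intro h
    apply hx
    ext
    rw [Fin.val_rev]
    omega
  · simp

lemma memLie_apply (hc : HasForm c) {X : Mat c R} : MemLie c X ↔ ∀ a b,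
    X a b.rev * algebraMap ℂ R (form c b.rev b)
      + algebraMap ℂ R (form c a a.rev) * X b a.rev = 0 := by
  rw [memLie_iff hc]
  constructor
  · intro h a b
    have := congrFun (congrFun h a) b
    rwa [Matrix.add_apply, mul_form_apply, form_mul_apply] at this
  · intro h
    ext a b
    rw [Matrix.add_apply, mul_form_apply, form_mul_apply]
    exact h a b

/-- In the entry `(a, a.rev)` of `g J gᵀ` triangularity leaves a single term: summation indices
below `a.rev` are killed by the second factor `g`, and those above it by the first. -/
lemma similitude_diag_mul (hc : HasForm c) {g : Mat c R} (hg : g.BlockTriangular id) {μ : R}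
    (h : g * const R (form c) * g.transpose = μ • const R (form c)) (a : Fin c.size) :
    g a a * g a.rev a.rev = μ := by
  have h1 := congrFun (congrFun h a) a.rev
  rw [Matrix.mul_apply, Finset.sum_eq_single a.rev, mul_form_apply, Matrix.smul_apply, const_apply,
    smul_eq_mul, Fin.rev_rev, Matrix.transpose_apply] at h1
  · have h2 : IsUnit (algebraMap ℂ R (form c a a.rev)) :=
      (isUnit_iff_ne_zero.2 (form_rev_ne_zero hc a)).map _
    apply h2.mul_right_cancel
    rw [← h1]; ring
  · intro x _ hx
    rw [mul_form_apply, Matrix.transpose_apply]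
    rcases lt_or_gt_of_ne hx with h2 | h2
    · rw [hg (show id x < id a.rev from h2), mul_zero]
    · rw [hg (show id x.rev < id a from Fin.rev_lt_iff.1 (by simpa using h2)), zero_mul, zero_mul]
  · simp

lemma prod_fin_two_mul {r : ℕ} {d : Fin (2 * r) → R} {μ : R} (h : ∀ a, d a * d a.rev = μ) :
    ∏ a, d a = μ ^ r := by
  have hr : r + r = 2 * r := by omega
  rw [← (finCongr hr).prod_comp, Fin.prod_univ_add, ← Equiv.prod_comp Fin.revPerm (fun i : Fin r => d (finCongr hr (Fin.natAdd r i))),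
    ← Finset.prod_mul_distrib, Finset.prod_congr rfl (g := fun _ => μ), Finset.prod_const,
    Finset.card_univ, Fintype.card_fin]
  intro i _
  rw [← h (finCongr hr (Fin.castAdd r i))]
  congr 2
  ext
  simp [Fin.val_rev]
  omega

/-- Diagonal entries at opposite positions multiply to `μ`, so the determinant is `μ ^ r`. A
triangular similitude therefore satisfies the determinant condition of the even orthogonal type
automatically. -/
lemma memBorel_of_similitude {g : GL (Fin c.size) R} (hg : g.val.BlockTriangular id) {μ : Rˣ}
    (h : HasForm c → g.val * const R (form c) * g.val.transpose = μ.val • const R (form c)) :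
    MemBorel c g := by
  refine ⟨?_, hg⟩
  cases c
  · trivial
  · exact ⟨μ, h trivial⟩
  · exact ⟨μ, h trivial⟩
  · refine ⟨μ, h trivial, ?_⟩
    rw [Matrix.det_of_isUpperTriangular hg]
    exact prod_fin_two_mul fun a => similitude_diag_mul (c := soEven _) trivial hg (h trivial) a

lemma form_mul_self (hc : HasForm c) : ∃ ε : ℂ, ε ≠ 0 ∧ form c * form c = ε • 1 := by
  have key : ∀ (ε : ℂ), (∀ a : Fin c.size, form c a a.rev * form c a.rev a = ε) →
      form c * form c = ε • 1 := by
    intro ε h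
    ext a b
    have := mul_form_apply (R := ℂ) (form c) a b
    rw [const_self] at this
    rw [this, Matrix.smul_apply, Matrix.one_apply]
    split_ifs with hab
    · subst hab; simpa using h a
    · rw [form_apply_of_ne, zero_mul, smul_zero]
      intro h1
      apply hab
      ext
      rw [Fin.val_rev] at h1
      omega
  have hrev : ∀ a : Fin c.size, a.val + a.rev.val + 1 = c.size := fun a => by
    rw [Fin.val_rev]; omega
  cases c with
  | sl N => exact hc.elim
  | sp n =>
    refine ⟨-1, by norm_num, key _ fun a => ?_⟩
    have h := hrev a
    change a.val + a.rev.val + 1 = 2 * n at h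
    simp only [form, Matrix.of_apply]
    rw [if_pos h, if_pos (by omega), ← pow_add,
      show a.val + 1 + (a.rev.val + 1) = 2 * n + 1 by omega, pow_succ, pow_mul]
    norm_num
  | soOdd n =>
    refine ⟨1, by norm_num, key _ fun a => ?_⟩
    have h := hrev a
    change a.val + a.rev.val + 1 = 2 * n + 1 at h
    simp only [form, Matrix.of_apply]
    rw [if_pos h, if_pos (by omega), ← pow_add,
      show a.val + 1 + (a.rev.val + 1) = 2 * (n + 1) by omega, pow_mul]
    norm_num
  | soEven r =>
    refine ⟨1, by norm_num, key _ fun a => ?_⟩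
    have h := hrev a
    change a.val + a.rev.val + 1 = 2 * r at h
    simp only [form, Matrix.of_apply]
    rw [if_pos h, if_pos (by omega), max_comm a.rev.val, ← mul_pow]
    norm_num

lemma isUnit_natCast {N : ℕ} (hN : 0 < N) : IsUnit (N : R) := by
  rw [← map_natCast (algebraMap ℂ R)]
  exact (isUnit_iff_ne_zero.2 (Nat.cast_ne_zero.2 hN.ne')).map _

/-- Conjugation by `J` turns `X` into `-Xᵀ`, so its trace equals its own negative. Tracelessness is
what later determines the scalars in gauge equivalences. -/
lemma MemLie.trace_eq_zero {X : Mat c R} (h : MemLie c X) : X.trace = 0 := by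
  rcases hasForm_or c with ⟨N, rfl⟩ | hc
  · exact h
  · obtain ⟨ε, hε, hJ⟩ := form_mul_self hc
    rw [memLie_iff hc] at h
    have h1 : const R (form c) * const R (form c) = algebraMap ℂ R ε • 1 := by
      rw [← const_mul, hJ, const_smul, const_one]
    have h2 : (X * const R (form c) * const R (form c)).trace
        = -(X * const R (form c) * const R (form c)).trace := by
      conv_lhs => rw [eq_neg_of_add_eq_zero_left h, neg_mul, Matrix.trace_neg, Matrix.trace_mul_comm,
        ← mul_assoc, h1]
      rw [mul_assoc X, h1]
      simp
    rw [mul_assoc, h1, Matrix.mul_smul, mul_one, Matrix.trace_smul, smul_eq_mul] at h2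
    have h3 : IsUnit (algebraMap ℂ R ε) := (isUnit_iff_ne_zero.2 hε).map _
    have h4 : ((2 : ℕ) : R) * (algebraMap ℂ R ε * X.trace) = 0 := by
      push_cast; linear_combination h2
    exact h3.mul_right_eq_zero.1 ((isUnit_natCast (by norm_num)).mul_right_eq_zero.1 h4)

end Group

end Oper

/-! ### Existence and uniqueness of canonical forms -/

namespace Oper

open ClassicalType

/-- The invertible diagonal matrix with given diagonal. -/
def diagUnit {ι R : Type} [Fintype ι] [DecidableEq ι] [CommRing R] (t : ι → Rˣ) : GL ι R where
  val := Matrix.diagonal fun a => (t a).val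
  inv := Matrix.diagonal fun a => (t a)⁻¹.val
  val_inv := by rw [Matrix.diagonal_mul_diagonal]; simp
  inv_val := by rw [Matrix.diagonal_mul_diagonal]; simp

lemma diagUnit_conj_apply {ι R : Type} [Fintype ι] [DecidableEq ι] [CommRing R] (t : ι → Rˣ)
    (X : Matrix ι ι R) (a b : ι) :
    ((diagUnit t).val * X * (diagUnit t)⁻¹.val) a b = (t a).val * X a b * (t b)⁻¹.val := by
  change ((Matrix.diagonal fun a => (t a).val) * X *
    (Matrix.diagonal fun a => (t a)⁻¹.val) : Matrix ι ι R) a b = _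
  rw [Matrix.mul_diagonal, Matrix.diagonal_mul]

/-- What the theory of canonical forms uses of a simple Lie algebra with its principal
`𝔰𝔩₂`-triple. -/
structure Principal (c : ClassicalType) : Prop where
  pos : 0 < c.size
  height_mono : ∀ a b : Fin c.size, a ≤ b → height c a ≤ height c b
  triple : GradedTriple (height c) (pPlus c) (pMinus c)
  lie_plus : MemLie c (pPlus c)
  lie_minus : MemLie c (pMinus c)
  lie_degComp : ∀ {R : Type} [CommRing R] [Algebra ℂ R] (k : ℤ) {X : Mat c R},
    MemLie c X → MemLie c (degComp (height c) k X)
  lie_upper : ∀ {R : Type} [CommRing R] [Algebra ℂ R] {X : Mat c R},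
    MemLie c X → DegGE (height c) 0 X → X.BlockTriangular id
  lie_zero : ∀ {x : Mat c ℂ}, MemLie c x → HasDeg (height c) 0 x →
    pPlus c * x = x * pPlus c → x = 0
  scalar : ∀ {R : Type} [CommRing R] [Algebra ℂ R] {g : Mat c R}, g.BlockTriangular id →
    degComp (height c) 0 g * const R (pMinus c) = const R (pMinus c) * degComp (height c) 0 g →
    ∃ u : R, degComp (height c) 0 g = u • 1
  torus : ∀ {R : Type} [CommRing R] [Algebra ℂ R] (ψ : Fin c.rank → Rˣ),
    ∃ t : Fin c.size → Rˣ, MemBorel c (diagUnit t) ∧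
      ∀ k : Fin c.rank, ∀ a b, negSimple c k a b ≠ 0 → t a * ψ k = t b
  torus_height : ∀ {R : Type} [CommRing R] [Algebra ℂ R] (u : Rˣ),
    MemBorel c (diagUnit fun a => u ^ height c a)

/-- `v` is a section of `⨁ V_{𝔤,i}`. -/
structure IsCanonical (c : ClassicalType) {R : Type} [CommRing R] [Algebra ℂ R] (v : Mat c R) :
    Prop where
  memLie : MemLie c v
  degGE : DegGE (height c) 1 v
  comm : const R (pPlus c) * v = v * const R (pPlus c)

namespace Principal

variable {c : ClassicalType} {R : Type} [CommRing R] [Algebra ℂ R]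

lemma degGE_of_triangular (P : Principal c) {X : Mat c R} (h : X.BlockTriangular id) :
    DegGE (height c) 0 X := fun a b hab => h <| by
  by_contra hlt
  have := P.height_mono a b (not_lt.1 hlt)
  simp only [deg] at hab
  omega

lemma triangular_of_degGE (P : Principal c) {X : Mat c R} (h : DegGE (height c) 1 X) :
    X.BlockTriangular id := fun a b hab => h a b <| by
  have := P.height_mono b a (le_of_lt hab)
  simp only [deg]
  omega

lemma comm_degComp (P : Principal c) {v : Mat c R}
    (h : const R (pPlus c) * v = v * const R (pPlus c)) (k : ℤ) :
    const R (pPlus c) * degComp (height c) k v = degComp (height c) k v * const R (pPlus c) := by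
  have h1 := P.triple.deg_e.baseChange (R := R)
  rw [← h1.degComp_mul (k := k + 1) (by ring), ← h1.degComp_mul_right (k := k + 1) (by ring), h]

/-- The gauge equation is compared degree by degree. Degree `-1` makes the degree `0` part of `g` a
scalar `u`. If the remainder `y` of `g` starts in degree `k + 1`, then `[p₋₁, y]` in degree `k` is
`u` times the degree `k` part of `v - v'`, which centralises `p₁`; injectivity of `ad p₁ ∘ ad p₋₁`
then removes the leading part of `y`. -/
theorem canonical_unique (P : Principal c) {D : Derivation ℂ R R} {g : GL (Fin c.size) R}
    (hg : g.val.BlockTriangular id) {v v' : Mat c R} (hv : DegGE (height c) 1 v)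
    (hv' : DegGE (height c) 1 v') (hvc : const R (pPlus c) * v = v * const R (pPlus c))
    (hvc' : const R (pPlus c) * v' = v' * const R (pPlus c))
    (h : Gauge D g (const R (pMinus c) + v) (const R (pMinus c) + v')) : v = v' := by
  set p := const R (pMinus c) with hp
  obtain ⟨f, hf⟩ := gauge_iff.1 h
  have hpdeg : HasDeg (height c) (-1) p := P.triple.deg_f.baseChange
  have hg0 := P.degGE_of_triangular hg
  have hgmap : DegGE (height c) 0 (g.val.map D) := hg0.map (map_zero D)
  -- In degree `-1` only `p₋₁` times the degree `0` part of `g` survives on either side, so the two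
  -- commute.
  obtain ⟨u, hu⟩ := P.scalar hg <| by
    have h1 := congrArg (degComp (height c) (-1)) hf
    rw [add_mul, mul_add, degComp_add, degComp_add, degComp_sub, degComp_add,
      hpdeg.degComp_mul (j := 0) (by ring), hpdeg.degComp_mul_right (i := 0) (by ring),
      (hv'.mul hg0 (k := 0) (by norm_num)).degComp_lt (by norm_num),
      (hg0.mul hv (k := 0) (by norm_num)).degComp_lt (by norm_num),
      hgmap.degComp_lt (by norm_num), (hg0.smul f).degComp_lt (by norm_num)] at h1
    simpa using h1.symm
  obtain ⟨y, hy⟩ : ∃ y, g.val = u • 1 + y := ⟨g.val - u • 1, by abel⟩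
  have hy0 : degComp (height c) 0 y = 0 := by
    rw [hy, degComp_add, (HasDeg.one.smul u).degComp_eq] at hu
    simpa using hu
  have hy1 : DegGE (height c) 1 y := by
    have h1 : DegGE (height c) 0 y := by
      have h2 : y = g.val - u • 1 := by rw [hy]; abel
      rw [h2]
      exact hg0.sub ((HasDeg.one.smul u).degGE le_rfl)
    simpa using degGE_succ h1 hy0
  have hDu : ((u • 1 : Mat c R) + y).map D = D u • 1 + y.map D := by
    rw [Matrix.map_add D (map_add D)]
    congr 1
    ext a b
    by_cases hab : a = b
    · subst hab; simp
    · simp [hab]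
  rw [hy, hDu] at hf
  -- The gauge equation for `g = u + y`, with the commutator of `p₋₁` isolated.
  have hE : u • (v - v') + (f * u - D u) • 1 + (y * v - v' * y - y.map D + f • y)
      = p * y - y * p := by
    have h1 : (p + v') * (u • 1 + y) - ((u • 1 + y) * (p + v) - (D u • 1 + y.map D)
      + f • (u • 1 + y)) = 0 := sub_eq_zero.2 hf
    simp only [add_mul, mul_add, Matrix.smul_mul, Matrix.mul_smul, one_mul, mul_one, smul_add,
      smul_smul] at h1
    rw [← sub_eq_zero, ← neg_eq_zero, ← h1]
    simp only [sub_smul, smul_sub]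
    abel
  -- Take traces: every other term is a commutator or has positive degree.
  have hs : f * u - D u = 0 := by
    have h1 := congrArg Matrix.trace hE
    simp only [Matrix.trace_add, Matrix.trace_sub, Matrix.trace_smul, Matrix.trace_mul_comm y p,
      sub_self, Matrix.trace_one, Fintype.card_fin, hv.trace_eq_zero one_pos,
      hv'.trace_eq_zero one_pos, hy1.trace_eq_zero one_pos,
      (hy1.map (map_zero D)).trace_eq_zero one_pos,
      (hy1.mul hv (k := 1) (by norm_num)).trace_eq_zero one_pos,
      (hv'.mul hy1 (k := 1) (by norm_num)).trace_eq_zero one_pos] at h1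
    simp only [smul_eq_mul, mul_zero, add_zero, zero_add] at h1
    exact (isUnit_natCast P.pos).mul_left_eq_zero.1 h1
  rw [hs, zero_smul, add_zero] at hE
  have hyk : ∀ k : ℕ, DegGE (height c) (k + 1 : ℕ) y := by
    intro k
    induction k with
    | zero => simpa using hy1
    | succ k ih =>
      refine (degGE_succ ih ?_).mono (by push_cast; rfl)
      have h1 := congrArg (degComp (height c) k) hE
      have h2 : DegGE (height c) (k + 1 : ℕ) (y * v - v' * y - y.map D + f • y) :=
        (((ih.mul hv (by omega)).sub (hv'.mul ih (by omega))).sub (ih.map (map_zero D))).add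
          (ih.smul f)
      rw [degComp_add, h2.degComp_lt (by omega), add_zero, degComp_sub,
        hpdeg.degComp_mul (j := (k + 1 : ℕ)) (by push_cast; ring),
        hpdeg.degComp_mul_right (i := (k + 1 : ℕ)) (by push_cast; ring), degComp_smul,
        degComp_sub] at h1
      -- By `h1` the bracket of `p₋₁` with the lowest part of `y` is a multiple of a component of `v
      -- - v'`, and this commutes with `p₁`.
      refine P.triple.eq_zero_of_bracket_const (k := (k + 1 : ℕ)) (by omega) hasDeg_degComp ?_
      rw [← h1, Matrix.mul_smul, Matrix.smul_mul, mul_sub, sub_mul, P.comm_degComp hvc,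
        P.comm_degComp hvc']
  obtain ⟨m, hm⟩ : ∃ m : ℕ, ∀ a, height c a < m :=
    ⟨Finset.univ.sup (height c) + 1, fun a => Nat.lt_succ_of_le (Finset.le_sup (Finset.mem_univ a))⟩
  have hy_zero : y = 0 := (hyk m).eq_zero fun a => by have := hm a; push_cast; omega
  subst hy_zero
  -- Now `g` is the scalar matrix `u` and is invertible.
  have hu_unit : IsUnit u := by
    have h1 := congrFun (congrFun (Units.mul_inv g) ⟨0, P.pos⟩) ⟨0, P.pos⟩
    rw [hy, add_zero, Matrix.smul_mul, one_mul, Matrix.smul_apply, Matrix.one_apply_eq,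
      smul_eq_mul] at h1
    exact IsUnit.of_mul_eq_one _ h1
  have h1 : u • (v - v') = 0 := by simpa using hE
  exact sub_eq_zero.1 (hu_unit.smul_eq_zero.1 h1)

/-- The construction over `ℂ` applied to each coordinate of `x` in a basis of `R`, and reassembled
with the same basis elements. -/
lemma canonical_component (P : Principal c) {k : ℤ} (hk : 0 ≤ k) {x : Mat c R} (hx : MemLie c x)
    (hxk : HasDeg (height c) k x) : ∃ y : Mat c R, MemLie c y ∧ HasDeg (height c) (k + 1) y ∧
      const R (pPlus c) * (x - (const R (pMinus c) * y - y * const R (pMinus c)))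
        = (x - (const R (pMinus c) * y - y * const R (pMinus c))) * const R (pPlus c) := by
  let L : Submodule ℂ (Mat c ℂ) :=
    { carrier := {y | MemLie c y}
      zero_mem' := MemLie.zero
      add_mem' := MemLie.add
      smul_mem' := fun r _ h => h.smul r }
  have key : ∀ l : R →ₗ[ℂ] ℂ, ∃ y : Mat c ℂ, MemLie c y ∧ HasDeg (height c) (k + 1) y ∧
      pPlus c * (x.map l - (pMinus c * y - y * pMinus c))
        = (x.map l - (pMinus c * y - y * pMinus c)) * pPlus c := fun l =>
    P.triple.exists_bracket L (fun _ h => P.lie_plus.bracket h) (fun _ h => P.lie_minus.bracket h)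
      hk (hxk.map (map_zero l)) (hx.map_linear l)
  choose F hF using key
  obtain ⟨κ, s, b, l, hX⟩ := exists_eq_sum_smul_const x
  refine ⟨∑ i ∈ s, b i • const R (F (l i)),
    MemLie.sum s fun i _ => (hF (l i)).1.baseChange.smul (b i), ?_, ?_⟩
  · intro a a' haa
    rw [Matrix.sum_apply]
    exact Finset.sum_eq_zero fun i _ => (((hF (l i)).2.1.baseChange).smul (b i)) a a' haa
  · have h1 : x - (const R (pMinus c) * (∑ i ∈ s, b i • const R (F (l i)))
        - (∑ i ∈ s, b i • const R (F (l i))) * const R (pMinus c))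
        = ∑ i ∈ s, b i • const R (x.map (l i)
          - (pMinus c * F (l i) - F (l i) * pMinus c)) := by
      conv_lhs => rw [hX]
      simp only [const_sub, const_mul, smul_sub, Finset.sum_sub_distrib, Finset.mul_sum,
        Finset.sum_mul, Matrix.mul_smul, Matrix.smul_mul]
    rw [h1, Finset.mul_sum, Finset.sum_mul]
    refine Finset.sum_congr rfl fun i _ => ?_
    rw [Matrix.mul_smul, Matrix.smul_mul, ← const_mul, (hF (l i)).2.2, const_mul]

/-- The Cayley transform `(1 + y/2)(1 - y/2)⁻¹` preserves the form because `y` is skew, and agrees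
with `1 + y` up to the square of `y`. It serves instead of the exponential. -/
lemma exists_cayley (P : Principal c) {k : ℕ} {y : Mat c R} (hy : MemLie c y)
    (hyk : HasDeg (height c) (k + 1) y) : ∃ (g : GL (Fin c.size) R) (z : Mat c R), MemBorel c g ∧
      DegGE (height c) (k + 2) z ∧ g.val = 1 + y + z := by
  set q : Mat c R := algebraMap ℂ R 2⁻¹ • y with hq
  have hqq : q + q = y := by
    have : algebraMap ℂ R 2⁻¹ + algebraMap ℂ R 2⁻¹ = 1 := by
      rw [← map_add, ← map_one (algebraMap ℂ R)]; norm_num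
    rw [hq, ← add_smul, this, one_smul]
  have hqL : MemLie c q := hy.smul _
  have hqk : HasDeg (height c) (k + 1) q := hyk.smul _
  have hq1 : DegGE (height c) 1 q := hqk.degGE (by omega)
  obtain ⟨A, hA⟩ := (hq1.isNilpotent).isUnit_one_add
  obtain ⟨B, hB⟩ := (hq1.isNilpotent).isUnit_one_sub
  have hAt : A.val.BlockTriangular id := by
    rw [hA]; exact Matrix.blockTriangular_one.add (P.triangular_of_degGE hq1)
  have hBt : B.val.BlockTriangular id := by
    rw [hB]; exact Matrix.blockTriangular_one.sub (P.triangular_of_degGE hq1)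
  have hgt : (A * B⁻¹).val.BlockTriangular id := hAt.mul (inv_blockTriangular hBt)
  have h1 : (A * B⁻¹).val * B.val = A.val := by rw [← Units.val_mul, inv_mul_cancel_right]
  refine ⟨A * B⁻¹, q * q + (A * B⁻¹).val * (q * q), memBorel_of_similitude hgt (μ := 1) ?_,
    ?_, ?_⟩
  · intro hc
    rw [memLie_iff hc] at hqL
    set J := const R (form c)
    have hqJ : q * J = -(J * q.transpose) := eq_neg_of_add_eq_zero_left hqL
    have hAJ : A.val * J = J * B.val.transpose := by
      rw [hA, hB, add_mul, one_mul, hqJ, Matrix.transpose_sub, Matrix.transpose_one, mul_sub,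
        mul_one, sub_eq_add_neg]
    have hBJ : B.val * J = J * A.val.transpose := by
      rw [hA, hB, sub_mul, one_mul, hqJ, Matrix.transpose_add, Matrix.transpose_one, mul_add,
        mul_one, sub_neg_eq_add]
    have hcomm : A.val * B.val = B.val * A.val := by rw [hA, hB]; noncomm_ring
    have hcomm' : A * B⁻¹ = B⁻¹ * A := by
      rw [mul_inv_eq_iff_eq_mul, mul_assoc, eq_inv_mul_iff_mul_eq]
      exact Units.ext hcomm.symm
    have h3 : J * B⁻¹.val.transpose = A⁻¹.val * J := by
      have h4 : B.val.transpose * B⁻¹.val.transpose = 1 := by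
        rw [← Matrix.transpose_mul, Units.inv_mul, Matrix.transpose_one]
      calc _ = A⁻¹.val * A.val * J * B⁻¹.val.transpose := by rw [Units.inv_mul, one_mul]
        _ = A⁻¹.val * (J * (B.val.transpose * B⁻¹.val.transpose)) := by
          rw [mul_assoc A⁻¹.val, hAJ]; simp only [mul_assoc]
        _ = _ := by rw [h4, mul_one]
    calc (A * B⁻¹).val * J * (A * B⁻¹).val.transpose
        = B⁻¹.val * A.val * (J * B⁻¹.val.transpose) * A.val.transpose := by
          nth_rewrite 1 [hcomm']
          rw [Units.val_mul, Units.val_mul, Matrix.transpose_mul]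
          simp only [mul_assoc]
      _ = B⁻¹.val * (A.val * A⁻¹.val) * (J * A.val.transpose) := by
          rw [h3]; simp only [mul_assoc]
      _ = _ := by
          rw [Units.mul_inv, mul_one, ← hBJ, ← mul_assoc, Units.inv_mul, one_mul, Units.val_one,
            one_smul]
  · have h2 : DegGE (height c) (k + 2) (q * q) :=
      (hqk.degGE le_rfl).mul (hqk.degGE le_rfl) (by omega)
    exact h2.add ((P.degGE_of_triangular hgt).mul h2 (by omega))
  · rw [hB, hA] at h1
    -- The identity `g = 1 + q + g q`, inserted into itself, gives `g = 1 + 2q + q² + g q²`.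
    have h2 : (A * B⁻¹).val = 1 + q + (A * B⁻¹).val * q := by
      rw [← h1, mul_sub, mul_one]; abel
    rw [← hqq]
    calc (A * B⁻¹).val = 1 + q + (1 + q + (A * B⁻¹).val * q) * q := by rw [← h2, ← h2]
      _ = _ := by noncomm_ring

/-- The adjoint torus acts on the simple root vectors with arbitrary independent scalars, so all the
units `ψ_k` can be normalised to `1`. The derivative of a diagonal matrix is diagonal and only
affects degree `0`. -/
lemma exists_torus (P : Principal c) (D : Derivation ℂ R R) {A : Mat c R} (hA : IsOperForm c A) :
    ∃ (g : GL (Fin c.size) R) (w : Mat c R), MemBorel c g ∧ MemLie c w ∧ DegGE (height c) 0 w ∧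
      Gauge D g A (const R (pMinus c) + w) := by
  obtain ⟨hL, ψ, hψ⟩ := hA
  obtain ⟨t, ht, htψ⟩ := P.torus ψ
  obtain ⟨f, hf⟩ := hL.gauge (D := D) ht.1
  refine ⟨diagUnit t, _, ht, hf.sub P.lie_minus.baseChange, ?_, f,
    (add_sub_cancel _ _)⟩
  intro a b hab
  have hne : a ≠ b := by rintro rfl; simp [deg] at hab
  have h1 := P.degGE_of_triangular hψ a b hab
  rw [Matrix.sub_apply, sub_eq_zero, Matrix.sum_apply] at h1
  have h2 : ((diagUnit t).val.map D * (diagUnit t)⁻¹.val) a b = 0 := by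
    have h3 : (diagUnit t).val.map D = Matrix.diagonal fun a => D (t a).val := by
      change (Matrix.diagonal _).map D = _
      rw [Matrix.diagonal_map (map_zero D)]
    rw [h3, Matrix.diagonal_mul]
    change D (t a).val * Matrix.diagonal _ a b = 0
    rw [Matrix.diagonal_apply_ne _ hne, mul_zero]
  rw [Matrix.sub_apply, Matrix.add_apply, Matrix.sub_apply, h2, diagUnit_conj_apply,
    Matrix.smul_apply, Matrix.one_apply_ne hne, smul_zero, sub_zero, add_zero, h1, sub_eq_zero,
    const_apply, pMinus, Matrix.sum_apply, map_sum, Finset.mul_sum, Finset.sum_mul]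
  refine Finset.sum_congr rfl fun k _ => ?_
  rw [Matrix.smul_apply, const_apply, smul_eq_mul]
  by_cases h0 : negSimple c k a b = 0
  · rw [h0, map_zero]; ring
  · have h3 : (t a).val * (ψ k).val = (t b).val := congrArg Units.val (htψ k a b h0)
    rw [← mul_assoc, h3, mul_right_comm, Units.mul_inv, one_mul]

/-- After normalisation of the `ψ_k`, the part of the matrix not yet centralising `p₁` is pushed
into higher and higher degree. In degree `k` it is a canonical element plus a bracket `[p₋₁, y]`,
and the gauge transformation `1 + y + ⋯` removes the bracket while changing nothing in lower degree.
Heights are bounded, so the process ends. -/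
theorem canonical_exists (P : Principal c) (D : Derivation ℂ R R) {A : Mat c R}
    (hA : IsOperForm c A) : ∃ (g : GL (Fin c.size) R) (v : Mat c R), MemBorel c g ∧
      IsCanonical c v ∧ Gauge D g A (const R (pMinus c) + v) := by
  have hp : HasDeg (height c) (-1) (const R (pMinus c)) := P.triple.deg_f.baseChange
  have key : ∀ k : ℕ, ∃ (g : GL (Fin c.size) R) (u w : Mat c R), MemBorel c g ∧
      MemLie c u ∧ DegGE (height c) 0 u ∧ const R (pPlus c) * u = u * const R (pPlus c) ∧
      MemLie c w ∧ DegGE (height c) k w ∧ Gauge D g A (const R (pMinus c) + (u + w)) := by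
    intro k
    induction k with
    | zero =>
      obtain ⟨g, w, hg, hw, hw0, hG⟩ := P.exists_torus D hA
      exact ⟨g, 0, w, hg, MemLie.zero, DegGE.zero, by simp, hw, hw0, by simpa using hG⟩
    | succ k ih =>
      obtain ⟨g, u, w, hg, hu, hu0, huc, hw, hwk, hG⟩ := ih
      obtain ⟨y, hyL, hyk, hyc⟩ := P.canonical_component (k := k) (by omega)
        (P.lie_degComp k hw) hasDeg_degComp
      obtain ⟨h, z, hh, hz, hhz⟩ := P.exists_cayley hyL hyk
      set p := const R (pMinus c)
      set x := degComp (height c) k w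
      have hxk : HasDeg (height c) k x := hasDeg_degComp
      set vk := x - (p * y - y * p) with hvk
      have hvkL : MemLie c vk :=
        (P.lie_degComp k hw).sub ((P.lie_minus.baseChange).bracket hyL)
      have hvkd : HasDeg (height c) k vk :=
        hxk.sub ((hp.mul hyk (by ring)).sub (hyk.mul hp (by ring)))
      have hAL : MemLie c (p + (u + w)) := P.lie_minus.baseChange.add (hu.add hw)
      obtain ⟨f, hf⟩ := hAL.gauge (D := D) hh.1
      have hy0 : DegGE (height c) (k + 1) y := hyk.degGE le_rfl
      have hmap : h.val.map D = y.map D + z.map D := by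
        rw [hhz, Matrix.map_add D (map_add D), Matrix.map_add D (map_add D), map_derivation_one,
          zero_add]
      have hmapd : DegGE (height c) (k + 1) (h.val.map D) := by
        rw [hmap]
        exact (hy0.map (map_zero D)).add ((hz.map (map_zero D)).mono (by omega))
      have hinv : DegGE (height c) 0 h⁻¹.val := P.degGE_of_triangular (inv_blockTriangular hh.2)
      have hwk1 : DegGE (height c) (k + 1) (w - x) := hwk.sub_degComp
      have hA0 : DegGE (height c) (-1) (p + (u + w)) :=
        (hp.degGE le_rfl).add ((hu0.mono (by norm_num)).add (hwk.mono (by omega)))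
      have huw : DegGE (height c) 0 (u + w) := hu0.add (hwk.mono (by omega))
      have hpuv : DegGE (height c) (-1) (p + u + vk) :=
        ((hp.degGE le_rfl).add (hu0.mono (by norm_num))).add (hvkd.degGE (by omega))
      have huv : DegGE (height c) 0 (u + vk) := hu0.add (hvkd.degGE (by omega))
      -- In degree `k` the difference is `x + [y, p₋₁] - vk`, which vanishes by the choice of `vk`;
      -- all remaining terms have larger degree.
      have hdiff : DegGE (height c) (k + 1)
          (h.val * (p + (u + w)) - h.val.map D - (p + u + vk) * h.val) := by
        have h1 : h.val * (p + (u + w)) - h.val.map D - (p + u + vk) * h.val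
            = (w - x) + y * (u + w) + z * (p + (u + w)) - h.val.map D - (u + vk) * y
              - (p + u + vk) * z := by
          rw [hhz, hvk]; noncomm_ring
        rw [h1]
        refine ((((hwk1.add (hy0.mul huw (by omega))).add (hz.mul hA0 (by omega))).sub
          hmapd).sub (huv.mul hy0 (by omega))).sub (hpuv.mul hz (by omega))
      set A' := h.val * (p + (u + w)) * h⁻¹.val - h.val.map D * h⁻¹.val + f • (1 : Mat c R)
        with hA'
      have hdiff' : DegGE (height c) (k + 1) (A' - f • 1 - (p + u + vk)) := by
        have h1 : A' - f • 1 - (p + u + vk)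
            = (h.val * (p + (u + w)) - h.val.map D - (p + u + vk) * h.val) * h⁻¹.val := by
          rw [sub_mul, sub_mul, mul_assoc (p + u + vk), Units.mul_inv, mul_one, hA']
          abel
        rw [h1]
        exact hdiff.mul hinv (by omega)
      -- Every other term is traceless, so the scalar correction vanishes.
      have hf0 : f = 0 := by
        have h1 : A' = (A' - f • 1 - (p + u + vk)) + (p + u + vk) + f • 1 := by abel
        have h2 := hf.trace_eq_zero
        have h3 : (p + u + vk).trace = 0 :=
          ((P.lie_minus.baseChange.add hu).add hvkL).trace_eq_zero
        rw [h1, Matrix.trace_add, Matrix.trace_add, h3, hdiff'.trace_eq_zero (by omega),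
          Matrix.trace_smul, Matrix.trace_one, Fintype.card_fin, smul_eq_mul, zero_add,
          zero_add] at h2
        exact (isUnit_natCast P.pos).mul_left_eq_zero.1 h2
      rw [hf0, zero_smul, sub_zero] at hdiff'
      refine ⟨h * g, u + vk, A' - (p + u + vk), hh.mul hg, hu.add hvkL, huv, ?_, ?_, ?_, ?_⟩
      · rw [mul_add, add_mul, huc, hyc]
      · exact hf.sub ((P.lie_minus.baseChange.add hu).add hvkL)
      · exact_mod_cast hdiff'
      · refine hG.trans ?_
        have h1 : p + (u + vk + (A' - (p + u + vk))) = A' := by abel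
        rw [h1]
        exact ⟨f, hA'⟩
  obtain ⟨m, hm⟩ : ∃ m : ℕ, ∀ a, height c a < m :=
    ⟨Finset.univ.sup (height c) + 1, fun a => Nat.lt_succ_of_le (Finset.le_sup (Finset.mem_univ a))⟩
  obtain ⟨g, u, w, hg, hu, hu0, huc, hw, hwk, hG⟩ := key m
  have hw0 : w = 0 := hwk.eq_zero fun a => by have := hm a; omega
  rw [hw0, add_zero] at hG
  refine ⟨g, u, hg, ⟨hu, ?_, huc⟩, hG⟩
  -- A degree `0` element of `𝔤` that commutes with `p₁` is zero, so `u` starts in degree `1`.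
  refine degGE_succ hu0 (eq_zero_of_map fun l => ?_)
  refine P.lie_zero ((P.lie_degComp 0 hu).map_linear l) (hasDeg_degComp.map (map_zero l)) ?_
  have := congrArg (fun X => Matrix.map X l) (P.comm_degComp huc 0)
  simpa only [map_const_mul, map_mul_const] using this

end Principal

end Oper

/-! ### Derivations and substitutions of Laurent polynomials and Laurent series -/

namespace Oper

noncomputable section

lemma algebraMap_laurentSeries (r : ℂ) : algebraMap ℂ ℂ⸨X⸩ r = HahnSeries.C r := by
  rw [HahnSeries.algebraMap_apply']
  exact HahnSeries.ofPowerSeries_C r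

lemma formalDeriv_coeff (f : ℂ⸨X⸩) (n : ℤ) :
    (formalDeriv f).coeff n = (n + 1 : ℤ) * f.coeff (n + 1) := by
  rw [formalDeriv, LaurentSeries.derivative_apply, LaurentSeries.hasseDeriv_coeff]
  simp

lemma formalDeriv_add (f g : ℂ⸨X⸩) : formalDeriv (f + g) = formalDeriv f + formalDeriv g :=
  map_add _ _ _

lemma single_one_mul_formalDeriv_coeff (f : ℂ⸨X⸩) (n : ℤ) :
    (HahnSeries.single (1 : ℤ) (1 : ℂ) * formalDeriv f).coeff n = n * f.coeff n := by
  rw [HahnSeries.coeff_single_mul, formalDeriv_coeff]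
  simp

lemma single_neg_mul_cancel (k : ℤ) (f : ℂ⸨X⸩) :
    HahnSeries.single (-k) (1 : ℂ) * (HahnSeries.single k (1 : ℂ) * f) = f := by
  rw [← mul_assoc, HahnSeries.single_mul_single]
  simp

/-- For `x d/dx` in place of `d/dx`, coefficients are only rescaled and supports do not grow. Both
sides are then sums over the same antidiagonal, and the rule becomes `n = i + j` term by term. -/
lemma formalDeriv_mul (f g : ℂ⸨X⸩) :
    formalDeriv (f * g) = f * formalDeriv g + g * formalDeriv f := by
  have hsupp : ∀ h : ℂ⸨X⸩,
      (HahnSeries.single (1 : ℤ) (1 : ℂ) * formalDeriv h).support ⊆ h.support := by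
    intro h n hn
    rw [HahnSeries.mem_support, single_one_mul_formalDeriv_coeff] at hn
    exact right_ne_zero_of_mul hn
  have key : HahnSeries.single (1 : ℤ) (1 : ℂ) * formalDeriv (f * g)
      = HahnSeries.single (1 : ℤ) (1 : ℂ) * (f * formalDeriv g + g * formalDeriv f) := by
    rw [mul_add, mul_left_comm, mul_left_comm _ g, mul_comm g]
    ext n
    rw [single_one_mul_formalDeriv_coeff, HahnSeries.coeff_add,
      HahnSeries.coeff_mul_left' f.isPWO_support (hsupp f),
      HahnSeries.coeff_mul_right' g.isPWO_support (hsupp g), HahnSeries.coeff_mul,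
      ← Finset.sum_add_distrib, Finset.mul_sum]
    refine Finset.sum_congr rfl fun ij hij => ?_
    rw [single_one_mul_formalDeriv_coeff, single_one_mul_formalDeriv_coeff]
    rw [Finset.mem_antidiagonal] at hij
    rw [← hij.2.2]
    push_cast
    ring
  rw [← single_neg_mul_cancel 1 (formalDeriv (f * g)), key, single_neg_mul_cancel]

lemma formalDeriv_single (k : ℤ) (a : ℂ) :
    formalDeriv (HahnSeries.single k a) = HahnSeries.single (k - 1) ((k : ℂ) * a) := by
  ext n
  rw [formalDeriv_coeff, HahnSeries.coeff_single, HahnSeries.coeff_single]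
  by_cases h : n = k - 1
  · rw [if_pos h, if_pos (by omega), h]; push_cast; ring
  · rw [if_neg h, if_neg (by omega), mul_zero]

/-- The derivation `d/dx` of `ℂ((x))`. -/
def formalDer : AlgDer ℂ⸨X⸩ :=
  AlgDer.ofFun formalDeriv formalDeriv_add formalDeriv_mul fun r => by
    rw [algebraMap_laurentSeries, HahnSeries.C_apply, formalDeriv_single]
    simp

lemma laurentDeriv_add (f g : ℂ[T;T⁻¹]) :
    laurentDeriv (f + g) = laurentDeriv f + laurentDeriv g := by
  unfold laurentDeriv
  rw [AddMonoidAlgebra.coeff_add]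
  refine Finsupp.sum_add_index' (fun k => by simp) fun k a b => ?_
  rw [mul_add, map_add, add_mul]

lemma laurentDeriv_C_mul_T (a : ℂ) (k : ℤ) :
    laurentDeriv (LaurentPolynomial.C a * LaurentPolynomial.T k)
      = LaurentPolynomial.C ((k : ℂ) * a) * LaurentPolynomial.T (k - 1) := by
  unfold laurentDeriv
  rw [← LaurentPolynomial.single_eq_C_mul_T]
  exact Finsupp.sum_single_index (by simp)

lemma xPow_zpow (k e : ℤ) : ((xPow k ^ e : (ℂ⸨X⸩)ˣ) : ℂ⸨X⸩) = HahnSeries.single (k * e) 1 := by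
  have hnat : ∀ n : ℕ, ((xPow k ^ n : (ℂ⸨X⸩)ˣ) : ℂ⸨X⸩) = HahnSeries.single (k * n) 1 := by
    intro n
    rw [Units.val_pow_eq_pow_val]
    change (HahnSeries.single k (1 : ℂ)) ^ n = _
    rw [HahnSeries.single_pow]
    simp [mul_comm]
  cases e with
  | ofNat n => simpa using hnat n
  | negSucc n =>
    rw [zpow_negSucc, ← mul_one (((xPow k ^ (n + 1))⁻¹ : (ℂ⸨X⸩)ˣ) : ℂ⸨X⸩), Units.inv_mul_eq_iff_eq_mul,
      hnat, HahnSeries.single_mul_single, one_mul]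
    rw [Int.negSucc_eq]
    push_cast
    rw [← mul_add, add_neg_cancel, mul_zero]
    rfl

lemma expand_C_mul_T (k : ℤ) (a : ℂ) (e : ℤ) :
    expand k (LaurentPolynomial.C a * LaurentPolynomial.T e) = HahnSeries.single (k * e) a := by
  rw [expand, LaurentPolynomial.eval₂_C_mul_T, xPow_zpow, HahnSeries.C_apply,
    HahnSeries.single_mul_single, zero_add, mul_one]

lemma expand_coeff (k : ℤ) (hk : k ≠ 0) (f : ℂ[T;T⁻¹]) (e : ℤ) :
    (expand k f).coeff (k * e) = f.coeff e := by
  induction f using LaurentPolynomial.induction_on' with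
  | add p q hp hq => rw [map_add, HahnSeries.coeff_add, hp, hq]; rfl
  | C_mul_T n a =>
    rw [expand_C_mul_T, ← LaurentPolynomial.single_eq_C_mul_T, HahnSeries.coeff_single,
      AddMonoidAlgebra.coeff_single, Finsupp.single_apply]
    simp only [mul_right_inj' hk, eq_comm]

lemma expand_coeff_of_not_dvd (k : ℤ) (f : ℂ[T;T⁻¹]) (e : ℤ) (he : ¬ k ∣ e) :
    (expand k f).coeff e = 0 := by
  induction f using LaurentPolynomial.induction_on' with
  | add p q hp hq => rw [map_add, HahnSeries.coeff_add, hp, hq, add_zero]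
  | C_mul_T n a =>
    rw [expand_C_mul_T, HahnSeries.coeff_single_of_ne]
    rintro rfl
    exact he (dvd_mul_right _ _)

lemma expand_injective (k : ℤ) (hk : k ≠ 0) : Function.Injective (expand k) := by
  intro f g h
  refine LaurentPolynomial.ext fun e => ?_
  rw [← expand_coeff k hk, h, expand_coeff k hk]

/-- `expand` as a homomorphism of `ℂ`-algebras. -/
def expandAlg (k : ℤ) : ℂ[T;T⁻¹] →ₐ[ℂ] ℂ⸨X⸩ :=
  { expand k with
    commutes' := fun r => by
      rw [algebraMap_laurentSeries]
      exact LaurentPolynomial.eval₂_C _ _ r }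

lemma formalDeriv_expand (k : ℤ) (f : ℂ[T;T⁻¹]) :
    formalDeriv (expand k f) = HahnSeries.single (k - 1) (k : ℂ) * expand k (laurentDeriv f) := by
  induction f using LaurentPolynomial.induction_on' with
  | add p q hp hq => rw [laurentDeriv_add, map_add, map_add, formalDeriv_add, hp, hq, mul_add]
  | C_mul_T n a =>
    rw [laurentDeriv_C_mul_T, expand_C_mul_T, expand_C_mul_T, formalDeriv_single,
      HahnSeries.single_mul_single, show k - 1 + k * (n - 1) = k * n - 1 by ring,
      show ((k * n : ℤ) : ℂ) * a = k * (n * a) by push_cast; ring]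

/-- Inherited from `ℂ((x))`, into which `ℂ[t, t⁻¹]` embeds compatibly with the derivations. -/
lemma laurentDeriv_mul (f g : ℂ[T;T⁻¹]) :
    laurentDeriv (f * g) = f * laurentDeriv g + g * laurentDeriv f := by
  apply expand_injective 1 one_ne_zero
  have h : ∀ p, expand 1 (laurentDeriv p) = formalDeriv (expand 1 p) := fun p => by
    rw [formalDeriv_expand]
    simp
  rw [map_add, map_mul, map_mul, h, h, h, map_mul, formalDeriv_mul]

/-- The derivation `d/dt` of `ℂ[t, t⁻¹]`. -/
def laurentDer : AlgDer ℂ[T;T⁻¹] :=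
  AlgDer.ofFun laurentDeriv laurentDeriv_add laurentDeriv_mul fun r => by
    have := laurentDeriv_C_mul_T r 0
    simpa using this

/-- Power series in `ℂ((x))`, as a homomorphism of `ℂ`-algebras. -/
def seriesAlg : ℂ⟦X⟧ →ₐ[ℂ] ℂ⸨X⸩ :=
  { HahnSeries.ofPowerSeries ℤ ℂ with
    commutes' := fun r => by
      rw [algebraMap_laurentSeries]
      exact HahnSeries.ofPowerSeries_C r }

lemma coe_seriesAlg : ⇑seriesAlg = HahnSeries.ofPowerSeries ℤ ℂ := rfl

lemma seriesAlg_injective : Function.Injective seriesAlg := HahnSeries.ofPowerSeries_injective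

lemma seriesAlg_coeff (f : ℂ⟦X⟧) (n : ℕ) : (seriesAlg f).coeff n = PowerSeries.coeff n f :=
  HahnSeries.ofPowerSeries_apply_coeff _ _

lemma seriesAlg_coeff_neg (f : ℂ⟦X⟧) {n : ℤ} (hn : n < 0) : (seriesAlg f).coeff n = 0 := by
  rw [coe_seriesAlg, PowerSeries.coeff_coe, if_pos hn]

lemma exists_seriesAlg {f : ℂ⸨X⸩} (h : ∀ n < 0, f.coeff n = 0) : ∃ p, seriesAlg p = f := by
  refine ⟨PowerSeries.mk fun n => f.coeff n, ?_⟩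
  ext n
  rcases lt_or_ge n 0 with hn | hn
  · rw [seriesAlg_coeff_neg _ hn, h n hn]
  · lift n to ℕ using hn
    rw [seriesAlg_coeff, PowerSeries.coeff_mk]

lemma formalDeriv_seriesAlg (f : ℂ⟦X⟧) :
    formalDeriv (seriesAlg f) = seriesAlg (PowerSeries.derivative ℂ f) := by
  ext n
  rw [formalDeriv_coeff]
  rcases lt_or_ge n 0 with hn | hn
  · rw [seriesAlg_coeff_neg _ hn]
    rcases eq_or_ne n (-1) with rfl | h
    · simp
    · rw [seriesAlg_coeff_neg _ (by omega), mul_zero]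
  · lift n to ℕ using hn
    rw [seriesAlg_coeff, PowerSeries.coeff_derivative]
    have : (seriesAlg f).coeff ((n : ℤ) + 1) = PowerSeries.coeff (n + 1) f := by
      rw [← seriesAlg_coeff]; rfl
    rw [this]
    push_cast
    ring

/-- The substitution `x ↦ x ^ k` in `ℂ((x))`. -/
def ramify (k : ℕ) (hk : 0 < k) : ℂ⸨X⸩ →ₐ[ℂ] ℂ⸨X⸩ :=
  { HahnSeries.embDomainRingHom (AddMonoidHom.mulLeft (k : ℤ))
      (fun _ _ h => mul_left_cancel₀ (by exact_mod_cast hk.ne') h)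
      (fun _ _ => mul_le_mul_iff_right₀ (by exact_mod_cast hk)) with
    commutes' := fun r => by
      rw [algebraMap_laurentSeries]
      exact HahnSeries.embDomainRingHom_C }

lemma ramify_coeff (k : ℕ) (hk : 0 < k) (f : ℂ⸨X⸩) (n : ℤ) :
    (ramify k hk f).coeff (k * n) = f.coeff n :=
  HahnSeries.embDomain_coeff (f := ⟨⟨AddMonoidHom.mulLeft (k : ℤ), _⟩, _⟩) (a := n)

lemma ramify_coeff_of_not_dvd (k : ℕ) (hk : 0 < k) (f : ℂ⸨X⸩) (n : ℤ) (hn : ¬ (k : ℤ) ∣ n) :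
    (ramify k hk f).coeff n = 0 := by
  refine HahnSeries.embDomain_of_notMem_range ?_
  rintro ⟨m, rfl⟩
  exact hn (dvd_mul_right _ _)

lemma laurentSeries_ext_of_dvd {k : ℕ} {f g : ℂ⸨X⸩}
    (h1 : ∀ n : ℤ, f.coeff (k * n) = g.coeff (k * n))
    (h2 : ∀ n : ℤ, ¬ (k : ℤ) ∣ n → f.coeff n = 0) (h3 : ∀ n : ℤ, ¬ (k : ℤ) ∣ n → g.coeff n = 0) :
    f = g := by
  ext n
  by_cases hn : (k : ℤ) ∣ n
  · obtain ⟨m, rfl⟩ := hn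
    exact h1 m
  · rw [h2 n hn, h3 n hn]

lemma ramify_expand (k : ℕ) (hk : 0 < k) (l : ℤ) (hl : l ≠ 0) (f : ℂ[T;T⁻¹]) :
    ramify k hk (expand l f) = expand (k * l) f := by
  have hk' : (k : ℤ) ≠ 0 := by exact_mod_cast hk.ne'
  refine laurentSeries_ext_of_dvd (k := k) (fun n => ?_)
    (ramify_coeff_of_not_dvd k hk _) (fun n hn => ?_)
  · rw [ramify_coeff]
    by_cases h : l ∣ n
    · obtain ⟨m, rfl⟩ := h
      rw [expand_coeff l hl, ← mul_assoc, expand_coeff _ (mul_ne_zero hk' hl)]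
    · rw [expand_coeff_of_not_dvd _ _ _ h, expand_coeff_of_not_dvd]
      rwa [mul_dvd_mul_iff_left hk']
  · exact expand_coeff_of_not_dvd _ _ _ fun h => hn (dvd_of_mul_right_dvd h)

/-- Multiplication by `x` keeps both sides supported on multiples of `k`, where coefficients can be
compared directly. -/
lemma formalDeriv_ramify (k : ℕ) (hk : 0 < k) (f : ℂ⸨X⸩) :
    formalDeriv (ramify k hk f)
      = HahnSeries.single ((k : ℤ) - 1) (k : ℂ) * ramify k hk (formalDeriv f) := by
  have key : HahnSeries.single (1 : ℤ) (1 : ℂ) * formalDeriv (ramify k hk f)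
      = HahnSeries.single (k : ℤ) (k : ℂ) * ramify k hk (formalDeriv f) := by
    refine laurentSeries_ext_of_dvd (k := k) (fun n => ?_) (fun n hn => ?_) (fun n hn => ?_)
    · rw [single_one_mul_formalDeriv_coeff, HahnSeries.coeff_single_mul, ramify_coeff,
        show (k : ℤ) * n - k = k * (n - 1) by ring, ramify_coeff, formalDeriv_coeff]
      rw [sub_add_cancel]
      push_cast
      ring
    · rw [single_one_mul_formalDeriv_coeff, ramify_coeff_of_not_dvd k hk _ _ hn, mul_zero]
    · rw [HahnSeries.coeff_single_mul, ramify_coeff_of_not_dvd k hk, mul_zero]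
      rwa [dvd_sub_self_right]
  rw [← single_neg_mul_cancel 1 (formalDeriv (ramify k hk f)), key, ← mul_assoc,
    HahnSeries.single_mul_single, one_mul, neg_add_eq_sub]

end

end Oper

/-! ### Canonical forms of opers on `𝔾_m` and the condition at `0` -/

namespace Oper

noncomputable section

section Scaling

variable {R : Type} [CommRing R] [Algebra ℂ R]

/-- A change of derivation from `D` to `s D`, used to pass between `d/dt` and the Euler derivation
`t d/dt`. -/
lemma Gauge.smul {N : ℕ} {D : AlgDer R} {g : GL (Fin N) R} {A A' : Matrix (Fin N) (Fin N) R}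
    (h : Gauge D g A A') (s : R) : Gauge (s • D : AlgDer R) g (s • A) (s • A') := by
  obtain ⟨f, hf⟩ := gauge_iff.1 h
  refine gauge_iff.2 ⟨s * f, ?_⟩
  have h1 : g.val.map (s • D : AlgDer R) = s • g.val.map D := by ext a b; simp
  rw [h1, Matrix.smul_mul, hf, Matrix.mul_smul, smul_add, smul_sub, mul_smul]

lemma Gauge.of_smul {N : ℕ} {D : AlgDer R} {g : GL (Fin N) R} {A A' : Matrix (Fin N) (Fin N) R}
    {s r : R} (hrs : r * s = 1) (h : Gauge (s • D : AlgDer R) g (s • A) (s • A')) :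
    Gauge D g A A' := by
  have := h.smul r
  rwa [smul_smul, smul_smul, smul_smul, hrs, one_smul, one_smul, one_smul] at this

variable {c : ClassicalType}

lemma IsOperForm.units_smul {A : Mat c R} (h : IsOperForm c A) (s : Rˣ) :
    IsOperForm c (s.val • A) := by
  obtain ⟨hL, ψ, hψ⟩ := h
  refine ⟨hL.smul _, fun k => s * ψ k, ?_⟩
  have h1 : s.val • A - ∑ k, (s * ψ k).val • const R (negSimple c k)
      = s.val • (A - ∑ k, (ψ k).val • const R (negSimple c k)) := by
    rw [smul_sub, Finset.smul_sum]
    simp only [Units.val_mul, mul_smul]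
  rw [h1]
  intro a b hab
  rw [Matrix.smul_apply, hψ hab, smul_zero]

lemma Principal.isOperForm (P : Principal c) {w : Mat c R} (hw : MemLie c w)
    (hd : DegGE (height c) 0 w) : IsOperForm c (const R (pMinus c) + w) := by
  refine ⟨P.lie_minus.baseChange.add hw, fun _ => 1, ?_⟩
  have h1 : ∑ k : Fin c.rank, (1 : Rˣ).val • const R (negSimple c k) = const R (pMinus c) := by
    ext a b
    simp [pMinus, Matrix.sum_apply, const]
  rw [h1, add_sub_cancel_left]
  exact P.lie_upper hw hd

end Scaling

variable {c : ClassicalType}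

lemma isCanonical_map {R S : Type} [CommRing R] [Algebra ℂ R] [CommRing S] [Algebra ℂ S]
    (φ : R →ₐ[ℂ] S) {v : Mat c R} (h : IsCanonical c v) : IsCanonical c (v.map φ : Mat c S) := by
  refine ⟨h.memLie.map_algHom φ, h.degGE.map (map_zero φ), ?_⟩
  have := congrArg (fun X => Matrix.map X φ) h.comm
  simpa only [Matrix.map_mul, const_map_algHom] using this

lemma isCanonical_map_linear {R : Type} [CommRing R] [Algebra ℂ R] (l : R →ₗ[ℂ] ℂ) {v : Mat c R}
    (h : IsCanonical c v) : IsCanonical c (v.map l : Mat c ℂ) := by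
  refine ⟨h.memLie.map_linear l, h.degGE.map (map_zero l), ?_⟩
  have := congrArg (fun X => Matrix.map X l) h.comm
  rw [const_self]
  simpa only [map_mul_const, map_const_mul] using this

lemma IsCanonical.baseChange {R : Type} [CommRing R] [Algebra ℂ R] {v : Mat c ℂ}
    (h : IsCanonical c v) : IsCanonical c (const R v) :=
  isCanonical_map (Algebra.ofId ℂ R) h

lemma IsCanonical.smul {R : Type} [CommRing R] [Algebra ℂ R] {v : Mat c R}
    (h : IsCanonical c v) (r : R) : IsCanonical c (r • v) :=
  ⟨h.memLie.smul r, h.degGE.smul r, by rw [Matrix.mul_smul, Matrix.smul_mul, h.comm]⟩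

/-- The matrix `t⁻¹ (p₋₁ + v)`. -/
def conn (c : ClassicalType) (v : Mat c ℂ[T;T⁻¹]) : Mat c ℂ[T;T⁻¹] :=
  (LaurentPolynomial.T (-1) : ℂ[T;T⁻¹]) • (const ℂ[T;T⁻¹] (pMinus c) + v)

/-- The monomial `t ^ k` as a unit. -/
def tUnit (k : ℤ) : (ℂ[T;T⁻¹])ˣ where
  val := LaurentPolynomial.T k
  inv := LaurentPolynomial.T (-k)
  val_inv := by rw [← LaurentPolynomial.T_add, add_neg_cancel, LaurentPolynomial.T_zero]
  inv_val := by rw [← LaurentPolynomial.T_add, neg_add_cancel, LaurentPolynomial.T_zero]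

lemma T_neg_one_mul : (LaurentPolynomial.T (-1) : ℂ[T;T⁻¹]) * LaurentPolynomial.T 1 = 1 := by
  rw [← LaurentPolynomial.T_add]; rfl

lemma T_one_mul : (LaurentPolynomial.T 1 : ℂ[T;T⁻¹]) * LaurentPolynomial.T (-1) = 1 := by
  rw [← LaurentPolynomial.T_add]; rfl

lemma Principal.isOperForm_conn (P : Principal c) {v : Mat c ℂ[T;T⁻¹]} (h : IsCanonical c v) :
    IsOperForm c (conn c v) :=
  (P.isOperForm h.memLie (h.degGE.mono (by norm_num))).units_smul (tUnit (-1))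

/-- The oper connection `∂_t + t⁻¹ (p₋₁ + v)`. -/
def Principal.operConn (P : Principal c) {v : Mat c ℂ[T;T⁻¹]} (h : IsCanonical c v) : OperConn c :=
  ⟨conn c v, P.isOperForm_conn h⟩

/-- The relation of which opers are the quotient is already an equivalence relation, since `B` is a
group. -/
theorem toOper_eq_iff {A A' : OperConn c} : toOper A = toOper A' ↔
    ∃ g : GL (Fin c.size) ℂ[T;T⁻¹], MemBorel c g ∧ Gauge laurentDeriv g A.1 A'.1 := by
  refine ⟨fun h => ?_, fun h => Quot.sound h⟩
  have h' := Quot.eqvGen_exact h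
  clear h
  induction h' with
  | rel _ _ h => exact h
  | refl A => exact ⟨1, MemBorel.one, Gauge.refl laurentDer A.1⟩
  | symm A B _ ih =>
    obtain ⟨g, hg, hG⟩ := ih
    exact ⟨g⁻¹, hg.inv, Gauge.symm (D := laurentDer) hG⟩
  | trans A B C _ _ ih1 ih2 =>
    obtain ⟨g, hg, hG⟩ := ih1
    obtain ⟨g', hg', hG'⟩ := ih2
    exact ⟨g' * g, hg'.mul hg, Gauge.trans (D := laurentDer) hG hG'⟩

/-- Multiplication by the unit `t` preserves oper form and turns `d/dt` into `t d/dt`, to which the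
canonical form theorem applies. With this normalisation a regular singularity at `0` means that `v`
is integral. -/
theorem Principal.exists_conn (P : Principal c) (A : OperConn c) :
    ∃ (v : Mat c ℂ[T;T⁻¹]) (h : IsCanonical c v), toOper A = toOper (P.operConn h) := by
  have hA : IsOperForm c ((LaurentPolynomial.T 1 : ℂ[T;T⁻¹]) • A.1) := A.2.units_smul (tUnit 1)
  obtain ⟨g, v, hg, hv, hG⟩ :=
    P.canonical_exists ((LaurentPolynomial.T 1 : ℂ[T;T⁻¹]) • laurentDer : AlgDer _) hA
  refine ⟨v, hv, toOper_eq_iff.2 ⟨g, hg, ?_⟩⟩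
  refine Gauge.of_smul (D := laurentDer) (s := LaurentPolynomial.T 1) T_neg_one_mul ?_
  have h1 : (LaurentPolynomial.T 1 : ℂ[T;T⁻¹]) • (P.operConn hv).1
      = const ℂ[T;T⁻¹] (pMinus c) + v := by
    change LaurentPolynomial.T 1 • (LaurentPolynomial.T (-1) • (const ℂ[T;T⁻¹] (pMinus c) + v)) = _
    rw [smul_smul, T_one_mul, one_smul]
  rw [h1]
  exact hG

theorem Principal.conn_injective (P : Principal c) {v v' : Mat c ℂ[T;T⁻¹]} (h : IsCanonical c v)
    (h' : IsCanonical c v') (he : toOper (P.operConn h) = toOper (P.operConn h')) : v = v' := by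
  obtain ⟨g, hg, hG⟩ := toOper_eq_iff.1 he
  have h1 := Gauge.smul (D := laurentDer) hG (LaurentPolynomial.T 1)
  simp only [operConn, conn, smul_smul, T_one_mul, one_smul] at h1
  exact P.canonical_unique hg.2 h.degGE h'.degGE h.comm h'.comm h1

lemma Gauge.pullback {g : GL (Fin c.size) ℂ[T;T⁻¹]} {A A' : Mat c ℂ[T;T⁻¹]}
    (h : Gauge laurentDeriv g A A') (k : ℤ) :
    Gauge formalDeriv (Matrix.GeneralLinearGroup.map ((expandAlg k : ℂ[T;T⁻¹] →ₐ[ℂ] ℂ⸨X⸩) :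
      ℂ[T;T⁻¹] →+* ℂ⸨X⸩) g) (Oper.pullback k A : Mat c ℂ⸨X⸩) (Oper.pullback k A') :=
  Gauge.map (D := laurentDer) (D' := formalDer) _ (fun x => formalDeriv_expand k x) h

lemma RegularResidueZero.gauge {g : GL (Fin c.size) ℂ[T;T⁻¹]} {A A' : Mat c ℂ[T;T⁻¹]}
    (hg : MemBorel c g) (h : Gauge laurentDeriv g A A') (hA : RegularResidueZero c A) :
    RegularResidueZero c A' := by
  obtain ⟨g', M, hg', hM, hG, hN⟩ := hA
  have h1 := h.pullback (c := c) 1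
  exact ⟨_, M, hg'.mul (hg.map (expandAlg 1)).inv, hM,
    Gauge.trans (D := formalDer) (Gauge.symm (D := formalDer) h1) hG, hN⟩

lemma IsSlopeAtInfty.gauge {g : GL (Fin c.size) ℂ[T;T⁻¹]} {A A' : Mat c ℂ[T;T⁻¹]}
    (hg : MemBorel c g) (h : Gauge laurentDeriv g A A') {q : ℚ} (hA : IsSlopeAtInfty c A q) :
    IsSlopeAtInfty c A' q := by
  obtain ⟨a, b, hb, hq, g', M, hg', hM, hG, hN⟩ := hA
  have h1 := h.pullback (c := c) (-(b : ℤ))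
  exact ⟨a, b, hb, hq, _, M, hg'.mul (hg.1.map (expandAlg (-(b : ℤ)))).inv, hM,
    Gauge.trans (D := formalDer) (Gauge.symm (D := formalDer) h1) hG, hN⟩

/-- The only nilpotent element of the slice `p₋₁ + ⨁ V_{𝔤,i}` is `p₋₁`. -/
def NilpotentSlice (c : ClassicalType) : Prop :=
  ∀ w : Mat c ℂ, IsCanonical c w → IsNilpotent (pMinus c + w) → w = 0

lemma expand_T (k e : ℤ) : expand k (LaurentPolynomial.T e) = HahnSeries.single (k * e) 1 := by
  have := expand_C_mul_T k 1 e
  rwa [map_one, one_mul] at this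

/-- Since `dt/t = k dx/x`, the simple pole keeps its shape under `t = x ^ k`, for positive and
negative `k` alike; this treats `0` and `∞` at once. -/
lemma pullback_conn (k : ℤ) (v : Mat c ℂ[T;T⁻¹]) :
    (pullback k (conn c v) : Mat c ℂ⸨X⸩)
      = HahnSeries.single (-1 : ℤ) (k : ℂ) • (const ℂ⸨X⸩ (pMinus c) + v.map (expandAlg k)) := by
  have h1 : (conn c v).map (expand k)
      = HahnSeries.single (-k) (1 : ℂ) • (const ℂ⸨X⸩ (pMinus c) + v.map (expandAlg k)) := by
    rw [← const_map_algHom (expandAlg k)]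
    ext a b : 2
    simp only [conn, Matrix.map_apply, Matrix.smul_apply, Matrix.add_apply, smul_eq_mul]
    rw [map_mul, map_add, expand_T]
    simp only [mul_neg, mul_one]
    rfl
  rw [pullback, h1, smul_smul, HahnSeries.single_mul_single]
  congr 2
  · congr 1; ring
  · ring

/-- The derivation `x d/dx` of `ℂ[[x]]`. -/
def eulerSeries : AlgDer ℂ⟦X⟧ :=
  AlgDer.ofFun (fun f => PowerSeries.X * PowerSeries.derivative ℂ f)
    (fun f g => by rw [map_add, mul_add])
    (fun f g => by rw [Derivation.leibniz, smul_eq_mul, smul_eq_mul]; ring)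
    (fun r => by
      rw [show algebraMap ℂ ℂ⟦X⟧ r = PowerSeries.C r from rfl, PowerSeries.derivative_C, mul_zero])

lemma eulerSeries_apply (f : ℂ⟦X⟧) :
    eulerSeries f = PowerSeries.X * PowerSeries.derivative ℂ f := rfl

/-- The derivation `x d/dx` of `ℂ((x))`. -/
def eulerFormal : AlgDer ℂ⸨X⸩ := HahnSeries.single (1 : ℤ) (1 : ℂ) • formalDer

lemma eulerFormal_apply (f : ℂ⸨X⸩) :
    eulerFormal f = HahnSeries.single (1 : ℤ) (1 : ℂ) * formalDeriv f := rfl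

lemma eulerFormal_seriesAlg (f : ℂ⟦X⟧) : eulerFormal (seriesAlg f) = seriesAlg (eulerSeries f) := by
  rw [eulerFormal_apply, eulerSeries_apply, formalDeriv_seriesAlg, map_mul, coe_seriesAlg,
    HahnSeries.ofPowerSeries_X]

lemma Gauge.map_seriesAlg {N : ℕ} {g : GL (Fin N) ℂ⟦X⟧} {A A' : Matrix (Fin N) (Fin N) ℂ⟦X⟧}
    (h : Gauge eulerSeries g A A') : Gauge eulerFormal
      (Matrix.GeneralLinearGroup.map (seriesAlg : ℂ⟦X⟧ →+* ℂ⸨X⸩) g)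
      (A.map seriesAlg) (A'.map seriesAlg) := by
  have h1 := Gauge.map (D' := eulerFormal) (φ := (seriesAlg : ℂ⟦X⟧ →+* ℂ⸨X⸩)) 1
    (fun x => by rw [one_mul]; exact eulerFormal_seriesAlg x) h
  rwa [one_smul, one_smul] at h1

/-- The derivation `x d/dx` vanishes at `x = 0`, so there the gauge relation becomes conjugation up
to a scalar, and traces kill the scalar. Thus `p₋₁ + w(0)` is conjugate to the nilpotent `M(0)`, and
the slice property applies. -/
lemma Principal.eval_zero_of_gauge (P : Principal c) (hN : NilpotentSlice c)
    {h : GL (Fin c.size) ℂ⟦X⟧} {M w : Mat c ℂ⟦X⟧} (hw : IsCanonical c w)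
    (hM : IsNilpotent (atZero M)) (hG : Gauge eulerSeries h M (const ℂ⟦X⟧ (pMinus c) + w)) :
    w.map (PowerSeries.constantCoeff (R := ℂ)) = 0 := by
  let ev : ℂ⟦X⟧ →ₐ[ℂ] ℂ :=
    { (PowerSeries.constantCoeff (R := ℂ)) with
      commutes' := fun r => PowerSeries.constantCoeff_C r }
  refine hN _ (isCanonical_map ev hw) ?_
  obtain ⟨f, hf⟩ := gauge_iff.1 hG
  have h3 := congrArg (fun X => Matrix.map X ev) hf
  have h4 : (h.val.map eulerSeries).map ev = 0 := by
    ext a b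
    change PowerSeries.constantCoeff (PowerSeries.X * _) = (0 : ℂ)
    rw [map_mul, PowerSeries.constantCoeff_X, zero_mul]
  have h5 : (f • h.val).map ev = ev f • h.val.map ev := by ext a b; simp
  simp only [Matrix.map_mul, Matrix.map_add ev (map_add ev), Matrix.map_sub ev (map_sub ev), h4,
    h5, const_map_algHom, sub_zero] at h3
  set h0 := Matrix.GeneralLinearGroup.map (ev : ℂ⟦X⟧ →+* ℂ) h
  have h6 : h.val.map ev = h0.val := rfl
  rw [h6, const_self] at h3
  have h7 : pMinus c + w.map ev = h0.val * M.map ev * h0⁻¹.val + ev f • 1 := by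
    rw [← mul_one (pMinus c + w.map ev), ← Units.mul_inv h0, ← mul_assoc, h3, add_mul,
      Matrix.smul_mul, Units.mul_inv]
  have h8 : IsNilpotent (h0.val * M.map ev * h0⁻¹.val) := by
    obtain ⟨n, hn⟩ := hM
    refine ⟨n, ?_⟩
    rw [Units.conj_pow]
    have : (M.map ev) ^ n = 0 := hn
    rw [this, mul_zero, zero_mul]
  have h9 : ev f = 0 := by
    have h10 := congrArg Matrix.trace h7
    have h11 := (Matrix.isNilpotent_trace_of_isNilpotent h8).eq_zero
    rw [(P.lie_minus.add (isCanonical_map ev hw).memLie).trace_eq_zero, Matrix.trace_add, h11,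
      Matrix.trace_smul, Matrix.trace_one, Fintype.card_fin, smul_eq_mul, zero_add] at h10
    exact (isUnit_natCast P.pos).mul_left_eq_zero.1 h10.symm
  rw [h9, zero_smul, add_zero] at h7
  change IsNilpotent (pMinus c + w.map ev)
  rw [h7]
  exact h8

/-- The regular form has a canonical form `w` over `ℂ[[x]]`. Uniqueness over `ℂ((x))` identifies it
with `v`, so negative exponents do not occur, and exponent `0` does not occur because `w(0) = 0`. -/
theorem Principal.coeff_eq_zero_of_regular (P : Principal c) (hN : NilpotentSlice c)
    {v : Mat c ℂ[T;T⁻¹]} (hv : IsCanonical c v) (hr : RegularResidueZero c (conn c v))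
    (i j : Fin c.size) {e : ℤ} (he : e ≤ 0) : (v i j).coeff e = 0 := by
  obtain ⟨g, M, hg, hM, hG, hMN⟩ := hr
  obtain ⟨h, w, hh, hw, hG'⟩ := P.canonical_exists eulerSeries hM
  have h1 : Gauge eulerFormal g (const ℂ⸨X⸩ (pMinus c) + v.map (expandAlg 1))
      (M.map seriesAlg) := by
    have h2 := Gauge.smul (D := formalDer) hG (HahnSeries.single (1 : ℤ) (1 : ℂ))
    rw [pullback_conn, polar, smul_smul, smul_smul, HahnSeries.single_mul_single] at h2
    have h3 : HahnSeries.single (1 : ℤ) (1 : ℂ) * (xPow (-((0 : ℕ) + 1 : ℤ))).val = 1 := by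
      change HahnSeries.single (1 : ℤ) (1 : ℂ) * HahnSeries.single _ 1 = 1
      rw [HahnSeries.single_mul_single]
      simp
    have h4 : HahnSeries.single ((1 : ℤ) + -1) ((1 : ℂ) * (1 : ℤ)) = 1 := by simp
    rw [h3, h4, one_smul, one_smul] at h2
    exact h2
  have h2 := hG'.map_seriesAlg
  rw [Matrix.map_add seriesAlg (map_add seriesAlg), const_map_algHom] at h2
  have hvK := isCanonical_map (expandAlg 1) hv
  have hwK := isCanonical_map seriesAlg hw
  have hvw : v.map (expandAlg 1) = w.map seriesAlg :=
    P.canonical_unique ((hh.map seriesAlg).mul hg).2 hvK.degGE hwK.degGE hvK.comm hwK.comm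
      (h1.trans h2)
  have hw0 := P.eval_zero_of_gauge hN hw hMN hG'
  have h3 : expand 1 (v i j) = seriesAlg (w i j) := congrFun (congrFun hvw i) j
  have h4 := expand_coeff 1 one_ne_zero (v i j) e
  rw [one_mul, h3] at h4
  rw [← h4]
  rcases lt_or_eq_of_le he with h5 | rfl
  · exact seriesAlg_coeff_neg _ h5
  · have := seriesAlg_coeff (w i j) 0
    rw [Nat.cast_zero] at this
    rw [this, PowerSeries.coeff_zero_eq_constantCoeff_apply]
    exact congrFun (congrFun hw0 i) j

end

end Oper

/-! ### Uniqueness of the slope -/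

namespace Oper

noncomputable section

section Order

/-- The matrix `X` is divisible by `x ^ j`. -/
def OrdGE {m n : Type} (j : ℤ) (X : Matrix m n ℂ⸨X⸩) : Prop :=
  ∀ a b, ∀ i < j, (X a b).coeff i = 0

variable {m n p : Type} {i j k : ℤ}

lemma OrdGE.add {X Y : Matrix m n ℂ⸨X⸩} (hX : OrdGE j X) (hY : OrdGE j Y) : OrdGE j (X + Y) :=
  fun a b i hi => by rw [Matrix.add_apply, HahnSeries.coeff_add, hX a b i hi, hY a b i hi, add_zero]

lemma OrdGE.sub {X Y : Matrix m n ℂ⸨X⸩} (hX : OrdGE j X) (hY : OrdGE j Y) : OrdGE j (X - Y) :=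
  fun a b i hi => by rw [Matrix.sub_apply, HahnSeries.coeff_sub, hX a b i hi, hY a b i hi, sub_zero]

lemma OrdGE.mono {X : Matrix m n ℂ⸨X⸩} (hX : OrdGE j X) (h : k ≤ j) : OrdGE k X :=
  fun a b i hi => hX a b i (hi.trans_le h)

lemma coeff_mul_eq_zero {f g : ℂ⸨X⸩} (hf : ∀ l < i, f.coeff l = 0) (hg : ∀ l < j, g.coeff l = 0)
    {l : ℤ} (hl : l < i + j) : (f * g).coeff l = 0 := by
  rw [HahnSeries.coeff_mul]
  refine Finset.sum_eq_zero fun q hq => ?_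
  rw [Finset.mem_antidiagonal] at hq
  by_cases h : q.1 < i
  · rw [hf _ h, zero_mul]
  · rw [hg q.2 (by have := hq.2.2; omega), mul_zero]

lemma OrdGE.mul [Fintype n] {X : Matrix m n ℂ⸨X⸩} {Y : Matrix n p ℂ⸨X⸩} (hX : OrdGE i X)
    (hY : OrdGE j Y) (h : k ≤ i + j) : OrdGE k (X * Y) := by
  intro a b l hl
  rw [Matrix.mul_apply, HahnSeries.coeff_sum]
  exact Finset.sum_eq_zero fun q _ => coeff_mul_eq_zero (hX a q) (hY q b) (by omega)

lemma OrdGE.smul {f : ℂ⸨X⸩} {X : Matrix m n ℂ⸨X⸩} (hf : ∀ l < i, f.coeff l = 0)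
    (hX : OrdGE j X) (h : k ≤ i + j) : OrdGE k (f • X) :=
  fun a b _ hl => coeff_mul_eq_zero hf (hX a b) (by omega)

lemma OrdGE.deriv {X : Matrix m n ℂ⸨X⸩} (hX : OrdGE j X) : OrdGE (j - 1) (X.map formalDeriv) :=
  fun a b l hl => by
    rw [Matrix.map_apply, formalDeriv_coeff, hX a b (l + 1) (by omega), mul_zero]

lemma OrdGE.const (X : Matrix m n ℂ) : OrdGE 0 (Oper.const ℂ⸨X⸩ X) := by
  intro a b l hl
  rw [const_apply, algebraMap_laurentSeries, HahnSeries.C_apply,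
    HahnSeries.coeff_single_of_ne hl.ne]

lemma exists_ordGE [Finite m] [Finite n] (X : Matrix m n ℂ⸨X⸩) : ∃ j : ℤ, OrdGE j X := by
  cases nonempty_fintype m
  cases nonempty_fintype n
  refine ⟨-∑ a, ∑ b, |(X a b).order|, fun a b l hl => HahnSeries.coeff_eq_zero_of_lt_order ?_⟩
  have h1 : |(X a b).order| ≤ ∑ b, |(X a b).order| :=
    Finset.single_le_sum (f := fun b => |(X a b).order|) (fun _ _ => abs_nonneg _)
      (Finset.mem_univ b)
  have h2 : ∑ b, |(X a b).order| ≤ ∑ a, ∑ b, |(X a b).order| :=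
    Finset.single_le_sum (f := fun a => ∑ b, |(X a b).order|)
      (fun _ _ => Finset.sum_nonneg fun _ _ => abs_nonneg _) (Finset.mem_univ a)
  have h3 := neg_abs_le (X a b).order
  linarith

lemma coeff_single_eq_zero (s : ℤ) (r : ℂ) : ∀ l < s, (HahnSeries.single s r).coeff l = 0 :=
  fun _ hl => HahnSeries.coeff_single_of_ne hl.ne

end Order

/-- Left multiplication by `g` intertwines the two connections, viewed as operators on matrices `Y`;
the scalar `f` is carried to the side of `A'`. -/
lemma mul_connection_apply {R : Type} [CommRing R] [Algebra ℂ R] {N : ℕ} (D : AlgDer R)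
    {g A A' : Matrix (Fin N) (Fin N) R} {f : R} (hG : A' * g = g * A - g.map D + f • g)
    (x r : R) (Y : Matrix (Fin N) (Fin N) R) :
    g * (x • Y.map D + (x • A) * Y + r • Y)
      = x • (g * Y).map D + (x • A') * (g * Y) - (x * f - r) • (g * Y) := by
  have h2 : A' * (g * Y) = g * (A * Y) - g.map D * Y + f • (g * Y) := by
    rw [← mul_assoc, hG, add_mul, sub_mul, Matrix.smul_mul, mul_assoc]
  rw [map_derivation_mul, Matrix.smul_mul x A', h2]
  simp only [mul_add, Matrix.mul_smul, Matrix.smul_mul, smul_add, smul_sub, sub_smul, smul_smul]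
  abel

lemma connection_apply_sub {R : Type} [CommRing R] {N : ℕ} (x r : R)
    (Y' Y A B C : Matrix (Fin N) (Fin N) R) :
    x • Y' + (x • A) * Y + r • Y - (B + r • 1) * C
      = x • Y' + (x • A - B) * Y + (B + r • 1) * (Y - C) := by
  simp only [add_mul, mul_sub, sub_mul, Matrix.smul_mul, one_mul]
  abel

/-- If `∂ + A` is gauge equivalent to `∂ + A' - f` and `x ^ s A' `, `x ^ s f - r` vanish at `0`, then
`x ^ s A + r` is nilpotent at `0`. -/
theorem isNilpotent_of_gauge {N : ℕ} {s : ℤ} (hs : 2 ≤ s) {g : GL (Fin N) ℂ⸨X⸩}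
    {A A' : Matrix (Fin N) (Fin N) ℂ⸨X⸩} {f : ℂ⸨X⸩}
    (hG : A' * g.val = g.val * A - g.val.map formalDeriv + f • g.val)
    {B : Matrix (Fin N) (Fin N) ℂ} {r : ℂ}
    (hA : OrdGE 1 (HahnSeries.single s (1 : ℂ) • A - const ℂ⸨X⸩ B))
    (hA' : OrdGE 1 (HahnSeries.single s (1 : ℂ) • A'))
    (hf : ∀ l < 1, (HahnSeries.single s (1 : ℂ) * f - HahnSeries.C r).coeff l = 0) :
    IsNilpotent (B + r • (1 : Matrix (Fin N) (Fin N) ℂ)) := by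
  set x : ℂ⸨X⸩ := HahnSeries.single s (1 : ℂ) with hx
  -- `T` is `x ^ s (∂ + A) + r` acting on matrices, and `T'` is its transform by `g`. The operator
  -- `T'` is divisible by `x`, while `T` reduces to multiplication by `B + r` at `x = 0`; iterating
  -- compares the two.
  let T : Matrix (Fin N) (Fin N) ℂ⸨X⸩ → Matrix (Fin N) (Fin N) ℂ⸨X⸩ := fun Y =>
    x • Y.map formalDeriv + (x • A) * Y + (HahnSeries.C r : ℂ⸨X⸩) • Y
  let T' : Matrix (Fin N) (Fin N) ℂ⸨X⸩ → Matrix (Fin N) (Fin N) ℂ⸨X⸩ := fun Y =>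
    x • Y.map formalDeriv + (x • A') * Y - (x * f - HahnSeries.C r) • Y
  have hTT' : ∀ Y, g.val * T Y = T' (g.val * Y) := by
    exact fun Y => mul_connection_apply formalDer hG x _ Y
  -- The bound `2 ≤ s` makes `x ^ s ∂` raise the order by at least one.
  have hT' : ∀ j Y, OrdGE j Y → OrdGE (j + 1) (T' Y) := by
    intro j Y hY
    refine ((OrdGE.smul (coeff_single_eq_zero s 1) hY.deriv (by omega)).add
      (hA'.mul hY (by omega))).sub (OrdGE.smul hf hY (by omega))
  have hT'k : ∀ (k : ℕ) j Y, OrdGE j Y → OrdGE (j + k) (T'^[k] Y) := by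
    intro k
    induction k with
    | zero => intro j Y hY; simpa using hY
    | succ k ih =>
      intro j Y hY
      rw [Function.iterate_succ_apply]
      exact (ih _ _ (hT' j Y hY)).mono (by push_cast; omega)
  have hTk : ∀ k : ℕ, g.val * T^[k] 1 = T'^[k] g.val := by
    intro k
    induction k with
    | zero => simp
    | succ k ih => rw [Function.iterate_succ_apply', Function.iterate_succ_apply', hTT', ih]
  -- Modulo `x`, the `k`-th iterate of `T` on the identity is `(B + r) ^ k`.
  have hT0 : ∀ k : ℕ, OrdGE 1 (T^[k] 1 - const ℂ⸨X⸩ ((B + r • 1) ^ k)) := by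
    intro k
    induction k with
    | zero =>
      intro a b l _
      simp [const_one]
    | succ k ih =>
      rw [Function.iterate_succ_apply']
      set Y := T^[k] 1
      set C := (B + r • (1 : Matrix (Fin N) (Fin N) ℂ)) ^ k with hC
      have hY : OrdGE 0 Y := by
        have := (ih.mono (by norm_num : (0 : ℤ) ≤ 1)).add (OrdGE.const C)
        rwa [sub_add_cancel] at this
      have h1 : T Y - const ℂ⸨X⸩ ((B + r • 1) ^ (k + 1))
          = x • Y.map formalDeriv + (x • A - const ℂ⸨X⸩ B) * Y
            + const ℂ⸨X⸩ (B + r • 1) * (Y - const ℂ⸨X⸩ C) := by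
        rw [pow_succ', ← hC, const_mul, const_add, const_smul, const_one, algebraMap_laurentSeries]
        exact connection_apply_sub _ _ _ _ _ _ _
      rw [h1]
      exact ((OrdGE.smul (coeff_single_eq_zero s 1) hY.deriv (by omega)).add
        (hA.mul hY (by omega))).add ((OrdGE.const _).mul ih (by omega))
  obtain ⟨i, hi⟩ := exists_ordGE g.val
  obtain ⟨j, hj⟩ := exists_ordGE g⁻¹.val
  -- Large enough that `k` iterations of `T'` outweigh the poles of `g` and `g⁻¹`; then `(B + r) ^
  -- k` is divisible by `x`, hence zero.
  obtain ⟨k, hk⟩ : ∃ k : ℕ, 1 - i - j ≤ k := ⟨(1 - i - j).toNat, Int.self_le_toNat _⟩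
  refine ⟨k, ?_⟩
  have h1 : OrdGE 1 (T^[k] 1) := by
    have h2 : T^[k] 1 = g⁻¹.val * T'^[k] g.val := by
      rw [← hTk, ← mul_assoc, Units.inv_mul, one_mul]
    rw [h2]
    exact hj.mul (hT'k k i _ hi) (by omega)
  have h2 : OrdGE 1 (const ℂ⸨X⸩ ((B + r • (1 : Matrix (Fin N) (Fin N) ℂ)) ^ k)) := by
    have := h1.sub (hT0 k)
    rwa [sub_sub_cancel] at this
  ext a b
  have h3 := h2 a b 0 (by norm_num)
  rwa [const_apply, algebraMap_laurentSeries, HahnSeries.C_apply, HahnSeries.coeff_single_same] at h3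

variable {c : ClassicalType}

lemma single_smul_polar (s : ℤ) (a : ℕ) (M : Mat c ℂ⟦X⟧) :
    HahnSeries.single s (1 : ℂ) • polar a M
      = HahnSeries.single (s - (a + 1)) (1 : ℂ) • M.map seriesAlg := by
  rw [polar, smul_smul]
  change (HahnSeries.single s (1 : ℂ) * HahnSeries.single _ 1) • _ = _
  rw [HahnSeries.single_mul_single, one_mul]
  rfl

lemma ordGE_map_seriesAlg (M : Mat c ℂ⟦X⟧) : OrdGE 0 (M.map seriesAlg) :=
  fun _ _ _ hl => seriesAlg_coeff_neg _ hl

lemma ordGE_map_seriesAlg_sub (M : Mat c ℂ⟦X⟧) :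
    OrdGE 1 (M.map seriesAlg - const ℂ⸨X⸩ (atZero M)) := by
  intro a b l hl
  rw [Matrix.sub_apply, HahnSeries.coeff_sub, const_apply, algebraMap_laurentSeries,
    HahnSeries.C_apply]
  rcases lt_or_eq_of_le (show l ≤ 0 by omega) with h | rfl
  · rw [Matrix.map_apply, seriesAlg_coeff_neg _ h, HahnSeries.coeff_single_of_ne h.ne, sub_zero]
  · rw [HahnSeries.coeff_single_same, Matrix.map_apply]
    have := seriesAlg_coeff (M a b) 0
    rw [Nat.cast_zero] at this
    rw [this, PowerSeries.coeff_zero_eq_constantCoeff_apply]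
    exact sub_self _

/-- A gauge transformation that lowers the pole order forces a nilpotent leading coefficient.
Equivalence is only up to a scalar `f`, and the preceding theorem is applied at the pole order `a +
1` of the connection when `f` has no larger pole, and at that of `f` otherwise. -/
theorem isNilpotent_of_gauge_polar (hc : 0 < c.size) {g : GL (Fin c.size) ℂ⸨X⸩}
    {M M' : Mat c ℂ⟦X⟧} {a a' : ℕ} (ha : a' < a) (ht : (atZero M).trace = 0)
    (hG : Gauge formalDeriv g (polar a M) (polar a' M')) : IsNilpotent (atZero M) := by
  obtain ⟨f, hf⟩ := (gauge_iff (D := formalDer)).1 hG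
  have key : ∀ s : ℤ, (a : ℤ) + 1 ≤ s → OrdGE 1 (HahnSeries.single s (1 : ℂ) • polar a' M') := by
    intro s hs
    rw [single_smul_polar]
    exact OrdGE.smul (coeff_single_eq_zero _ 1) (ordGE_map_seriesAlg M') (by omega)
  have hcoeff : ∀ (s : ℤ), (∀ l < -s, f.coeff l = 0) → ∀ l < 1,
      (HahnSeries.single s (1 : ℂ) * f - HahnSeries.C (f.coeff (-s))).coeff l = 0 := by
    intro s hs l hl
    rw [HahnSeries.coeff_sub, HahnSeries.coeff_single_mul, one_mul, HahnSeries.C_apply]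
    rcases lt_or_eq_of_le (show l ≤ 0 by omega) with h | rfl
    · rw [hs _ (by omega), HahnSeries.coeff_single_of_ne h.ne, sub_zero]
    · rw [HahnSeries.coeff_single_same, zero_sub, sub_self]
  by_cases h : ∀ l < -((a : ℤ) + 1), f.coeff l = 0
  -- Here `M(0) + r` is nilpotent; since `M(0)` has trace zero, so is `r`.
  · have h1 := isNilpotent_of_gauge (s := a + 1) (by omega) hf (B := atZero M)
      (r := f.coeff (-((a : ℤ) + 1))) (by
        rw [single_smul_polar, sub_self]
        have : (HahnSeries.single (0 : ℤ) (1 : ℂ)) = 1 := rfl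
        rw [this, one_smul]
        exact ordGE_map_seriesAlg_sub M) (key _ le_rfl) (hcoeff _ h)
    have h2 := (Matrix.isNilpotent_trace_of_isNilpotent h1).eq_zero
    rw [Matrix.trace_add, ht, zero_add, Matrix.trace_smul, Matrix.trace_one, Fintype.card_fin,
      smul_eq_mul] at h2
    rw [(isUnit_natCast hc).mul_left_eq_zero.1 h2, zero_smul, add_zero] at h1
    exact h1
  -- If `f` had the deeper pole, its nonzero leading coefficient times the identity would be
  -- nilpotent.
  · exfalso
    push Not at h
    obtain ⟨l, hl, hl0⟩ := h
    have hf0 : f ≠ 0 := by rintro rfl; exact hl0 rfl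
    have hord : f.order ≤ l := HahnSeries.order_le_of_coeff_ne_zero hl0
    have h1 := isNilpotent_of_gauge (s := -f.order) (by omega) hf (B := 0)
      (r := f.coeff (-(-f.order))) (by
        rw [single_smul_polar, const_zero, sub_zero]
        exact OrdGE.smul (coeff_single_eq_zero _ 1) (ordGE_map_seriesAlg M) (by omega))
      (key _ (by omega)) (hcoeff _ fun l hl => HahnSeries.coeff_eq_zero_of_lt_order (by omega))
    have h2 := (Matrix.isNilpotent_trace_of_isNilpotent h1).eq_zero
    rw [zero_add, Matrix.trace_smul, Matrix.trace_one, Fintype.card_fin, smul_eq_mul,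
      neg_neg] at h2
    exact HahnSeries.coeff_order_eq_zero.not.2 hf0 ((isUnit_natCast hc).mul_left_eq_zero.1 h2)

lemma seriesAlg_smul (r : ℂ) (f : ℂ⟦X⟧) : seriesAlg (r • f) = HahnSeries.C r * seriesAlg f := by
  rw [PowerSeries.smul_eq_C_mul, map_mul]
  congr 1
  exact HahnSeries.ofPowerSeries_C r

/-- Pulling back once more along `x ↦ x ^ k` multiplies `a`, `b` and the leading coefficient by `k`.
This brings slopes with different denominators over the same covering. -/
lemma Gauge.ramify {A : Mat c ℂ[T;T⁻¹]} {g : GL (Fin c.size) ℂ⸨X⸩} {a b : ℕ} (hb : 0 < b)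
    {M : Mat c ℂ⟦X⟧} (h : Gauge formalDeriv g (Oper.pullback (-(b : ℤ)) A : Mat c ℂ⸨X⸩) (polar a M))
    {k : ℕ} (hk : 0 < k) : ∃ (g' : GL (Fin c.size) ℂ⸨X⸩) (M' : Mat c ℂ⟦X⟧),
      Gauge formalDeriv g' (Oper.pullback (-((k * b : ℕ) : ℤ)) A : Mat c ℂ⸨X⸩) (polar (k * a) M') ∧
      atZero M' = (k : ℂ) • atZero M := by
  set φ := Oper.ramify k hk with hφ
  have h1 := Gauge.map (D := formalDer) (D' := formalDer) (φ := (φ : ℂ⸨X⸩ →+* ℂ⸨X⸩))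
    (HahnSeries.single ((k : ℤ) - 1) (k : ℂ)) (fun f => formalDeriv_ramify k hk f) h
  have hM : ∀ i j, ∃ p, seriesAlg p = φ (seriesAlg (M i j)) := by
    intro i j
    refine exists_seriesAlg fun n hn => ?_
    by_cases hkn : (k : ℤ) ∣ n
    · obtain ⟨m, rfl⟩ := hkn
      rw [hφ, ramify_coeff]
      refine seriesAlg_coeff_neg _ ?_
      by_contra hm
      have : 0 ≤ (k : ℤ) * m := mul_nonneg (by positivity) (not_lt.1 hm)
      omega
    · rw [hφ, ramify_coeff_of_not_dvd k hk _ _ hkn]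
  choose F hF using hM
  have hsingle : ∀ (e : ℤ), φ (HahnSeries.single e (1 : ℂ)) = HahnSeries.single (k * e) 1 := by
    intro e
    have := ramify_expand k hk 1 one_ne_zero (LaurentPolynomial.T e)
    rw [expand_T, expand_T] at this
    simpa using this
  refine ⟨Matrix.GeneralLinearGroup.map (φ : ℂ⸨X⸩ →+* ℂ⸨X⸩) g,
    ((k : ℂ) • Matrix.of F : Matrix (Fin c.size) (Fin c.size) ℂ⟦X⟧), ?_, ?_⟩
  · have h2 : HahnSeries.single ((k : ℤ) - 1) (k : ℂ)
        • (Oper.pullback (-(b : ℤ)) A : Mat c ℂ⸨X⸩).map (φ : ℂ⸨X⸩ →+* ℂ⸨X⸩)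
        = Oper.pullback (-((k * b : ℕ) : ℤ)) A := by
      refine Matrix.ext fun i j => ?_
      simp only [Oper.pullback, Matrix.smul_apply, Matrix.map_apply, smul_eq_mul, map_mul]
      have h3 : HahnSeries.single (-(b : ℤ) - 1) ((-(b : ℤ) : ℤ) : ℂ)
          = HahnSeries.C ((-(b : ℤ) : ℤ) : ℂ) * HahnSeries.single (-(b : ℤ) - 1) 1 := by
        rw [HahnSeries.C_apply, HahnSeries.single_mul_single, zero_add, mul_one]
      have h4 : φ (HahnSeries.C ((-(b : ℤ) : ℤ) : ℂ)) = HahnSeries.C ((-(b : ℤ) : ℤ) : ℂ) := by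
        rw [← algebraMap_laurentSeries, AlgHom.commutes]
      change HahnSeries.single ((k : ℤ) - 1) (k : ℂ) * (φ _ * φ _) = _
      rw [h3, map_mul, h4, hsingle, ramify_expand k hk _ (by omega), ← mul_assoc, ← mul_assoc,
        HahnSeries.C_apply, HahnSeries.single_mul_single, HahnSeries.single_mul_single]
      push_cast
      rw [show (k : ℤ) - 1 + 0 + k * (-(b : ℤ) - 1) = -(k * b) - 1 by ring,
        show (k : ℤ) * -(b : ℤ) = -(k * b) by ring,
        show (k : ℂ) * -(b : ℂ) * 1 = -(k * b) by ring]
    have h3 : HahnSeries.single ((k : ℤ) - 1) (k : ℂ)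
        • (polar a M).map (φ : ℂ⸨X⸩ →+* ℂ⸨X⸩) = polar (k * a) ((k : ℂ) • Matrix.of F : Mat c ℂ⟦X⟧) := by
      refine Matrix.ext fun i j => ?_
      simp only [polar, Matrix.smul_apply, Matrix.map_apply, smul_eq_mul, map_mul, Matrix.of_apply]
      change HahnSeries.single ((k : ℤ) - 1) (k : ℂ) *
        (φ (HahnSeries.single _ 1) * φ (seriesAlg (M i j)))
        = HahnSeries.single _ 1 * seriesAlg ((k : ℂ) • F i j)
      rw [hsingle, ← hF, seriesAlg_smul, ← mul_assoc,
        ← mul_assoc, HahnSeries.C_apply, HahnSeries.single_mul_single,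
        HahnSeries.single_mul_single, mul_one, one_mul, add_zero]
      push_cast
      rw [show (k : ℤ) - 1 + k * -((a : ℤ) + 1) = -(k * a + 1) by ring]
    rw [h2, h3] at h1
    exact h1
  · ext i j
    simp only [atZero, Matrix.map_apply, Matrix.smul_apply, Matrix.of_apply]
    have h5 : PowerSeries.constantCoeff (F i j) = PowerSeries.constantCoeff (M i j) := by
      rw [← PowerSeries.coeff_zero_eq_constantCoeff_apply,
        ← PowerSeries.coeff_zero_eq_constantCoeff_apply, ← seriesAlg_coeff, ← seriesAlg_coeff, hF]
      have := ramify_coeff k hk (seriesAlg (M i j)) 0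
      rwa [mul_zero] at this
    rw [← h5, ← PowerSeries.coeff_zero_eq_constantCoeff_apply,
      ← PowerSeries.coeff_zero_eq_constantCoeff_apply, PowerSeries.coeff_smul]

/-- Uniqueness of the slope at infinity. -/
theorem slope_le (hc : 0 < c.size) {A : Mat c ℂ[T;T⁻¹]} {g g' : GL (Fin c.size) ℂ⸨X⸩}
    {a b a' b' : ℕ} (hb : 0 < b) (hb' : 0 < b') {M M' : Mat c ℂ⟦X⟧}
    (h : Gauge formalDeriv g (pullback (-(b : ℤ)) A : Mat c ℂ⸨X⸩) (polar a M))
    (h' : Gauge formalDeriv g' (pullback (-(b' : ℤ)) A : Mat c ℂ⸨X⸩) (polar a' M'))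
    (ht : (atZero M).trace = 0) (hN : ¬ IsNilpotent (atZero M)) : a * b' ≤ a' * b := by
  by_contra hlt
  push Not at hlt
  -- On the common covering of degree `b b'` the poles have orders `b' a + 1` and `b a' + 1`, and
  -- the first would be larger.
  obtain ⟨g1, M1, hG1, hM1⟩ := h.ramify hb hb'
  obtain ⟨g2, M2, hG2, -⟩ := h'.ramify hb' hb
  rw [mul_comm b b'] at hG2
  have h3 : Gauge formalDeriv (g2 * g1⁻¹) (polar (b' * a) M1) (polar (b * a') M2) :=
    Gauge.trans (D := formalDer) (Gauge.symm (D := formalDer) hG1) hG2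
  have h4 := isNilpotent_of_gauge_polar hc (by nlinarith) (by
    rw [hM1, Matrix.trace_smul, ht, smul_zero]) h3
  apply hN
  rw [hM1] at h4
  obtain ⟨n, hn⟩ := h4
  refine ⟨n, ?_⟩
  rw [smul_pow] at hn
  exact (smul_eq_zero.1 hn).resolve_left (pow_ne_zero _ (Nat.cast_ne_zero.2 hb'.ne'))

end

end Oper

/-! ### The slope of a canonical form and the description of the oper spaces -/

namespace Oper

noncomputable section

/-- A linear functional on a `ℂ`-algebra, from its values. -/
def functional {R : Type} [CommRing R] [Algebra ℂ R] (f : R → ℂ)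
    (hadd : ∀ x y, f (x + y) = f x + f y)
    (hmul : ∀ (r : ℂ) x, f (algebraMap ℂ R r * x) = r * f x) : R →ₗ[ℂ] ℂ where
  toFun := f
  map_add' := hadd
  map_smul' r x := by rw [Algebra.smul_def, hmul]; rfl

variable {c : ClassicalType}

lemma isCanonical_map_coeff_series {W : Mat c ℂ⸨X⸩} (h : IsCanonical c W) (n : ℤ) :
    IsCanonical c (W.map fun f => f.coeff n : Mat c ℂ) :=
  isCanonical_map_linear (functional (fun f : ℂ⸨X⸩ => f.coeff n) (fun _ _ => rfl) fun r f => by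
    rw [algebraMap_laurentSeries, HahnSeries.C_apply, HahnSeries.coeff_single_zero_mul]) h

lemma laurent_coeff_C_mul (r : ℂ) (f : ℂ[T;T⁻¹]) (n : ℤ) :
    (LaurentPolynomial.C r * f).coeff n = r * f.coeff n := by
  rw [← LaurentPolynomial.smul_eq_C_mul]
  rfl

lemma isCanonical_map_coeff_laurent {v : Mat c ℂ[T;T⁻¹]} (h : IsCanonical c v) (n : ℤ) :
    IsCanonical c (v.map fun f => f.coeff n : Mat c ℂ) :=
  isCanonical_map_linear (functional (fun f : ℂ[T;T⁻¹] => f.coeff n) (fun _ _ => rfl)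
    fun r f => laurent_coeff_C_mul r f n) h

/-- The diagonal gauge transformation `x ^ (-a ρ̌)`, up to scalars. -/
def slopeGauge (c : ClassicalType) (a : ℕ) : GL (Fin c.size) ℂ⸨X⸩ :=
  diagUnit fun i => xPow (-(a : ℤ)) ^ height c i

lemma slopeGauge_entry (a : ℕ) (i : Fin c.size) :
    ((xPow (-(a : ℤ)) ^ height c i : (ℂ⸨X⸩)ˣ) : ℂ⸨X⸩)
      = HahnSeries.single (-(a : ℤ) * height c i) 1 := by
  rw [← zpow_natCast, xPow_zpow]

lemma slopeGauge_entry_inv (a : ℕ) (i : Fin c.size) :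
    (((xPow (-(a : ℤ)) ^ height c i)⁻¹ : (ℂ⸨X⸩)ˣ) : ℂ⸨X⸩)
      = HahnSeries.single ((a : ℤ) * height c i) 1 := by
  rw [← zpow_natCast, ← zpow_neg, xPow_zpow, neg_mul_neg]

lemma slopeGauge_conj_apply (a : ℕ) (X : Mat c ℂ⸨X⸩) (i j : Fin c.size) :
    ((slopeGauge c a).val * X * (slopeGauge c a)⁻¹.val) i j
      = HahnSeries.single (a * deg (height c) i j) (1 : ℂ) * X i j := by
  rw [slopeGauge, diagUnit_conj_apply, slopeGauge_entry, slopeGauge_entry_inv, mul_right_comm,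
    HahnSeries.single_mul_single, one_mul]
  rw [show -(a : ℤ) * height c i + a * height c j = a * deg (height c) i j by simp only [deg]; ring]

lemma slopeGauge_conj_of_hasDeg (a : ℕ) {X : Mat c ℂ⸨X⸩} {k : ℤ} (h : HasDeg (height c) k X) :
    (slopeGauge c a).val * X * (slopeGauge c a)⁻¹.val
      = HahnSeries.single (a * k) (1 : ℂ) • X := by
  refine Matrix.ext fun i j => ?_
  rw [slopeGauge_conj_apply]
  by_cases hij : deg (height c) i j = k
  · rw [hij]; rfl
  · rw [Matrix.smul_apply, h i j hij, mul_zero, smul_zero]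

/-- The matrix `v(x ^ (-b))` after the gauge transformation by `x ^ (-a ρ̌)`, divided by the pole of
the image of `p₋₁`. -/
def slopeMatrix (a b : ℕ) (v : Mat c ℂ[T;T⁻¹]) : Mat c ℂ⸨X⸩ :=
  HahnSeries.single (a : ℤ) (1 : ℂ) •
    ((slopeGauge c a).val * v.map (expandAlg (-(b : ℤ))) * (slopeGauge c a)⁻¹.val)

/-- A term of `v` at `t ^ e` in degree `k` lands in exponent `a (k + 1) - b e`. Integrality thus
amounts to `b e ≤ a (k + 1)`, and equality is what contributes to the value at `0`. -/
lemma slopeMatrix_coeff (a b : ℕ) (v : Mat c ℂ[T;T⁻¹]) (i j : Fin c.size) (n : ℤ) :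
    (slopeMatrix a b v i j).coeff n
      = (expand (-(b : ℤ)) (v i j)).coeff (n - a * (deg (height c) i j + 1)) := by
  rw [slopeMatrix, Matrix.smul_apply, slopeGauge_conj_apply, smul_eq_mul, ← mul_assoc,
    HahnSeries.single_mul_single, one_mul, HahnSeries.coeff_single_mul, one_mul]
  rw [show (n - (a + a * deg (height c) i j) : ℤ) = n - a * (deg (height c) i j + 1) by ring]
  rfl

lemma mul_slopeMatrix {R : Type} [CommRing R] {N : ℕ} {g : GL (Fin N) R}
    {e V : Matrix (Fin N) (Fin N) R} {y : R} {s : Rˣ} (h : g.val * e * g⁻¹.val = s.val • e)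
    (hV : e * V = V * e) :
    e * (y • (g.val * V * g⁻¹.val)) = (y • (g.val * V * g⁻¹.val)) * e := by
  have h1 : e = s⁻¹.val • (g.val * e * g⁻¹.val) := by rw [h, smul_smul, Units.inv_mul, one_smul]
  have h2 : ∀ X Y : Matrix (Fin N) (Fin N) R,
      (g.val * X * g⁻¹.val) * (g.val * Y * g⁻¹.val) = g.val * (X * Y) * g⁻¹.val := by
    intro X Y
    calc _ = g.val * X * (g⁻¹.val * g.val) * Y * g⁻¹.val := by simp only [mul_assoc]
      _ = _ := by rw [Units.inv_mul, mul_one]; simp only [mul_assoc]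
  rw [h1, Matrix.mul_smul, Matrix.smul_mul, Matrix.mul_smul, Matrix.smul_mul, h2, h2, hV, smul_comm]

lemma conj_smul_add {R : Type} [CommRing R] {N : ℕ} {g g' p V : Matrix (Fin N) (Fin N) R}
    {x s s' : R} (hp : p = x • (g * p * g')) (hs : s' * x = s) :
    g * (s • (p + V)) * g' = s' • (p + x • (g * V * g')) := by
  nth_rewrite 2 [hp]
  rw [← smul_add, smul_smul, hs, Matrix.mul_smul, Matrix.smul_mul, mul_add, add_mul]

lemma sub_smul_add {R : Type} [CommRing R] {N : ℕ} (X E : Matrix (Fin N) (Fin N) R) (x r : R) :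
    X - x • E + (x * r) • 1 = X + x • (r • 1 - E) := by
  rw [smul_sub, smul_smul]
  abel

/-- Conjugation by the torus rescales `p₁` by a unit, so the centraliser of `p₁` is preserved, and
so are degrees. -/
lemma Principal.isCanonical_slopeMatrix (P : Principal c) (a b : ℕ) {v : Mat c ℂ[T;T⁻¹]}
    (hv : IsCanonical c v) : IsCanonical c (slopeMatrix a b v) := by
  have hV := isCanonical_map (expandAlg (-(b : ℤ))) hv
  refine ⟨(hV.memLie.conj (P.torus_height (xPow (-(a : ℤ)))).1).smul _, ?_, ?_⟩
  · intro i j hij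
    have h1 := hV.degGE i j hij
    refine HahnSeries.ext (funext fun n => ?_)
    rw [slopeMatrix_coeff]
    have h2 : expand (-(b : ℤ)) (v i j) = 0 := h1
    rw [h2]
    rfl
  · exact mul_slopeMatrix (s := xPow (a * 1))
      (slopeGauge_conj_of_hasDeg a P.triple.deg_e.baseChange) hV.comm

/-- Conjugation by `x ^ (-a ρ̌)` gives `p₋₁` a pole of order `a + 1`. The derivative of the gauge
transformation and the scalar correction only add a simple pole, with constant residue `E`. -/
lemma Principal.exists_slope_form (P : Principal c) (a b : ℕ) {v : Mat c ℂ[T;T⁻¹]}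
    (hv : IsCanonical c v) : ∃ (E : Mat c ℂ) (A' : Mat c ℂ⸨X⸩), MemLie c A' ∧
      Gauge formalDeriv (slopeGauge c a) (pullback (-(b : ℤ)) (conn c v) : Mat c ℂ⸨X⸩) A' ∧
      A' = HahnSeries.single (-((a : ℤ) + 1)) (-(b : ℂ)) •
          (const ℂ⸨X⸩ (pMinus c) + slopeMatrix a b v)
        + HahnSeries.single (-1 : ℤ) (1 : ℂ) • const ℂ⸨X⸩ E := by
  have hg := P.torus_height (xPow (-(a : ℤ)))
  have hV := isCanonical_map (expandAlg (-(b : ℤ))) hv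
  set g := slopeGauge c a with hgdef
  have hAL : MemLie c (pullback (-(b : ℤ)) (conn c v) : Mat c ℂ⸨X⸩) := by
    rw [pullback_conn]
    exact (P.lie_minus.baseChange.add hV.memLie).smul _
  obtain ⟨f, hf⟩ := hAL.gauge (D := formalDer) (g := g) hg.1
  have hconj : g.val * (pullback (-(b : ℤ)) (conn c v) : Mat c ℂ⸨X⸩) * g⁻¹.val
      = HahnSeries.single (-((a : ℤ) + 1)) (-(b : ℂ)) •
          (const ℂ⸨X⸩ (pMinus c) + slopeMatrix a b v) := by
    have h1 : const ℂ⸨X⸩ (pMinus c)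
        = HahnSeries.single (a : ℤ) (1 : ℂ) • (g.val * const ℂ⸨X⸩ (pMinus c) * g⁻¹.val) := by
      rw [slopeGauge_conj_of_hasDeg a P.triple.deg_f.baseChange, smul_smul,
        HahnSeries.single_mul_single, mul_neg_one, add_neg_cancel, one_mul]
      exact (one_smul _ _).symm
    have h2 : HahnSeries.single (-((a : ℤ) + 1)) (-(b : ℂ)) * HahnSeries.single (a : ℤ) (1 : ℂ)
        = HahnSeries.single (-1 : ℤ) ((-(b : ℤ) : ℤ) : ℂ) := by
      rw [HahnSeries.single_mul_single, mul_one]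
      rw [show -((a : ℤ) + 1) + a = -1 by ring]
      push_cast
      rfl
    rw [pullback_conn]
    exact conj_smul_add h1 h2
  have hder : g.val.map formalDer * g⁻¹.val = HahnSeries.single (-1 : ℤ) (1 : ℂ) •
      const ℂ⸨X⸩ (Matrix.diagonal fun i => -((a : ℂ) * height c i)) := by
    have h3 : g.val.map formalDer
        = Matrix.diagonal fun i => formalDeriv (HahnSeries.single (-(a : ℤ) * height c i) 1) := by
      change (Matrix.diagonal _).map formalDer = _
      rw [Matrix.diagonal_map (map_zero formalDer)]
      congr 1
      funext i
      rw [slopeGauge_entry]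
      rfl
    rw [h3]
    change Matrix.diagonal _ * Matrix.diagonal _ = _
    rw [Matrix.diagonal_mul_diagonal]
    refine Matrix.ext fun i j => ?_
    rw [Matrix.smul_apply, const_apply]
    by_cases hij : i = j
    · subst hij
      rw [Matrix.diagonal_apply_eq, Matrix.diagonal_apply_eq, slopeGauge_entry_inv,
        formalDeriv_single, HahnSeries.single_mul_single, algebraMap_laurentSeries,
        HahnSeries.C_apply, smul_eq_mul, HahnSeries.single_mul_single]
      rw [show (-(a : ℤ) * height c i - 1 + a * height c i) = -1 + 0 by ring]
      push_cast
      rw [show (-(a : ℂ) * height c i * 1 * 1) = 1 * -((a : ℂ) * height c i) by ring]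
    · rw [Matrix.diagonal_apply_ne _ hij, Matrix.diagonal_apply_ne _ hij, map_zero]
      exact (mul_zero _).symm
  -- Taking traces determines the scalar, and it is a constant multiple of `x⁻¹` like the derivative
  -- term.
  have hf' : ∃ r : ℂ, f = HahnSeries.single (-1 : ℤ) (1 : ℂ) * HahnSeries.C r := by
    have h1 := hf.trace_eq_zero
    rw [Matrix.trace_add, Matrix.trace_sub, (hAL.conj (g := g) hg.1).trace_eq_zero, hder,
      Matrix.trace_smul, Matrix.trace_smul, Matrix.trace_one, Fintype.card_fin] at h1
    have h2 : (const ℂ⸨X⸩ (Matrix.diagonal fun i => -((a : ℂ) * height c i))).trace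
        = HahnSeries.C (Matrix.diagonal fun i => -((a : ℂ) * height c i)).trace := by
      rw [← algebraMap_laurentSeries]
      exact (AddMonoidHom.map_trace (algebraMap ℂ ℂ⸨X⸩ : ℂ →+ ℂ⸨X⸩) _).symm
    rw [h2, smul_eq_mul, smul_eq_mul] at h1
    set τ := (Matrix.diagonal fun i : Fin c.size => -((a : ℂ) * height c i)).trace
    have hN : (c.size : ℂ) ≠ 0 := Nat.cast_ne_zero.2 P.pos.ne'
    have h4 : (c.size : ℂ⸨X⸩) * HahnSeries.C ((c.size : ℂ)⁻¹) = 1 := by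
      rw [← map_natCast (HahnSeries.C : ℂ →+* ℂ⸨X⸩), ← map_mul, mul_inv_cancel₀ hN, map_one]
    refine ⟨τ * (c.size : ℂ)⁻¹, ?_⟩
    rw [map_mul]
    linear_combination HahnSeries.C ((c.size : ℂ)⁻¹) * h1 - f * h4
  obtain ⟨r, hr⟩ := hf'
  refine ⟨r • 1 - Matrix.diagonal fun i => -((a : ℂ) * height c i), _, hf, ⟨f, rfl⟩, ?_⟩
  rw [hconj, hder, hr, const_sub, const_smul, const_one, algebraMap_laurentSeries]
  exact sub_smul_add _ _ _ _

/-- A connection in canonical form has a slope at infinity, which can be read off from the degrees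
of its coefficients. -/
theorem Principal.exists_slope (P : Principal c) (hN : NilpotentSlice c) {v : Mat c ℂ[T;T⁻¹]}
    (hv : IsCanonical c v) {a b : ℕ} (ha : 0 < a) (hb : 0 < b)
    (hle : ∀ i j e, (v i j).coeff e ≠ 0 → (b : ℤ) * e ≤ a * (deg (height c) i j + 1))
    (heq : ∃ i j e, (v i j).coeff e ≠ 0 ∧ (b : ℤ) * e = a * (deg (height c) i j + 1)) :
    ∃ (g : GL (Fin c.size) ℂ⸨X⸩) (M : Mat c ℂ⟦X⟧), MemGroup c g ∧ MemLie c M ∧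
      Gauge formalDeriv g (pullback (-(b : ℤ)) (conn c v) : Mat c ℂ⸨X⸩) (polar a M) ∧
      ¬ IsNilpotent (atZero M) := by
  obtain ⟨E, A', hA', hG, hA'eq⟩ := P.exists_slope_form a b hv
  have hb' : (-(b : ℤ)) ≠ 0 := by omega
  set W := slopeMatrix a b v with hWdef
  have hW : IsCanonical c W := P.isCanonical_slopeMatrix a b hv
  -- The hypothesis `hle` says precisely that no negative exponent occurs after the torus
  -- conjugation.
  have hWint : ∀ i j, ∀ n < 0, (W i j).coeff n = 0 := by
    intro i j n hn
    rw [hWdef, slopeMatrix_coeff]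
    by_cases hd : (-(b : ℤ)) ∣ n - a * (deg (height c) i j + 1)
    · obtain ⟨e, he⟩ := hd
      rw [he, expand_coeff _ hb']
      by_contra h0
      have := hle i j e h0
      linarith
    · exact expand_coeff_of_not_dvd _ _ _ hd
  set Mt : Mat c ℂ⸨X⸩ := HahnSeries.single ((a : ℤ) + 1) (1 : ℂ) • A' with hMt
  have hMt' : ∀ i j, Mt i j = HahnSeries.C (-(b : ℂ)) *
      ((const ℂ⸨X⸩ (pMinus c)) i j + W i j) +
      HahnSeries.single (a : ℤ) (1 : ℂ) * HahnSeries.C (E i j) := by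
    intro i j
    rw [hMt, hA'eq, Matrix.smul_apply, Matrix.add_apply, Matrix.smul_apply, Matrix.smul_apply,
      Matrix.add_apply, const_apply E, algebraMap_laurentSeries]
    simp only [smul_eq_mul]
    rw [mul_add (HahnSeries.single ((a : ℤ) + 1) (1 : ℂ)), ← mul_assoc, ← mul_assoc,
      HahnSeries.single_mul_single, HahnSeries.single_mul_single, add_neg_cancel, one_mul, one_mul,
      HahnSeries.C_apply]
    rw [show (a : ℤ) + 1 + -1 = a by ring]
    rfl
  -- The residue `E` enters with `x ^ a` and `0 < a`, so it does not affect the value at `0`.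
  have hcoeff : ∀ i j, ∀ n ≤ 0, (Mt i j).coeff n
      = -(b : ℂ) * (((const ℂ⸨X⸩ (pMinus c)) i j).coeff n + (W i j).coeff n) := by
    intro i j n hn
    rw [hMt', HahnSeries.coeff_add, HahnSeries.C_apply, HahnSeries.coeff_single_zero_mul,
      HahnSeries.coeff_add, HahnSeries.C_apply, HahnSeries.single_mul_single,
      HahnSeries.coeff_single_of_ne (by omega), add_zero]
  have hp : ∀ i j, (const ℂ⸨X⸩ (pMinus c)) i j = HahnSeries.single 0 (pMinus c i j) := by
    intro i j
    rw [const_apply, algebraMap_laurentSeries]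
    rfl
  have hlift : ∀ i j, ∃ p, seriesAlg p = Mt i j := by
    intro i j
    refine exists_seriesAlg fun n hn => ?_
    rw [hcoeff i j n hn.le, hWint i j n hn, hp, HahnSeries.coeff_single_of_ne hn.ne, add_zero,
      mul_zero]
  choose F hF using hlift
  have hMap : (Matrix.of F : Mat c ℂ⟦X⟧).map seriesAlg = Mt := Matrix.ext fun i j => hF i j
  refine ⟨slopeGauge c a, Matrix.of F, (P.torus_height (xPow (-(a : ℤ)))).1, ?_, ?_, ?_⟩
  · refine MemLie.of_map_algHom seriesAlg seriesAlg_injective ?_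
    rw [hMap]
    exact hA'.smul _
  · have h1 : (polar a (Matrix.of F : Mat c ℂ⟦X⟧) : Mat c ℂ⸨X⸩) = A' := by
      change (HahnSeries.single (-((a : ℤ) + 1)) (1 : ℂ) : ℂ⸨X⸩) •
        (Matrix.of F : Mat c ℂ⟦X⟧).map seriesAlg = A'
      rw [hMap, hMt, smul_smul, HahnSeries.single_mul_single, neg_add_cancel, one_mul]
      exact one_smul _ _
    rw [h1]
    exact hG
  · set w : Mat c ℂ := W.map fun f => f.coeff 0 with hw
    have hwc : IsCanonical c w := isCanonical_map_coeff_series hW 0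
    have h0 : atZero (Matrix.of F : Mat c ℂ⟦X⟧) = -(b : ℂ) • (pMinus c + w) := by
      refine Matrix.ext fun i j => ?_
      change PowerSeries.constantCoeff (F i j) = _
      rw [← PowerSeries.coeff_zero_eq_constantCoeff_apply, ← seriesAlg_coeff, hF]
      have := hcoeff i j 0 le_rfl
      rw [hp, HahnSeries.coeff_single_same] at this
      exact this
    rw [h0]
    rintro ⟨n, hn⟩
    rw [smul_pow] at hn
    have h2 : (pMinus c + w) ^ n = 0 := (smul_eq_zero.1 hn).resolve_left
      (pow_ne_zero _ (neg_ne_zero.2 (Nat.cast_ne_zero.2 hb.ne')))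
    have h3 := hN w hwc ⟨n, h2⟩
    -- If the leading term were nilpotent then `w = 0`; but the entry with equality appears in `w`.
    obtain ⟨i, j, e, he, hbe⟩ := heq
    apply he
    have h4 : (W i j).coeff 0 = 0 := congrFun (congrFun h3 i) j
    rw [hWdef, slopeMatrix_coeff, ← hbe, zero_sub, ← neg_mul, expand_coeff _ hb'] at h4
    exact h4

/-- The matrix `t w`, with `w` constant. -/
def tConst (w : Mat c ℂ) : Mat c ℂ[T;T⁻¹] :=
  (LaurentPolynomial.T 1 : ℂ[T;T⁻¹]) • const ℂ[T;T⁻¹] w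

lemma IsCanonical.tConst {w : Mat c ℂ} (h : IsCanonical c w) : IsCanonical c (tConst w) :=
  h.baseChange.smul _

lemma tConst_coeff (w : Mat c ℂ) (i j : Fin c.size) (e : ℤ) :
    (tConst w i j).coeff e = if e = 1 then w i j else 0 := by
  change (LaurentPolynomial.T 1 * LaurentPolynomial.C (w i j)).coeff e = _
  rw [mul_comm, laurent_coeff_C_mul, LaurentPolynomial.T_apply]
  simp [eq_comm]

/-- A term of `v` at `t ^ e` in degree `k` has slope `e / (k + 1)`, and the slope of the connection
is the maximum. The bound `1/d` gives `e d ≤ k + 1 < 2d`, so `e = 1` and `k ≥ d - 1`. -/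
theorem Principal.exists_tConst (P : Principal c) (hN : NilpotentSlice c) {d : ℕ}
    (hd : 0 < d) (hmax : ∀ i j : Fin c.size, deg (height c) i j + 1 < 2 * d) {x : OperGm c}
    (hx : x ∈ OperSpace c d) : ∃ (w : Mat c ℂ) (hw : IsCanonical c w),
      DegGE (height c) (d - 1) w ∧ x = toOper (P.operConn hw.tConst) := by
  obtain ⟨A, rfl, hreg, q, hslope, hq⟩ := hx
  obtain ⟨v, hv, hAv⟩ := P.exists_conn A
  obtain ⟨g, hg, hG⟩ := toOper_eq_iff.1 hAv
  have hcoeff : ∀ i j e, (v i j).coeff e ≠ 0 → 1 ≤ e := by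
    intro i j e he
    by_contra hlt
    exact he (P.coeff_eq_zero_of_regular hN hv (hreg.gauge hg hG) i j (by omega))
  have hdeg : ∀ i j e, (v i j).coeff e ≠ 0 → 1 ≤ deg (height c) i j := by
    intro i j e he
    by_contra hlt
    apply he
    rw [hv.degGE i j (by omega)]
    rfl
  have key : ∀ i j e, (v i j).coeff e ≠ 0 → e = 1 ∧ (d : ℤ) ≤ deg (height c) i j + 1 := by
    intro i j e he
    -- Among the finitely many nonzero coefficients, one of maximal slope is chosen; its exponent is
    -- `a` and its degree plus one is `b`.
    let S := (Finset.univ : Finset (Fin c.size × Fin c.size)).sigma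
      fun p => (v p.1 p.2).coeff.support
    have hmem : ∀ i j e, (v i j).coeff e ≠ 0 → (⟨(i, j), e⟩ : (_ : Fin c.size × Fin c.size) × ℤ) ∈ S :=
      fun i j e he => by simpa [S] using he
    obtain ⟨⟨⟨i0, j0⟩, e0⟩, hS0, hS⟩ := S.exists_max_image
      (fun s => (s.2 : ℚ) / (deg (height c) s.1.1 s.1.2 + 1)) ⟨_, hmem i j e he⟩
    have he0 : (v i0 j0).coeff e0 ≠ 0 := by simpa [S] using hS0
    have h1 := hcoeff _ _ _ he0
    have h2 := hdeg _ _ _ he0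
    obtain ⟨a, ha⟩ := Int.eq_ofNat_of_zero_le (show 0 ≤ e0 by omega)
    obtain ⟨b, hb⟩ := Int.eq_ofNat_of_zero_le (show 0 ≤ deg (height c) i0 j0 + 1 by omega)
    have hle : ∀ i j e, (v i j).coeff e ≠ 0 → (b : ℤ) * e ≤ a * (deg (height c) i j + 1) := by
      intro i j e he
      have h3 := hS _ (hmem i j e he)
      have h4 := hdeg _ _ _ he
      simp only at h3
      rw [div_le_div_iff₀ (by exact_mod_cast (show 0 < deg (height c) i j + 1 by omega))
        (by exact_mod_cast (show 0 < deg (height c) i0 j0 + 1 by omega))] at h3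
      rw [← hb, ← ha, mul_comm]
      exact_mod_cast h3
    obtain ⟨g1, M1, hg1, hM1, hG1, hM1n⟩ := P.exists_slope hN hv (a := a) (b := b) (by omega)
      (by omega) hle ⟨i0, j0, e0, he0, by rw [hb, ha, mul_comm]⟩
    obtain ⟨a', b', hb', hqab, g2, M2, hg2, hM2, hG2, -⟩ := hslope.gauge hg hG
    -- The maximum is a slope with non-nilpotent leading term, hence is bounded by the slope
    -- supplied by the membership hypothesis.
    have h5 : a * b' ≤ a' * b := by
      refine slope_le P.pos (by omega) hb' hG1 hG2 ?_ hM1n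
      have h6 := hM1.trace_eq_zero
      have h7 : (atZero M1).trace = PowerSeries.constantCoeff M1.trace :=
        (AddMonoidHom.map_trace ((PowerSeries.constantCoeff (R := ℂ)) : ℂ⟦X⟧ →+ ℂ) M1).symm
      rw [h7, h6, map_zero]
    have h6 : a' * d ≤ b' := by
      rw [hqab, div_le_div_iff₀ (by exact_mod_cast hb') (by exact_mod_cast hd), one_mul] at hq
      exact_mod_cast hq
    have h7 : a * d ≤ b := by
      have : (a * d) * b' ≤ b * b' := by nlinarith
      exact le_of_mul_le_mul_right this hb'
    have h8 := hle i j e he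
    have hbpos : (0 : ℤ) < b := by omega
    have h7' : (a : ℤ) * d ≤ b := by exact_mod_cast h7
    have h4 := hdeg _ _ _ he
    have h9 : e * d ≤ deg (height c) i j + 1 := by
      have h10 : b * (e * d) ≤ b * (deg (height c) i j + 1) := by
        calc b * (e * d) = (b * e) * d := by ring
          _ ≤ (a * (deg (height c) i j + 1)) * d := by gcongr
          _ = (a * d) * (deg (height c) i j + 1) := by ring
          _ ≤ _ := by gcongr
      exact le_of_mul_le_mul_left h10 hbpos
    have h10 := hmax i j
    have h11 := hcoeff _ _ _ he
    -- The bound `hmax` on all degrees excludes exponents `e ≥ 2`.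
    have h12 : e < 2 := by
      by_contra h
      have : (2 : ℤ) * d ≤ e * d := by gcongr; omega
      omega
    have h13 : e = 1 := by omega
    exact ⟨h13, by rw [h13, one_mul] at h9; exact h9⟩
  have hw := isCanonical_map_coeff_laurent hv 1
  have hvw : v = tConst (v.map fun f => f.coeff 1 : Mat c ℂ) := by
    refine Matrix.ext fun i j => LaurentPolynomial.ext fun e => ?_
    rw [tConst_coeff]
    split_ifs with h
    · rw [h]; rfl
    · by_contra h0
      exact h (key i j e h0).1
  refine ⟨_, hw, ?_, ?_⟩
  · intro i j hij
    by_contra h0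
    have := (key i j 1 h0).2
    omega
  · rw [hAv]
    congr 1
    exact Subtype.ext (congrArg (conn c) hvw)

lemma Principal.regular_tConst (P : Principal c) {w : Mat c ℂ} (hw : IsCanonical c w) :
    RegularResidueZero c (conn c (tConst w)) := by
  refine ⟨1, const ℂ⟦X⟧ (pMinus c) + (PowerSeries.X : ℂ⟦X⟧) • const ℂ⟦X⟧ w, MemBorel.one,
    P.isOperForm (hw.baseChange.memLie.smul _)
      ((hw.baseChange.degGE.smul _).mono (by norm_num)), ?_, ?_⟩
  · have h1 : (polar 0 (const ℂ⟦X⟧ (pMinus c) + (PowerSeries.X : ℂ⟦X⟧) • const ℂ⟦X⟧ w) : Mat c ℂ⸨X⸩)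
        = pullback 1 (conn c (tConst w)) := by
      rw [pullback_conn]
      have h2 : (HahnSeries.single (-1 : ℤ) ((1 : ℤ) : ℂ) : ℂ⸨X⸩)
          = (xPow (-((0 : ℕ) + 1 : ℤ))).val := by
        change _ = HahnSeries.single _ 1
        simp
      rw [h2, polar]
      congr 1
      refine Matrix.ext fun i j => ?_
      change seriesAlg (algebraMap ℂ _ (pMinus c i j) + PowerSeries.X * algebraMap ℂ _ (w i j))
        = algebraMap ℂ _ (pMinus c i j)
          + expandAlg 1 (LaurentPolynomial.T 1 * algebraMap ℂ _ (w i j))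
      rw [map_add, map_mul, map_mul, AlgHom.commutes, AlgHom.commutes, AlgHom.commutes,
        coe_seriesAlg, HahnSeries.ofPowerSeries_X]
      congr 2
      exact (expand_T 1 1).symm
    rw [h1]
    exact Gauge.refl formalDer _
  · have h1 : atZero (const ℂ⟦X⟧ (pMinus c) + (PowerSeries.X : ℂ⟦X⟧) • const ℂ⟦X⟧ w)
        = pMinus c := by
      refine Matrix.ext fun i j => ?_
      change PowerSeries.constantCoeff
        (PowerSeries.C (pMinus c i j) + PowerSeries.X * PowerSeries.C (w i j)) = _
      simp
    rw [h1]
    exact P.triple.deg_f.isNilpotent (by norm_num)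

lemma single_mul_seriesAlg_neg (p : ℂ) {e : ℤ} {z : ℂ} (he : e = -1) (hz : z = -1) :
    (HahnSeries.single e (1 : ℂ) : ℂ⸨X⸩) * seriesAlg (-algebraMap ℂ ℂ⟦X⟧ p)
      = HahnSeries.single (-1) z * algebraMap ℂ ℂ⸨X⸩ p := by
  subst he hz
  rw [← map_neg (algebraMap ℂ ℂ⟦X⟧), AlgHom.commutes, algebraMap_laurentSeries,
    algebraMap_laurentSeries, HahnSeries.C_apply, HahnSeries.C_apply, HahnSeries.single_mul_single, HahnSeries.single_mul_single, one_mul,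
    neg_one_mul]

/-- The slope of `∂_t + t⁻¹ p₋₁ + w` is `1/(k + 1)` with `k` the lowest degree present in `w`, and
it is `0` when `w = 0`. -/
theorem Principal.tConst_mem (P : Principal c) (hN : NilpotentSlice c) {d : ℕ} (hd : 0 < d)
    {w : Mat c ℂ} (hw : IsCanonical c w) (hwd : DegGE (height c) (d - 1) w) :
    toOper (P.operConn hw.tConst) ∈ OperSpace c d := by
  refine ⟨_, rfl, P.regular_tConst hw, ?_⟩
  change ∃ q, IsSlopeAtInfty c (conn c (tConst w)) q ∧ _
  by_cases hw0 : w = 0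
  · refine ⟨0, ⟨0, 1, one_pos, by simp, 1, -const ℂ⟦X⟧ (pMinus c), MemGroup.one, ?_, ?_,
      Or.inl ⟨rfl, rfl⟩⟩, by positivity⟩
    · have := P.lie_minus.baseChange.smul (-1 : ℂ⟦X⟧)
      rwa [neg_one_smul] at this
    · have h1 : (polar 0 (-const ℂ⟦X⟧ (pMinus c)) : Mat c ℂ⸨X⸩)
          = pullback (-((1 : ℕ) : ℤ)) (conn c (tConst w)) := by
        rw [pullback_conn, hw0]
        refine Matrix.ext fun i j => ?_
        change HahnSeries.single _ 1 * seriesAlg (-algebraMap ℂ _ (pMinus c i j))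
          = HahnSeries.single _ _ * (algebraMap ℂ _ (pMinus c i j)
            + expandAlg _ (LaurentPolynomial.T 1 * algebraMap ℂ _ 0))
        rw [map_zero, mul_zero, map_zero, add_zero]
        exact single_mul_seriesAlg_neg _ (by norm_num) (by norm_num)
      rw [h1]
      exact Gauge.refl formalDer _
  · let S := (Finset.univ : Finset (Fin c.size × Fin c.size)).filter fun p => w p.1 p.2 ≠ 0
    have hS : S.Nonempty := by
      by_contra h
      rw [Finset.not_nonempty_iff_eq_empty, Finset.filter_eq_empty_iff] at h
      exact hw0 (Matrix.ext fun i j => not_not.1 (h (Finset.mem_univ (i, j))))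
    obtain ⟨⟨i0, j0⟩, h0, hmin⟩ := S.exists_min_image (fun p => deg (height c) p.1 p.2) hS
    have hw00 : w i0 j0 ≠ 0 := (Finset.mem_filter.1 h0).2
    have h1 : (d : ℤ) - 1 ≤ deg (height c) i0 j0 := by
      by_contra h
      exact hw00 (hwd i0 j0 (by omega))
    obtain ⟨b, hb⟩ := Int.eq_ofNat_of_zero_le (show 0 ≤ deg (height c) i0 j0 + 1 by omega)
    have hbd : d ≤ b := by omega
    obtain ⟨g, M, hg, hM, hG, hMn⟩ := P.exists_slope hN hw.tConst (a := 1) (b := b) one_pos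
      (by omega) (fun i j e he => by
        rw [tConst_coeff] at he
        split_ifs at he with h
        · subst h
          have := hmin (i, j) (Finset.mem_filter.2 ⟨Finset.mem_univ _, he⟩)
          simp only at this
          push_cast
          omega
        · exact absurd rfl he)
      ⟨i0, j0, 1, by rwa [tConst_coeff, if_pos rfl], by push_cast; omega⟩
    refine ⟨(1 : ℕ) / (b : ℚ), ⟨1, b, by omega, rfl, g, M, hg, hM, hG, Or.inr ⟨one_pos, hMn⟩⟩, ?_⟩
    push_cast
    exact one_div_le_one_div_of_le (by exact_mod_cast hd) (by exact_mod_cast hbd)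

theorem Principal.tConst_injective (P : Principal c) {w w' : Mat c ℂ} (hw : IsCanonical c w)
    (hw' : IsCanonical c w')
    (h : toOper (P.operConn hw.tConst) = toOper (P.operConn hw'.tConst)) : w = w' := by
  have h1 := P.conn_injective _ _ h
  refine Matrix.ext fun i j => ?_
  have h2 := tConst_coeff w i j 1
  rw [h1, tConst_coeff, if_pos rfl, if_pos rfl] at h2
  exact h2.symm

end

end Oper

/-! ### The principal triple for `𝔰𝔩_N`, `𝔰𝔭_{2n}` and `𝔰𝔬_{2n+1}` -/

namespace Oper

open ClassicalType

/-- The types in which the standard representation has one-dimensional weight spaces for `ρ̌`. -/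
def Regular : ClassicalType → Prop
  | soEven _ => False
  | _ => True

lemma Regular.height_eq {c : ClassicalType} (hc : Regular c) (a : Fin c.size) :
    height c a = a.val := by
  cases c
  · rfl
  · rfl
  · rfl
  · exact hc.elim

lemma height_add_rev (c : ClassicalType) : ∃ s, ∀ a : Fin c.size,
    height c a + height c a.rev = s := by
  cases c with
  | sl N =>
    refine ⟨N - 1, fun a => ?_⟩
    have ha : a.val < N := a.isLt
    simp only [Oper.height, Fin.val_rev, ClassicalType.size]
    omega
  | sp n =>
    refine ⟨2 * n - 1, fun a => ?_⟩
    have ha : a.val < 2 * n := a.isLt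
    simp only [Oper.height, Fin.val_rev, ClassicalType.size]
    omega
  | soOdd n =>
    refine ⟨2 * n, fun a => ?_⟩
    have ha : a.val < 2 * n + 1 := a.isLt
    simp only [Oper.height, Fin.val_rev, ClassicalType.size]
    omega
  | soEven r =>
    refine ⟨2 * r - 2, fun a => ?_⟩
    have ha : a.val < 2 * r := a.isLt
    simp only [Oper.height, Fin.val_rev, ClassicalType.size]
    split_ifs <;> omega

lemma height_mono (c : ClassicalType) {a b : Fin c.size} (h : a ≤ b) :
    height c a ≤ height c b := by
  have h' : a.val ≤ b.val := h
  cases c <;> simp only [Oper.height]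
  · exact h'
  · exact h'
  · exact h'
  · split_ifs <;> omega

lemma height_soEven {r : ℕ} (a : Fin (soEven r).size) :
    (a.val < r ∧ height (soEven r) a = a.val) ∨
      (r ≤ a.val ∧ height (soEven r) a = a.val - 1) := by
  simp only [Oper.height]
  split_ifs with h
  · exact Or.inl ⟨h, rfl⟩
  · exact Or.inr ⟨not_lt.1 h, rfl⟩

lemma sum_ite_one {r : ℕ} (p : Fin r → Prop) [DecidablePred p]
    (h : ∀ k k', p k → p k' → k = k') (q : Prop) [Decidable q] (hq : q ↔ ∃ k, p k) :
    ∑ k, (if p k then (1 : ℂ) else 0) = if q then 1 else 0 := by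
  split_ifs with h0
  · obtain ⟨k, hk⟩ := hq.1 h0
    rw [Finset.sum_eq_single k (fun k' _ hk' => if_neg fun h1 => hk' (h _ _ h1 hk)) (by simp),
      if_pos hk]
  · exact Finset.sum_eq_zero fun k _ => if_neg fun h1 => h0 (hq.2 ⟨k, h1⟩)

lemma pMinus_apply (c : ClassicalType) (a b : Fin c.size) :
    pMinus c a b = if height c a = height c b + 1 then 1 else 0 := by
  rw [pMinus, Matrix.sum_apply]
  cases c with
  | sl N =>
    have ha : a.val < N := a.isLt
    have hb : b.val < N := b.isLt
    have hr : ∀ k : Fin (sl N).rank, k.val < N - 1 := fun k => k.isLt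
    simp only [negSimple, Matrix.of_apply, Oper.height]
    refine sum_ite_one _ (fun k k' h h' => Fin.ext (by have := hr k; have := hr k'; omega)) _ ⟨fun h => ⟨⟨b.val, ?_⟩, ?_, ?_⟩, ?_⟩
    · change b.val < N - 1; omega
    · exact h
    · rfl
    · rintro ⟨k, hk⟩; have := hr k; omega
  | sp n =>
    have ha : a.val < 2 * n := a.isLt
    have hb : b.val < 2 * n := b.isLt
    have hr : ∀ k : Fin (sp n).rank, k.val < n := fun k => k.isLt
    simp only [negSimple, Matrix.of_apply, Oper.height]
    refine sum_ite_one _ (fun k k' h h' => Fin.ext (by have := hr k; have := hr k'; omega)) _ ⟨fun h => ?_, ?_⟩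
    · by_cases hbn : b.val < n
      · exact ⟨⟨b.val, hbn⟩, Or.inl ⟨h, rfl⟩⟩
      · exact ⟨⟨2 * n - 2 - b.val, show 2 * n - 2 - b.val < n by omega⟩, by simp only; omega⟩
    · rintro ⟨k, hk⟩; have := hr k; omega
  | soOdd n =>
    have ha : a.val < 2 * n + 1 := a.isLt
    have hb : b.val < 2 * n + 1 := b.isLt
    have hr : ∀ k : Fin (soOdd n).rank, k.val < n := fun k => k.isLt
    simp only [negSimple, Matrix.of_apply, Oper.height]
    refine sum_ite_one _ (fun k k' h h' => Fin.ext (by have := hr k; have := hr k'; omega)) _ ⟨fun h => ?_, ?_⟩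
    · by_cases hbn : b.val < n
      · exact ⟨⟨b.val, hbn⟩, Or.inl ⟨h, rfl⟩⟩
      · exact ⟨⟨2 * n - 1 - b.val, show 2 * n - 1 - b.val < n by omega⟩, by simp only; omega⟩
    · rintro ⟨k, hk⟩; have := hr k; omega
  | soEven r =>
    have ha : a.val < 2 * r := a.isLt
    have hb : b.val < 2 * r := b.isLt
    have hr : ∀ k : Fin (soEven r).rank, k.val < r := fun k => k.isLt
    simp only [negSimple, Matrix.of_apply, Oper.height]
    have h1 : ∀ k : ℕ, (if k + 1 < r then
        if (a.val = k + 1 ∧ b.val = k) ∨ (a.val + k + 1 = 2 * r ∧ b.val + k + 2 = 2 * r)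
        then (1 : ℂ) else 0
      else
        if (a.val = r ∧ b.val + 2 = r) ∨ (a.val = r + 1 ∧ b.val + 1 = r) then 1 else 0)
        = if (k + 1 < r ∧ ((a.val = k + 1 ∧ b.val = k) ∨
            (a.val + k + 1 = 2 * r ∧ b.val + k + 2 = 2 * r))) ∨
          (¬ k + 1 < r ∧ ((a.val = r ∧ b.val + 2 = r) ∨ (a.val = r + 1 ∧ b.val + 1 = r)))
          then 1 else 0 := by
      intro k
      by_cases hk : k + 1 < r
      · simp only [hk, if_true, true_and, not_true, false_and, or_false]
      · simp only [hk, if_false, true_and, not_false_iff, false_and, false_or]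
    simp only [h1]
    refine sum_ite_one _ (fun k k' h h' => Fin.ext (by have := hr k; have := hr k'; omega)) _ ⟨fun h => ?_, ?_⟩
    · by_cases h2 : b.val + 1 < r ∧ a.val < r
      · exact ⟨⟨b.val, show b.val < r by omega⟩, Or.inl ⟨h2.1, Or.inl ⟨by split_ifs at h <;> omega, rfl⟩⟩⟩
      · by_cases h3 : r ≤ b.val
        · exact ⟨⟨2 * r - 2 - b.val, show 2 * r - 2 - b.val < r by split_ifs at h <;> omega⟩, by
            split_ifs at h <;> simp only <;> omega⟩
        · exact ⟨⟨r - 1, show r - 1 < r by omega⟩, by split_ifs at h <;> simp only <;> omega⟩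
    · rintro ⟨k, hk⟩
      have := hr k
      split_ifs <;> omega

/-- The entries of `p₁`. -/
noncomputable def plusCoeff : ClassicalType → ℕ → ℝ
  | soEven r, i => if i + 2 = r ∨ i + 1 = r then (r : ℝ) * (r - 1) / 2
      else (i + 1 : ℝ) * (2 * (r : ℝ) - 2 - i)
  | c, i => ((i : ℝ) + 1) * ((c.size : ℝ) - 1 - i)

lemma pPlus_apply (c : ClassicalType) (a b : Fin c.size) :
    pPlus c a b = if height c b = height c a + 1 then (plusCoeff c (height c a) : ℂ) else 0 := by
  have ha := a.isLt
  have hb := b.isLt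
  cases c with
  | sl N =>
    simp only [pPlus, plusCoeff, Oper.height, Matrix.of_apply]
    push_cast
    rfl
  | sp n =>
    simp only [pPlus, plusCoeff, Oper.height, Matrix.of_apply]
    push_cast
    rfl
  | soOdd n =>
    simp only [pPlus, plusCoeff, Oper.height, Matrix.of_apply]
    push_cast
    rw [add_sub_cancel_right]
  | soEven r =>
    have hx := height_soEven a
    have hy := height_soEven b
    have ha : a.val < 2 * r := a.isLt
    have hb : b.val < 2 * r := b.isLt
    generalize Oper.height (soEven r) a = x at hx ⊢
    generalize Oper.height (soEven r) b = y at hy ⊢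
    simp only [pPlus, plusCoeff, Matrix.of_apply]
    by_cases h1 : a.val + 2 < r ∧ b.val = a.val + 1
    · rw [if_pos h1, if_pos (by omega), if_neg (by omega), show x = a.val by omega]
      push_cast
      ring
    rw [if_neg h1]
    by_cases h2 : a.val + 2 = r ∧ (b.val + 1 = r ∨ b.val = r)
    · rw [if_pos h2, if_pos (by omega), if_pos (by omega)]
      push_cast
      ring
    rw [if_neg h2]
    by_cases h3 : (a.val + 1 = r ∨ a.val = r) ∧ b.val = r + 1
    · rw [if_pos h3, if_pos (by omega), if_pos (by omega)]
      push_cast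
      ring
    rw [if_neg h3]
    by_cases h4 : r + 1 ≤ a.val ∧ b.val = a.val + 1
    · rw [if_pos h4, if_pos (by omega), if_neg (by omega), show a.val = x + 1 by omega]
      push_cast
      ring
    rw [if_neg h4, if_neg (by omega)]

lemma plusCoeff_pos (c : ClassicalType) {i : ℕ} {a : Fin c.size} (h : i < height c a) :
    0 < plusCoeff c i := by
  have ha := a.isLt
  have key : ∀ N : ℕ, i + 1 < N → 0 < ((i : ℝ) + 1) * ((N : ℝ) - 1 - i) := by
    intro N hN
    have : (i : ℝ) + 1 < N := by exact_mod_cast hN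
    exact mul_pos (by positivity) (by linarith)
  cases c with
  | sl N => exact key _ (lt_of_le_of_lt h ha)
  | sp n => exact key _ (lt_of_le_of_lt h ha)
  | soOdd n => exact key _ (lt_of_le_of_lt h ha)
  | soEven r =>
    replace ha : a.val < 2 * r := ha
    simp only [Oper.height] at h
    simp only [plusCoeff]
    split_ifs with h1
    · have h2 : (2 : ℝ) ≤ r := by
        exact_mod_cast (show 2 ≤ r by split_ifs at h <;> omega)
      exact div_pos (mul_pos (by linarith) (by linarith)) two_pos
    · have h2 : (i : ℝ) + 3 ≤ 2 * r := by
        exact_mod_cast (show i + 3 ≤ 2 * r by split_ifs at h <;> omega)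
      exact mul_pos (by positivity) (by linarith)

lemma pMinus_hasDeg (c : ClassicalType) : HasDeg (height c) (-1) (pMinus c) := fun a b h => by
  rw [pMinus_apply, if_neg]
  simp only [deg] at h
  omega

lemma pPlus_hasDeg (c : ClassicalType) : HasDeg (height c) 1 (pPlus c) := fun a b h => by
  rw [pPlus_apply, if_neg]
  simp only [deg] at h
  omega

/-- Only the bracket depends on the type: the entries of `p₁` and `p₋₁` depend on heights alone, so
the hermitian form has a uniform description. -/
lemma gradedTriple_of_bracket (c : ClassicalType) {κ : ℂ}
    (h : pPlus c * pMinus c - pMinus c * pPlus c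
      = Matrix.diagonal fun a => κ - 2 * (height c a : ℂ)) :
    GradedTriple (height c) (pPlus c) (pMinus c) where
  deg_e := pPlus_hasDeg c
  deg_f := pMinus_hasDeg c
  adjoint := by
    -- The adjointness condition is a recursion along heights with the entries of `p₁` as ratios;
    -- these are positive, and their partial products solve it.
    refine ⟨fun a => ∏ i ∈ Finset.range (height c a), plusCoeff c i, fun a =>
      Finset.prod_pos fun i hi => plusCoeff_pos c (Finset.mem_range.1 hi), fun a b => ?_⟩
    rw [pPlus_apply, pMinus_apply]
    by_cases hab : height c b = height c a + 1
    · simp only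
      rw [if_pos hab, if_pos hab, hab, Finset.prod_range_succ]
      push_cast
      simp
    · rw [if_neg hab, if_neg hab]
      simp
  bracket := ⟨κ, h⟩

lemma Regular.pMinus_apply {c : ClassicalType} (hc : Regular c) (a b : Fin c.size) :
    pMinus c a b = if a.val = b.val + 1 then 1 else 0 := by
  rw [Oper.pMinus_apply, hc.height_eq, hc.height_eq]

lemma Regular.pPlus_apply {c : ClassicalType} (hc : Regular c) (a b : Fin c.size) :
    pPlus c a b = if b.val = a.val + 1 then ((a.val : ℂ) + 1) * ((c.size : ℂ) - 1 - a.val)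
      else 0 := by
  rw [Oper.pPlus_apply, hc.height_eq, hc.height_eq]
  cases c
  case soEven => exact hc.elim
  all_goals
    simp only [plusCoeff]
    push_cast
    rfl

lemma Regular.plus_mul_minus {c : ClassicalType} (hc : Regular c) :
    pPlus c * pMinus c
      = Matrix.diagonal fun a => ((a.val : ℂ) + 1) * ((c.size : ℂ) - 1 - a.val) := by
  ext a b
  rw [Matrix.mul_apply, Matrix.diagonal_apply]
  simp only [hc.pPlus_apply, hc.pMinus_apply]
  by_cases h : a.val + 1 < c.size
  · rw [Finset.sum_eq_single ⟨a.val + 1, h⟩]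
    · rw [if_pos rfl, mul_ite, mul_one, mul_zero]
      refine if_congr ?_ rfl rfl
      rw [Fin.ext_iff]
      simp only
      omega
    · intro x _ hx
      rw [if_neg, zero_mul]
      intro h1
      exact hx (Fin.ext h1)
    · simp
  · have h1 : (c.size : ℂ) = a.val + 1 := by
      exact_mod_cast (show c.size = a.val + 1 by have := a.isLt; omega)
    rw [Finset.sum_eq_zero, h1]
    · simp
    · intro x _
      rw [if_neg, zero_mul]
      have := x.isLt
      omega

lemma Regular.minus_mul_plus {c : ClassicalType} (hc : Regular c) :
    pMinus c * pPlus c = Matrix.diagonal fun a => (a.val : ℂ) * ((c.size : ℂ) - a.val) := by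
  ext a b
  rw [Matrix.mul_apply, Matrix.diagonal_apply]
  simp only [hc.pPlus_apply, hc.pMinus_apply]
  by_cases h : 0 < a.val
  · rw [Finset.sum_eq_single ⟨a.val - 1, by omega⟩]
    · rw [if_pos (by simp only; omega), one_mul]
      refine if_congr ?_ ?_ rfl
      · rw [Fin.ext_iff]
        simp only
        omega
      · simp only
        rw [Nat.cast_sub (by omega)]
        push_cast
        ring
    · intro x _ hx
      rw [if_neg, zero_mul]
      intro h1
      exact hx (Fin.ext (by simp only; omega))
    · simp
  · have h1 : a.val = 0 := by omega
    rw [Finset.sum_eq_zero, h1]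
    · simp
    · intro x _
      rw [if_neg, zero_mul]
      omega

lemma Regular.bracket {c : ClassicalType} (hc : Regular c) :
    pPlus c * pMinus c - pMinus c * pPlus c
      = Matrix.diagonal fun a => (c.size - 1 : ℂ) - 2 * (height c a : ℂ) := by
  rw [hc.plus_mul_minus, hc.minus_mul_plus, Matrix.diagonal_sub]
  congr 1
  funext a
  rw [hc.height_eq]
  ring

/-- Opposite heights have constant sum, so the two entries paired by `X J + J Xᵀ = 0` have the same
degree. -/
lemma MemLie.degComp {c : ClassicalType} {R : Type} [CommRing R] [Algebra ℂ R] (k : ℤ) {X : Mat c R}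
    (h : MemLie c X) : MemLie c (degComp (height c) k X) := by
  rcases hasForm_or c with ⟨N, rfl⟩ | hc
  · rw [memLie_sl] at h ⊢
    by_cases hk : k = 0
    · rw [← h, hk]
      refine Finset.sum_congr rfl fun a _ => ?_
      rw [Matrix.diag_apply, degComp_apply, if_pos (by simp [deg])]
      rfl
    · exact hasDeg_degComp.trace_eq_zero hk
  · rw [memLie_apply hc] at h ⊢
    intro a b
    obtain ⟨s, hs⟩ := height_add_rev c
    have h1 := hs a
    have h2 := hs b
    rw [degComp_apply, degComp_apply]
    by_cases hk : deg (height c) a b.rev = k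
    · rw [if_pos hk, if_pos (by simp only [deg] at *; omega), h a b]
    · rw [if_neg hk, if_neg (by simp only [deg] at *; omega), zero_mul, mul_zero, add_zero]

/-- The signs of `J` alternate. For entries next to the diagonal the two signs in the equation are
opposite, so symmetry about the antidiagonal suffices. -/
lemma Regular.memLie_of_apply {c : ClassicalType} (hc : HasForm c) (hr : Regular c) {X : Mat c ℂ}
    (hdeg : ∀ a b : Fin c.size, X a b ≠ 0 → a.val = b.val + 1 ∨ b.val = a.val + 1)
    (h : ∀ a b, X a b.rev = X b a.rev) : MemLie c X := by
  rw [memLie_apply hc]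
  intro a b
  by_cases h0 : X a b.rev = 0
  · rw [h0, ← h, h0, zero_mul, mul_zero, add_zero]
  · have h1 : form c b.rev b + form c a a.rev = 0 := by
      have h2 := hdeg _ _ h0
      rw [Fin.val_rev] at h2
      have hb := b.isLt
      have ha := a.isLt
      have h6 := Fin.val_rev a
      have h7 := Fin.val_rev b
      have h5 : b.rev.val + 1 = a.val + 1 + 1 ∨ a.val + 1 = b.rev.val + 1 + 1 := by
        rw [Fin.val_rev]; omega
      cases c with
      | sl N => exact hc.elim
      | soEven r => exact hr.elim
      | sp n =>
        change b.rev.val = 2 * n - _ at h7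
        change a.rev.val = 2 * n - _ at h6
        change b.val < 2 * n at hb
        change a.val < 2 * n at ha
        simp only [form, Matrix.of_apply]
        rw [if_pos (by omega), if_pos (by omega)]
        rcases h5 with h5 | h5 <;> rw [h5, pow_succ (-1 : ℂ) (_ + 1)] <;> ring
      | soOdd n =>
        change b.rev.val = 2 * n + 1 - _ at h7
        change a.rev.val = 2 * n + 1 - _ at h6
        change b.val < 2 * n + 1 at hb
        change a.val < 2 * n + 1 at ha
        simp only [form, Matrix.of_apply]
        rw [if_pos (by omega), if_pos (by omega)]
        rcases h5 with h5 | h5 <;> rw [h5, pow_succ (-1 : ℂ) (_ + 1)] <;> ring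
    rw [← h a b, mul_comm (X a b.rev), ← add_mul]
    change (form c b.rev b + form c a a.rev) * _ = 0
    rw [h1, zero_mul]

lemma Regular.memLie_pMinus {c : ClassicalType} (hr : Regular c) : MemLie c (pMinus c) := by
  rcases hasForm_or c with ⟨N, rfl⟩ | hc
  · exact (pMinus_hasDeg _).trace_eq_zero (by norm_num)
  · refine hr.memLie_of_apply hc (fun a b h => ?_) fun a b => ?_
    · rw [hr.pMinus_apply] at h
      by_contra h1
      exact h (if_neg (by tauto))
    · rw [hr.pMinus_apply, hr.pMinus_apply]
      refine if_congr ?_ rfl rfl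
      rw [Fin.val_rev, Fin.val_rev]
      omega

lemma Regular.memLie_pPlus {c : ClassicalType} (hr : Regular c) : MemLie c (pPlus c) := by
  rcases hasForm_or c with ⟨N, rfl⟩ | hc
  · exact (pPlus_hasDeg _).trace_eq_zero (by norm_num)
  · refine hr.memLie_of_apply hc (fun a b h => ?_) fun a b => ?_
    · rw [hr.pPlus_apply] at h
      by_contra h1
      exact h (if_neg (by tauto))
    · rw [hr.pPlus_apply, hr.pPlus_apply]
      have ha := a.isLt
      have hb := b.isLt
      by_cases h : a.val + b.val + 2 = c.size
      · rw [if_pos (by rw [Fin.val_rev]; omega), if_pos (by rw [Fin.val_rev]; omega)]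
        have h1 : (c.size : ℂ) = a.val + b.val + 2 := by exact_mod_cast h.symm
        rw [h1]
        ring
      · rw [if_neg (by rw [Fin.val_rev]; omega), if_neg (by rw [Fin.val_rev]; omega)]

section Diagonal

variable {c : ClassicalType} {R : Type} [CommRing R] [Algebra ℂ R]

lemma exists_height_pred (c : ClassicalType) (a : Fin c.size) (h : height c a ≠ 0) :
    ∃ b : Fin c.size, height c a = height c b + 1 := by
  have ha := a.isLt
  cases c with
  | sl N => exact ⟨⟨a.val - 1, by omega⟩, by simp only [Oper.height] at *; omega⟩
  | sp n => exact ⟨⟨a.val - 1, by omega⟩, by simp only [Oper.height] at *; omega⟩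
  | soOdd n => exact ⟨⟨a.val - 1, by omega⟩, by simp only [Oper.height] at *; omega⟩
  | soEven r =>
    simp only [Oper.height] at h ⊢
    by_cases h1 : a.val = r
    · exact ⟨⟨r - 2, by omega⟩, by simp only; split_ifs at * <;> omega⟩
    · exact ⟨⟨a.val - 1, by omega⟩, by simp only; split_ifs at * <;> omega⟩

/-- A function on the weights that takes equal values on neighbouring weights is constant. -/
lemma eq_of_height (h0 : ∀ a b : Fin c.size, height c a = 0 → height c b = 0 → a = b) {x : Fin c.size → R}
    (hx : ∀ a b : Fin c.size, height c a = height c b + 1 → x a = x b) (a b : Fin c.size) :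
    x a = x b := by
  have key : ∀ (k : ℕ) (a : Fin c.size), height c a = k → ∃ b, height c b = 0 ∧ x a = x b := by
    intro k
    induction k with
    | zero => exact fun a ha => ⟨a, ha, rfl⟩
    | succ k ih =>
      intro a ha
      obtain ⟨b, hb⟩ := exists_height_pred c a (by omega)
      obtain ⟨d, hd, hbd⟩ := ih b (by omega)
      exact ⟨d, hd, (hx a b hb).trans hbd⟩
  obtain ⟨a', ha', h1⟩ := key _ a rfl
  obtain ⟨b', hb', h2⟩ := key _ b rfl
  rw [h1, h2, h0 a' b' ha' hb']

lemma diagonal_eq_smul_one {ι : Type} [DecidableEq ι] [Inhabited ι] {x : ι → R}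
    (h : ∀ a b, x a = x b) : Matrix.diagonal x = x default • (1 : Matrix ι ι R) := by
  rw [Matrix.smul_one_eq_diagonal]
  congr 1
  funext a
  exact h _ _

lemma diagonal_comm_pMinus {x : Fin c.size → R}
    (h : Matrix.diagonal x * const R (pMinus c) = const R (pMinus c) * Matrix.diagonal x)
    (a b : Fin c.size) (hab : height c a = height c b + 1) : x a = x b := by
  have h1 := congrFun (congrFun h a) b
  rwa [Matrix.diagonal_mul, Matrix.mul_diagonal, const_apply, pMinus_apply, if_pos hab, map_one,
    mul_one, one_mul] at h1

lemma diagonal_comm_pPlus {x : Fin c.size → ℂ}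
    (h : pPlus c * Matrix.diagonal x = Matrix.diagonal x * pPlus c)
    (a b : Fin c.size) (hab : height c a = height c b + 1) : x a = x b := by
  have h1 := congrFun (congrFun h b) a
  rw [Matrix.diagonal_mul, Matrix.mul_diagonal, pPlus_apply, if_pos hab, mul_comm] at h1
  have h2 : plusCoeff c (height c b) ≠ 0 := (plusCoeff_pos c (a := a) (by omega)).ne'
  exact mul_right_cancel₀ (Complex.ofReal_ne_zero.2 h2) h1

/-- Commuting with `p₁` makes the diagonal constant along neighbouring heights, hence scalar, and a
scalar of trace zero vanishes. -/
lemma diagonal_eq_zero_of_comm (hc : 0 < c.size)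
    (h0 : ∀ a b : Fin c.size, height c a = 0 → height c b = 0 → a = b) {x : Fin c.size → ℂ}
    (hx : MemLie c (Matrix.diagonal x))
    (h : pPlus c * Matrix.diagonal x = Matrix.diagonal x * pPlus c) : Matrix.diagonal x = 0 := by
  have : Inhabited (Fin c.size) := ⟨⟨0, hc⟩⟩
  have h1 := diagonal_eq_smul_one (eq_of_height h0 (diagonal_comm_pPlus h))
  have h2 := hx.trace_eq_zero
  rw [h1, Matrix.trace_smul, Matrix.trace_one, Fintype.card_fin, smul_eq_mul] at h2
  rw [h1, (isUnit_natCast hc).mul_left_eq_zero.1 h2, zero_smul]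

lemma memBorel_diagUnit {t : Fin c.size → Rˣ} {μ : Rˣ} (h : HasForm c → ∀ a, t a * t a.rev = μ) :
    MemBorel c (diagUnit t) := by
  refine memBorel_of_similitude (Matrix.blockTriangular_diagonal _) (μ := μ) fun hc => ?_
  change Matrix.diagonal _ * const R (form c) * (Matrix.diagonal _).transpose = _
  rw [Matrix.diagonal_transpose]
  ext a b
  rw [Matrix.mul_diagonal, Matrix.diagonal_mul, Matrix.smul_apply, const_apply, smul_eq_mul]
  by_cases hab : b = a.rev
  · subst hab
    rw [← h hc a, Units.val_mul]
    ring
  · rw [form_apply_of_ne, map_zero, mul_zero, zero_mul, mul_zero]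
    intro h1
    refine hab (Fin.ext ?_)
    rw [Fin.val_rev]
    omega

lemma memBorel_diagUnit_height (u : Rˣ) : MemBorel c (diagUnit fun a => u ^ height c a) := by
  obtain ⟨s, hs⟩ := height_add_rev c
  refine memBorel_diagUnit (μ := u ^ s) fun _ a => ?_
  rw [← pow_add, hs]

/-- The functions `e k` are the fundamental coweights up to sign and a central shift: `e k`
increases by one along the nonzero entries of `f_k` and is constant along those of the other simple
root vectors. Constancy of `e k a + e k a.rev` makes the resulting torus element a similitude. -/
lemma exists_torus_of_exponent (e : Fin c.rank → Fin c.size → ℕ)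
    (h1 : ∀ k a b, negSimple c (k : Fin c.rank) a b ≠ 0 → ∀ j, e j a = e j b + if j = k then 1 else 0)
    (h2 : HasForm c → ∀ k, ∃ s, ∀ a, e k a + e k a.rev = s) (ψ : Fin c.rank → Rˣ) :
    ∃ t : Fin c.size → Rˣ, MemBorel c (diagUnit t) ∧
      ∀ k : Fin c.rank, ∀ a b, negSimple c k a b ≠ 0 → t a * ψ k = t b := by
  refine ⟨fun a => ∏ k, (ψ k)⁻¹ ^ e k a, ?_, ?_⟩
  · rcases hasForm_or c with ⟨N, rfl⟩ | hc
    · exact memBorel_diagUnit (μ := 1) fun h => h.elim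
    · choose s hs using h2 hc
      refine memBorel_diagUnit (μ := ∏ k, (ψ k)⁻¹ ^ s k) fun _ a => ?_
      rw [← Finset.prod_mul_distrib]
      refine Finset.prod_congr rfl fun k _ => ?_
      rw [← pow_add, hs]
  · intro k a b hab
    have h3 : ∏ j, (ψ j)⁻¹ ^ e j a = (∏ j, (ψ j)⁻¹ ^ e j b) * ∏ j, (ψ j)⁻¹ ^ (if j = k then 1 else 0) := by
      rw [← Finset.prod_mul_distrib]
      refine Finset.prod_congr rfl fun j _ => ?_
      rw [← pow_add, h1 k a b hab]
    have h4 : ∏ j, (ψ j)⁻¹ ^ (if j = k then 1 else 0) = (ψ k)⁻¹ := by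
      rw [Finset.prod_eq_single k (fun j _ hj => by rw [if_neg hj, pow_zero]) (by simp),
        if_pos rfl, pow_one]
    simp only
    rw [h3, h4, inv_mul_cancel_right]

end Diagonal

/-- Heights are distinct, so degree `0` means diagonal and every remaining condition reduces to
diagonal matrices. -/
lemma Regular.principal {c : ClassicalType} (hr : Regular c) (hc : 0 < c.size) 
    (htorus : ∀ {R : Type} [CommRing R] [Algebra ℂ R] (ψ : Fin c.rank → Rˣ),
      ∃ t : Fin c.size → Rˣ, MemBorel c (diagUnit t) ∧
        ∀ k : Fin c.rank, ∀ a b, negSimple c k a b ≠ 0 → t a * ψ k = t b) : Principal c := by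
  have hinj : ∀ a b : Fin c.size, height c a = height c b → a = b := fun a b h => by
    rw [hr.height_eq, hr.height_eq] at h
    exact Fin.ext h
  have hdiag : ∀ {R : Type} [CommRing R] {X : Mat c R}, HasDeg (height c) 0 X →
      X = Matrix.diagonal fun a => X a a := by
    intro R _ X hX
    ext a b
    rw [Matrix.diagonal_apply]
    split_ifs with h
    · rw [h]
    · refine hX a b fun h1 => h (hinj a b ?_)
      simp only [deg] at h1
      omega
  refine ⟨hc, fun a b => height_mono c, gradedTriple_of_bracket c hr.bracket, hr.memLie_pPlus,
    hr.memLie_pMinus, MemLie.degComp, ?_, ?_, ?_, htorus, memBorel_diagUnit_height⟩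
  · intro R _ _ X _ hX a b hab
    have hab' : b.val < a.val := hab
    refine hX a b ?_
    simp only [deg, hr.height_eq]
    omega
  · intro x hx hx0 hcomm
    rw [hdiag hx0] at hx hcomm ⊢
    exact diagonal_eq_zero_of_comm hc (fun a b ha hb => hinj a b (ha.trans hb.symm)) hx hcomm
  · intro R _ _ g _ hcomm
    rw [hdiag (hasDeg_degComp (X := g))] at hcomm ⊢
    have : Inhabited (Fin c.size) := ⟨⟨0, hc⟩⟩
    exact ⟨_, diagonal_eq_smul_one (eq_of_height (fun a b ha hb => hinj a b (ha.trans hb.symm))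
      (diagonal_comm_pMinus hcomm))⟩

lemma principal_sl {N : ℕ} (hN : 0 < N) : Principal (sl N) := by
  refine Regular.principal trivial hN fun ψ => exists_torus_of_exponent
    (fun k a => if k.val < a.val then 1 else 0) ?_ (fun h : HasForm (sl N) => False.elim h) ψ
  intro k a b h j
  simp only [negSimple, Matrix.of_apply] at h
  have h1 : a.val = k.val + 1 ∧ b.val = k.val := by
    by_contra h2
    exact h (if_neg h2)
  simp only [Fin.ext_iff]
  split_ifs <;> omega

lemma principal_sp {n : ℕ} (hn : 0 < n) : Principal (sp n) := by
  -- The exponent jumps at each nonzero entry of `f_k`. There are two of them, which coincide for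
  -- the long root `k = n - 1`.
  refine Regular.principal trivial (show 0 < 2 * n by omega) fun ψ =>
    exists_torus_of_exponent (fun k a => if k.val + 1 = n then (if k.val < a.val then 1 else 0)
      else (if k.val < a.val then 1 else 0) + (if 2 * n - 2 - k.val < a.val then 1 else 0))
      ?_ (fun _ k => ?_) ψ
  · intro k a b h j
    simp only [negSimple, Matrix.of_apply] at h
    have h1 : (a.val = k.val + 1 ∧ b.val = k.val) ∨
        (a.val + k.val + 1 = 2 * n ∧ b.val + k.val + 2 = 2 * n) := by
      by_contra h2
      exact h (if_neg h2)
    have hk : k.val < n := k.isLt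
    have hj : j.val < n := j.isLt
    simp only [Fin.ext_iff]
    split_ifs <;> omega
  · have hk : k.val < n := k.isLt
    by_cases h : k.val + 1 = n
    · refine ⟨1, fun a => ?_⟩
      have ha : a.val < 2 * n := a.isLt
      have hr : a.rev.val = 2 * n - (a.val + 1) := Fin.val_rev a
      simp only [h, if_true, hr]
      split_ifs <;> omega
    · refine ⟨2, fun a => ?_⟩
      have ha : a.val < 2 * n := a.isLt
      have hr : a.rev.val = 2 * n - (a.val + 1) := Fin.val_rev a
      simp only [h, if_false, hr]
      split_ifs <;> omega

lemma principal_soOdd (n : ℕ) : Principal (soOdd n) := by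
  refine Regular.principal trivial (Nat.succ_pos _) fun ψ =>
    exists_torus_of_exponent (fun k a =>
      (if k.val < a.val then 1 else 0) + (if 2 * n - 1 - k.val < a.val then 1 else 0))
      ?_ (fun _ k => ⟨2, fun a => ?_⟩) ψ
  · intro k a b h j
    simp only [negSimple, Matrix.of_apply] at h
    have h1 : (a.val = k.val + 1 ∧ b.val = k.val) ∨
        (a.val + k.val + 1 = 2 * n + 1 ∧ b.val + k.val + 2 = 2 * n + 1) := by
      by_contra h2
      exact h (if_neg h2)
    have hk : k.val < n := k.isLt
    have hj : j.val < n := j.isLt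
    simp only [Fin.ext_iff]
    split_ifs <;> omega
  · have hk : k.val < n := k.isLt
    have ha : a.val < 2 * n + 1 := a.isLt
    have hr : a.rev.val = 2 * n + 1 - (a.val + 1) := Fin.val_rev a
    simp only [hr]
    split_ifs <;> omega

end Oper

/-! ### The principal triple for `𝔰𝔬_{2n+2}`, through the inclusion of `𝔰𝔬_{2n+1}` -/

namespace Oper

noncomputable section

open ClassicalType

/-- The index of the standard representation of `𝔰𝔬_{2n+1}` of the same weight for `ρ̌`. -/
def fold {n : ℕ} (a : Fin (soEven (n + 1)).size) : Fin (soOdd n).size :=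
  ⟨height (soEven (n + 1)) a, by
    have ha : a.val < 2 * (n + 1) := a.isLt
    change _ < 2 * n + 1
    simp only [Oper.height]
    split_ifs <;> omega⟩

/-- The nonzero entries of `soIncl`. -/
def inclCoeff (n : ℕ) (a : ℕ) : ℂ := if a ≤ n + 1 then 1 else 2

/-- The nonzero entries of `soProj`. -/
def projCoeff (n : ℕ) (a : ℕ) : ℂ := if a < n then 1 else 1 / 2

variable {n : ℕ}

lemma soIncl_apply (a : Fin (2 * (n + 1))) (b : Fin (2 * n + 1)) :
    soIncl n a b = if b = fold a then inclCoeff n a.val else 0 := by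
  have ha := a.isLt
  have hb := b.isLt
  have h1 : b = fold a ↔ b.val = if a.val < n + 1 then a.val else a.val - 1 := by
    rw [Fin.ext_iff]; rfl
  simp only [soIncl, Matrix.of_apply, inclCoeff]
  by_cases h : b = fold a
  · rw [if_pos h]
    rw [h1] at h
    by_cases h2 : b.val < n
    · rw [if_pos h2, if_pos (by split_ifs at h <;> omega), if_pos (by split_ifs at h <;> omega)]
    rw [if_neg h2]
    by_cases h3 : b.val = n
    · rw [if_pos h3, if_pos (by split_ifs at h <;> omega), if_pos (by split_ifs at h <;> omega)]
    rw [if_neg h3, if_pos (by split_ifs at h <;> omega), if_neg (by split_ifs at h <;> omega)]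
  · rw [if_neg h]
    rw [h1] at h
    by_cases h2 : b.val < n
    · rw [if_pos h2, if_neg (by split_ifs at h <;> omega)]
    rw [if_neg h2]
    by_cases h3 : b.val = n
    · rw [if_pos h3, if_neg (by split_ifs at h <;> omega)]
    rw [if_neg h3, if_neg (by split_ifs at h <;> omega)]

lemma soProj_apply (a : Fin (2 * (n + 1))) (b : Fin (2 * n + 1)) :
    soProj n b a = if b = fold a then projCoeff n a.val else 0 := by
  have ha := a.isLt
  have hb := b.isLt
  have h1 : b = fold a ↔ b.val = if a.val < n + 1 then a.val else a.val - 1 := by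
    rw [Fin.ext_iff]; rfl
  simp only [soProj, Matrix.of_apply, projCoeff]
  by_cases h : b = fold a
  · rw [if_pos h]
    rw [h1] at h
    by_cases h2 : b.val < n
    · rw [if_pos h2, if_pos (by split_ifs at h <;> omega), if_pos (by split_ifs at h <;> omega)]
    rw [if_neg h2]
    by_cases h3 : b.val = n
    · rw [if_pos h3, if_pos (by split_ifs at h <;> omega), if_neg (by split_ifs at h <;> omega)]
    rw [if_neg h3, if_pos (by split_ifs at h <;> omega), if_neg (by split_ifs at h <;> omega)]
  · rw [if_neg h]
    rw [h1] at h
    by_cases h2 : b.val < n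
    · rw [if_pos h2, if_neg (by split_ifs at h <;> omega)]
    rw [if_neg h2]
    by_cases h3 : b.val = n
    · rw [if_pos h3, if_neg (by split_ifs at h <;> omega)]
    rw [if_neg h3, if_neg (by split_ifs at h <;> omega)]

section Ring

variable {R : Type} [CommRing R] [Algebra ℂ R]

lemma soInclusion_apply (X : Mat (soOdd n) R) (a b : Fin (soEven (n + 1)).size) :
    soInclusion n X a b
      = algebraMap ℂ R (inclCoeff n a.val * projCoeff n b.val) * X (fold a) (fold b) := by
  rw [soInclusion, Matrix.mul_apply, Finset.sum_eq_single (fold b), Matrix.mul_apply,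
    Finset.sum_eq_single (fold a)]
  · rw [const_apply, const_apply, soIncl_apply, soProj_apply, if_pos rfl, if_pos rfl, map_mul]
    ring
  · intro x _ hx
    rw [const_apply, soIncl_apply, if_neg hx, map_zero, zero_mul]
  · simp
  · intro x _ hx
    rw [const_apply, soProj_apply, if_neg hx, map_zero, mul_zero]
  · simp

lemma soProj_mul_soIncl : soProj n * soIncl n = 1 := by
  ext a b
  rw [Matrix.mul_apply]
  have ha := a.isLt
  have h1 : ∀ x : Fin (2 * (n + 1)), soProj n a x * soIncl n x b
      = if a = b ∧ (if x.val < n + 1 then x.val else x.val - 1) = a.val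
        then projCoeff n x.val * inclCoeff n x.val else 0 := by
    intro x
    have hfold : fold x = a ↔ (if x.val < n + 1 then x.val else x.val - 1) = a.val := by
      rw [Fin.ext_iff]
      rfl
    simp only [← hfold]
    rw [soProj_apply, soIncl_apply, ite_mul, zero_mul, mul_ite, mul_zero]
    by_cases h2 : a = fold x
    · rw [if_pos h2]
      by_cases h3 : b = fold x
      · rw [if_pos h3, if_pos ⟨h2.trans h3.symm, h2.symm⟩]
      · rw [if_neg h3, if_neg fun h => h3 (h.1.symm.trans h2)]
    · rw [if_neg h2, if_neg fun h => h2 h.2.symm]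
  rw [Finset.sum_congr rfl fun x _ => h1 x]
  by_cases hab : a = b
  · subst hab
    rw [Matrix.one_apply_eq]
    simp only [true_and, projCoeff, inclCoeff]
    rcases lt_trichotomy a.val n with h | h | h
    · rw [Finset.sum_eq_single ⟨a.val, by omega⟩]
      · simp only
        rw [if_pos (by split_ifs <;> omega), if_pos h, if_pos (by omega), one_mul]
      · intro x _ hx
        rw [if_neg]
        intro h2
        exact hx (Fin.ext (by simp only; split_ifs at h2 <;> omega))
      · simp
    -- The weight zero index has two preimages, and each contributes one half.
    · rw [Finset.sum_eq_add (⟨n, by omega⟩ : Fin (2 * (n + 1))) ⟨n + 1, by omega⟩]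
      · simp only
        have e1 : (if n < n + 1 then n else n - 1) = a.val := by rw [if_pos (by omega), h]
        have e2 : (if n + 1 < n + 1 then n + 1 else n + 1 - 1) = a.val := by
          rw [if_neg (by omega)]
          omega
        rw [if_pos e1, if_pos e2, if_neg (by omega), if_pos (by omega), if_neg (by omega),
          if_pos le_rfl]
        norm_num
      · simp
      · rintro x _ ⟨hx1, hx2⟩
        rw [if_neg]
        intro h2
        rw [Ne, Fin.ext_iff] at hx1 hx2
        simp only at hx1 hx2
        split_ifs at h2 <;> omega
      · simp
      · simp
    · rw [Finset.sum_eq_single ⟨a.val + 1, by omega⟩]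
      · simp only
        rw [if_pos (by split_ifs <;> omega), if_neg (by omega), if_neg (by omega)]
        norm_num
      · intro x _ hx
        rw [if_neg]
        intro h2
        exact hx (Fin.ext (by simp only; split_ifs at h2 <;> omega))
      · simp
  · rw [Matrix.one_apply_ne hab]
    exact Finset.sum_eq_zero fun x _ => if_neg fun h => hab h.1

lemma const_soProj_mul_soIncl : const R (soProj n) * const R (soIncl n) = 1 := by
  rw [← const_mul, soProj_mul_soIncl, const_one]

lemma soInclusion_mul (X Y : Mat (soOdd n) R) :
    soInclusion n (X * Y) = soInclusion n X * soInclusion n Y := by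
  have h : X * Y = X * (const R (soProj n) * const R (soIncl n)) * Y := by
    rw [const_soProj_mul_soIncl, Matrix.mul_one]
  rw [h]
  simp only [soInclusion, Matrix.mul_assoc]

lemma soInclusion_add (X Y : Mat (soOdd n) R) :
    soInclusion n (X + Y) = soInclusion n X + soInclusion n Y := by
  rw [soInclusion, Matrix.mul_add, Matrix.add_mul]
  rfl

lemma soInclusion_sub (X Y : Mat (soOdd n) R) :
    soInclusion n (X - Y) = soInclusion n X - soInclusion n Y := by
  rw [soInclusion, Matrix.mul_sub, Matrix.sub_mul]
  rfl

lemma soInclusion_smul (r : R) (X : Mat (soOdd n) R) :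
    soInclusion n (r • X) = r • soInclusion n X := by
  rw [soInclusion, Matrix.mul_smul, Matrix.smul_mul]
  rfl

lemma soInclusion_zero : soInclusion n (0 : Mat (soOdd n) R) = 0 := by
  rw [soInclusion, Matrix.mul_zero, Matrix.zero_mul]

lemma soInclusion_const (X : Mat (soOdd n) ℂ) :
    soInclusion n (const R X) = const R (soInclusion n X) := by
  simp only [soInclusion]
  rw [const_mul, const_mul, const_self, const_self]

lemma soInclusion_map {S : Type} [CommRing S] [Algebra ℂ S] (φ : R →ₐ[ℂ] S) (X : Mat (soOdd n) R) :
    (soInclusion n X).map φ = soInclusion n (X.map φ) := by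
  simp only [soInclusion, Matrix.map_mul, const_map_algHom]

lemma soProj_soInclusion (X : Mat (soOdd n) R) :
    const R (soProj n) * soInclusion n X * const R (soIncl n) = X := by
  calc _ = (const R (soProj n) * const R (soIncl n)) * X *
        (const R (soProj n) * const R (soIncl n)) := by
        simp only [soInclusion, Matrix.mul_assoc]
    _ = X := by rw [const_soProj_mul_soIncl, one_mul, mul_one]

lemma soInclusion_injective :
    Function.Injective (soInclusion n : Mat (soOdd n) R → Mat (soEven (n + 1)) R) := by
  intro X Y h
  rw [← soProj_soInclusion X, h, soProj_soInclusion]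

lemma soInclusion_hasDeg {X : Mat (soOdd n) R} {k : ℤ} (h : HasDeg (height (soOdd n)) k X) :
    HasDeg (height (soEven (n + 1))) k (soInclusion n X) := fun a b hab => by
  rw [soInclusion_apply, h (fold a) (fold b) hab, mul_zero]

lemma soInclusion_degGE {X : Mat (soOdd n) R} {k : ℤ} (h : DegGE (height (soOdd n)) k X) :
    DegGE (height (soEven (n + 1))) k (soInclusion n X) := fun a b hab => by
  rw [soInclusion_apply, h (fold a) (fold b) hab, mul_zero]

lemma fold_rev (a : Fin (soEven (n + 1)).size) : fold a.rev = (fold a).rev := by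
  have ha : a.val < 2 * (n + 1) := a.isLt
  have h1 : a.rev.val = 2 * (n + 1) - (a.val + 1) := Fin.val_rev a
  have h2 : (fold a).rev.val = 2 * n + 1 - ((fold a).val + 1) := Fin.val_rev _
  refine Fin.ext ?_
  rw [h2]
  simp only [fold, Oper.height, h1]
  split_ifs <;> omega

lemma projCoeff_rev (a : Fin (soEven (n + 1)).size) :
    projCoeff n a.rev.val = inclCoeff n a.val / 2 := by
  have ha : a.val < 2 * (n + 1) := a.isLt
  have h1 : a.rev.val = 2 * (n + 1) - (a.val + 1) := Fin.val_rev a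
  rw [projCoeff, inclCoeff, h1]
  by_cases h : a.val ≤ n + 1
  · rw [if_neg (by omega), if_pos h]
  · rw [if_pos (by omega), if_neg h]
    norm_num

lemma form_soOdd_rev (b : Fin (soOdd n).size) : form (soOdd n) b b.rev = (-1) ^ (b.val + 1) := by
  have hb : b.val < 2 * n + 1 := b.isLt
  have h1 : b.rev.val = 2 * n + 1 - (b.val + 1) := Fin.val_rev b
  simp only [form, Matrix.of_apply]
  rw [if_pos (by omega)]

lemma form_soOdd_symm (b : Fin (soOdd n).size) :
    form (soOdd n) b.rev b = form (soOdd n) b b.rev := by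
  have hb : b.val < 2 * n + 1 := b.isLt
  have h1 : b.rev.val = 2 * n + 1 - (b.val + 1) := Fin.val_rev b
  rw [form_soOdd_rev]
  have := form_soOdd_rev b.rev
  rw [Fin.rev_rev] at this
  have h2 : (-1 : ℂ) ^ (b.rev.val + 1) * (-1) ^ (b.val + 1) = 1 := by
    rw [← pow_add, show b.rev.val + 1 + (b.val + 1) = 2 * (n + 1) by omega, pow_mul]
    norm_num
  have h3 : (-1 : ℂ) ^ (b.val + 1) * (-1) ^ (b.val + 1) = 1 := by
    rw [← mul_pow]
    norm_num
  rw [this]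
  linear_combination (-1 : ℂ) ^ (b.val + 1) * h2 - (-1 : ℂ) ^ (b.rev.val + 1) * h3

lemma form_soEven_symm {r : ℕ} (b : Fin (soEven r).size) :
    form (soEven r) b.rev b = form (soEven r) b b.rev := by
  simp only [form, Matrix.of_apply]
  rw [max_comm, add_comm b.rev.val]

lemma form_soEven_rev (a : Fin (soEven (n + 1)).size) :
    form (soEven (n + 1)) a a.rev = -form (soOdd n) (fold a) (fold a).rev := by
  have ha : a.val < 2 * (n + 1) := a.isLt
  have h1 : a.rev.val = 2 * (n + 1) - (a.val + 1) := Fin.val_rev a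
  rw [form_soOdd_rev]
  simp only [form, Matrix.of_apply, fold, Oper.height]
  rw [if_pos (by omega)]
  by_cases h : a.val < n + 1
  · rw [if_pos h, max_eq_right (by omega), h1,
      show 2 * (n + 1) - (a.val + 1) + 1 = (a.val + 1) + 1 + 2 * (n - a.val) by omega, pow_add,
      pow_mul, pow_succ]
    norm_num
  · rw [if_neg h, max_eq_left (by omega), show a.val + 1 = a.val - 1 + 1 + 1 by omega,
      pow_succ _ (a.val - 1 + 1)]
    norm_num

/-- Reversal exchanges the entries of `soIncl` and `soProj` up to the factor `1/2`, and the two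
forms correspond up to a sign under `fold`; so the skewness equations are proportional. -/
lemma soInclusion_memLie {X : Mat (soOdd n) R} (h : MemLie (soOdd n) X) :
    MemLie (soEven (n + 1)) (soInclusion n X) := by
  have h0 := (memLie_apply (c := soOdd n) trivial).1 h
  refine (memLie_apply (c := soEven (n + 1)) trivial).2 fun a b => ?_
  have h1 := h0 (fold a) (fold b)
  rw [form_soOdd_symm] at h1
  rw [soInclusion_apply, soInclusion_apply, form_soEven_symm, form_soEven_rev, form_soEven_rev,
    projCoeff_rev, projCoeff_rev, fold_rev, fold_rev]
  simp only [map_mul, map_neg, div_eq_mul_inv]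
  linear_combination (-algebraMap ℂ R (inclCoeff n a.val) * algebraMap ℂ R (inclCoeff n b.val) *
    algebraMap ℂ R 2⁻¹) * h1

end Ring

lemma soInclusion_pMinus : soInclusion n (pMinus (soOdd n)) = pMinus (soEven (n + 1)) := by
  ext a b
  have ha : a.val < 2 * (n + 1) := a.isLt
  have hb : b.val < 2 * (n + 1) := b.isLt
  have hx := height_soEven a
  have hy := height_soEven b
  rw [soInclusion_apply, pMinus_apply, pMinus_apply]
  change algebraMap ℂ ℂ _ * (if height (soEven (n + 1)) a = height (soEven (n + 1)) b + 1 then 1 else 0)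
    = _
  split_ifs with h
  · rw [mul_one]
    change inclCoeff n a.val * projCoeff n b.val = 1
    simp only [inclCoeff, projCoeff]
    by_cases h1 : b.val < n
    · rw [if_pos (by omega), if_pos h1, one_mul]
    · rw [if_neg (by omega), if_neg h1]
      norm_num
  · rw [mul_zero]

lemma soInclusion_pPlus : soInclusion n (pPlus (soOdd n)) = pPlus (soEven (n + 1)) := by
  ext a b
  have ha : a.val < 2 * (n + 1) := a.isLt
  have hb : b.val < 2 * (n + 1) := b.isLt
  have hx := height_soEven a
  have hy := height_soEven b
  rw [soInclusion_apply, pPlus_apply, pPlus_apply]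
  change algebraMap ℂ ℂ _ * (if height (soEven (n + 1)) b = height (soEven (n + 1)) a + 1 then
    ((plusCoeff (soOdd n) (height (soEven (n + 1)) a) : ℝ) : ℂ) else 0) = _
  split_ifs with h
  · change inclCoeff n a.val * projCoeff n b.val * _ = _
    generalize height (soEven (n + 1)) a = x at *
    generalize height (soEven (n + 1)) b = y at *
    simp only [inclCoeff, projCoeff, plusCoeff]
    by_cases h1 : x + 2 = n + 1 ∨ x + 1 = n + 1
    · rw [if_pos h1, if_pos (by omega), if_neg (by omega)]
      rcases h1 with h1 | h1
      · have : (n : ℂ) = x + 1 := by exact_mod_cast (show n = x + 1 by omega)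
        push_cast
        rw [this]
        ring
      · have : (n : ℂ) = x := by exact_mod_cast (show n = x by omega)
        push_cast
        rw [this]
        ring
    · rw [if_neg h1]
      by_cases h2 : a.val < n
      · rw [if_pos (by omega), if_pos (by omega)]
        push_cast
        ring
      · rw [if_neg (by omega), if_neg (by omega)]
        push_cast
        ring
  · rw [mul_zero]

/-- The inclusion is multiplicative, so the bracket is transported from `𝔰𝔬_{2n+1}`. The included
diagonal matrix could fail to be diagonal only in the weight zero block, where its coefficient is
zero. -/
lemma bracket_soEven : pPlus (soEven (n + 1)) * pMinus (soEven (n + 1))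
      - pMinus (soEven (n + 1)) * pPlus (soEven (n + 1))
      = Matrix.diagonal fun a => 2 * (n : ℂ) - 2 * (height (soEven (n + 1)) a : ℂ) := by
  rw [← soInclusion_pMinus, ← soInclusion_pPlus, ← soInclusion_mul, ← soInclusion_mul,
    ← soInclusion_sub, Regular.bracket (c := soOdd n) trivial]
  ext a b
  have ha : a.val < 2 * (n + 1) := a.isLt
  have hb : b.val < 2 * (n + 1) := b.isLt
  have hx := height_soEven a
  have hy := height_soEven b
  rw [soInclusion_apply, Matrix.diagonal_apply, Matrix.diagonal_apply]
  change algebraMap ℂ ℂ _ * (if fold a = fold b then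
    ((2 * n + 1 : ℕ) : ℂ) - 1 - 2 * (height (soEven (n + 1)) a : ℂ) else 0) = _
  have h1 : ((2 * n + 1 : ℕ) : ℂ) - 1 = 2 * (n : ℂ) := by push_cast; ring
  have h2 : fold a = fold b ↔ height (soEven (n + 1)) a = height (soEven (n + 1)) b := Fin.ext_iff
  rw [h1]
  simp only [h2]
  change inclCoeff n a.val * projCoeff n b.val * _ = _
  generalize height (soEven (n + 1)) a = x at *
  generalize height (soEven (n + 1)) b = y at *
  by_cases hxy : x = y
  · rw [if_pos hxy]
    by_cases hxn : x = n
    · rw [hxn, sub_self, mul_zero, ite_self]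
    · rw [if_pos (Fin.ext (by omega))]
      simp only [inclCoeff, projCoeff]
      by_cases h3 : b.val < n
      · rw [if_pos (by omega), if_pos h3, one_mul, one_mul]
      · rw [if_neg (by omega), if_neg h3]
        norm_num
  · rw [if_neg hxy, if_neg, mul_zero]
    rintro rfl
    omega

section Skew

variable {R : Type} [CommRing R] [Algebra ℂ R]

/-- The form is symmetric, so the equation at an antidiagonal position reads twice the entry equals
zero. These positions include the off-diagonal ones of degree `0`. -/
lemma antidiagonal_eq_zero {r : ℕ} {X : Mat (soEven r) R} (h : MemLie (soEven r) X)
    (a : Fin (soEven r).size) : X a a.rev = 0 := by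
  have h1 := (memLie_apply (c := soEven r) trivial).1 h a a
  rw [form_soEven_symm, mul_comm, ← mul_add, ← two_mul] at h1
  have h2 : IsUnit (algebraMap ℂ R (form (soEven r) a a.rev)) :=
    (isUnit_iff_ne_zero.2 (form_rev_ne_zero (c := soEven r) trivial a)).map _
  have h3 : IsUnit (2 : R) := by simpa using isUnit_natCast (R := R) (N := 2) two_pos
  exact h3.mul_right_eq_zero.1 (h2.mul_right_eq_zero.1 h1)

/-- Two indices of the same weight are equal or opposite. -/
lemma eq_or_eq_rev {r : ℕ} {a b : Fin (soEven r).size}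
    (h : height (soEven r) a = height (soEven r) b) : a = b ∨ b = a.rev := by
  have ha : a.val < 2 * r := a.isLt
  have hb : b.val < 2 * r := b.isLt
  have hx := height_soEven a
  have hy := height_soEven b
  have h1 : a.rev.val = 2 * r - (a.val + 1) := Fin.val_rev a
  by_cases hab : a.val = b.val
  · exact Or.inl (Fin.ext hab)
  · exact Or.inr (Fin.ext (by omega))

/-- Off the diagonal, degree `0` and triangularity leave only the entry between the two vectors of
weight zero. Comparing the products at the neighbours of weights `1` and `-1` shows that twice this
entry vanishes. Triangularity matters: the exchange of the two vectors also commutes with `p₋₁`. -/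
lemma scalar_soEven (hn : 0 < n) {g : Mat (soEven (n + 1)) R} (hg : g.BlockTriangular id)
    (hdeg : HasDeg (height (soEven (n + 1))) 0 g)
    (hcomm : g * const R (pMinus (soEven (n + 1))) = const R (pMinus (soEven (n + 1))) * g)
    {a b : Fin (soEven (n + 1)).size} (hab : a ≠ b) : g a b = 0 := by
  by_cases hh : height (soEven (n + 1)) a = height (soEven (n + 1)) b
  swap
  · exact hdeg a b (by simp only [deg]; omega)
  by_cases hlt : b < a
  · exact hg hlt
  have hlt' : a.val < b.val := by
    rcases lt_trichotomy a.val b.val with h | h | h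
    · exact h
    · exact (hab (Fin.ext h)).elim
    · exact (hlt h).elim
  have ha : a.val < 2 * (n + 1) := a.isLt
  have hb : b.val < 2 * (n + 1) := b.isLt
  have hx := height_soEven a
  have hy := height_soEven b
  have hav : a.val = n := by omega
  have hbv : b.val = n + 1 := by omega
  let s : Fin (soEven (n + 1)).size := ⟨n - 1, show n - 1 < 2 * (n + 1) by omega⟩
  let t : Fin (soEven (n + 1)).size := ⟨n + 2, show n + 2 < 2 * (n + 1) by omega⟩
  have hs : height (soEven (n + 1)) s = n - 1 := if_pos (show n - 1 < n + 1 by omega)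
  have ht : height (soEven (n + 1)) t = n + 1 := if_neg (show ¬ n + 2 < n + 1 by omega)
  have hha : height (soEven (n + 1)) a = n := by omega
  have hhb : height (soEven (n + 1)) b = n := by omega
  have hp : ∀ x y, const R (pMinus (soEven (n + 1))) x y
      = if height (soEven (n + 1)) x = height (soEven (n + 1)) y + 1 then 1 else 0 := by
    intro x y
    rw [const_apply, pMinus_apply]
    split_ifs <;> simp
  have hz : ∀ x y, height (soEven (n + 1)) x ≠ height (soEven (n + 1)) y → g x y = 0 :=
    fun x y h => hdeg x y (by simp only [deg]; omega)
  have hval : ∀ x : Fin (soEven (n + 1)).size, height (soEven (n + 1)) x = n → x = a ∨ x = b := by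
    intro x h
    have hxx := height_soEven x
    by_cases h1 : x.val = n
    · exact Or.inl (Fin.ext (by omega))
    · exact Or.inr (Fin.ext (by omega))
  have hvals : ∀ x : Fin (soEven (n + 1)).size, height (soEven (n + 1)) x = n - 1 → x = s := by
    intro x h
    have hxx := height_soEven x
    exact Fin.ext (show x.val = n - 1 by omega)
  have hvalt : ∀ x : Fin (soEven (n + 1)).size, height (soEven (n + 1)) x = n + 1 → x = t := by
    intro x h
    have hxx := height_soEven x
    exact Fin.ext (show x.val = n + 2 by omega)
  have key : ∀ x y, ∑ z, g x z * const R (pMinus (soEven (n + 1))) z y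
      = ∑ z, const R (pMinus (soEven (n + 1))) x z * g z y := by
    intro x y
    have := congrFun (congrFun hcomm x) y
    rwa [Matrix.mul_apply, Matrix.mul_apply] at this
  have hs1 : ∀ x, height (soEven (n + 1)) x = n →
      ∑ z, const R (pMinus (soEven (n + 1))) x z * g z s = g s s := by
    intro x hxn
    rw [Finset.sum_eq_single s, hp, if_pos (by omega), one_mul]
    · intro z _ hz'
      rw [hz z s, mul_zero]
      intro h
      exact hz' (hvals z (h.trans hs))
    · simp
  have hs2 : ∀ x, ∑ z, g x z * const R (pMinus (soEven (n + 1))) z s = g x a + g x b := by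
    intro x
    rw [Finset.sum_eq_add a b hab, hp, hp, if_pos (by omega), if_pos (by omega), mul_one, mul_one]
    · rintro z _ ⟨hza, hzb⟩
      rw [hp, if_neg, mul_zero]
      intro h
      exact (hval z (by omega)).elim hza hzb
    · simp
    · simp
  have ht1 : ∀ x, height (soEven (n + 1)) x = n →
      ∑ z, g t z * const R (pMinus (soEven (n + 1))) z x = g t t := by
    intro x hxn
    rw [Finset.sum_eq_single t, hp, if_pos (by omega), mul_one]
    · intro z _ hz'
      rw [hz t z, zero_mul]
      intro h
      exact hz' (hvalt z (h.symm.trans ht))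
    · simp
  have ht2 : ∀ x, ∑ z, const R (pMinus (soEven (n + 1))) t z * g z x = g a x + g b x := by
    intro x
    rw [Finset.sum_eq_add a b hab, hp, hp, if_pos (by omega), if_pos (by omega), one_mul, one_mul]
    · rintro z _ ⟨hza, hzb⟩
      rw [hp, if_neg, zero_mul]
      intro h
      exact (hval z (by omega)).elim hza hzb
    · simp
    · simp
  have hba : g b a = 0 := hg hlt'
  have e1 : g a a + g a b = g s s := by rw [← hs2, key, hs1 a hha]
  have e2 : g b a + g b b = g s s := by rw [← hs2, key, hs1 b hhb]
  have e3 : g t t = g a a + g b a := by rw [← ht2, ← key, ht1 a hha]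
  have e4 : g t t = g a b + g b b := by rw [← ht2, ← key, ht1 b hhb]
  have h3 : IsUnit (2 : R) := by simpa using isUnit_natCast (R := R) (N := 2) two_pos
  refine h3.mul_right_eq_zero.1 ?_
  linear_combination e1 - e2 + e3 - e4 + 2 * hba

end Skew

lemma principal_soEven (hn : 0 < n) : Principal (soEven (n + 1)) := by
  have h0 : ∀ a b : Fin (soEven (n + 1)).size, height (soEven (n + 1)) a = 0 →
      height (soEven (n + 1)) b = 0 → a = b := by
    intro a b ha hb
    have hx := height_soEven a
    have hy := height_soEven b
    exact Fin.ext (by omega)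
  have hpos : 0 < (soEven (n + 1)).size := show 0 < 2 * (n + 1) by omega
  have hdiag : ∀ {R : Type} [CommRing R] {X : Mat (soEven (n + 1)) R},
      (∀ a b, a ≠ b → X a b = 0) → X = Matrix.diagonal fun a => X a a := by
    intro R _ X hX
    ext a b
    rw [Matrix.diagonal_apply]
    split_ifs with h
    · rw [h]
    · exact hX a b h
  refine ⟨hpos, fun a b => height_mono _, gradedTriple_of_bracket _ bracket_soEven,
    soInclusion_pPlus ▸ soInclusion_memLie (Regular.memLie_pPlus trivial),
    soInclusion_pMinus ▸ soInclusion_memLie (Regular.memLie_pMinus trivial),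
    MemLie.degComp, ?_, ?_, ?_, ?_, memBorel_diagUnit_height⟩
  · intro R _ _ X hX hdeg a b hab
    have hab' : b < a := hab
    rcases lt_or_eq_of_le (height_mono _ hab'.le) with h | h
    · exact hdeg a b (by simp only [deg]; omega)
    · rcases eq_or_eq_rev h.symm with h1 | h1
      · exact (hab'.ne h1.symm).elim
      · rw [h1]
        exact antidiagonal_eq_zero hX a
  · intro x hx hx0 hcomm
    have h1 := hdiag (X := x) fun a b hab => by
      by_cases h : height (soEven (n + 1)) a = height (soEven (n + 1)) b
      · rcases eq_or_eq_rev h with h1 | h1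
        · exact (hab h1).elim
        · rw [h1]
          exact antidiagonal_eq_zero hx a
      · exact hx0 a b (by simp only [deg]; omega)
    rw [h1] at hx hcomm ⊢
    exact diagonal_eq_zero_of_comm hpos h0 hx hcomm
  · intro R _ _ g hg hcomm
    have hg' : (degComp (height (soEven (n + 1))) 0 g).BlockTriangular id := by
      intro a b hab
      rw [degComp_apply, hg hab, ite_self]
    have h1 := hdiag (X := degComp (height (soEven (n + 1))) 0 g) fun a b hab => scalar_soEven hn hg' hasDeg_degComp hcomm hab
    rw [h1] at hcomm ⊢
    have : Inhabited (Fin (soEven (n + 1)).size) := ⟨⟨0, hpos⟩⟩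
    exact ⟨_, diagonal_eq_smul_one (eq_of_height h0 (diagonal_comm_pMinus hcomm))⟩
  · intro R _ _ ψ
    -- The last two cases are the coweights of the two branches at the end of the Dynkin diagram,
    -- whose root vectors end, respectively start, at the two weight zero vectors.
    refine exists_torus_of_exponent (fun k a =>
      if k.val + 1 < n then
        (if k.val < a.val then 1 else 0) + (if 2 * n - k.val < a.val then 1 else 0)
      else if k.val + 1 = n then (if a.val = n ∨ n + 2 ≤ a.val then 1 else 0)
      else (if n + 1 ≤ a.val then 1 else 0)) ?_ (fun _ k => ?_) ψ
    · intro k a b h j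
      have hk : k.val < n + 1 := k.isLt
      have hj : j.val < n + 1 := j.isLt
      simp only [negSimple, Matrix.of_apply] at h
      simp only [Fin.ext_iff]
      by_cases hkn : k.val + 1 < n + 1
      · rw [if_pos hkn] at h
        rw [Ne, ite_eq_right_iff, Classical.not_imp] at h
        have h1 := h.1
        split_ifs <;> omega
      · rw [if_neg hkn] at h
        rw [Ne, ite_eq_right_iff, Classical.not_imp] at h
        have h1 := h.1
        split_ifs <;> omega
    · have hk : k.val < n + 1 := k.isLt
      by_cases h : k.val + 1 < n
      · refine ⟨2, fun a => ?_⟩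
        have ha : a.val < 2 * (n + 1) := a.isLt
        have hr : a.rev.val = 2 * (n + 1) - (a.val + 1) := Fin.val_rev a
        simp only [h, if_true, hr]
        split_ifs <;> omega
      · refine ⟨1, fun a => ?_⟩
        have ha : a.val < 2 * (n + 1) := a.isLt
        have hr : a.rev.val = 2 * (n + 1) - (a.val + 1) := Fin.val_rev a
        simp only [h, if_false, hr]
        split_ifs <;> omega

end

end Oper

/-! ### Traces of powers, the nilpotent slice and the spaces `V_i` in the regular types -/

namespace Oper

open ClassicalType

section Trace

variable {ι R : Type} [Fintype ι] [DecidableEq ι] [CommRing R] {ht : ι → ℕ}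

/-- Expansion in words: `S` collects those with exactly one `w` and `E` those with at least two. By
cyclicity each word of `S f ^ j` has the same trace as `w f ^ l`. -/
lemma exists_pow_add {f w : Matrix ι ι R} (hf : HasDeg ht (-1) f) {k : ℤ} (hk : 0 ≤ k)
    (hw : DegGE ht k w) (m : ℕ) : ∃ S E, (f + w) ^ m = f ^ m + S + E ∧
      DegGE ht (k - m + 1) S ∧ DegGE ht (2 * k - m + 2) E ∧
      ∀ j l : ℕ, l + 1 = m + j → (S * f ^ j).trace = m * (w * f ^ l).trace := by
  induction m with
  | zero =>
    exact ⟨0, 0, by simp, DegGE.zero, DegGE.zero, fun _ _ _ => by simp⟩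
  | succ m ih =>
    obtain ⟨S, E, h, hS, hE, ht'⟩ := ih
    have hf' := hf.degGE (le_refl _)
    have hfm := (hf.pow m).degGE (le_refl _)
    refine ⟨S * f + f ^ m * w, E * f + S * w + E * w, ?_, ?_, ?_, ?_⟩
    · rw [pow_succ, h, pow_succ]
      simp only [add_mul, mul_add]
      abel
    · exact (hS.mul hf' (by push_cast; linarith)).add (hfm.mul hw (by push_cast; linarith))
    · exact ((hE.mul hf' (by push_cast; linarith)).add (hS.mul hw (by push_cast; linarith))).add
        (hE.mul hw (by push_cast; linarith))
    · intro j l hl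
      have h1 := ht' (j + 1) l (by omega)
      have h2 : (f ^ m * w * f ^ j).trace = (w * f ^ l).trace := by
        rw [mul_assoc, Matrix.trace_mul_comm, mul_assoc, ← pow_add, show j + m = l by omega]
      rw [add_mul, Matrix.trace_add, h2, mul_assoc, ← pow_succ', h1]
      push_cast
      ring

/-- Words with at least two factors `w` have degree at least `2k - (k + 1) + 2 > 0` and `f ^ (k +
1)` has negative degree; both are traceless, which leaves the first order term. -/
lemma trace_pow_add {f w : Matrix ι ι R} (hf : HasDeg ht (-1) f) {k : ℕ}
    (hw : DegGE ht k w) : ((f + w) ^ (k + 1)).trace = (k + 1) * (w * f ^ k).trace := by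
  obtain ⟨S, E, h, -, hE, ht'⟩ := exists_pow_add hf (by positivity) hw (k + 1)
  have h1 := ht' 0 k rfl
  rw [pow_zero, mul_one] at h1
  rw [h, Matrix.trace_add, Matrix.trace_add, h1,
    hE.trace_eq_zero (by push_cast; omega),
    (hf.pow (k + 1)).trace_eq_zero (by push_cast; omega)]
  push_cast
  ring

end Trace

section Slice

variable {ι : Type} [Fintype ι] [DecidableEq ι]

lemma weightedAdjoint_pow {S : ι → ℝ} (hS : ∀ a, 0 < S a) (X : Matrix ι ι ℂ) (k : ℕ) :
    weightedAdjoint S (X ^ k) = weightedAdjoint S X ^ k := by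
  induction k with
  | zero =>
    ext a b
    rw [pow_zero, pow_zero, weightedAdjoint, Matrix.of_apply, Matrix.one_apply, Matrix.one_apply]
    have : (S a : ℂ) ≠ 0 := by exact_mod_cast (hS a).ne'
    by_cases h : a = b
    · subst h
      simp [this]
    · rw [if_neg h, if_neg (Ne.symm h)]
      simp
  | succ k ih => rw [pow_succ, weightedAdjoint_mul hS, ih, pow_succ']

/-- As `f` is the adjoint of `e`, this trace is the squared norm of `e ^ k`. -/
lemma GradedTriple.pow_eq_zero {ht : ι → ℕ} {e f : Matrix ι ι ℂ} (h : GradedTriple ht e f) {k : ℕ}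
    (hk : (e ^ k * f ^ k).trace = 0) : e ^ k = 0 := by
  obtain ⟨S, hS, hef⟩ := h.adjoint
  have hS' : ∀ a, (S a : ℂ) ≠ 0 := fun a => by exact_mod_cast (hS a).ne'
  have he : weightedAdjoint S e = f := by
    ext a b
    simp only [weightedAdjoint, Matrix.of_apply]
    have := congrArg star (hef b a)
    simp only [star_mul', RCLike.star_def, Complex.conj_ofReal, Complex.conj_conj] at this ⊢
    rw [mul_assoc, mul_comm _ (S b : ℂ), this, mul_comm (f a b), inv_mul_cancel_left₀ (hS' a)]
  rw [← he, ← weightedAdjoint_pow hS, trace_mul_weightedAdjoint] at hk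
  exact eq_zero_of_trace_mul_weightedAdjoint hS (le_of_eq (by exact_mod_cast hk))

/-- An element of the slice through `f` along the powers of `e` is not nilpotent. -/
theorem GradedTriple.slice_eq_zero {ht : ι → ℕ} {e f : Matrix ι ι ℂ} (h : GradedTriple ht e f)
    {w : Matrix ι ι ℂ} (hw : DegGE ht 1 w)
    (hpow : ∀ k : ℕ, ∃ r : ℂ, degComp ht k w = r • e ^ k) (hnil : IsNilpotent (f + w)) : w = 0 := by
  have key : ∀ k : ℕ, 1 ≤ k → DegGE ht k w := by
    intro k hk
    induction k, hk using Nat.le_induction with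
    | base => exact_mod_cast hw
    | succ k hk ih =>
      -- The trace of the power `k + 1` vanishes, and it only sees the lowest part `r e ^ k` of `w`.
      -- Thus `r` times the trace of `e ^ k f ^ k` is zero.
      have h1 := (Matrix.isNilpotent_trace_of_isNilpotent (hnil.pow_succ k)).eq_zero
      rw [trace_pow_add h.deg_f ih] at h1
      have h2 : (w * f ^ k).trace = 0 := (mul_eq_zero.1 h1).resolve_left (Nat.cast_add_one_ne_zero k)
      obtain ⟨r, hr⟩ := hpow k
      have h3 : ((w - degComp ht k w) * f ^ k).trace = 0 :=
        (ih.sub_degComp.mul ((h.deg_f.pow k).degGE le_rfl) (k := 1) (by linarith)).trace_eq_zero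
          one_pos
      rw [sub_mul, Matrix.trace_sub, h2, hr, Matrix.smul_mul, Matrix.trace_smul, zero_sub,
        neg_eq_zero, smul_eq_mul] at h3
      push_cast
      refine degGE_succ ih ?_
      rw [hr]
      rcases mul_eq_zero.1 h3 with h4 | h4
      · rw [h4, zero_smul]
      · rw [h.pow_eq_zero h4, smul_zero]
  obtain ⟨m, hm⟩ : ∃ m : ℕ, ∀ a, ht a < m :=
    ⟨Finset.univ.sup ht + 1, fun a => Nat.lt_succ_of_le (Finset.le_sup (Finset.mem_univ a))⟩
  exact (key (m + 1) (by omega)).eq_zero fun a => by have := hm a; push_cast; omega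

end Slice

section Regular

variable {c : ClassicalType}

/-- The centraliser of `p₁` in the matrices of degree `k` is spanned by `p₁ ^ k`. -/
theorem Regular.eq_smul_pow (hr : Regular c) {x : Mat c ℂ} {k : ℕ} (hx : HasDeg (height c) k x)
    (hcomm : pPlus c * x = x * pPlus c) : ∃ r : ℂ, x = r • pPlus c ^ k := by
  rcases le_or_gt c.size k with hk | hk
  · refine ⟨0, ?_⟩
    rw [zero_smul]
    refine (hx.degGE le_rfl).eq_zero fun a => ?_
    rw [hr.height_eq]
    have := a.isLt
    omega
  have hγ : ∀ i : ℕ, i + 1 < c.size → ((i : ℂ) + 1) * ((c.size : ℂ) - 1 - i) ≠ 0 := by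
    intro i hi
    refine mul_ne_zero (Nat.cast_add_one_ne_zero i) ?_
    rw [show (c.size : ℂ) - 1 - i = ((c.size - (i + 1) : ℕ) : ℂ) by
      rw [Nat.cast_sub (by omega)]; push_cast; ring]
    exact Nat.cast_ne_zero.2 (by omega)
  have hmul : ∀ (y : Mat c ℂ) (a b : ℕ) (ha : a + 1 < c.size) (hb : b < c.size),
      (pPlus c * y) ⟨a, by omega⟩ ⟨b, hb⟩
        = ((a : ℂ) + 1) * ((c.size : ℂ) - 1 - a) * y ⟨a + 1, ha⟩ ⟨b, hb⟩ := by
    intro y a b ha hb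
    rw [Matrix.mul_apply, Finset.sum_eq_single ⟨a + 1, ha⟩, hr.pPlus_apply, if_pos rfl]
    · intro z _ hz
      rw [hr.pPlus_apply, if_neg fun h => hz (Fin.ext h), zero_mul]
    · simp
  have hmul' : ∀ (y : Mat c ℂ) (a b : ℕ) (ha : a < c.size) (hb : b + 1 < c.size),
      (y * pPlus c) ⟨a, ha⟩ ⟨b + 1, hb⟩
        = y ⟨a, ha⟩ ⟨b, by omega⟩ * (((b : ℂ) + 1) * ((c.size : ℂ) - 1 - b)) := by
    intro y a b ha hb
    rw [Matrix.mul_apply, Finset.sum_eq_single ⟨b, by omega⟩, hr.pPlus_apply, if_pos rfl]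
    · intro z _ hz
      rw [hr.pPlus_apply, if_neg fun h => hz (Fin.ext (by simp only at h ⊢; omega)), mul_zero]
    · simp
  have hpow : ∀ (k : ℕ) (hk : k < c.size), (pPlus c ^ k) ⟨0, by omega⟩ ⟨k, hk⟩ ≠ 0 := by
    intro k
    induction k with
    | zero => intro hk; simp
    | succ k ih =>
      intro hk
      rw [pow_succ, hmul' _ 0 k (by omega) hk]
      exact mul_ne_zero (ih (by omega)) (hγ k hk)
  -- Commuting with `p₁` relates consecutive entries on the `k`-th superdiagonal by nonzero factors,
  -- so the entry in the first row determines them all.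
  have hzero : ∀ y : Mat c ℂ, HasDeg (height c) k y → pPlus c * y = y * pPlus c →
      y ⟨0, by omega⟩ ⟨k, hk⟩ = 0 → y = 0 := by
    intro y hy hyc hy0
    have h1 : ∀ (a : ℕ) (ha : a + k < c.size), y ⟨a, by omega⟩ ⟨a + k, ha⟩ = 0 := by
      intro a
      induction a with
      | zero =>
        intro ha
        simp only [zero_add]
        exact hy0
      | succ a ih =>
        intro ha
        have h2 := congrFun (congrFun hyc ⟨a, by omega⟩) ⟨a + k + 1, by omega⟩
        rw [hmul _ _ _ (by omega), hmul' _ _ _ _ (by omega), ih (by omega), zero_mul] at h2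
        have h3 := (mul_eq_zero.1 h2).resolve_left (hγ a (by omega))
        simp only [show a + 1 + k = a + k + 1 by omega]
        exact h3
    ext a b
    by_cases hab : b.val = a.val + k
    · have h2 := h1 a.val (hab ▸ b.isLt)
      have h3 : b = ⟨a.val + k, hab ▸ b.isLt⟩ := Fin.ext hab
      rw [h3]
      exact h2
    · refine hy a b ?_
      simp only [deg, hr.height_eq]
      omega
  refine ⟨x ⟨0, by omega⟩ ⟨k, hk⟩ * ((pPlus c ^ k) ⟨0, by omega⟩ ⟨k, hk⟩)⁻¹, ?_⟩
  rw [← sub_eq_zero]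
  refine hzero _ (hx.sub (HasDeg.smul _ ?_)) ?_ ?_
  · have := (pPlus_hasDeg c).pow k
    rwa [mul_one] at this
  · rw [mul_sub, sub_mul, hcomm, Matrix.mul_smul, Matrix.smul_mul, ← pow_succ, ← pow_succ']
  · rw [Matrix.sub_apply, Matrix.smul_apply, smul_eq_mul, inv_mul_cancel_right₀ (hpow k hk), sub_self]

lemma Regular.gradedTriple (hr : Regular c) : GradedTriple (height c) (pPlus c) (pMinus c) :=
  gradedTriple_of_bracket c hr.bracket

lemma degComp_comm {k : ℤ} {v : Mat c ℂ} (h : pPlus c * v = v * pPlus c) :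
    pPlus c * degComp (height c) k v = degComp (height c) k v * pPlus c := by
  rw [← (pPlus_hasDeg c).degComp_mul (k := k + 1) (by ring),
    ← (pPlus_hasDeg c).degComp_mul_right (k := k + 1) (by ring), h]

theorem Regular.slice_eq_zero (hr : Regular c) {w : Mat c ℂ} (hw : DegGE (height c) 1 w)
    (hcomm : pPlus c * w = w * pPlus c) (hnil : IsNilpotent (pMinus c + w)) : w = 0 :=
  hr.gradedTriple.slice_eq_zero hw
    (fun k => hr.eq_smul_pow hasDeg_degComp (degComp_comm hcomm)) hnil

lemma IsCanonical.comm' {w : Mat c ℂ} (h : IsCanonical c w) : pPlus c * w = w * pPlus c := by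
  have := h.comm
  rwa [const_self] at this

theorem Regular.nilpotentSlice (hr : Regular c) : NilpotentSlice c :=
  fun _ hw hnil => hr.slice_eq_zero hw.degGE hw.comm' hnil

lemma MemLie.pow_mul_form (hc : HasForm c) {x : Mat c ℂ} (hx : MemLie c x) (k : ℕ) :
    x ^ k * form c = (-1 : ℂ) ^ k • (form c * (x ^ k).transpose) := by
  rw [memLie_iff hc, const_self] at hx
  induction k with
  | zero => simp
  | succ k ih =>
    rw [pow_succ', mul_assoc, ih, Matrix.mul_smul, ← mul_assoc, eq_neg_of_add_eq_zero_left hx,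
      pow_succ (-1 : ℂ), mul_smul, ← pow_succ', pow_succ x, Matrix.transpose_mul, neg_one_smul,
      neg_mul, mul_assoc]

lemma MemLie.pow (hc : HasForm c) {x : Mat c ℂ} (hx : MemLie c x) {k : ℕ} (hk : Odd k) :
    MemLie c (x ^ k : Mat c ℂ) := by
  rw [memLie_iff hc, const_self, hx.pow_mul_form hc, hk.neg_one_pow, neg_one_smul,
    neg_add_cancel]

/-- An even power of a skew element is self-adjoint for the form, and an element that is both skew
and self-adjoint is zero. Hence the odd `V_i` vanish for `𝔰𝔭` and `𝔰𝔬_{2n+1}`. -/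
lemma MemLie.smul_pow_eq_zero (hc : HasForm c) {x : Mat c ℂ} (hx : MemLie c x) {k : ℕ} (hk : Even k)
    {r : ℂ} (h : MemLie c (r • x ^ k : Mat c ℂ)) : r • x ^ k = 0 := by
  have h1 := hx.pow_mul_form hc k
  rw [hk.neg_one_pow, one_smul] at h1
  rw [memLie_iff hc, const_self, Matrix.transpose_smul, Matrix.smul_mul, Matrix.mul_smul, h1,
    ← two_smul ℂ] at h
  have h2 := (smul_eq_zero.1 h).resolve_left two_ne_zero
  obtain ⟨ε, hε, hJ⟩ := form_mul_self hc
  rw [← h1, ← Matrix.smul_mul] at h2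
  have h3 := congrArg (· * form c) h2
  simp only [mul_assoc, hJ, zero_mul] at h3
  rw [Matrix.mul_smul, mul_one] at h3
  exact (smul_eq_zero.1 h3).resolve_left hε

end Regular

section CanonicalSpace

variable {c : ClassicalType}

lemma twoRho_eq (c : ClassicalType) : ∃ κ : ℂ,
    twoRho c = Matrix.diagonal fun a => κ - 2 * (height c a : ℂ) := by
  cases c with
  | sl N => exact ⟨N - 1, rfl⟩
  | sp n => exact ⟨2 * n - 1, rfl⟩
  | soOdd n => exact ⟨2 * n, rfl⟩
  | soEven r =>
    refine ⟨2 * r - 2, congrArg Matrix.diagonal (funext fun a => ?_)⟩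
    simp only [Oper.height]
    split_ifs with h
    · rfl
    · have ha : 1 ≤ a.val ∨ r = 0 := by omega
      rcases ha with ha | ha
      · rw [Nat.cast_sub ha]
        push_cast
        ring
      · subst ha
        exact a.elim0

/-- Up to a scalar, `2ρ̌` is `-2` times the height, so its eigenspaces are the homogeneous matrices.
-/
theorem mem_canonicalSpace {i : ℕ} {x : Mat c ℂ} : x ∈ canonicalSpace c i ↔
    MemLie c x ∧ pPlus c * x = x * pPlus c ∧ HasDeg (height c) ((i : ℤ) - 1) x := by
  refine and_congr Iff.rfl (and_congr Iff.rfl ?_)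
  obtain ⟨κ, hκ⟩ := twoRho_eq c
  have h1 : ∀ a b, (twoRho c * x - x * twoRho c) a b
      = 2 * ((deg (height c) a b : ℤ) : ℂ) * x a b := by
    intro a b
    rw [Matrix.sub_apply, hκ, Matrix.diagonal_mul, Matrix.mul_diagonal]
    simp only [deg]
    push_cast
    ring
  constructor
  · intro h a b hab
    have h2 := congrFun (congrFun h a) b
    rw [h1, Matrix.smul_apply, smul_eq_mul, ← sub_eq_zero, ← sub_mul, ← mul_sub] at h2
    refine (mul_eq_zero.1 h2).resolve_left (mul_ne_zero two_ne_zero ?_)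
    rw [sub_ne_zero]
    intro h3
    exact hab (by exact_mod_cast h3)
  · intro h
    ext a b
    rw [h1, Matrix.smul_apply, smul_eq_mul]
    by_cases hab : deg (height c) a b = i - 1
    · rw [hab]
      push_cast
      ring
    · rw [h a b hab, mul_zero, mul_zero]

lemma IsCanonical.degComp_mem {w : Mat c ℂ} (h : IsCanonical c w) {i : ℕ} :
    degComp (height c) ((i : ℤ) - 1) w ∈ canonicalSpace c i :=
  mem_canonicalSpace.2 ⟨h.memLie.degComp _, degComp_comm h.comm', hasDeg_degComp⟩

lemma isCanonical_of_mem {i : ℕ} (hi : 2 ≤ i) {x : Mat c ℂ} (h : x ∈ canonicalSpace c i) :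
    IsCanonical c x := by
  obtain ⟨h1, h2, h3⟩ := mem_canonicalSpace.1 h
  exact ⟨h1, h3.degGE (by omega), by rwa [const_self]⟩

lemma Regular.exists_smul_pow (hr : Regular c) {k : ℕ} {x : Mat c ℂ}
    (hx : x ∈ canonicalSpace c (k + 1)) : ∃ r : ℂ, x = r • pPlus c ^ k := by
  obtain ⟨h1, h2, h3⟩ := mem_canonicalSpace.1 hx
  exact hr.eq_smul_pow (by simpa using h3) h2

theorem Regular.canonicalSpace_eq_span (hr : Regular c) {i : ℕ} (hi : 1 ≤ i) {q : Mat c ℂ}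
    (hq : q ∈ canonicalSpace c i) (hq0 : q ≠ 0) : canonicalSpace c i = Submodule.span ℂ {q} := by
  obtain ⟨k, rfl⟩ : ∃ k, i = k + 1 := ⟨i - 1, by omega⟩
  obtain ⟨s, hs⟩ := hr.exists_smul_pow hq
  have hs0 : s ≠ 0 := by
    rintro rfl
    exact hq0 (by rw [hs, zero_smul])
  refine le_antisymm (fun x hx => ?_) ((Submodule.span_singleton_le_iff_mem _ _).2 hq)
  obtain ⟨r, hr⟩ := hr.exists_smul_pow hx
  refine Submodule.mem_span_singleton.2 ⟨r * s⁻¹, ?_⟩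
  rw [hs, smul_smul, inv_mul_cancel_right₀ hs0, hr]

theorem Regular.canonicalSpace_eq_bot (hr : Regular c) {i : ℕ} (hi : c.size < i) :
    canonicalSpace c i = ⊥ := by
  refine (Submodule.eq_bot_iff _).2 fun x hx => ?_
  obtain ⟨h1, h2, h3⟩ := mem_canonicalSpace.1 hx
  refine (h3.degGE le_rfl).eq_zero fun a => ?_
  rw [hr.height_eq]
  have := a.isLt
  omega

theorem Regular.canonicalSpace_odd (hr : Regular c) (hc : HasForm c) {i : ℕ} (hi : Odd i) :
    canonicalSpace c i = ⊥ := by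
  refine (Submodule.eq_bot_iff _).2 fun x hx => ?_
  obtain ⟨k, rfl⟩ := hi
  obtain ⟨r, rfl⟩ := hr.exists_smul_pow hx
  exact hr.memLie_pPlus.smul_pow_eq_zero hc ⟨k, by ring⟩ (mem_canonicalSpace.1 hx).1

lemma Regular.pow_mem_canonicalSpace (hr : Regular c) (hc : HasForm c) {k : ℕ} (hk : Odd k) :
    pPlus c ^ k ∈ canonicalSpace c (k + 1) := by
  refine mem_canonicalSpace.2 ⟨hr.memLie_pPlus.pow hc hk, by rw [← pow_succ, ← pow_succ'], ?_⟩
  have := (pPlus_hasDeg c).pow k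
  simpa using this

end CanonicalSpace

end Oper

/-! ### Canonical elements of `𝔰𝔬_{2n+2}` and the Pfaffian -/

namespace Oper

noncomputable section

open ClassicalType

variable {n : ℕ}

/-- A section of `fold`. -/
def unfold (i : Fin (soOdd n).size) : Fin (soEven (n + 1)).size :=
  ⟨if i.val ≤ n then i.val else i.val + 1, by
    have hi : i.val < 2 * n + 1 := i.isLt
    change _ < 2 * (n + 1)
    split_ifs <;> omega⟩

lemma fold_unfold (i : Fin (soOdd n).size) : fold (unfold i) = i := by
  refine Fin.ext ?_
  simp only [fold, unfold, Oper.height]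
  split_ifs <;> omega

/-- The two indices of weight `0`. -/
def midL (n : ℕ) : Fin (soEven (n + 1)).size := ⟨n, show n < 2 * (n + 1) by omega⟩

/-- The two indices of weight `0`. -/
def midR (n : ℕ) : Fin (soEven (n + 1)).size := ⟨n + 1, show n + 1 < 2 * (n + 1) by omega⟩

lemma midL_ne_midR : midL n ≠ midR n := fun h => by
  have := Fin.ext_iff.1 h
  simp [midL, midR] at this

lemma rev_midL : (midL n).rev = midR n := Fin.ext (by
  have h1 : (midL n).rev.val = 2 * (n + 1) - (n + 1) := Fin.val_rev _
  rw [h1]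
  simp only [midR]
  omega)

lemma rev_midR : (midR n).rev = midL n := by rw [← rev_midL, Fin.rev_rev]

lemma height_midL : height (soEven (n + 1)) (midL n) = n := if_pos (show n < n + 1 by omega)

lemma height_midR : height (soEven (n + 1)) (midR n) = n := if_neg (show ¬ n + 1 < n + 1 by omega)

lemma eq_mid {a : Fin (soEven (n + 1)).size} (h : height (soEven (n + 1)) a = n) :
    a = midL n ∨ a = midR n := by
  have hx := height_soEven a
  by_cases h1 : a.val = n
  · exact Or.inl (Fin.ext h1)
  · exact Or.inr (Fin.ext (show a.val = n + 1 by omega))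

lemma eq_of_height_eq {a b : Fin (soEven (n + 1)).size}
    (h : height (soEven (n + 1)) a = height (soEven (n + 1)) b)
    (hn : height (soEven (n + 1)) a ≠ n) : a = b := by
  have hx := height_soEven a
  have hy := height_soEven b
  exact Fin.ext (by omega)

lemma unfold_fold (a : Fin (soEven (n + 1)).size) :
    unfold (fold a) = a ∨ (unfold (fold a) = midL n ∧ a = midR n) := by
  have ha : a.val < 2 * (n + 1) := a.isLt
  by_cases h : a.val = n + 1
  · refine Or.inr ⟨Fin.ext ?_, Fin.ext h⟩
    simp only [fold, unfold, Oper.height, midL]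
    split_ifs <;> omega
  · refine Or.inl (Fin.ext ?_)
    simp only [fold, unfold, Oper.height]
    split_ifs <;> omega

lemma inclCoeff_ne_zero (a : ℕ) : inclCoeff n a ≠ 0 := by
  rw [inclCoeff]; split_ifs <;> norm_num

lemma projCoeff_ne_zero (a : ℕ) : projCoeff n a ≠ 0 := by
  rw [projCoeff]; split_ifs <;> norm_num

section Reflect

variable {R : Type} [CommRing R] [Algebra ℂ R]

lemma soInclusion_unfold (X : Mat (soOdd n) R) (i j : Fin (soOdd n).size) :
    soInclusion n X (unfold i) (unfold j)
      = algebraMap ℂ R (inclCoeff n (unfold i).val * projCoeff n (unfold j).val) * X i j := by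
  rw [soInclusion_apply, fold_unfold, fold_unfold]

lemma eq_zero_of_soInclusion {X : Mat (soOdd n) R} {i j : Fin (soOdd n).size}
    (h : soInclusion n X (unfold i) (unfold j) = 0) : X i j = 0 := by
  rw [soInclusion_unfold] at h
  have h1 : IsUnit (algebraMap ℂ R (inclCoeff n (unfold i).val * projCoeff n (unfold j).val)) :=
    (isUnit_iff_ne_zero.2 (mul_ne_zero (inclCoeff_ne_zero _) (projCoeff_ne_zero _))).map _
  exact h1.mul_right_eq_zero.1 h

lemma deg_unfold (i j : Fin (soOdd n).size) :
    deg (height (soEven (n + 1))) (unfold i) (unfold j) = deg (height (soOdd n)) i j := by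
  have h : ∀ i : Fin (soOdd n).size, height (soEven (n + 1)) (unfold i) = height (soOdd n) i :=
    fun i => congrArg Fin.val (fold_unfold i)
  simp only [deg, h]

lemma degGE_of_soInclusion {X : Mat (soOdd n) R} {k : ℤ}
    (h : DegGE (height (soEven (n + 1))) k (soInclusion n X)) : DegGE (height (soOdd n)) k X :=
  fun i j hij => eq_zero_of_soInclusion (h _ _ (by rwa [deg_unfold]))

lemma hasDeg_of_soInclusion {X : Mat (soOdd n) R} {k : ℤ}
    (h : HasDeg (height (soEven (n + 1))) k (soInclusion n X)) : HasDeg (height (soOdd n)) k X :=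
  fun i j hij => eq_zero_of_soInclusion (h _ _ (by rwa [deg_unfold]))

lemma memLie_of_soInclusion {X : Mat (soOdd n) R}
    (h : MemLie (soEven (n + 1)) (soInclusion n X)) : MemLie (soOdd n) X := by
  have h0 := (memLie_apply (c := soEven (n + 1)) trivial).1 h
  refine (memLie_apply (c := soOdd n) trivial).2 fun i j => ?_
  have h1 := h0 (unfold i) (unfold j)
  rw [soInclusion_apply, soInclusion_apply, form_soEven_symm, form_soEven_rev, form_soEven_rev,
    projCoeff_rev, projCoeff_rev, fold_rev, fold_rev, fold_unfold, fold_unfold] at h1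
  rw [form_soOdd_symm]
  have h2 : IsUnit (algebraMap ℂ R (inclCoeff n (unfold i).val * inclCoeff n (unfold j).val / 2)) :=
    (isUnit_iff_ne_zero.2 (div_ne_zero (mul_ne_zero (inclCoeff_ne_zero _) (inclCoeff_ne_zero _))
      two_ne_zero)).map _
  refine h2.mul_right_eq_zero.1 ?_
  simp only [map_mul, map_neg, div_eq_mul_inv] at h1 ⊢
  linear_combination -h1

lemma soInclusion_pow_succ (X : Mat (soOdd n) R) (k : ℕ) :
    soInclusion n (X ^ (k + 1)) = soInclusion n X ^ (k + 1) := by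
  induction k with
  | zero => rw [zero_add, pow_one, pow_one]
  | succ k ih => rw [pow_succ, soInclusion_mul, ih, ← pow_succ]

lemma isNilpotent_soInclusion {X : Mat (soOdd n) R} :
    IsNilpotent (soInclusion n X) ↔ IsNilpotent X := by
  constructor
  · rintro ⟨k, hk⟩
    refine ⟨k + 1, soInclusion_injective ?_⟩
    rw [soInclusion_pow_succ, pow_succ, hk, zero_mul, soInclusion_zero]
  · rintro ⟨k, hk⟩
    refine ⟨k + 1, ?_⟩
    rw [← soInclusion_pow_succ, pow_succ, hk, zero_mul, soInclusion_zero]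

lemma const_soInclusion_pMinus_add (X : Mat (soOdd n) R) :
    const R (pMinus (soEven (n + 1))) + soInclusion n X
      = soInclusion n (const R (pMinus (soOdd n)) + X) := by
  rw [soInclusion_add, soInclusion_const, soInclusion_pMinus]

lemma isCanonical_soInclusion {v : Mat (soOdd n) R} (h : IsCanonical (soOdd n) v) :
    IsCanonical (soEven (n + 1)) (soInclusion n v) := by
  refine ⟨soInclusion_memLie h.memLie, soInclusion_degGE h.degGE, ?_⟩
  rw [← soInclusion_pPlus, ← soInclusion_const, ← soInclusion_mul, ← soInclusion_mul, h.comm]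

end Reflect

section Canonical

variable {w : Mat (soEven (n + 1)) ℂ}

/-- The two weight zero columns of `p₁` are equal, so those of `p₁ w = w p₁` are too; this reaches
every row except the top one. There the difference of the two entries is the Pfaffian coordinate. -/
lemma IsCanonical.midL_eq_midR (hw : IsCanonical (soEven (n + 1)) w)
    {a : Fin (soEven (n + 1)).size} (ha : height (soEven (n + 1)) a ≠ 0) :
    w a (midL n) = w a (midR n) := by
  by_cases han : n ≤ height (soEven (n + 1)) a
  · rw [hw.degGE a _ (by simp only [deg, height_midL]; omega),
      hw.degGE a _ (by simp only [deg, height_midR]; omega)]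
  · obtain ⟨p, hp⟩ := exists_height_pred _ a ha
    have h1 : ∀ b, (pPlus (soEven (n + 1)) * w) p b
        = plusCoeff (soEven (n + 1)) (height (soEven (n + 1)) p) * w a b := by
      intro b
      rw [Matrix.mul_apply, Finset.sum_eq_single a, pPlus_apply, if_pos hp]
      · intro z _ hz
        rw [pPlus_apply, if_neg, zero_mul]
        intro h
        exact hz (eq_of_height_eq (h.trans hp.symm) (by omega))
      · simp
    have h2 : (w * pPlus (soEven (n + 1))) p (midL n) = (w * pPlus (soEven (n + 1))) p (midR n) := by
      rw [Matrix.mul_apply, Matrix.mul_apply]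
      refine Finset.sum_congr rfl fun z _ => ?_
      rw [pPlus_apply, pPlus_apply, height_midL, height_midR]
    rw [← hw.comm', h1, h1] at h2
    have h3 : plusCoeff (soEven (n + 1)) (height (soEven (n + 1)) p) ≠ 0 :=
      (plusCoeff_pos _ (a := a) (by omega)).ne'
    exact mul_left_cancel₀ (Complex.ofReal_ne_zero.2 h3) h2

lemma form_midL : form (soEven (n + 1)) (midL n) (midR n) = form (soEven (n + 1)) (midR n) (midL n) := by
  have := form_soEven_symm (midL n)
  rw [rev_midL] at this
  exact this.symm

/-- Skewness exchanges rows and columns, and so turns the statement on the middle columns into one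
on the middle rows. -/
lemma MemLie.mid_sub (hw : MemLie (soEven (n + 1)) w) (b : Fin (soEven (n + 1)).size) :
    (w (midL n) b - w (midR n) b) * form (soEven (n + 1)) b b.rev
      = form (soEven (n + 1)) (midL n) (midR n) * (w b.rev (midL n) - w b.rev (midR n)) := by
  have h0 := (memLie_apply (c := soEven (n + 1)) trivial).1 hw
  have h1 := h0 (midL n) b.rev
  have h2 := h0 (midR n) b.rev
  rw [Fin.rev_rev, rev_midL] at h1
  rw [Fin.rev_rev, rev_midR, ← form_midL] at h2
  simp only [Algebra.algebraMap_self, RingHom.id_apply] at h1 h2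
  linear_combination h1 - h2

lemma IsCanonical.row_midL_eq_midR (hw : IsCanonical (soEven (n + 1)) w)
    {b : Fin (soEven (n + 1)).size} (hb : w b.rev (midL n) = w b.rev (midR n)) :
    w (midL n) b = w (midR n) b := by
  have h1 := hw.memLie.mid_sub b
  rw [hb, sub_self, mul_zero] at h1
  exact sub_eq_zero.1 ((mul_eq_zero.1 h1).resolve_right
    (form_rev_ne_zero (c := soEven (n + 1)) trivial b))

/-- A canonical element without Pfaffian part comes from `𝔰𝔬_{2n+1}`. -/
theorem IsCanonical.exists_soInclusion (hw : IsCanonical (soEven (n + 1)) w)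
    (h0 : ∀ a, height (soEven (n + 1)) a = 0 → w a (midL n) = w a (midR n)) :
    ∃ y : Mat (soOdd n) ℂ, IsCanonical (soOdd n) y ∧ w = soInclusion n y := by
  have hcol : ∀ a, w a (midL n) = w a (midR n) := fun a => by
    by_cases h : height (soEven (n + 1)) a = 0
    · exact h0 a h
    · exact hw.midL_eq_midR h
  have hrow : ∀ b, w (midL n) b = w (midR n) b := fun b => hw.row_midL_eq_midR (hcol _)
  have hcoef : ∀ a : Fin (soEven (n + 1)).size, inclCoeff n (unfold (fold a)).val = inclCoeff n a.val ∧
      projCoeff n (unfold (fold a)).val = projCoeff n a.val := by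
    intro a
    rcases unfold_fold a with h | ⟨h1, h2⟩
    · rw [h]; exact ⟨rfl, rfl⟩
    · rw [h1, h2]
      simp [inclCoeff, projCoeff, midL, midR]
  have hfold : ∀ a b, w (unfold (fold a)) (unfold (fold b)) = w a b := by
    intro a b
    have h1 : ∀ x, w x (unfold (fold b)) = w x b := by
      intro x
      rcases unfold_fold b with h | ⟨h1, h2⟩
      · rw [h]
      · rw [h1, h2, hcol]
    rw [h1]
    rcases unfold_fold a with h | ⟨h1, h2⟩
    · rw [h]
    · rw [h1, h2, hrow]
  let y : Mat (soOdd n) ℂ := Matrix.of fun i j => w (unfold i) (unfold j) *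
    (inclCoeff n (unfold i).val * projCoeff n (unfold j).val)⁻¹
  have hy : w = soInclusion n y := by
    ext a b
    rw [soInclusion_apply]
    simp only [y, Matrix.of_apply]
    rw [hfold, (hcoef a).1, (hcoef b).2]
    change _ = (inclCoeff n a.val * projCoeff n b.val) * _
    rw [mul_comm, inv_mul_cancel_right₀ (mul_ne_zero (inclCoeff_ne_zero _) (projCoeff_ne_zero _))]
  refine ⟨y, ⟨memLie_of_soInclusion (hy ▸ hw.memLie), degGE_of_soInclusion (hy ▸ hw.degGE),
    soInclusion_injective ?_⟩, hy⟩
  rw [soInclusion_mul, soInclusion_mul, soInclusion_const, soInclusion_pPlus, ← hy, hw.comm]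

lemma not_isNilpotent_of_injective {ι : Type} [Fintype ι] [DecidableEq ι] [Nonempty ι]
    {X : Matrix ι ι ℂ} (h : ∀ z : ι → ℂ, X.mulVec z = 0 → z = 0) : ¬ IsNilpotent X := by
  rintro ⟨k, hk⟩
  have h1 : ∀ k : ℕ, ∀ z : ι → ℂ, (X ^ k).mulVec z = 0 → z = 0 := by
    intro k
    induction k with
    | zero => intro z hz; simpa using hz
    | succ k ih =>
      intro z hz
      rw [pow_succ', ← Matrix.mulVec_mulVec] at hz
      exact ih z (h _ hz)
  have h2 := h1 k 1 (by rw [hk, Matrix.zero_mulVec])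
  exact one_ne_zero h2

/-- Without Pfaffian part, `w` comes from `𝔰𝔬_{2n+1}`, where the slice property is known. With
nonzero Pfaffian part, `p₋₁ + w` is shown to have trivial kernel, hence is not nilpotent. -/
theorem nilpotentSlice_soEven (hn : 0 < n) : NilpotentSlice (soEven (n + 1)) := by
  intro w hw hnil
  by_cases h0 : ∀ a, height (soEven (n + 1)) a = 0 → w a (midL n) = w a (midR n)
  · obtain ⟨y, hy, rfl⟩ := hw.exists_soInclusion h0
    have h1 := const_soInclusion_pMinus_add (R := ℂ) y
    rw [const_self, const_self] at h1
    rw [h1, isNilpotent_soInclusion] at hnil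
    rw [Regular.slice_eq_zero (c := soOdd n) trivial hy.degGE hy.comm' hnil, soInclusion_zero]
  exfalso
  push Not at h0
  obtain ⟨s, hs, hs0⟩ := h0
  have : Nonempty (Fin (soEven (n + 1)).size) := ⟨s⟩
  refine not_isNilpotent_of_injective (fun z hz => ?_) hnil
  have hX : ∀ a, ∑ b, pMinus (soEven (n + 1)) a b * z b + ∑ b, w a b * z b = 0 := by
    intro a
    have h1 := congrFun hz a
    rw [Matrix.add_mulVec] at h1
    exact h1
  -- Outside the top row, `w` sees the two middle coordinates of `z` only through their sum, so its
  -- contribution vanishes once all coordinates of larger height are controlled.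
  have hsum : ∀ h : ℕ, (∀ b, h < height (soEven (n + 1)) b →
      height (soEven (n + 1)) b ≠ n → z b = 0) → (h < n → z (midL n) + z (midR n) = 0) →
      ∀ a, height (soEven (n + 1)) a = h → h ≠ 0 → ∑ b, w a b * z b = 0 := by
    intro h h1 h2 a ha hh
    rw [Finset.sum_eq_add (midL n) (midR n) midL_ne_midR, hw.midL_eq_midR (by omega), ← mul_add]
    · by_cases hhn : h < n
      · rw [h2 hhn, mul_zero]
      · rw [hw.degGE a _ (by simp only [deg, height_midR]; omega), zero_mul]
    · rintro b _ ⟨hb1, hb2⟩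
      by_cases hb : h < height (soEven (n + 1)) b
      · rw [h1 b hb, mul_zero]
        intro h3
        rcases eq_mid h3 with h4 | h4
        · exact hb1 h4
        · exact hb2 h4
      · rw [hw.degGE a b (by simp only [deg]; omega), zero_mul]
    · simp
    · simp
  -- Subtract the two middle rows of the system: those of `p₋₁` agree, and those of `w` differ only
  -- in the last column, by a nonzero multiple of the Pfaffian coordinate.
  have hlast : z s.rev = 0 := by
    have h1 := hX (midL n)
    have h2 := hX (midR n)
    have h3 : ∑ b, pMinus (soEven (n + 1)) (midL n) b * z b
        = ∑ b, pMinus (soEven (n + 1)) (midR n) b * z b := by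
      refine Finset.sum_congr rfl fun b _ => ?_
      rw [pMinus_apply, pMinus_apply, height_midL, height_midR]
    have h4 : ∑ b, w (midL n) b * z b - ∑ b, w (midR n) b * z b
        = (w (midL n) s.rev - w (midR n) s.rev) * z s.rev := by
      rw [← Finset.sum_sub_distrib, Finset.sum_eq_single s.rev, sub_mul]
      · intro b _ hb
        rw [hw.row_midL_eq_midR, sub_self]
        refine hw.midL_eq_midR fun h5 => hb ?_
        have h6 := eq_of_height_eq (h5.trans hs.symm) (by omega)
        rw [← h6, Fin.rev_rev]
      · simp
    have h5 : (w (midL n) s.rev - w (midR n) s.rev) * z s.rev = 0 := by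
      rw [← h4]
      linear_combination h1 - h2 - h3
    refine (mul_eq_zero.1 h5).resolve_left fun h6 => hs0 ?_
    have h7 := hw.memLie.mid_sub s.rev
    rw [h6, zero_mul, Fin.rev_rev] at h7
    refine sub_eq_zero.1 ((mul_eq_zero.1 h7.symm).resolve_left ?_)
    rw [← rev_midL]
    exact form_rev_ne_zero (c := soEven (n + 1)) trivial _
  obtain ⟨σ, hσ⟩ := height_add_rev (soEven (n + 1))
  have hσ' : σ = 2 * n := by
    have := hσ (midL n)
    rw [rev_midL, height_midL, height_midR] at this
    omega
  -- Descending induction on the height `h = 2n - d`: a row of height `h + 1` of the system gives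
  -- the sum of the coordinates of height `h`. This is a single coordinate unless `h = n`, where
  -- only the sum is obtained.
  have hdown : ∀ d h : ℕ, h + d = 2 * n → (∀ b, h ≤ height (soEven (n + 1)) b →
      height (soEven (n + 1)) b ≠ n → z b = 0) ∧ (h ≤ n → z (midL n) + z (midR n) = 0) := by
    intro d
    induction d with
    | zero =>
      intro h hh
      refine ⟨fun b hb hbn => ?_, fun h1 => by omega⟩
      have h1 : b = s.rev := by
        refine eq_of_height_eq ?_ hbn
        have := hσ b
        have := hσ s
        omega
      rw [h1, hlast]
    | succ d ih =>
      intro h hh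
      obtain ⟨ih1, ih2⟩ := ih (h + 1) (by omega)
      have hnew : ∀ b, height (soEven (n + 1)) b = h →
          ∑ b', (if height (soEven (n + 1)) b' = h then z b' else 0) = 0 := by
        intro b hb
        have ha : ∃ a, height (soEven (n + 1)) a = h + 1 := by
          have h1 := hσ b
          obtain ⟨p, hp⟩ := exists_height_pred _ b.rev (by omega)
          exact ⟨p.rev, by have := hσ p; omega⟩
        obtain ⟨a, ha⟩ := ha
        have h1 := hX a
        rw [hsum (h + 1) (fun b hb => ih1 b (by omega)) (fun h => ih2 (by omega)) a ha (by omega),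
          add_zero] at h1
        refine Eq.trans (Finset.sum_congr rfl fun b' _ => ?_) h1
        rw [pMinus_apply, ha]
        by_cases hb' : height (soEven (n + 1)) b' = h
        · rw [if_pos hb', if_pos (by omega), one_mul]
        · rw [if_neg hb', if_neg (by omega), zero_mul]
      constructor
      · intro b hb hbn
        by_cases hb' : height (soEven (n + 1)) b = h
        · have h1 := hnew b hb'
          rwa [Finset.sum_eq_single b, if_pos hb'] at h1
          · intro b' _ hbb
            rw [if_neg]
            intro h2
            exact hbb (eq_of_height_eq (h2.trans hb'.symm) (by omega))
          · simp
        · exact ih1 b (by omega) hbn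
      · intro hle
        by_cases hhn : h = n
        · have h1 := hnew (midL n) (by rw [height_midL, hhn])
          rwa [Finset.sum_eq_add (midL n) (midR n) midL_ne_midR, height_midL, height_midR,
            if_pos hhn.symm, if_pos hhn.symm] at h1
          · rintro b _ ⟨hb1, hb2⟩
            rw [if_neg]
            intro h2
            rcases eq_mid (h2.trans hhn) with h4 | h4
            · exact hb1 h4
            · exact hb2 h4
          · simp
          · simp
        · exact ih2 (by omega)
  obtain ⟨hz1, hz2⟩ := hdown (2 * n) 0 (by omega)
  -- The top row separates the two middle coordinates, because its two entries differ.
  have hzL : z (midL n) = 0 := by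
    have h1 := hX s
    rw [Finset.sum_eq_zero, zero_add, Finset.sum_eq_add (midL n) (midR n) midL_ne_midR] at h1
    · have h2 : (w s (midL n) - w s (midR n)) * z (midL n) = 0 := by
        linear_combination h1 - w s (midR n) * hz2 (by omega)
      exact (mul_eq_zero.1 h2).resolve_left (sub_ne_zero.2 hs0)
    · rintro b _ ⟨hb1, hb2⟩
      rw [hz1 b (by omega), mul_zero]
      intro h2
      rcases eq_mid h2 with h4 | h4
      · exact hb1 h4
      · exact hb2 h4
    · simp
    · simp
    · intro b _
      rw [pMinus_apply, if_neg (by omega), zero_mul]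
  funext b
  by_cases hb : height (soEven (n + 1)) b = n
  · rcases eq_mid hb with h4 | h4
    · rw [h4, hzL]; rfl
    · have := hz2 (by omega)
      rw [hzL, zero_add] at this
      rw [h4, this]; rfl
  · exact hz1 b (by omega) hb

/-- In large degrees the canonical elements come from `𝔰𝔬_{2n+1}`. -/
theorem canonicalSpace_soEven {i : ℕ} (hi : n + 1 < i) {x : Mat (soEven (n + 1)) ℂ}
    (hx : x ∈ canonicalSpace (soEven (n + 1)) i) :
    ∃ y ∈ canonicalSpace (soOdd n) i, x = soInclusion n y := by
  have hdeg := (mem_canonicalSpace.1 hx).2.2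
  obtain ⟨y, hy, rfl⟩ := (isCanonical_of_mem (by omega) hx).exists_soInclusion fun a ha => by
    rw [hdeg a _ (by simp only [deg, height_midL]; omega),
      hdeg a _ (by simp only [deg, height_midR]; omega)]
  exact ⟨y, mem_canonicalSpace.2 ⟨hy.memLie, hy.comm', hasDeg_of_soInclusion hdeg⟩, rfl⟩

lemma soInclusion_mem_canonicalSpace {i : ℕ} {y : Mat (soOdd n) ℂ}
    (hy : y ∈ canonicalSpace (soOdd n) i) :
    soInclusion n y ∈ canonicalSpace (soEven (n + 1)) i := by
  obtain ⟨h1, h2, h3⟩ := mem_canonicalSpace.1 hy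
  refine mem_canonicalSpace.2 ⟨soInclusion_memLie h1, ?_, soInclusion_hasDeg h3⟩
  rw [← soInclusion_pPlus, ← soInclusion_mul, ← soInclusion_mul, h2]

end Canonical

end

end Oper

/-! ### The maps `λ ↦ ∇(λ)` -/

namespace Oper

noncomputable section

open ClassicalType

section NablaMap

variable {c : ClassicalType}

lemma IsCanonical.zero {R : Type} [CommRing R] [Algebra ℂ R] : IsCanonical c (0 : Mat c R) :=
  ⟨MemLie.zero, DegGE.zero, by rw [mul_zero, zero_mul]⟩

lemma IsCanonical.add {R : Type} [CommRing R] [Algebra ℂ R] {v w : Mat c R}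
    (hv : IsCanonical c v) (hw : IsCanonical c w) : IsCanonical c (v + w) :=
  ⟨hv.memLie.add hw.memLie, hv.degGE.add hw.degGE, by rw [mul_add, add_mul, hv.comm, hw.comm]⟩

lemma IsCanonical.sum {κ : Type} (s : Finset κ) {F : κ → Mat c ℂ}
    (h : ∀ i ∈ s, IsCanonical c (F i)) : IsCanonical c (∑ i ∈ s, F i) := by
  classical
  induction s using Finset.induction_on with
  | empty => exact IsCanonical.zero
  | insert i s hi ih =>
    rw [Finset.sum_insert hi]
    exact (h i (Finset.mem_insert_self i s)).add
      (ih fun j hj => h j (Finset.mem_insert_of_mem hj))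

lemma nabla_eq_conn {k : ℕ} (q : Fin k → Mat c ℂ) (l : Fin k → ℂ) :
    nabla c q l = conn c (tConst (∑ j, l j • q j)) := by
  rw [nabla, conn, tConst, smul_add, smul_smul, T_neg_one_mul, one_smul]

variable {k : ℕ} {q : Fin k → Mat c ℂ} {idx : Fin k → ℕ}

lemma isCanonical_sum_smul (h2 : ∀ j, 2 ≤ idx j) (hq : ∀ j, q j ∈ canonicalSpace c (idx j))
    (l : Fin k → ℂ) : IsCanonical c (∑ j, l j • q j) :=
  IsCanonical.sum _ fun j _ => (isCanonical_of_mem (h2 j) (hq j)).smul (l j)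

lemma degGE_sum_smul {d : ℕ} (hd : ∀ j, d ≤ idx j) (hq : ∀ j, q j ∈ canonicalSpace c (idx j))
    (l : Fin k → ℂ) : DegGE (height c) ((d : ℤ) - 1) (∑ j, l j • q j) := by
  refine Finset.sum_induction _ (DegGE (height c) ((d : ℤ) - 1)) (fun _ _ => DegGE.add)
    DegGE.zero fun j _ => ?_
  have := hd j
  exact ((mem_canonicalSpace.1 (hq j)).2.2.degGE (by omega)).smul _

lemma degComp_sum_smul
    (hq : ∀ j, q j ∈ canonicalSpace c (idx j)) (l : Fin k → ℂ) (i : ℕ) :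
    degComp (height c) ((i : ℤ) - 1) (∑ j, l j • q j) =
      ∑ j, if idx j = i then l j • q j else 0 := by
  have h1 : ∀ s : Finset (Fin k), degComp (height c) ((i : ℤ) - 1) (∑ j ∈ s, l j • q j) =
      ∑ j ∈ s, if idx j = i then l j • q j else 0 := by
    intro s
    induction s using Finset.induction_on with
    | empty => exact HasDeg.zero.degComp_eq
    | insert j s hj ih =>
      rw [Finset.sum_insert hj, Finset.sum_insert hj, degComp_add, ih]
      congr 1
      have h := (mem_canonicalSpace.1 (hq j)).2.2.smul (l j)
      split_ifs with hji
      · rw [← hji]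
        exact h.degComp_eq
      · exact h.degComp_ne (by omega)
  exact h1 _

/-- The connections `∂_t + t⁻¹ p₋₁ + ∑ λ_j q_j` give opers with residue `ϖ(0)` at `0` and slope
at most `1/d` at `∞`, injectively; when `2d` exceeds all degrees and the `q_j` span the relevant
canonical elements, every such oper arises. -/
theorem exists_nablaMap (P : Principal c) (hN : NilpotentSlice c) {d : ℕ} (hd2 : 2 ≤ d)
    (hidx : Function.Injective idx) (hd : ∀ j, d ≤ idx j)
    (hq : ∀ j, q j ∈ canonicalSpace c (idx j)) (hq0 : ∀ j, q j ≠ 0) :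
    ∃ x : (Fin k → ℂ) → OperSpace c d, IsNablaMap c d q x ∧ Function.Injective x ∧
      ((∀ a b : Fin c.size, deg (height c) a b + 1 < 2 * d) →
        (∀ j, canonicalSpace c (idx j) ≤ Submodule.span ℂ {q j}) →
        (∀ i, d ≤ i → (∀ j, idx j ≠ i) → canonicalSpace c i = ⊥) → Function.Surjective x) := by
  have hcan := isCanonical_sum_smul (fun j => hd2.trans (hd j)) hq
  refine ⟨fun l => ⟨toOper (P.operConn (hcan l).tConst),
    P.tConst_mem hN (by omega) (hcan l) (degGE_sum_smul hd hq l)⟩, fun l => ?_, ?_, ?_⟩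
  · exact ⟨P.operConn (hcan l).tConst, (nabla_eq_conn q l).symm, rfl⟩
  · intro l l' h
    have h1 := P.tConst_injective (hcan l) (hcan l') (congrArg Subtype.val h)
    funext j
    have h2 := congrArg (degComp (height c) ((idx j : ℤ) - 1)) h1
    rw [degComp_sum_smul hq, degComp_sum_smul hq, Finset.sum_eq_single j,
      Finset.sum_eq_single j, if_pos rfl, if_pos rfl] at h2
    · exact smul_left_injective ℂ (hq0 j) h2
    all_goals simp +contextual [hidx.eq_iff]
  · rintro hmax hspan hbot ⟨y, hy⟩
    obtain ⟨w, hw, hwd, rfl⟩ := P.exists_tConst hN (by omega) hmax hy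
    have h1 : ∀ j, ∃ r : ℂ, degComp (height c) ((idx j : ℤ) - 1) w = r • q j := by
      intro j
      obtain ⟨r, hr⟩ := Submodule.mem_span_singleton.1 (hspan j hw.degComp_mem)
      exact ⟨r, hr.symm⟩
    choose r hr using h1
    refine ⟨r, Subtype.ext ?_⟩
    -- Compared degree by degree: below `d - 1` both sides vanish, in the degrees of the `q_j` the
    -- span hypothesis applies, and in all others the canonical space is zero.
    have hwr : w = ∑ j, r j • q j := by
      rw [← sub_eq_zero]
      refine eq_zero_of_degComp (ht := height c) fun e => ?_
      by_cases he : e < (d : ℤ) - 1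
      · exact (hwd.sub (degGE_sum_smul hd hq r)).degComp_lt he
      · obtain ⟨i, rfl⟩ : ∃ i : ℕ, e = (i : ℤ) - 1 := ⟨(e + 1).toNat, by omega⟩
        rw [degComp_sub, degComp_sum_smul hq, sub_eq_zero]
        by_cases hi : ∃ j, idx j = i
        · obtain ⟨j, rfl⟩ := hi
          rw [Finset.sum_eq_single j, if_pos rfl, hr]
          · intro b _ hb
            rw [if_neg fun h3 => hb (hidx h3)]
          · simp
        · push Not at hi
          have h2 := hw.degComp_mem (i := i)
          rw [hbot i (by omega) hi, Submodule.mem_bot] at h2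
          rw [h2, Finset.sum_eq_zero fun j _ => if_neg (hi j)]
    subst hwr
    rfl

/-- The value of a map of the form `λ ↦ ∇(λ)` is determined by the matrix of the connection. -/
lemma IsNablaMap.eq_of_nabla_eq {d : ℕ} {x : (Fin k → ℂ) → OperSpace c d}
    (hx : IsNablaMap c d q x) {l : Fin k → ℂ} {A : OperConn c} (hA : A.1 = nabla c q l) :
    (x l).1 = toOper A := by
  obtain ⟨A', h1, h2⟩ := hx l
  rw [h2, Subtype.ext (h1.trans hA.symm)]

/-- Pushout takes `∇(λ)` to `∇(λ')` when it does so for the matrices. -/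
lemma IsPushout.apply_nabla {c' : ClassicalType} {d k' : ℕ} {q' : Fin k' → Mat c' ℂ}
    {φ : Mat c ℂ[T;T⁻¹] → Mat c' ℂ[T;T⁻¹]} {ι : OperSpace c d → OperSpace c' d}
    (hι : IsPushout c c' d φ ι) {x : (Fin k → ℂ) → OperSpace c d} (hx : IsNablaMap c d q x)
    {y : (Fin k' → ℂ) → OperSpace c' d} (hy : IsNablaMap c' d q' y) {l : Fin k → ℂ}
    {l' : Fin k' → ℂ} (h : φ (nabla c q l) = nabla c' q' l') : ι (x l) = y l' := by
  obtain ⟨A, hA, hxA⟩ := hx l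
  obtain ⟨A', hA', hιA⟩ := hι A (hxA ▸ (x l).2)
  have h1 : x l = ⟨toOper A, hxA ▸ (x l).2⟩ := Subtype.ext hxA
  refine Subtype.ext ?_
  rw [h1, hιA, hy.eq_of_nabla_eq (hA'.trans (by rw [hA, h]))]

end NablaMap

end

end Oper

/-! ### Pushout of opers along an embedding -/

namespace Oper

noncomputable section

open ClassicalType

section Pushout

/-- A natural linear map of matrix Lie algebras compatible with everything that enters the
definition of opers. -/
structure IsEmbedding (c c' : ClassicalType)
    (φ : ∀ {R : Type} [CommRing R] [Algebra ℂ R], Mat c R → Mat c' R) : Prop where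
  memLie : ∀ {R : Type} [CommRing R] [Algebra ℂ R] {X : Mat c R}, MemLie c X → MemLie c' (φ X)
  operForm : ∀ {R : Type} [CommRing R] [Algebra ℂ R] {X : Mat c R},
    IsOperForm c X → IsOperForm c' (φ X)
  borel : ∀ {R : Type} [CommRing R] [Algebra ℂ R] (D : AlgDer R) {g : GL (Fin c.size) R}
    {A A' : Mat c R}, MemLie c A → MemLie c A' → MemBorel c g → Gauge D g A A' →
    ∃ g' : GL (Fin c'.size) R, MemBorel c' g' ∧ Gauge D g' (φ A) (φ A')
  group : ∀ {R : Type} [CommRing R] [Algebra ℂ R] (D : AlgDer R) {g : GL (Fin c.size) R}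
    {A A' : Mat c R}, MemLie c A → MemLie c A' → MemGroup c g → Gauge D g A A' →
    ∃ g' : GL (Fin c'.size) R, MemGroup c' g' ∧ Gauge D g' (φ A) (φ A')
  map : ∀ {R S : Type} [CommRing R] [Algebra ℂ R] [CommRing S] [Algebra ℂ S] (f : R →ₐ[ℂ] S)
    (X : Mat c R), (φ X).map f = φ (X.map f)
  smul : ∀ {R : Type} [CommRing R] [Algebra ℂ R] (r : R) (X : Mat c R), φ (r • X) = r • φ X
  isNilpotent : ∀ {X : Mat c ℂ}, IsNilpotent (φ X) ↔ IsNilpotent X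
  isCanonical : ∀ {R : Type} [CommRing R] [Algebra ℂ R] {X : Mat c R},
    IsCanonical c X → IsCanonical c' (φ X)
  pMinus_add : ∀ {R : Type} [CommRing R] [Algebra ℂ R] (X : Mat c R),
    φ (const R (pMinus c) + X) = const R (pMinus c') + φ X
  injective : ∀ {R : Type} [CommRing R] [Algebra ℂ R],
    Function.Injective (φ : Mat c R → Mat c' R)

variable {c c' : ClassicalType} {φ : ∀ {R : Type} [CommRing R] [Algebra ℂ R], Mat c R → Mat c' R}

lemma pullback_eq (k : ℤ) (A : Mat c ℂ[T;T⁻¹]) : (pullback k A : Mat c ℂ⸨X⸩)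
    = (HahnSeries.single (k - 1) (k : ℂ) : ℂ⸨X⸩) • A.map (expandAlg k) := rfl

lemma polar_eq (a : ℕ) (M : Mat c ℂ⟦X⟧) : (polar a M : Mat c ℂ⸨X⸩)
    = (xPow (-((a : ℤ) + 1))).val • M.map seriesAlg := rfl

/-- The value at `0` as a homomorphism of algebras. -/
def constantCoeffAlg : ℂ⟦X⟧ →ₐ[ℂ] ℂ where
  __ := PowerSeries.constantCoeff (R := ℂ)
  commutes' r := PowerSeries.constantCoeff_C r

lemma atZero_eq (M : Mat c ℂ⟦X⟧) : (atZero M : Mat c ℂ) = M.map constantCoeffAlg := rfl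

lemma MemLie.pullback {A : Mat c ℂ[T;T⁻¹]} (h : MemLie c A) (k : ℤ) :
    MemLie c (pullback k A : Mat c ℂ⸨X⸩) :=
  (h.map_algHom (expandAlg k)).smul _

lemma MemLie.polar {M : Mat c ℂ⟦X⟧} (h : MemLie c M) (a : ℕ) : MemLie c (polar a M : Mat c ℂ⸨X⸩) :=
  (h.map_algHom seriesAlg).smul _

namespace IsEmbedding

variable (E : IsEmbedding c c' φ)
include E

lemma pullback (k : ℤ) (A : Mat c ℂ[T;T⁻¹]) :
    (Oper.pullback k (φ A) : Mat c' ℂ⸨X⸩) = φ (Oper.pullback k A : Mat c ℂ⸨X⸩) := by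
  rw [pullback_eq, pullback_eq, E.smul, E.map]

lemma polar (a : ℕ) (M : Mat c ℂ⟦X⟧) :
    (Oper.polar a (φ M) : Mat c' ℂ⸨X⸩) = φ (Oper.polar a M : Mat c ℂ⸨X⸩) := by
  rw [polar_eq, polar_eq, E.smul, E.map]

lemma atZero (M : Mat c ℂ⟦X⟧) : (Oper.atZero (φ M) : Mat c' ℂ) = φ (Oper.atZero M : Mat c ℂ) := by
  rw [atZero_eq, atZero_eq, E.map]

lemma regularResidueZero {A : Mat c ℂ[T;T⁻¹]} (hA : MemLie c A) (h : RegularResidueZero c A) :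
    RegularResidueZero c' (φ A) := by
  obtain ⟨g, M, hg, hM, hG, hn⟩ := h
  obtain ⟨g', hg', hG'⟩ := E.borel formalDer (hA.pullback 1) (hM.1.polar 0) hg hG
  refine ⟨g', φ M, hg', E.operForm hM, ?_, ?_⟩
  · rw [E.pullback, E.polar]
    exact hG'
  · rw [E.atZero]
    exact E.isNilpotent.2 hn

lemma isSlopeAtInfty {A : Mat c ℂ[T;T⁻¹]} (hA : MemLie c A) {q : ℚ} (h : IsSlopeAtInfty c A q) :
    IsSlopeAtInfty c' (φ A) q := by
  obtain ⟨a, b, hb, hq, g, M, hg, hM, hG, hn⟩ := h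
  obtain ⟨g', hg', hG'⟩ := E.group formalDer (hA.pullback _) (hM.polar a) hg hG
  refine ⟨a, b, hb, hq, g', φ M, hg', E.memLie hM, ?_, ?_⟩
  · rw [E.pullback, E.polar]
    exact hG'
  · rw [E.atZero]
    exact hn.imp_right fun h => ⟨h.1, fun h' => h.2 (E.isNilpotent.1 h')⟩

/-- The image of a connection of oper form. -/
def mapConn (A : OperConn c) : OperConn c' := ⟨φ A.1, E.operForm A.2⟩

/-- The image of an oper. -/
def mapOper : OperGm c → OperGm c' :=
  Quot.map E.mapConn fun A A' ⟨_, hg, hG⟩ => E.borel laurentDer A.2.1 A'.2.1 hg hG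

lemma mapOper_mem {d : ℕ} {x : OperGm c} (hx : x ∈ OperSpace c d) :
    E.mapOper x ∈ OperSpace c' d := by
  obtain ⟨A, rfl, hr, q, hq, hqd⟩ := hx
  exact ⟨E.mapConn A, rfl, E.regularResidueZero A.2.1 hr, q, E.isSlopeAtInfty A.2.1 hq, hqd⟩

/-- Canonical representatives go to canonical representatives, which are unique on the target; so
two opers with the same image have the same canonical matrix, by injectivity of `φ`. -/
lemma mapOper_injective (P : Principal c) (P' : Principal c') :
    Function.Injective E.mapOper := by
  have h1 : ∀ A : OperConn c, ∃ (v : Mat c ℂ[T;T⁻¹]) (h : IsCanonical c v),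
      toOper A = toOper (P.operConn h) ∧
        E.mapOper (toOper A) = toOper (P'.operConn (E.isCanonical h)) := by
    intro A
    obtain ⟨v, h, hA⟩ := P.exists_conn A
    refine ⟨v, h, hA, ?_⟩
    rw [hA]
    refine congrArg toOper (Subtype.ext ?_)
    change φ (conn c v) = conn c' (φ v)
    rw [conn, conn, E.smul, E.pMinus_add]
  rintro ⟨A⟩ ⟨A'⟩ h
  obtain ⟨v, hv, hA, hA1⟩ := h1 A
  obtain ⟨v', hv', hA', hA1'⟩ := h1 A'
  have h2 := P'.conn_injective _ _ (hA1.symm.trans (Eq.trans h hA1'))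
  have h3 := E.injective h2
  subst h3
  exact hA.trans hA'.symm

/-- Pushout of opers along an embedding is well defined and injective. -/
theorem exists_pushout (P : Principal c) (P' : Principal c') (d : ℕ) :
    ∃ ι : OperSpace c d → OperSpace c' d, IsPushout c c' d φ ι ∧ Function.Injective ι :=
  ⟨fun x => ⟨E.mapOper x.1, E.mapOper_mem x.2⟩, fun A _ => ⟨E.mapConn A, rfl, rfl⟩,
    fun _ _ h => Subtype.ext (E.mapOper_injective P P' (congrArg Subtype.val h))⟩

end IsEmbedding

end Pushout

/-! ### Positions occupied by the simple root vectors -/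

section OperForm

variable {c : ClassicalType} {R : Type} [CommRing R] [Algebra ℂ R]

lemma negSimple_eq_zero_or_one (c : ClassicalType) (k : ℕ) (a b : Fin c.size) :
    negSimple c k a b = 0 ∨ negSimple c k a b = 1 := by
  cases c <;> simp only [negSimple, Matrix.of_apply] <;> split_ifs <;> simp

lemma sum_smul_negSimple_apply (ψ : Fin c.rank → R) (a b : Fin c.size) :
    (∑ k : Fin c.rank, ψ k • const R (negSimple c k)) a b
      = ∑ k : Fin c.rank, ψ k * algebraMap ℂ R (negSimple c k a b) := by
  rw [Matrix.sum_apply]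
  rfl

/-- The matrix `p₋₁` is a sum of matrices with entries `0` and `1` and has itself such entries, so
no two simple root vectors share a position. -/
lemma card_negSimple (a b : Fin c.size) :
    (Finset.univ.filter fun k : Fin c.rank => negSimple c k a b = 1).card
      = if height c a = height c b + 1 then 1 else 0 := by
  have h1 := pMinus_apply c a b
  rw [pMinus, Matrix.sum_apply] at h1
  have h2 : ∀ k : Fin c.rank, negSimple c k a b = if negSimple c k a b = 1 then 1 else 0 := by
    intro k
    rcases negSimple_eq_zero_or_one c k a b with h | h <;> rw [h] <;> simp
  rw [Finset.sum_congr rfl fun k _ => h2 k, Finset.sum_boole] at h1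
  split_ifs at h1 ⊢ <;> exact_mod_cast h1

lemma sum_smul_negSimple_eq_zero {a b : Fin c.size} (h : height c a ≠ height c b + 1)
    (ψ : Fin c.rank → R) : (∑ k : Fin c.rank, ψ k • const R (negSimple c k)) a b = 0 := by
  have h1 := card_negSimple a b
  rw [if_neg h, Finset.card_eq_zero, Finset.filter_eq_empty_iff] at h1
  rw [sum_smul_negSimple_apply]
  refine Finset.sum_eq_zero fun k _ => ?_
  rw [(negSimple_eq_zero_or_one c k a b).resolve_right (h1 (Finset.mem_univ k)), map_zero, mul_zero]

lemma exists_sum_smul_negSimple {a b : Fin c.size} (h : height c a = height c b + 1) :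
    ∃ k : Fin c.rank, negSimple c k a b = 1 := by
  have h1 := card_negSimple a b
  rw [if_pos h, Finset.card_eq_one] at h1
  obtain ⟨k, hk⟩ := h1
  have h2 : k ∈ Finset.univ.filter fun k : Fin c.rank => negSimple c k a b = 1 := by
    rw [hk]
    exact Finset.mem_singleton_self k
  exact ⟨k, (Finset.mem_filter.1 h2).2⟩

lemma sum_smul_negSimple_eq {a b : Fin c.size} {k : Fin c.rank} (hk : negSimple c k a b = 1)
    (ψ : Fin c.rank → R) : (∑ k : Fin c.rank, ψ k • const R (negSimple c k)) a b = ψ k := by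
  have h1 := card_negSimple a b
  have h2 : (Finset.univ.filter fun k : Fin c.rank => negSimple c k a b = 1).card ≤ 1 := by
    rw [h1]
    split_ifs <;> norm_num
  rw [sum_smul_negSimple_apply, Finset.sum_eq_single k, hk, map_one, mul_one]
  · intro j _ hj
    rcases negSimple_eq_zero_or_one c j a b with h | h
    · rw [h, map_zero, mul_zero]
    · exact absurd (Finset.card_le_one.1 h2 j (by simp [h]) k (by simp [hk])) hj
  · simp

end OperForm

end

end Oper

/-! ### The inclusions into `𝔰𝔩_N` -/

namespace Oper

noncomputable section

open ClassicalType

section ToSl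

variable {c : ClassicalType} {R : Type} [CommRing R] [Algebra ℂ R]

lemma Regular.pMinus_eq (hr : Regular c) : (pMinus c : Mat c ℂ) = pMinus (sl c.size) := by
  ext a b
  rw [hr.pMinus_apply, Regular.pMinus_apply (c := sl c.size) trivial]

lemma Regular.pPlus_eq (hr : Regular c) : (pPlus c : Mat c ℂ) = pPlus (sl c.size) := by
  ext a b
  rw [hr.pPlus_apply, Regular.pPlus_apply (c := sl c.size) trivial]

lemma Regular.height_eq_sl (hr : Regular c) : height c = height (sl c.size) :=
  funext fun a => hr.height_eq a

lemma MemLie.toSl {X : Mat c R} (h : MemLie c X) : MemLie (sl c.size) (X : Mat (sl c.size) R) :=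
  h.trace_eq_zero

lemma MemBorel.toSl {g : GL (Fin c.size) R} (h : MemBorel c g) : MemBorel (sl c.size) g :=
  ⟨trivial, h.2⟩

/-- Each subdiagonal position is occupied by exactly one simple root vector of type `c`, whose unit
serves as the unit of the simple root of `𝔰𝔩_N` at that position. -/
lemma Regular.isOperForm_sl (hr : Regular c) {X : Mat c R} (h : IsOperForm c X) :
    IsOperForm (sl c.size) (X : Mat (sl c.size) R) := by
  obtain ⟨hL, ψ, hψ⟩ := h
  have h1 : ∀ k : Fin (c.size - 1), ∃ u : Rˣ, ∀ a b : Fin c.size, a.val = k.val + 1 →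
      b.val = k.val → X a b = u.val := by
    intro k
    have hk := k.2
    obtain ⟨j, hj⟩ := exists_sum_smul_negSimple (c := c) (a := ⟨k.val + 1, by omega⟩)
      (b := ⟨k.val, by omega⟩) (by rw [hr.height_eq, hr.height_eq])
    refine ⟨ψ j, ?_⟩
    rintro ⟨a, ha'⟩ ⟨b, hb'⟩ ha hb
    change a = k.val + 1 at ha
    change b = k.val at hb
    subst ha hb
    have h2 := hψ (i := ⟨k.val + 1, by omega⟩) (j := ⟨k.val, by omega⟩)
      (show k.val < k.val + 1 by omega)
    rw [Matrix.sub_apply, sum_smul_negSimple_eq hj (fun i => (ψ i).val), sub_eq_zero] at h2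
    exact h2
  choose u hu using h1
  refine ⟨hL.toSl, u, fun a b hab => ?_⟩
  have hab' : b.val < a.val := hab
  have ha : a.val < c.size := a.2
  rw [Matrix.sub_apply]
  by_cases h2 : a.val = b.val + 1
  · have hk : b.val < c.size - 1 := by omega
    have h3 : negSimple (sl c.size) b.val a b = 1 := if_pos ⟨h2, rfl⟩
    have h4 := sum_smul_negSimple_eq (c := sl c.size) (R := R) (k := ⟨b.val, hk⟩) h3
      (fun i => (u i).val)
    rw [h4, hu ⟨b.val, hk⟩ a b h2 rfl, sub_self]
  · rw [sum_smul_negSimple_eq_zero (c := sl c.size) h2 (fun i => (u i).val), sub_zero]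
    have h3 := hψ hab
    rw [Matrix.sub_apply, sum_smul_negSimple_eq_zero _ (fun i => (ψ i).val), sub_zero] at h3
    · exact h3
    · rw [hr.height_eq, hr.height_eq]
      exact h2

/-- The inclusion into `𝔰𝔩_N` for the types whose principal nilpotent element is regular in
`𝔰𝔩_N`. -/
theorem Regular.isEmbedding (hr : Regular c) :
    IsEmbedding c (sl c.size) (fun {_} _ _ X => X) where
  memLie h := h.toSl
  operForm h := hr.isOperForm_sl h
  borel {_ _ _} _ {g} {_ _} _ _ hg hG := ⟨g, hg.toSl, hG⟩
  group {_ _ _} _ {g} {_ _} _ _ _ hG := ⟨g, trivial, hG⟩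
  map _ _ := rfl
  smul _ _ := rfl
  isNilpotent := Iff.rfl
  isCanonical {R _ _ X} h := by
    refine ⟨h.memLie.toSl, ?_, ?_⟩
    · rw [← hr.height_eq_sl]
      exact h.degGE
    · have h1 := h.comm
      rw [hr.pPlus_eq] at h1
      exact h1
  pMinus_add X := by rw [hr.pMinus_eq]
  injective {_ _ _} {_ _} h := h

/-- The elements of even degree of the centraliser of `p₁` in `𝔰𝔩_N` lie in `𝔰𝔭_N`, `𝔰𝔬_N`. -/
lemma Regular.mem_canonicalSpace_of_sl (hr : Regular c) (hc : HasForm c) {i : ℕ} (hi : 1 ≤ i)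
    {x : Mat c ℂ} (h : (x : Mat (sl c.size) ℂ) ∈ canonicalSpace (sl c.size) (2 * i)) :
    x ∈ canonicalSpace c (2 * i) := by
  obtain ⟨k, rfl⟩ : ∃ k, i = k + 1 := ⟨i - 1, by omega⟩
  obtain ⟨r, hx⟩ := Regular.exists_smul_pow (c := sl c.size) (k := 2 * k + 1) trivial h
  rw [← hr.pPlus_eq] at hx
  have h1 : x = r • pPlus c ^ (2 * k + 1) := hx
  rw [h1]
  exact Submodule.smul_mem _ _ (hr.pow_mem_canonicalSpace hc ⟨k, rfl⟩)

end ToSl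

end

end Oper

/-! ### The inclusion of `𝔰𝔬_{2n+1}` into `𝔰𝔬_{2n+2}` -/

namespace Oper

noncomputable section

open ClassicalType

section SoInclusion

variable {n : ℕ} {R : Type} [CommRing R] [Algebra ℂ R]

lemma form_soOdd_mul_self : form (soOdd n) * form (soOdd n) = 1 := by
  obtain ⟨ε, -, h⟩ := form_mul_self (c := soOdd n) trivial
  have h1 := congrFun (congrFun h 0) 0
  have h2 : (form (soOdd n) * form (soOdd n)) 0 0 = 1 := by
    have h3 := mul_form_apply (c := soOdd n) (form (soOdd n)) (0 : Fin (soOdd n).size) 0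
    rw [const_self, Algebra.algebraMap_self_apply, form_soOdd_symm, form_soOdd_rev] at h3
    rw [h3]
    norm_num
  rw [h2] at h1
  rw [h]
  have h4 : (ε • (1 : Mat (soOdd n) ℂ)) 0 0 = ε := by simp
  rw [h4] at h1
  rw [← h1, one_smul]

/-- The adjoint for the invariant form of `𝔰𝔬_{2n+1}`. -/
def formAdjoint (X : Mat (soOdd n) R) : Mat (soOdd n) R :=
  const R (form (soOdd n)) * X.transpose * const R (form (soOdd n))

lemma formAdjoint_one : formAdjoint (1 : Mat (soOdd n) R) = 1 := by
  rw [formAdjoint, Matrix.transpose_one, mul_one, ← const_mul, form_soOdd_mul_self, const_one]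

lemma mul_formAdjoint {g : Mat (soOdd n) R} {μ : R}
    (h : g * const R (form (soOdd n)) * g.transpose = μ • const R (form (soOdd n))) :
    g * formAdjoint g = μ • 1 := by
  rw [formAdjoint, ← mul_assoc, ← mul_assoc, h, Matrix.smul_mul, ← const_mul, form_soOdd_mul_self,
    const_one]

lemma form_mul_soInclusion_transpose (X : Mat (soOdd n) R) :
    const R (form (soEven (n + 1))) * (soInclusion n X).transpose
      = soInclusion n (formAdjoint X) * const R (form (soEven (n + 1))) := by
  ext a b
  rw [form_mul_apply, mul_form_apply, Matrix.transpose_apply, soInclusion_apply, soInclusion_apply,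
    formAdjoint, fold_rev, fold_rev, mul_form_apply, form_mul_apply, Matrix.transpose_apply,
    projCoeff_rev, projCoeff_rev, form_soEven_symm, form_soEven_rev, form_soEven_rev,
    Fin.rev_rev]
  have h : algebraMap ℂ R (form (soOdd n) (fold b) (fold b).rev)
      * algebraMap ℂ R (form (soOdd n) (fold b) (fold b).rev) = 1 := by
    rw [← map_mul, form_soOdd_rev, ← mul_pow]
    norm_num
  simp only [map_mul, map_neg, div_eq_mul_inv]
  linear_combination (-algebraMap ℂ R (form (soOdd n) (fold a) (fold a).rev) *
    (algebraMap ℂ R (inclCoeff n b.val) * (algebraMap ℂ R (inclCoeff n a.val) *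
    algebraMap ℂ R 2⁻¹) * X (fold b) (fold a).rev)) * (-h)

/-- The action of `g` on the image of `soIncl n`, and of the scalar `s` on its complement. -/
def extendScalar (g : Mat (soOdd n) R) (s : R) : Mat (soEven (n + 1)) R :=
  soInclusion n g + s • (1 - soInclusion n 1)

lemma soInclusion_one_mul (X : Mat (soOdd n) R) :
    soInclusion n 1 * soInclusion n X = soInclusion n X := by
  rw [← soInclusion_mul, one_mul]

lemma soInclusion_mul_one (X : Mat (soOdd n) R) :
    soInclusion n X * soInclusion n 1 = soInclusion n X := by
  rw [← soInclusion_mul, mul_one]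

lemma extendScalar_mul (g h : Mat (soOdd n) R) (s t : R) :
    extendScalar g s * extendScalar h t = extendScalar (g * h) (s * t) := by
  have h1 : (1 - soInclusion n 1) * (1 - soInclusion n (1 : Mat (soOdd n) R))
      = 1 - soInclusion n 1 := by
    rw [mul_sub, sub_mul, sub_mul, one_mul, mul_one, one_mul, soInclusion_one_mul, sub_self,
      sub_zero]
  rw [extendScalar, extendScalar, extendScalar, add_mul, mul_add, mul_add, Matrix.smul_mul,
    Matrix.smul_mul, Matrix.mul_smul, Matrix.mul_smul, h1, ← soInclusion_mul, mul_sub, sub_mul,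
    mul_one, one_mul, soInclusion_mul_one, soInclusion_one_mul, sub_self, sub_self, smul_zero,
    smul_zero, add_zero, zero_add, smul_smul]

lemma extendScalar_one : extendScalar (1 : Mat (soOdd n) R) 1 = 1 := by
  rw [extendScalar, one_smul, add_sub_cancel]

lemma extendScalar_smul (g : Mat (soOdd n) R) (s t : R) :
    extendScalar (t • g) (t * s) = t • extendScalar g s := by
  rw [extendScalar, extendScalar, soInclusion_smul, smul_add, smul_smul]

lemma form_mul_extendScalar_transpose (g : Mat (soOdd n) R) (s : R) :
    const R (form (soEven (n + 1))) * (extendScalar g s).transpose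
      = extendScalar (formAdjoint g) s * const R (form (soEven (n + 1))) := by
  rw [extendScalar, extendScalar, Matrix.transpose_add, Matrix.transpose_smul,
    Matrix.transpose_sub, Matrix.transpose_one, mul_add, Matrix.mul_smul, mul_sub, mul_one,
    form_mul_soInclusion_transpose, form_mul_soInclusion_transpose, formAdjoint_one, add_mul,
    Matrix.smul_mul, sub_mul, one_mul]

/-- The unit `extendScalar g s`. -/
def extendUnit (g : GL (Fin (soOdd n).size) R) (s : Rˣ) : GL (Fin (soEven (n + 1)).size) R where
  val := extendScalar g.val s.val
  inv := extendScalar g⁻¹.val s⁻¹.val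
  val_inv := by rw [extendScalar_mul, Units.mul_inv, Units.mul_inv, extendScalar_one]
  inv_val := by rw [extendScalar_mul, Units.inv_mul, Units.inv_mul, extendScalar_one]

/-- On the image of `soIncl` the factor is that of `g`, on the complementary line it is `s ^ 2`; a
square root of `μ` makes them agree. -/
lemma extendScalar_similitude {g : Mat (soOdd n) R} {s μ : R}
    (h : g * const R (form (soOdd n)) * g.transpose = μ • const R (form (soOdd n)))
    (hs : s * s = μ) :
    extendScalar g s * const R (form (soEven (n + 1))) * (extendScalar g s).transpose
      = μ • const R (form (soEven (n + 1))) := by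
  have h1 : extendScalar (μ • (1 : Mat (soOdd n) R)) μ = μ • 1 := by
    rw [← extendScalar_one, ← extendScalar_smul, mul_one]
  rw [mul_assoc, form_mul_extendScalar_transpose, ← mul_assoc, extendScalar_mul,
    mul_formAdjoint h, hs, h1, Matrix.smul_mul, one_mul]

/-- After extraction of `s`, the identity `det (1 + A B) = det (1 + B A)` reduces to size `2n + 1`.
-/
lemma det_extendScalar (g : Mat (soOdd n) R) (s : Rˣ) :
    (extendScalar g s.val).det = s.val * g.det := by
  have h1 : extendScalar g s.val
      = s.val • (1 + const R (soIncl n) * ((s⁻¹.val • g - 1) * const R (soProj n))) := by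
    have h2 : const R (soIncl n) * ((s⁻¹.val • g - 1) * const R (soProj n))
        = soInclusion n (s⁻¹.val • g - 1) := by
      rw [← Matrix.mul_assoc, soInclusion]
    rw [h2, soInclusion_sub, soInclusion_smul, extendScalar, smul_add, smul_sub, smul_sub,
      smul_smul, Units.mul_inv, one_smul]
    abel
  rw [h1, Matrix.det_smul, Matrix.det_one_add_mul_comm, Matrix.mul_assoc, const_soProj_mul_soIncl,
    Matrix.mul_one, add_sub_cancel, Matrix.det_smul, Fintype.card_fin, Fintype.card_fin]
  change s.val ^ (2 * n + 1 + 1) * (s⁻¹.val ^ (2 * n + 1) * g.det) = _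
  rw [pow_succ, ← mul_assoc, mul_right_comm (s.val ^ (2 * n + 1)), ← mul_pow, Units.mul_inv, one_pow,
    one_mul]

/-- Triangularity is in doubt only in the weight zero plane, spanned by a line where `g` acts
through its middle diagonal entry and a line where `s` acts. Equality of the two scalars makes the
block scalar. -/
lemma extendScalar_triangular {g : Mat (soOdd n) R} (hg : g.BlockTriangular id) {m : Fin (soOdd n).size}
    (hm : m.val = n) : (extendScalar g (g m m)).BlockTriangular id := by
  intro a b hab
  have hab' : b.val < a.val := hab
  have ha : a.val < 2 * (n + 1) := a.isLt
  have hx := height_soEven a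
  have hy := height_soEven b
  have hfa : (fold a).val = height (soEven (n + 1)) a := rfl
  have hfb : (fold b).val = height (soEven (n + 1)) b := rfl
  have hne : a ≠ b := fun h => by rw [h] at hab'; exact lt_irrefl _ hab'
  rw [extendScalar, Matrix.add_apply, Matrix.smul_apply, Matrix.sub_apply, Matrix.one_apply_ne hne,
    soInclusion_apply, soInclusion_apply]
  rcases lt_or_ge (fold b).val (fold a).val with h | h
  · rw [hg (show id (fold b) < id (fold a) from h), Matrix.one_apply_ne fun h' => by
      rw [h'] at h; exact lt_irrefl _ h]
    simp
  · have h1 : fold a = m := Fin.ext (by omega)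
    have h2 : fold b = m := Fin.ext (by omega)
    rw [h1, h2, Matrix.one_apply_eq, smul_eq_mul]
    ring

lemma soInclusion_map_derivation (D : AlgDer R) (X : Mat (soOdd n) R) :
    (soInclusion n X).map D = soInclusion n (X.map D) := by
  ext a b
  rw [Matrix.map_apply, soInclusion_apply, soInclusion_apply, Derivation.leibniz,
    Derivation.map_algebraMap, smul_zero, add_zero, Matrix.map_apply, smul_eq_mul]

/-- The scalar in a gauge transformation between elements of `𝔤`. -/
lemma gauge_scalar {c : ClassicalType} (hc : HasForm c) (hpos : 0 < c.size) {D : AlgDer R}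
    {g : GL (Fin c.size) R} {μ f : R}
    (hμ : g.val * const R (form c) * g.val.transpose = μ • const R (form c)) {A A' : Mat c R}
    (hA : MemLie c A) (hA' : MemLie c A') (h : A' = g.val * A * g⁻¹.val - g.val.map D * g⁻¹.val
      + f • (1 : Mat c R)) : 2 * μ * f = D μ := by
  have h1 := skew_conj (Units.inv_mul g) hμ ((memLie_iff hc).1 hA)
  have h2 := skew_derivation D (Units.inv_mul g) hμ
  have h3 := (memLie_iff hc).1 hA'
  have h4 : (2 * μ * f) • const R (form c)
      = μ • (A' * const R (form c) + const R (form c) * A'.transpose)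
        - μ • (g.val * A * g⁻¹.val * const R (form c)
          + const R (form c) * (g.val * A * g⁻¹.val).transpose)
        + μ • (g.val.map D * g⁻¹.val * const R (form c)
          + const R (form c) * (g.val.map D * g⁻¹.val).transpose) := by
    rw [h, Matrix.transpose_add, Matrix.transpose_sub, Matrix.transpose_smul, Matrix.transpose_one]
    simp only [add_mul, sub_mul, mul_add, mul_sub, Matrix.smul_mul, Matrix.mul_smul, one_mul,
      mul_one]
    module
  rw [h1, h2, h3, smul_zero, sub_zero, zero_add, ← sub_eq_zero, ← sub_smul] at h4
  have h5 := congrFun (congrFun h4 ⟨0, hpos⟩) (Fin.rev ⟨0, hpos⟩)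
  rw [Matrix.smul_apply, const_apply, smul_eq_mul, Matrix.zero_apply] at h5
  have h6 : IsUnit (algebraMap ℂ R (form c ⟨0, hpos⟩ (Fin.rev ⟨0, hpos⟩))) :=
    (IsUnit.mk0 _ (form_rev_ne_zero hc _)).map _
  exact sub_eq_zero.1 (h6.mul_left_eq_zero.1 h5)

/-- With `μ = s ^ 2` the relation `2 μ f = D(μ)` becomes `D(s) = f s`. On the complementary line,
where both connection matrices vanish, the derivative term and the scalar therefore cancel. -/
lemma gauge_extendUnit {D : AlgDer R} {g : GL (Fin (soOdd n).size) R} {s : Rˣ}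
    (hμ : g.val * const R (form (soOdd n)) * g.val.transpose
      = (s.val * s.val) • const R (form (soOdd n))) {A A' : Mat (soOdd n) R}
    (hA : MemLie (soOdd n) A) (hA' : MemLie (soOdd n) A') (h : Gauge D g A A') :
    Gauge D (extendUnit g s) (soInclusion n A) (soInclusion n A') := by
  obtain ⟨f, hf⟩ := h
  have h1 := gauge_scalar (c := soOdd n) trivial (Nat.succ_pos _) hμ hA hA' hf
  have h2 : D s.val = f * s.val := by
    rw [Derivation.leibniz, smul_eq_mul] at h1
    have h3 : IsUnit (2 * s.val) := by
      have : IsUnit (2 : R) := by exact_mod_cast isUnit_natCast (R := R) (N := 2) (by norm_num)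
      exact this.mul s.isUnit
    refine (h3.mul_right_inj).1 ?_
    linear_combination -h1
  obtain ⟨f', hf'⟩ : ∃ f' : R, f' = f ∧ A' * g.val = g.val * A - g.val.map D + f' • g.val := by
    refine ⟨f, rfl, ?_⟩
    rw [hf, add_mul, sub_mul, mul_assoc, Units.inv_mul, mul_one, mul_assoc, Units.inv_mul, mul_one,
      Matrix.smul_mul, one_mul]
  rw [gauge_iff]
  refine ⟨f, ?_⟩
  have h3 : (extendUnit g s).val.map D
      = soInclusion n (g.val.map D) + (f * s.val) • (1 - soInclusion n 1) := by
    have h4 : (1 - soInclusion n (1 : Mat (soOdd n) R)).map D = 0 := by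
      have h5 : (1 - soInclusion n (1 : Mat (soOdd n) R)) = const R (1 - soInclusion n 1) := by
        rw [const_sub, const_one, ← soInclusion_const, const_one]
      rw [h5, map_derivation_const]
    rw [← soInclusion_map_derivation, ← h2]
    ext a b
    have h5 := congrFun (congrFun h4 a) b
    rw [Matrix.map_apply, Matrix.zero_apply] at h5
    change D ((soInclusion n g.val) a b + s.val * (1 - soInclusion n (1 : Mat (soOdd n) R)) a b)
      = D ((soInclusion n g.val) a b) + D s.val * (1 - soInclusion n (1 : Mat (soOdd n) R)) a b
    rw [map_add, Derivation.leibniz, h5, smul_zero, zero_add, smul_eq_mul, mul_comm]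
  rw [h3]
  change soInclusion n A' * extendScalar g.val s.val = extendScalar g.val s.val * soInclusion n A
    - (soInclusion n (g.val.map D) + (f * s.val) • (1 - soInclusion n 1))
    + f • extendScalar g.val s.val
  rw [extendScalar, mul_add, add_mul, Matrix.mul_smul, Matrix.smul_mul, mul_sub, sub_mul, mul_one,
    one_mul, soInclusion_mul_one, soInclusion_one_mul, sub_self, sub_self, smul_zero, add_zero,
    add_zero, ← soInclusion_mul, hf'.2, hf'.1, soInclusion_add, soInclusion_sub, soInclusion_mul,
    soInclusion_smul, smul_add, smul_smul]
  abel

lemma det_sq_of_similitude {g : Mat (soOdd n) R} {μ : R}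
    (h : g * const R (form (soOdd n)) * g.transpose = μ • const R (form (soOdd n))) :
    g.det * g.det = μ ^ (2 * n + 1) := by
  have h1 := congrArg Matrix.det h
  have h2 : (const R (form (soOdd n))).det * (const R (form (soOdd n))).det = 1 := by
    rw [← Matrix.det_mul, ← const_mul, form_soOdd_mul_self, const_one, Matrix.det_one]
  rw [Matrix.det_mul, Matrix.det_mul, Matrix.det_transpose, Matrix.det_smul, Fintype.card_fin] at h1
  change _ = μ ^ (2 * n + 1) * _ at h1
  linear_combination (const R (form (soOdd n))).det * h1
    - (g.det * g.det - μ ^ (2 * n + 1)) * h2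

lemma isOperForm_soInclusion {X : Mat (soOdd n) R} (hn : 0 < n) (h : IsOperForm (soOdd n) X) :
    IsOperForm (soEven (n + 1)) (soInclusion n X) := by
  obtain ⟨hL, ψ, hψ⟩ := h
  -- The last two simple roots of `𝔰𝔬_{2n+2}` both restrict to the last simple root of `𝔰𝔬_{2n+1}`.
  let σ : Fin (soEven (n + 1)).rank → Fin (soOdd n).rank := fun k =>
    ⟨min k.val (n - 1), by
      have : min k.val (n - 1) < n := by omega
      exact this⟩
  have hL' := soInclusion_memLie hL
  refine ⟨hL', fun k => ψ (σ k), fun a b hab => ?_⟩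
  have hab' : b.val < a.val := hab
  have ha : a.val < 2 * (n + 1) := a.isLt
  have hx := height_soEven a
  have hy := height_soEven b
  have hfa : (fold a).val = height (soEven (n + 1)) a := rfl
  have hfb : (fold b).val = height (soEven (n + 1)) b := rfl
  have hr : Regular (soOdd n) := trivial
  rw [Matrix.sub_apply]
  by_cases h1 : height (soEven (n + 1)) a = height (soEven (n + 1)) b + 1
  · obtain ⟨k, hk⟩ := exists_sum_smul_negSimple h1
    have hk' : negSimple (soOdd n) (σ k) (fold a) (fold b) = 1 := by
      have hkn : k.val < n + 1 := k.2
      have hσ : (σ k).val = min k.val (n - 1) := rfl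
      have hk1 : (k.val + 1 < n + 1 ∧ ((a.val = k.val + 1 ∧ b.val = k.val) ∨
          (a.val + k.val + 1 = 2 * (n + 1) ∧ b.val + k.val + 2 = 2 * (n + 1)))) ∨
          (¬ k.val + 1 < n + 1 ∧ ((a.val = n + 1 ∧ b.val + 2 = n + 1) ∨
          (a.val = n + 1 + 1 ∧ b.val + 1 = n + 1))) := by
        by_contra hcon
        rw [not_or, not_and, not_and] at hcon
        simp only [negSimple] at hk
        split_ifs at hk with h3
        · rw [Matrix.of_apply, if_neg (hcon.1 h3)] at hk
          exact zero_ne_one hk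
        · rw [Matrix.of_apply, if_neg (hcon.2 h3)] at hk
          exact zero_ne_one hk
      simp only [negSimple, Matrix.of_apply]
      rw [if_pos]
      omega
    have h2 := hψ (show id (fold b) < id (fold a) from show (fold b).val < (fold a).val by omega)
    rw [Matrix.sub_apply, sum_smul_negSimple_eq hk' (fun i => (ψ i).val), sub_eq_zero] at h2
    have h3 := congrFun (congrFun (soInclusion_pMinus (n := n)) a) b
    rw [soInclusion_apply, hr.pMinus_apply, if_pos (by omega), pMinus_apply, if_pos h1, mul_one,
      Algebra.algebraMap_self_apply] at h3
    rw [sum_smul_negSimple_eq hk (fun k => (ψ (σ k)).val), soInclusion_apply, h2, h3, map_one,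
      one_mul, sub_self]
  · rw [sum_smul_negSimple_eq_zero h1 (fun k => (ψ (σ k)).val), sub_zero]
    by_cases h2 : height (soEven (n + 1)) a = height (soEven (n + 1)) b
    · rcases eq_or_eq_rev h2 with h3 | h3
      · rw [h3] at hab'
        exact absurd hab' (lt_irrefl _)
      · rw [h3]
        exact antidiagonal_eq_zero hL' a
    · have h3 := hψ (show id (fold b) < id (fold a) from show (fold b).val < (fold a).val by omega)
      rw [Matrix.sub_apply, sum_smul_negSimple_eq_zero _ (fun i => (ψ i).val), sub_zero] at h3
      · rw [soInclusion_apply, h3, mul_zero]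
      · rw [hr.height_eq, hr.height_eq]
        omega

/-- Extending a similitude needs a square root `s` of its factor `μ`. In odd dimension one always
exists: for triangular `g` the middle diagonal entry, which keeps the extension triangular, and in
general `det g / μ ^ n`, because `(det g) ^ 2 = μ ^ (2n+1)`. -/
theorem isEmbedding_soInclusion (hn : 0 < n) :
    IsEmbedding (soOdd n) (soEven (n + 1)) (fun {_} _ _ X => soInclusion n X) where
  memLie h := soInclusion_memLie h
  operForm h := isOperForm_soInclusion hn h
  borel {_ _ _} D {g} {_ _} hA hA' hg hG := by
    obtain ⟨μ, hμ⟩ := hg.1.exists_similitude (c := soOdd n) trivial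
    have hn' : n < (soOdd n).size := by change n < 2 * n + 1; omega
    have hrev : (⟨n, hn'⟩ : Fin (soOdd n).size).rev = ⟨n, hn'⟩ := by
      refine Fin.ext ?_
      rw [Fin.val_rev]
      change 2 * n + 1 - (n + 1) = n
      omega
    have h1 := similitude_diag_mul (c := soOdd n) trivial hg.2 hμ ⟨n, hn'⟩
    rw [hrev] at h1
    have h2 : IsUnit (g.val ⟨n, hn'⟩ ⟨n, hn'⟩) := isUnit_of_mul_isUnit_left (h1 ▸ μ.isUnit)
    obtain ⟨s, hs⟩ := h2
    rw [← hs] at h1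
    refine ⟨extendUnit g s, memBorel_of_similitude (μ := μ) ?_ fun _ => ?_,
      gauge_extendUnit (by rw [h1]; exact hμ) hA hA' hG⟩
    · have := extendScalar_triangular hg.2 (m := ⟨n, hn'⟩) rfl
      rw [← hs] at this
      exact this
    · exact extendScalar_similitude hμ h1
  group {R _ _} D {g} {_ _} hA hA' hg hG := by
    obtain ⟨μ, hμ⟩ := hg.exists_similitude (c := soOdd n) trivial
    have h1 := det_sq_of_similitude hμ
    let δ : Rˣ := Matrix.GeneralLinearGroup.det g
    have hδ : δ.val = g.val.det := rfl
    have h2 : δ * δ = μ ^ (2 * n + 1) := Units.ext (by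
      rw [Units.val_mul, Units.val_pow_eq_pow_val, hδ, h1])
    have h3 : (δ * (μ ^ n)⁻¹) * (δ * (μ ^ n)⁻¹) = μ := by
      rw [mul_mul_mul_comm, h2, ← mul_inv, ← pow_add, ← two_mul, pow_succ, mul_inv_cancel_comm]
    -- This choice among the square roots gives the extension determinant `μ ^ (n + 1)`, as the
    -- identity component requires.
    have h4 : (δ * (μ ^ n)⁻¹) * δ = μ ^ (n + 1) := by
      rw [mul_right_comm, h2, mul_inv_eq_iff_eq_mul, ← pow_add]
      congr 1
      omega
    have h5 : (δ * (μ ^ n)⁻¹).val * (δ * (μ ^ n)⁻¹).val = μ.val := by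
      rw [← Units.val_mul, h3]
    refine ⟨extendUnit g (δ * (μ ^ n)⁻¹), ⟨μ, extendScalar_similitude hμ h5, ?_⟩,
      gauge_extendUnit (by rw [h5]; exact hμ) hA hA' hG⟩
    refine (det_extendScalar g.val _).trans ?_
    rw [← hδ, ← Units.val_mul, h4, Units.val_pow_eq_pow_val]
  map f X := soInclusion_map f X
  smul r X := soInclusion_smul r X
  isNilpotent := isNilpotent_soInclusion
  isCanonical h := isCanonical_soInclusion h
  pMinus_add X := (const_soInclusion_pMinus_add X).symm
  injective {_ _ _} {_ _} h := soInclusion_injective h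

end SoInclusion

end

end Oper

/-! ### Assembly of the comparison statements -/

namespace Oper

noncomputable section

open ClassicalType

section Main

variable {c : ClassicalType}

/-- The bound `2k ≤ k' + 1` lets the last even position `2 (k - 1)` fit; any further positions are
filled with zeros. -/
lemma sum_insertZeros {M : Type} [AddCommGroup M] [Module ℂ M] {k k' m : ℕ} (hk : 2 * k ≤ k' + 1)
    (p : ℕ → M) (l : Fin k → ℂ) :
    ∑ j, l j • p (2 * (m + j.val)) = ∑ j : Fin k', insertZeros l j • p (2 * m + j.val) := by
  have hlt : ∀ j : Fin k, 2 * j.val < k' := fun j => by have := j.2; omega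
  refine Finset.sum_of_injOn (fun j => ⟨2 * j.val, hlt j⟩) ?_ ?_ ?_ ?_
  · intro i _ j _ h
    have h1 := congrArg Fin.val h
    exact Fin.ext (by simpa using h1)
  · intro j _
    simp
  · intro j _ hj
    rw [insertZeros, dif_neg, zero_smul]
    rintro ⟨h1, h2⟩
    refine hj ⟨⟨j.val / 2, h2⟩, by simp, Fin.ext ?_⟩
    change 2 * (j.val / 2) = j.val
    omega
  · intro j _
    have h1 : (insertZeros l ⟨2 * j.val, hlt j⟩ : ℂ) = l j := by
      rw [insertZeros, dif_pos ⟨by simp, by simp⟩]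
      congr 1
      exact Fin.ext (by simp)
    rw [h1, mul_add]

/-- Degrees are at most `2n`, and `n < 2m` gives `2n + 1 < 4m`. This is the origin of the
bijectivity range. -/
lemma Regular.deg_lt (hr : Regular c) {n m : ℕ} (hN : c.size ≤ 2 * n + 1) (h : n < 2 * m)
    (a b : Fin c.size) : deg (height c) a b + 1 < 2 * (2 * m : ℕ) := by
  have ha := a.2
  have hb := b.2
  rw [deg, hr.height_eq, hr.height_eq]
  push_cast
  omega

lemma Regular.canonicalSpace_eq_bot_of_even (hr : Regular c) (hc : HasForm c) {n m i : ℕ}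
    (hN : c.size ≤ 2 * n + 1) (hi : 2 * m ≤ i) (h : ∀ j : Fin (n + 1 - m), 2 * (m + j.val) ≠ i) :
    canonicalSpace c i = ⊥ := by
  rcases Nat.even_or_odd' i with ⟨k, rfl | rfl⟩
  · refine hr.canonicalSpace_eq_bot ?_
    by_contra hk
    refine h ⟨k - m, by omega⟩ ?_
    change 2 * (m + (k - m)) = 2 * k
    omega
  · exact hr.canonicalSpace_odd hc ⟨k, rfl⟩

lemma Regular.exists_nablaMap_even (hr : Regular c) (hc : HasForm c) (P : Principal c) {n m : ℕ}
    (hm : 1 ≤ m) (hN : c.size ≤ 2 * n + 1) {p : ℕ → Mat c ℂ}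
    (hp : ∀ i, 1 ≤ i → i ≤ n → p (2 * i) ∈ canonicalSpace c (2 * i) ∧ p (2 * i) ≠ 0) :
    ∃ x : (Fin (n + 1 - m) → ℂ) → OperSpace c (2 * m),
      IsNablaMap c (2 * m) (fun j => p (2 * (m + j.val))) x ∧ Function.Injective x ∧
        (n < 2 * m → Function.Surjective x) := by
  have hp' : ∀ j : Fin (n + 1 - m), p (2 * (m + j.val)) ∈ canonicalSpace c (2 * (m + j.val)) ∧
      p (2 * (m + j.val)) ≠ 0 := fun j => hp _ (by omega) (by have := j.2; omega)
  obtain ⟨x, hx, hinj, hsurj⟩ := exists_nablaMap P hr.nilpotentSlice (d := 2 * m) (by omega)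
    (idx := fun j : Fin (n + 1 - m) => 2 * (m + j.val))
    (fun i j h => Fin.ext (by simpa using h)) (fun j => by simp) (fun j => (hp' j).1)
    (fun j => (hp' j).2)
  exact ⟨x, hx, hinj, fun h => hsurj (hr.deg_lt hN h)
    (fun j => (hr.canonicalSpace_eq_span (by omega) (hp' j).1 (hp' j).2).le)
    fun i hi h' => hr.canonicalSpace_eq_bot_of_even hc hN hi h'⟩

/-- The comparison of opers for `𝔰𝔭_{2n}` or `𝔰𝔬_{2n+1}` with those for `𝔰𝔩_N`. -/
theorem Regular.pushout_sl (hr : Regular c) (hc : HasForm c) (P : Principal c)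
    (P' : Principal (sl c.size)) {n m K : ℕ} (hm : 1 ≤ m) (hN : 2 * n ≤ c.size)
    (hN' : c.size ≤ 2 * n + 1) (hmn : m ≤ n) (hK : K + 2 * m = c.size + 1) (p : ℕ → Mat c ℂ)
    (hp : ∀ i, 2 ≤ i → i ≤ c.size →
      (p i : Mat (sl c.size) ℂ) ∈ canonicalSpace (sl c.size) i ∧ p i ≠ 0) :
    (∀ i, 1 ≤ i → i ≤ n → canonicalSpace c (2 * i) = Submodule.span ℂ {p (2 * i)}) ∧
    ∃ (ι : OperSpace c (2 * m) → OperSpace (sl c.size) (2 * m))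
      (x : (Fin (n + 1 - m) → ℂ) → OperSpace c (2 * m))
      (y : (Fin K → ℂ) → OperSpace (sl c.size) (2 * m)),
      IsPushout c (sl c.size) (2 * m) (fun A => A) ι ∧ Function.Injective ι ∧
      IsNablaMap c (2 * m) (fun j => p (2 * (m + j.val))) x ∧
      IsNablaMap (sl c.size) (2 * m) (fun j => p (2 * m + j.val)) y ∧
      Function.Injective x ∧ Function.Injective y ∧
      (n < 2 * m → Function.Surjective x ∧ Function.Surjective y) ∧
      ∀ l, ι (x l) = y (insertZeros l) := by
  have hsl : Regular (sl c.size) := trivial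
  have hpc : ∀ i, 1 ≤ i → i ≤ n → p (2 * i) ∈ canonicalSpace c (2 * i) ∧ p (2 * i) ≠ 0 :=
    fun i hi hin => by
      obtain ⟨h1, h2⟩ := hp (2 * i) (by omega) (by omega)
      exact ⟨hr.mem_canonicalSpace_of_sl hc hi h1, h2⟩
  refine ⟨fun i hi hin => hr.canonicalSpace_eq_span (by omega) (hpc i hi hin).1 (hpc i hi hin).2, ?_⟩
  obtain ⟨ι, hι, hιinj⟩ := hr.isEmbedding.exists_pushout P P' (2 * m)
  obtain ⟨x, hx, hxinj, hxsurj⟩ := hr.exists_nablaMap_even hc P hm hN' hpc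
  have hp' : ∀ j : Fin K, (p (2 * m + j.val) : Mat (sl c.size) ℂ) ∈
      canonicalSpace (sl c.size) (2 * m + j.val) ∧ p (2 * m + j.val) ≠ 0 :=
    fun j => hp _ (by omega) (by have := j.2; omega)
  obtain ⟨y, hy, hyinj, hysurj⟩ := exists_nablaMap P' hsl.nilpotentSlice (d := 2 * m) (by omega)
    (idx := fun j : Fin K => 2 * m + j.val)
    (fun i j h => Fin.ext (by simpa using h)) (fun j => by simp) (fun j => (hp' j).1)
    (fun j => (hp' j).2)
  refine ⟨ι, x, y, hι, hιinj, hx, hy, hxinj, hyinj, fun h => ⟨hxsurj h, hysurj (hsl.deg_lt hN' h)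
    (fun j => (hsl.canonicalSpace_eq_span (by omega) (hp' j).1 (hp' j).2).le) fun i hi h' =>
      hsl.canonicalSpace_eq_bot ?_⟩, fun l => hι.apply_nabla hx hy ?_⟩
  · change c.size < i
    by_contra hlt
    exact h' ⟨i - 2 * m, by omega⟩ (by simp only; omega)
  · have h1 := sum_insertZeros (m := m) (k' := K) (by omega) p l
    change (LaurentPolynomial.T (-1) : ℂ[T;T⁻¹]) • const ℂ[T;T⁻¹] (pMinus c) + const ℂ[T;T⁻¹] _
      = (LaurentPolynomial.T (-1) : ℂ[T;T⁻¹]) • const ℂ[T;T⁻¹] (pMinus (sl c.size))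
        + const ℂ[T;T⁻¹] _
    rw [h1, hr.pMinus_eq]

lemma canonicalSpace_soEven_eq_span {n i : ℕ} (hi : n + 1 < 2 * i) {q : Mat (soOdd n) ℂ}
    (hq : q ∈ canonicalSpace (soOdd n) (2 * i)) (hq0 : q ≠ 0) :
    canonicalSpace (soEven (n + 1)) (2 * i) = Submodule.span ℂ {soInclusion n q} := by
  refine le_antisymm (fun x hx => ?_) ?_
  · obtain ⟨y, hy, rfl⟩ := canonicalSpace_soEven hi hx
    rw [Regular.canonicalSpace_eq_span (c := soOdd n) trivial (by omega) hq hq0,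
      Submodule.mem_span_singleton] at hy
    obtain ⟨r, rfl⟩ := hy
    exact Submodule.mem_span_singleton.2 ⟨r, (soInclusion_smul r q).symm⟩
  · rw [Submodule.span_singleton_le_iff_mem]
    exact soInclusion_mem_canonicalSpace hq

lemma soInclusion_nabla {n k : ℕ} (q : Fin k → Mat (soOdd n) ℂ) (l : Fin k → ℂ) :
    soInclusion n (nabla (soOdd n) q l)
      = nabla (soEven (n + 1)) (fun j => soInclusion n (q j)) l := by
  have h1 : ∀ s : Finset (Fin k), soInclusion n (∑ j ∈ s, l j • q j)
      = ∑ j ∈ s, l j • soInclusion n (q j) := by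
    intro s
    induction s using Finset.induction_on with
    | empty => exact soInclusion_zero
    | insert j s hj ih =>
      rw [Finset.sum_insert hj, Finset.sum_insert hj, soInclusion_add, soInclusion_smul, ih]
  rw [nabla, nabla, soInclusion_add, soInclusion_smul, soInclusion_const, soInclusion_const,
    soInclusion_pMinus, h1]

/-- The comparison of opers for `𝔰𝔬_{2n+1}` and `𝔰𝔬_{2n+2}`. -/
theorem pushout_soEven {n m : ℕ} (hm : 1 ≤ m) (hmn : m ≤ n) (h : n + 1 < 2 * m)
    (p : ℕ → Mat (soOdd n) ℂ)
    (hp : ∀ i, 1 ≤ i → i ≤ n → p (2 * i) ∈ canonicalSpace (soOdd n) (2 * i) ∧ p (2 * i) ≠ 0) :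
    ∃ (ι : OperSpace (soOdd n) (2 * m) → OperSpace (soEven (n + 1)) (2 * m))
      (x : (Fin (n + 1 - m) → ℂ) → OperSpace (soOdd n) (2 * m))
      (y : (Fin (n + 1 - m) → ℂ) → OperSpace (soEven (n + 1)) (2 * m)),
      IsPushout (soOdd n) (soEven (n + 1)) (2 * m) (soInclusion n) ι ∧ Function.Injective ι ∧
      IsNablaMap (soOdd n) (2 * m) (fun j => p (2 * (m + j.val))) x ∧
      IsNablaMap (soEven (n + 1)) (2 * m) (fun j => soInclusion n (p (2 * (m + j.val)))) y ∧
      Function.Bijective x ∧ Function.Bijective y ∧ ∀ l, ι (x l) = y l := by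
  have hn : 0 < n := by omega
  have hr : Regular (soOdd n) := trivial
  have hc : HasForm (soOdd n) := trivial
  have hN : (soOdd n).size ≤ 2 * n + 1 := le_rfl
  obtain ⟨ι, hι, hιinj⟩ := (isEmbedding_soInclusion hn).exists_pushout (principal_soOdd n)
    (principal_soEven hn) (2 * m)
  obtain ⟨x, hx, hxinj, hxsurj⟩ := hr.exists_nablaMap_even hc (principal_soOdd n) hm hN hp
  have hp' : ∀ j : Fin (n + 1 - m), p (2 * (m + j.val)) ∈
      canonicalSpace (soOdd n) (2 * (m + j.val)) ∧ p (2 * (m + j.val)) ≠ 0 :=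
    fun j => hp _ (by omega) (by have := j.2; omega)
  obtain ⟨y, hy, hyinj, hysurj⟩ := exists_nablaMap (principal_soEven hn) (nilpotentSlice_soEven hn)
    (d := 2 * m) (by omega) (idx := fun j : Fin (n + 1 - m) => 2 * (m + j.val))
    (q := fun j => soInclusion n (p (2 * (m + j.val))))
    (fun i j h => Fin.ext (by simpa using h)) (fun j => by simp)
    (fun j => soInclusion_mem_canonicalSpace (hp' j).1)
    (fun j h0 => (hp' j).2 (soInclusion_injective (h0.trans soInclusion_zero.symm)))
  refine ⟨ι, x, y, hι, hιinj, hx, hy, ⟨hxinj, hxsurj (by omega)⟩, ⟨hyinj, hysurj ?_ ?_ ?_⟩,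
    fun l => hι.apply_nabla hx hy (soInclusion_nabla _ l)⟩
  · intro a b
    have hb : b.val < 2 * (n + 1) := b.isLt
    have h1 := height_soEven b
    rw [deg]
    push_cast
    omega
  · intro j
    exact (canonicalSpace_soEven_eq_span (by omega) (hp' j).1 (hp' j).2).le
  -- All degrees considered exceed `n + 1`, so the Pfaffian element does not occur and the vanishing
  -- is inherited from `𝔰𝔬_{2n+1}`.
  · intro i hi h'
    rw [eq_bot_iff]
    intro z hz
    obtain ⟨w, hw, rfl⟩ := canonicalSpace_soEven (by omega) hz
    rw [hr.canonicalSpace_eq_bot_of_even hc hN hi h', Submodule.mem_bot] at hw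
    rw [hw, soInclusion_zero]
    exact Submodule.zero_mem _

end Main

end

end Oper

open Oper Oper.ClassicalType in
theorem propositionp (n m : ℕ) (hm : 1 ≤ m) (hmn : m ≤ n) :
    -- (i) `𝔰𝔭_{2n} → 𝔰𝔩_{2n}`
    (∀ p : ℕ → Matrix (Fin (2 * n)) (Fin (2 * n)) ℂ,
      (∀ i, 2 ≤ i → i ≤ 2 * n → p i ∈ canonicalSpace (sl (2 * n)) i ∧ p i ≠ 0) →
      (∀ i, 1 ≤ i → i ≤ n → canonicalSpace (sp n) (2 * i) = Submodule.span ℂ {p (2 * i)}) ∧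
      ∃ (ι : OperSpace (sp n) (2 * m) → OperSpace (sl (2 * n)) (2 * m))
        (x : (Fin (n + 1 - m) → ℂ) → OperSpace (sp n) (2 * m))
        (y : (Fin (2 * n + 1 - 2 * m) → ℂ) → OperSpace (sl (2 * n)) (2 * m)),
        IsPushout (sp n) (sl (2 * n)) (2 * m) (fun A => A) ι ∧ Function.Injective ι ∧
        IsNablaMap (sp n) (2 * m) (fun j => p (2 * (m + j.val))) x ∧
        IsNablaMap (sl (2 * n)) (2 * m) (fun j => p (2 * m + j.val)) y ∧
        Function.Injective x ∧ Function.Injective y ∧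
        (n < 2 * m → Function.Surjective x ∧ Function.Surjective y) ∧
        ∀ l, ι (x l) = y (insertZeros l)) ∧
    -- (ii) `𝔰𝔬_{2n+1} → 𝔰𝔩_{2n+1}`
    (∀ p : ℕ → Matrix (Fin (2 * n + 1)) (Fin (2 * n + 1)) ℂ,
      (∀ i, 2 ≤ i → i ≤ 2 * n + 1 → p i ∈ canonicalSpace (sl (2 * n + 1)) i ∧ p i ≠ 0) →
      (∀ i, 1 ≤ i → i ≤ n → canonicalSpace (soOdd n) (2 * i) = Submodule.span ℂ {p (2 * i)}) ∧
      ∃ (ι : OperSpace (soOdd n) (2 * m) → OperSpace (sl (2 * n + 1)) (2 * m))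
        (x : (Fin (n + 1 - m) → ℂ) → OperSpace (soOdd n) (2 * m))
        (y : (Fin (2 * n + 2 - 2 * m) → ℂ) → OperSpace (sl (2 * n + 1)) (2 * m)),
        IsPushout (soOdd n) (sl (2 * n + 1)) (2 * m) (fun A => A) ι ∧ Function.Injective ι ∧
        IsNablaMap (soOdd n) (2 * m) (fun j => p (2 * (m + j.val))) x ∧
        IsNablaMap (sl (2 * n + 1)) (2 * m) (fun j => p (2 * m + j.val)) y ∧
        Function.Injective x ∧ Function.Injective y ∧
        (n < 2 * m → Function.Surjective x ∧ Function.Surjective y) ∧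
        ∀ l, ι (x l) = y (insertZeros l)) ∧
    -- (iii) `𝔰𝔬_{2n+1} → 𝔰𝔬_{2n+2}`
    (n + 1 < 2 * m → ∀ p : ℕ → Matrix (Fin (2 * n + 1)) (Fin (2 * n + 1)) ℂ,
      (∀ i, 1 ≤ i → i ≤ n → p (2 * i) ∈ canonicalSpace (soOdd n) (2 * i) ∧ p (2 * i) ≠ 0) →
      (∀ i, n + 1 < 2 * i → i ≤ n →
        canonicalSpace (soEven (n + 1)) (2 * i) = Submodule.span ℂ {soInclusion n (p (2 * i))}) ∧
      ∃ (ι : OperSpace (soOdd n) (2 * m) → OperSpace (soEven (n + 1)) (2 * m))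
        (x : (Fin (n + 1 - m) → ℂ) → OperSpace (soOdd n) (2 * m))
        (y : (Fin (n + 1 - m) → ℂ) → OperSpace (soEven (n + 1)) (2 * m)),
        IsPushout (soOdd n) (soEven (n + 1)) (2 * m) (soInclusion n) ι ∧ Function.Injective ι ∧
        IsNablaMap (soOdd n) (2 * m) (fun j => p (2 * (m + j.val))) x ∧
        IsNablaMap (soEven (n + 1)) (2 * m) (fun j => soInclusion n (p (2 * (m + j.val)))) y ∧
        Function.Bijective x ∧ Function.Bijective y ∧
        ∀ l, ι (x l) = y l) := by
  refine ⟨fun p hp => ?_, fun p hp => ?_, fun h p hp => ⟨fun i hi hin => ?_, ?_⟩⟩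
  · exact Regular.pushout_sl (c := sp n) trivial trivial (principal_sp (by omega))
      (principal_sl (by change 0 < 2 * n; omega)) hm le_rfl (Nat.le_succ _) hmn
      (by change _ = 2 * n + 1; omega) p hp
  · exact Regular.pushout_sl (c := soOdd n) trivial trivial (principal_soOdd n)
      (principal_sl (Nat.succ_pos _)) hm (Nat.le_succ _) le_rfl hmn
      (by change _ = 2 * n + 1 + 1; omega) p hp
  · obtain ⟨h1, h2⟩ := hp i (by omega) hin
    exact canonicalSpace_soEven_eq_span hi h1 h2
  · exact pushout_soEven hm hmn h p hp
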